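/- Orient $S^3\subset\mathbb C^2$ as the boundary of the unit ball. A framed knot is a smooth orientation-preserving embedding $h\colon S^1\times D^2\to S^3$, with core $K=h(S^1\times\{0\})$, tubular neighbourhood $N(K)=h(S^1\times D^2)$, framing longitude $\lambda=h(S^1\times\{1\})$ and meridian $m=h(\{1\}\times\partial D^2)$, regarded as elements of $\pi_1(S^3\setminus N(K))=\pi_1(\overline{S^3\setminus N(K)},h(1,1))$. Its framing number is the integer $n$ with $[\lambda]=n[m]$ in $H_1(S^3\setminus N(K))$, i.e. the linking number of $\lambda$ with $K$; for the blackboard framing of a diagram of $K$ it is the writhe of the diagram. Surgery along the framed knot produces $$\chi_K(S^3)=\overline{S^3\setminus N(K)}\ \cup_{h|_{S^1\times S^1}}\ (D^2\times S^1).$$ Let $T$ be the right-handed trefoil (the trefoil whose standard diagram has three positive crossings), i.e. the image of $t\mapsto(e^{2it},e^{3it})/\sqrt2$ up to orientation-preserving diffeomorphism of $S^3$, and let $$W=(a,b,c\mid a=b^{-1}cb,\ b=c^{-1}ac,\ c=a^{-1}ba).$$ 1. Framed knots with core $T$ and framing number $3$ (the blackboard framing of the standard diagram) exist. For each of them there is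 an isomorphism $\pi_1(S^3\setminus N(T))\cong W$ that carries $m$ to $a$ and $\lambda$ to $cab$; moreover $\pi_1(\chi_T(S^3))\cong\pi_1(S^3\setminus N(T))/\langle\langle\lambda\rangle\rangle$, and this group is isomorphic to the binary tetrahedral group $\langle 3,3,2\rangle=(A,B,C\mid A^3=B^3=C^2=ABC)$. 2. Framed knots with core $T$ and framing number $1$ (the blackboard framing of the standard diagram with two negative curls added) exist. For each of them there is an isomorphism $\pi_1(S^3\setminus N(T))\cong W$ that carries $m$ to $a$ and $\lambda$ to $caba^{-2}$; moreover $\pi_1(\chi_T(S^3))\cong\pi_1(S^3\setminus N(T))/\langle\langle\lambda\rangle\rangle$, and this group is isomorphic to the binary icosahedral group $\langle 5,3,2\rangle=(A,B,C\mid A^5=B^3=C^2=ABC)$. 3. The group $\langle 5,3,2\rangle$ is the fundamental group of the Poincaré homology sphere, the quotient of the group $S^3$ of unit quaternions by the subgroup of order $120$ generated by $\tfrac12(1+i+j+k)$ and $\tfrac12(\varphi+\varphi^{-1}i+j)$, where $\varphi=\tfrac12(1+\sqrt5)$. -/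

import Mathlib

open scoped Quaternion ContDiff

noncomputable section

/-! ### Group presentations -/

/-- The Wirtinger presentation of the trefoil group,
`(a, b, c | a = b⁻¹cb, b = c⁻¹ac, c = a⁻¹ba)`, with `a, b, c` the generators `0, 1, 2`. -/
def trefoilRels : Set (FreeGroup (Fin 3)) :=
  let a := FreeGroup.of (0 : Fin 3)
  let b := FreeGroup.of (1 : Fin 3)
  let c := FreeGroup.of (2 : Fin 3)
  {a * (b⁻¹ * c * b)⁻¹, b * (c⁻¹ * a * c)⁻¹, c * (a⁻¹ * b * a)⁻¹}

abbrev TrefoilGroup : Type := PresentedGroup trefoilRels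

namespace TrefoilGroup

def a : TrefoilGroup := PresentedGroup.of 0
def b : TrefoilGroup := PresentedGroup.of 1
def c : TrefoilGroup := PresentedGroup.of 2

end TrefoilGroup

/-- The relations `A ^ p = B ^ q = C ^ r = A * B * C`. -/
def binaryPolyhedralRels (p q r : ℕ) : Set (FreeGroup (Fin 3)) :=
  let A := FreeGroup.of (0 : Fin 3)
  let B := FreeGroup.of (1 : Fin 3)
  let C := FreeGroup.of (2 : Fin 3)
  {A ^ p * (A * B * C)⁻¹, B ^ q * (A * B * C)⁻¹, C ^ r * (A * B * C)⁻¹}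

/-- The binary polyhedral group `⟨p, q, r⟩ = (A, B, C | A ^ p = B ^ q = C ^ r = ABC)`. -/
abbrev BinaryPolyhedral (p q r : ℕ) : Type := PresentedGroup (binaryPolyhedralRels p q r)

/-- The binary tetrahedral group `⟨3, 3, 2⟩`. -/
abbrev BinaryTetrahedral : Type := BinaryPolyhedral 3 3 2

/-- The binary icosahedral group `⟨5, 3, 2⟩`. -/
abbrev BinaryIcosahedral : Type := BinaryPolyhedral 5 3 2

/-! ### The 3-sphere, and knots in it -/

/-- The 3-sphere, as the group of unit quaternions. It is oriented as the boundary of the unit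
ball of `ℍ`, where `(1, i, j, k)` is a positive basis. Under `(z, w) ↦ z + w j` it is the unit
sphere of `ℂ²` with its complex orientation. -/
abbrev Sphere3 : Type := Metric.sphere (0 : ℍ[ℝ]) 1

/-- The quaternion `a + b i + c j + d k`. -/
def quat (a b c d : ℝ) : ℍ[ℝ] := ⟨a, b, c, d⟩

theorem quat_mem_sphere {a b c d : ℝ} (h : a ^ 2 + b ^ 2 + c ^ 2 + d ^ 2 = 1) :
    quat a b c d ∈ Metric.sphere (0 : ℍ[ℝ]) 1 := by
  rw [mem_sphere_zero_iff_norm, ← sq_eq_sq₀ (norm_nonneg _) zero_le_one, sq,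
    ← Quaternion.normSq_eq_norm_mul_self, Quaternion.normSq_def']
  simpa [quat] using h

/-- The determinant of four quaternions in the basis `(1, i, j, k)`. -/
def quatDet (p q r s : ℍ[ℝ]) : ℝ :=
  Matrix.det !![p.re, p.imI, p.imJ, p.imK;
                q.re, q.imI, q.imJ, q.imK;
                r.re, r.imI, r.imJ, r.imK;
                s.re, s.imI, s.imJ, s.imK]

/-- The right-handed trefoil, as the `(2, 3)` torus knot `t ↦ (e^{2it}, e^{3it}) / √2` in the unit
sphere of `ℂ²`. -/
def trefoil (t : ℝ) : ℍ[ℝ] :=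
  (√2)⁻¹ • quat (Real.cos (2 * t)) (Real.sin (2 * t)) (Real.cos (3 * t)) (Real.sin (3 * t))

/-- Orientation-preserving diffeomorphisms of the 3-sphere, given by their radial extensions
`x ↦ ‖x‖ • f (x / ‖x‖)` to `ℍ`. -/
structure IsOrientedSphereDiffeo (F : ℍ[ℝ] → ℍ[ℝ]) : Prop where
  bijective : Function.Bijective F
  norm_map : ∀ x, ‖F x‖ = ‖x‖
  map_smul : ∀ (r : ℝ) (x : ℍ[ℝ]), 0 ≤ r → F (r • x) = r • F x
  contDiffOn : ContDiffOn ℝ ∞ F {0}ᶜ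
  det_pos : ∀ x, x ≠ 0 → 0 < (fderiv ℝ F x).det

/-- A framed knot in `S³`: a smooth orientation-preserving embedding `h` of the solid torus
`S¹ × D²`, where `D²` is the closed unit disc of `ℂ`. As usual for maps on a manifold with
boundary, `h` is taken to be defined and smooth beyond `S¹ × D²`; its values there play no role.
The angle `t` of the point `e^{it}` of `S¹` is used to express smoothness and orientation. -/
structure FramedKnot where
  toFun : Circle × ℂ → Sphere3
  smooth : ContDiff ℝ ∞ (fun p : ℝ × ℂ => (toFun (Circle.exp p.1, p.2) : ℍ[ℝ]))
  injOn : Set.InjOn toFun {p | ‖p.2‖ ≤ 1}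
  orientation : ∀ p : ℝ × ℂ, ‖p.2‖ ≤ 1 →
    let D := fderiv ℝ (fun p : ℝ × ℂ => (toFun (Circle.exp p.1, p.2) : ℍ[ℝ])) p
    0 < quatDet (toFun (Circle.exp p.1, p.2)) (D (1, 0)) (D (0, 1)) (D (0, Complex.I))

namespace FramedKnot

variable (h : FramedKnot)

/-- The knot `K = h (S¹ × {0})`. -/
def core : Set Sphere3 := Set.range fun x : Circle => h.toFun (x, 0)

/-- `K` is a right-handed trefoil knot: some orientation-preserving diffeomorphism of `S³` carries
the standard right-handed trefoil to `K`. -/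
def IsTrefoil : Prop :=
  ∃ F : ℍ[ℝ] → ℍ[ℝ], IsOrientedSphereDiffeo F ∧
    (Subtype.val '' h.core : Set ℍ[ℝ]) = F '' Set.range trefoil

/-- The interior `h (S¹ × int D²)` of the tubular neighbourhood `N(K)`. -/
def openTube : Set Sphere3 := h.toFun '' {p | ‖p.2‖ < 1}

/-- The knot exterior, the closure of `S³ \ N(K)`. -/
abbrev Exterior : Type := {x : Sphere3 // x ∉ h.openTube}

theorem boundary_notMem (x y : Circle) : h.toFun (x, (y : ℂ)) ∉ h.openTube := by
  rintro ⟨⟨u, v⟩, hv, huv⟩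
  have hv' : ‖v‖ < 1 := hv
  have hy : ‖(y : ℂ)‖ = 1 := y.norm_coe
  have key := @FramedKnot.injOn h (u, v) hv'.le (x, (y : ℂ)) hy.le huv
  have hvy : v = y := (Prod.ext_iff.1 key).2
  rw [hvy] at hv'
  exact hv'.ne hy

/-- The restriction of `h` to `S¹ × S¹ = ∂(S¹ × D²)`. -/
def boundary (x y : Circle) : h.Exterior := ⟨h.toFun (x, (y : ℂ)), h.boundary_notMem x y⟩

/-- The framing longitude `h (S¹ × {1})`, as a loop at `h (1, 1)`. -/
def longitudePath : Path (h.boundary 1 1) (h.boundary 1 1) where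
  toFun s := h.boundary (Circle.exp (2 * Real.pi * s)) 1
  continuous_toFun := by
    refine Continuous.subtype_mk (Continuous.subtype_mk ?_ _) _
    exact h.smooth.continuous.comp (f := fun s : unitInterval => (2 * Real.pi * (s : ℝ), (1 : ℂ)))
      (by fun_prop)
  source' := by simp
  target' := by simp

/-- The meridian `h ({1} × ∂D²)`, as a loop at `h (1, 1)`. -/
def meridianPath : Path (h.boundary 1 1) (h.boundary 1 1) where
  toFun s := h.boundary 1 (Circle.exp (2 * Real.pi * s))
  continuous_toFun := by
    refine Continuous.subtype_mk (Continuous.subtype_mk ?_ _) _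
    have := h.smooth.continuous.comp
      (f := fun s : unitInterval => ((0 : ℝ), (Circle.exp (2 * Real.pi * (s : ℝ)) : ℂ)))
      (by fun_prop)
    simpa [Function.comp_def] using this
  source' := by simp
  target' := by simp

/-- The knot group `π₁(S³ \ N(K))`, with base point on the boundary torus. -/
abbrev KnotGroup : Type := FundamentalGroup h.Exterior (h.boundary 1 1)

def longitude : h.KnotGroup :=
  FundamentalGroup.fromPath (Path.Homotopic.Quotient.mk h.longitudePath)

def meridian : h.KnotGroup :=
  FundamentalGroup.fromPath (Path.Homotopic.Quotient.mk h.meridianPath)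

/-- The framing number is `n`, i.e. the longitude has linking number `n` with `K`: it is
homologous to `n` times the meridian in the exterior, whose first homology group is the
abelianization of the knot group. -/
def HasFraming (n : ℤ) : Prop :=
  Abelianization.of h.longitude = Abelianization.of h.meridian ^ n

/-- The closed unit disc `D²`. -/
abbrev Disc : Type := Metric.closedBall (0 : ℂ) 1

def circleToDisc (x : Circle) : Disc := ⟨(x : ℂ), mem_closedBall_zero_iff.2 x.norm_coe.le⟩

/-- The gluing of `D² × S¹` to the exterior along `h : S¹ × S¹ → ∂N(K)`; the meridian
`∂D² × {1}` is glued to the framing longitude `h (S¹ × {1})`. -/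
inductive GlueRel : h.Exterior ⊕ Disc × Circle → h.Exterior ⊕ Disc × Circle → Prop
  | glue (x y : Circle) : GlueRel (Sum.inl (h.boundary x y)) (Sum.inr (circleToDisc x, y))

/-- The result `χ_K(S³)` of surgery along the framed knot, with the quotient topology. -/
abbrev Surgery : Type := Quot h.GlueRel

end FramedKnot

/-! ### The Poincaré homology sphere -/

/-- `(1 + i + j + k) / 2` -/
def icosianS : Sphere3 :=
  ⟨quat (1 / 2) (1 / 2) (1 / 2) (1 / 2), quat_mem_sphere (by norm_num)⟩

/-- `(φ + φ⁻¹ i + j) / 2`, with `φ` the golden ratio -/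
def icosianT : Sphere3 :=
  ⟨quat (Real.goldenRatio / 2) (Real.goldenRatio⁻¹ / 2) (1 / 2) 0, quat_mem_sphere (by
    rw [Real.inv_goldenRatio]
    linarith [Real.goldenRatio_sq, Real.goldenConj_sq, Real.goldenRatio_add_goldenConj])⟩

/-- The binary icosahedral group as a group of unit quaternions (the 120 unit icosians). -/
def unitIcosians : Subgroup Sphere3 := Subgroup.closure {icosianS, icosianT}

/-- The Poincaré homology sphere: the quotient of `S³` by the action of the binary icosahedral
group by multiplication. -/
abbrev PoincareSphere : Type := Sphere3 ⧸ unitIcosians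

end

open scoped unitInterval ContinuousMap ComplexConjugate Topology
open Set

noncomputable section

/-! ### Representations of the fundamental groupoid in a group -/

/-! Everything rests on one peripheral fact (`FramedKnot.IsTrefoil.exists_equiv`): the knot group of
a framed trefoil is isomorphic to the trefoil group so that the meridian becomes `a` and the
longitude `fiber * a ^ k`, where `fiber = (ba)³ = (bab)²` is central. In the abelianization `fiber`
is six times the meridian, so framing number n means k = n - 6. For n = 3 the longitude is cab
(`TrefoilGroup.cab_eq`), for n = 1 it is caba⁻². Put x = ba and y = bab. The trefoil group is (x, y
| x³ = y²), and axy = `fiber`. Killing `fiber * a ^ (-p)` therefore gives ⟨p, 3, 2⟩ with A = a, B =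
x, C = y (`TrefoilGroup.nonempty_quotient_equiv`).

For the topology, the complement of the trefoil is replaced by the complement in ℂ² of the cone |z|
= |w|, z³w̄² ≥ 0. It is the union of two open sets. One retracts to the circle of w, the other to
the circle of z, and their intersection, where z³w̄² is not in [0, ∞), is homotopy equivalent to a
Seifert fibre (s², s³e^{iθ}), which winds 3 and 2 times round the two circles. Van Kampen gives x³ =
y². Near the cone, explicit coordinates exhibit a covering by ℝ⁴ with deck group ℤ². One generator
is the fibre. The other is a meridian, and cutting it into two arcs, one in each open set, shows
that it is y⁻¹x² = a.

A given embedding is compared with these coordinates only near its core. The orientation condition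
makes the direction of the core and the sense of a small meridian reverse together, and the
automorphism inverting a and b absorbs a simultaneous reversal. Radial paths then carry small loops
to the boundary torus, so uniqueness of tubular neighbourhoods is not used. A general trefoil is
pulled back by its diffeomorphism. Framings with a prescribed number arise by twisting an explicit
tube.

For surgery, a representation of the exterior that is trivial on the longitude can be changed by a
gauge until it ignores the longitudinal coordinate of the boundary torus. It then extends over the
glued solid torus. Applied to the quotient of the knot group by the longitude, this gives
`FramedKnot.nonempty_surgery_equiv`.

The Poincaré sphere is covered by the simply connected S³, so its group is the group of unit
icosians. An enumeration of twelve cosets of ⟨A⟩ with A¹⁰ = 1 bounds the order of ⟨5, 3, 2⟩ by 120.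
The image in the quaternions has order divisible by 8, 3 and 5, so the representation is injective.

The language throughout is that of `PathRep`: functions on all paths with values in a group. Van
Kampen becomes gluing (`PathRep.exists_glue`) and uniqueness (`PathRep.eq_of_forall_cover`). A
fundamental group is computed by a representation that is faithful and full
(`PathRep.toHom_bijective`). -/

/-- A representation of the fundamental groupoid of `X` in a group `G`, as a function on paths.
It is contravariant, in accordance with the multiplication of `FundamentalGroup`. -/
structure PathRep (X G : Type*) [TopologicalSpace X] [Group G] where
  val : ∀ {x y : X}, Path x y → G
  map_homotopic : ∀ {x y : X} {γ γ' : Path x y}, γ.Homotopic γ' → val γ = val γ'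
  map_trans : ∀ {x y z : X} (γ : Path x y) (γ' : Path y z),
    val (γ.trans γ') = val γ' * val γ

namespace PathRep

variable {X Y G H : Type*} [TopologicalSpace X] [TopologicalSpace Y] [Group G] [Group H]

variable (R : PathRep X G)

/-- Paths built by different constructions often have end points that agree only propositionally, so
equality of the paths cannot even be stated. Pointwise agreement can, and it suffices. -/
theorem congr_path {x y x' y' : X} (γ : Path x y) (γ' : Path x' y') (h : ∀ t, γ t = γ' t) :
    R.val γ = R.val γ' := by
  have hx : x = x' := by simpa using h 0
  have hy : y = y' := by simpa using h 1
  subst hx hy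
  congr 1
  ext t
  exact h t

@[simp] theorem map_refl (x : X) : R.val (Path.refl x) = 1 := by
  have h := R.map_trans (Path.refl x) (Path.refl x)
  rw [Path.refl_trans_refl] at h
  exact left_eq_mul.1 h

@[simp] theorem map_symm {x y : X} (γ : Path x y) : R.val γ.symm = (R.val γ)⁻¹ := by
  rw [eq_inv_iff_mul_eq_one, ← R.map_trans, R.map_homotopic (γ' := Path.refl x), R.map_refl]
  exact ⟨(Path.Homotopy.reflTransSymm γ).symm⟩

theorem map_subpath_mul {x y : X} (γ : Path x y) (r s t : I) :
    R.val (γ.subpath s t) * R.val (γ.subpath r s) = R.val (γ.subpath r t) := by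
  rw [← R.map_trans]
  exact R.map_homotopic ⟨Path.Homotopy.subpathTransSubpath γ r s t⟩

theorem map_subpath_zero_one {x y : X} (γ : Path x y) : R.val (γ.subpath 0 1) = R.val γ :=
  R.congr_path _ _ fun t => by simp

/-- Pullback along a continuous map. -/
def comap (f : C(Y, X)) : PathRep Y G where
  val γ := R.val (γ.map f.continuous)
  map_homotopic h := R.map_homotopic (h.map f)
  map_trans γ γ' := by rw [Path.map_trans, R.map_trans]

theorem comap_apply (f : C(Y, X)) {x y : Y} (γ : Path x y) :
    (R.comap f).val γ = R.val (γ.map f.continuous) := rfl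

/-- Postcomposition with a homomorphism. -/
def mapHom (φ : G →* H) : PathRep X H where
  val γ := φ (R.val γ)
  map_homotopic h := by rw [R.map_homotopic h]
  map_trans γ γ' := by rw [R.map_trans, map_mul]

theorem mapHom_apply (φ : G →* H) {x y : X} (γ : Path x y) : (R.mapHom φ).val γ = φ (R.val γ) := rfl

/-- The homomorphism on the fundamental group. -/
def toHom (x : X) : FundamentalGroup X x →* G where
  toFun p := Quotient.lift (fun γ : Path x x => R.val γ) (fun _ _ h => R.map_homotopic h) p
  map_one' := R.map_refl x
  map_mul' p q := by
    induction p using Quotient.inductionOn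
    induction q using Quotient.inductionOn
    exact R.map_trans _ _

@[simp] theorem toHom_mk {x : X} (γ : Path x x) :
    R.toHom x (FundamentalGroup.fromPath (Path.Homotopic.Quotient.mk γ)) = R.val γ := rfl

/-- The representation in the fundamental group defined by paths from the base point. -/
def ofSections {x₀ : X} (c : ∀ x, Path x₀ x) : PathRep X (FundamentalGroup X x₀) where
  val {x y} γ := FundamentalGroup.fromPath
    (Path.Homotopic.Quotient.mk ((c x).trans (γ.trans (c y).symm)))
  map_homotopic h := Path.Homotopic.Quotient.eq.2 (.hcomp (.refl _) (.hcomp h (.refl _)))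
  map_trans {x y z} γ γ' := by
    rw [FundamentalGroup.mul_def]
    simp only [Path.Homotopic.Quotient.mk_trans, Path.Homotopic.Quotient.mk_symm]
    grind

theorem ofSections_apply {x₀ : X} (c : ∀ x, Path x₀ x) {x y : X} (γ : Path x y) :
    (ofSections c).val γ = FundamentalGroup.fromPath
      (Path.Homotopic.Quotient.mk ((c x).trans (γ.trans (c y).symm))) := rfl

end PathRep

/-! ### Paths in subsets -/

/-- A path whose values lie in `s`, as a path in `s`. -/
def Path.codRestrict {X : Type*} [TopologicalSpace X] {x y : X} (γ : Path x y) (s : Set X)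
    (h : ∀ t, γ t ∈ s) :
    Path (⟨x, by simpa using h 0⟩ : s) ⟨y, by simpa using h 1⟩ where
  toFun t := ⟨γ t, h t⟩
  continuous_toFun := by fun_prop
  source' := by simp
  target' := by simp

@[simp] theorem Path.coe_codRestrict_apply {X : Type*} [TopologicalSpace X] {x y : X}
    (γ : Path x y) (s : Set X) (h : ∀ t, γ t ∈ s) (t : I) : (γ.codRestrict s h t : X) = γ t := rfl

theorem unitInterval.convexComb_mem_Icc {s t : I} (h : s ≤ t) (u : I) :
    Icc.convexComb s t u ∈ Icc s t :=
  ⟨Icc.le_convexComb h u, Icc.convexComb_le h u⟩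

theorem Path.subpath_mem {X : Type*} [TopologicalSpace X] {x y : X} {γ : Path x y} {s : Set X}
    {r t : I} (hrt : r ≤ t) (h : ∀ u ∈ Icc r t, γ u ∈ s) (u : I) : γ.subpath r t u ∈ s :=
  h _ (unitInterval.convexComb_mem_Icc hrt u)

/-- The midpoint of the unit interval. -/
def unitInterval.mid : I := ⟨1 / 2, by norm_num, by norm_num⟩

/-- Used to restrict a transport or a lift along a composite path to its two halves. -/
theorem Path.trans_convexComb_left {X : Type*} [TopologicalSpace X] {x y z : X} (γ : Path x y)
    (γ' : Path y z) (u : I) : (γ.trans γ') (Icc.convexComb 0 unitInterval.mid u) = γ u := by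
  have h : ((Icc.convexComb 0 unitInterval.mid u : I) : ℝ) ≤ 1 / 2 := by
    have := unitInterval.le_one u
    simp only [Icc.coe_convexComb, Icc.coe_zero, unitInterval.mid]; linarith
  rw [Path.trans_apply, dif_pos h]
  congr 1
  ext
  simp only [Icc.coe_convexComb, Icc.coe_zero, unitInterval.mid]
  ring

theorem Path.trans_convexComb_right {X : Type*} [TopologicalSpace X] {x y z : X} (γ : Path x y)
    (γ' : Path y z) (u : I) : (γ.trans γ') (Icc.convexComb unitInterval.mid 1 u) = γ' u := by
  rcases eq_or_ne u 0 with rfl | hu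
  · rw [Icc.convexComb_zero, Path.trans_apply, dif_pos (by simp [unitInterval.mid])]
    simp [unitInterval.mid]
  have h : ¬ ((Icc.convexComb unitInterval.mid 1 u : I) : ℝ) ≤ 1 / 2 := by
    have : (0 : ℝ) < u := lt_of_le_of_ne (unitInterval.nonneg u) fun h => hu (Subtype.ext h.symm)
    simp only [Icc.coe_convexComb, Icc.coe_one, unitInterval.mid]; linarith
  rw [Path.trans_apply, dif_neg h]
  congr 1
  ext
  simp only [Icc.coe_convexComb, Icc.coe_one, unitInterval.mid]
  ring

/-! ### Gluing representations: the van Kampen theorem -/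

namespace VanKampen

variable {X G ι : Type*} [TopologicalSpace X] [Group G] {c : ι → Set X}

/-- Compatible representations of the members of a cover. -/
def Compatible (R : ∀ i, PathRep (c i) G) : Prop :=
  ∀ (i j : ι) {x y : X} (γ : Path x y) (hi : ∀ t, γ t ∈ c i) (hj : ∀ t, γ t ∈ c j),
    (R i).val (γ.codRestrict _ hi) = (R j).val (γ.codRestrict _ hj)

/-- `g` is the parallel transport along `γ` up to the time `T`. -/
structure IsTransport (R : ∀ i, PathRep (c i) G) {x y : X} (γ : Path x y) (T : I) (g : I → G) :
    Prop where
  zero : g 0 = 1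
  step : ∀ (s t : I) (hst : s ≤ t), t ≤ T → ∀ (i : ι) (h : ∀ u ∈ Icc s t, γ u ∈ c i),
    g t = (R i).val ((γ.subpath s t).codRestrict _ (Path.subpath_mem hst h)) * g s

/-- The multiplicativity of `map_subpath_mul`, for subpaths that are only known to lie in one member
of the cover. -/
theorem subpath_mul (R : ∀ i, PathRep (c i) G) {x y : X} (γ : Path x y) (i : ι) {r s t : I}
    (hrs : r ≤ s) (hst : s ≤ t) (h : ∀ u ∈ Icc r t, γ u ∈ c i) :
    (R i).val ((γ.subpath s t).codRestrict _
        (Path.subpath_mem hst fun u hu => h u ⟨hrs.trans hu.1, hu.2⟩)) *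
      (R i).val ((γ.subpath r s).codRestrict _
        (Path.subpath_mem hrs fun u hu => h u ⟨hu.1, hu.2.trans hst⟩)) =
      (R i).val ((γ.subpath r t).codRestrict _ (Path.subpath_mem (hrs.trans hst) h)) := by
  let δ := (γ.subpath r t).codRestrict _ (Path.subpath_mem (hrs.trans hst) h)
  rcases (hrs.trans hst).eq_or_lt with hrt | hrt
  · have h1 : r = s := le_antisymm hrs (hst.trans hrt.ge)
    subst h1
    subst hrt
    have h2 : (R i).val ((γ.subpath r r).codRestrict _ (Path.subpath_mem le_rfl h)) = 1 := by
      rw [← (R i).map_refl (⟨γ r, h r ⟨le_rfl, le_rfl⟩⟩ : c i)]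
      exact (R i).congr_path _ _ fun t => Subtype.ext (by simp)
    rw [h2, one_mul]
  -- The parameter at which the segment from `r` to `t` passes `s`. The division is legitimate
  -- because r = t has been dealt with.
  let a : I := ⟨((s : ℝ) - r) / (t - r), by
    have h1 : (r : ℝ) ≤ s := hrs
    have h2 : (s : ℝ) ≤ t := hst
    have h3 : (r : ℝ) < t := hrt
    constructor
    · exact div_nonneg (by linarith) (by linarith)
    · rw [div_le_one (by linarith)]; linarith⟩
  have ha : (a : ℝ) * (t - r) = s - r := by
    have h3 : (r : ℝ) < t := hrt
    exact div_mul_cancel₀ _ (by linarith)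
  rw [← (R i).map_subpath_zero_one δ, ← (R i).map_subpath_mul δ 0 a 1]
  congr 1
  · refine (R i).congr_path _ _ fun u => Subtype.ext ?_
    change γ _ = γ _
    congr 1
    ext
    simp only [Icc.coe_convexComb, Icc.coe_one]
    linear_combination (u - 1 : ℝ) * ha
  · refine (R i).congr_path _ _ fun u => Subtype.ext ?_
    change γ _ = γ _
    congr 1
    ext
    simp only [Icc.coe_convexComb, Icc.coe_zero]
    linear_combination (-u : ℝ) * ha

/-- The times of a partition subordinate to a cover. -/
theorem exists_partition (hc : ∀ i, IsOpen (c i)) (hcov : ∀ x, ∃ i, x ∈ c i) {x y : X}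
    (γ : Path x y) : ∃ t : ℕ → I, t 0 = 0 ∧ Monotone t ∧ (∃ n, ∀ m ≥ n, t m = 1) ∧
      ∀ n, ∃ i, ∀ u ∈ Icc (t n) (t (n + 1)), γ u ∈ c i :=
  exists_monotone_Icc_subset_open_cover_unitInterval (c := fun i => γ ⁻¹' c i)
    (fun i => (hc i).preimage γ.continuous)
    (fun u _ => mem_iUnion.2 (hcov (γ u)))

/-- On a partition subordinate to the cover, the step rule determines each value from the preceding
one. -/
theorem IsTransport.eq (hc : ∀ i, IsOpen (c i)) (hcov : ∀ x, ∃ i, x ∈ c i)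
    {R : ∀ i, PathRep (c i) G} {x y : X} {γ : Path x y} {g g' : I → G}
    (h : IsTransport R γ 1 g) (h' : IsTransport R γ 1 g') : g 1 = g' 1 := by
  obtain ⟨t, t0, tm, ⟨n, tn⟩, ht⟩ := exists_partition hc hcov γ
  have key : ∀ n, g (t n) = g' (t n) := by
    intro n
    induction n with
    | zero => rw [t0, h.zero, h'.zero]
    | succ n ih =>
      obtain ⟨i, hi⟩ := ht n
      rw [h.step _ _ (tm n.le_succ) (unitInterval.le_one _) i hi,
        h'.step _ _ (tm n.le_succ) (unitInterval.le_one _) i hi, ih]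
  rw [← tn n le_rfl, key]

/-- Induction over a subordinate partition: a transport up to `t n` is continued to `t (n + 1)` by
the representation of one member of the cover that contains this piece of the path. -/
theorem exists_isTransport (hc : ∀ i, IsOpen (c i)) (hcov : ∀ x, ∃ i, x ∈ c i)
    {R : ∀ i, PathRep (c i) G} (hR : Compatible R) {x y : X} (γ : Path x y) :
    ∃ g, IsTransport R γ 1 g := by
  obtain ⟨t, t0, tm, ⟨n, tn⟩, ht⟩ := exists_partition hc hcov γ
  rw [← tn n le_rfl]
  clear tn
  induction n with
  | zero =>
    refine ⟨fun _ => 1, rfl, fun s u hsu hu i h => ?_⟩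
    have hs : s = u := le_antisymm hsu (hu.trans (t0 ▸ unitInterval.nonneg'))
    subst hs
    rw [mul_one, ← (R i).map_refl (⟨γ s, h s ⟨le_rfl, le_rfl⟩⟩ : c i)]
    exact (R i).congr_path _ _ fun t => Subtype.ext (by simp)
  | succ n ih =>
    obtain ⟨g, hg⟩ := ih
    obtain ⟨j, hj⟩ := ht n
    classical
    -- At the common time `t n` the new clause takes over; it gives the old value there, since a
    -- constant path has value 1.
    refine ⟨fun u => if h : t n ≤ u ∧ u ≤ t (n + 1) then
      (R j).val ((γ.subpath (t n) u).codRestrict _ (Path.subpath_mem h.1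
        fun v hv => hj v ⟨hv.1, hv.2.trans h.2⟩)) * g (t n) else g u, ?_, ?_⟩
    · split_ifs with h
      · have h0 : t n = 0 := le_antisymm h.1 unitInterval.nonneg'
        rw [show g (t n) = 1 by rw [h0, hg.zero], mul_one, ← (R j).map_refl (⟨γ 0, hj 0 h⟩ : c j)]
        refine (R j).congr_path _ _ fun u => Subtype.ext ?_
        change γ (Icc.convexComb (t n) 0 u) = γ 0
        rw [h0, Icc.convexComb_eq]
      · exact hg.zero
    · intro s u hsu hu i hi
      by_cases hun : t n ≤ u
      · rw [dif_pos ⟨hun, hu⟩]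
        by_cases hsn : t n ≤ s
        · rw [dif_pos ⟨hsn, hsu.trans hu⟩, ← mul_assoc,
            hR i j _ _ (Path.subpath_mem hsu fun v hv => hj v ⟨hsn.trans hv.1, hv.2.trans hu⟩),
            subpath_mul R γ j hsn hsu fun v hv => hj v ⟨hv.1, hv.2.trans hu⟩]
        -- The interval straddles `t n`. It is cut there, and compatibility replaces `R j` by `R i`
        -- on the second piece.
        · rw [dif_neg fun h => hsn h.1]
          have hsn' := (not_le.1 hsn).le
          rw [hg.step s (t n) hsn' le_rfl i fun v hv => hi v ⟨hv.1, hv.2.trans hun⟩,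
            hR j i _ _ (Path.subpath_mem hun fun v hv => hi v ⟨hsn'.trans hv.1, hv.2⟩),
            ← mul_assoc, subpath_mul R γ i hsn' hun hi]
      · rw [dif_neg fun h => hun h.1, dif_neg fun h => hun (h.1.trans hsu)]
        exact hg.step s u hsu (not_le.1 hun).le i hi

/-- The parallel transport along a path. -/
def transport (hc : ∀ i, IsOpen (c i)) (hcov : ∀ x, ∃ i, x ∈ c i)
    {R : ∀ i, PathRep (c i) G} (hR : Compatible R) {x y : X} (γ : Path x y) : I → G :=
  (exists_isTransport hc hcov hR γ).choose

theorem isTransport_transport (hc : ∀ i, IsOpen (c i)) (hcov : ∀ x, ∃ i, x ∈ c i)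
    {R : ∀ i, PathRep (c i) G} (hR : Compatible R) {x y : X} (γ : Path x y) :
    IsTransport R γ 1 (transport hc hcov hR γ) :=
  (exists_isTransport hc hcov hR γ).choose_spec

/-- Restricted to the two halves of the time interval, the transport along the composite is a
transport along each factor, the second after normalization at the midpoint. Uniqueness of the end
value does the rest. -/
theorem transport_trans (hc : ∀ i, IsOpen (c i)) (hcov : ∀ x, ∃ i, x ∈ c i)
    {R : ∀ i, PathRep (c i) G} (hR : Compatible R) {x y z : X} (γ : Path x y) (γ' : Path y z) :
    transport hc hcov hR (γ.trans γ') 1 =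
      transport hc hcov hR γ' 1 * transport hc hcov hR γ 1 := by
  set g := transport hc hcov hR (γ.trans γ')
  have hg : IsTransport R (γ.trans γ') 1 g := isTransport_transport hc hcov hR _
  let half : I := unitInterval.mid
  have e1 := Path.trans_convexComb_left γ γ'
  have e2 := Path.trans_convexComb_right γ γ'
  have mono : ∀ a b : I, a ≤ b → Monotone (Icc.convexComb a b : I → I) := by
    intro a b hab s t hst
    have h1 : (a : ℝ) ≤ b := hab
    have h2 : (s : ℝ) ≤ t := hst
    change ((Icc.convexComb a b s : I) : ℝ) ≤ (Icc.convexComb a b t : I)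
    simp only [Icc.coe_convexComb]
    nlinarith
  have surj : ∀ a b : I, a ≤ b → ∀ s t v : I, s ≤ t →
      v ∈ Icc (Icc.convexComb a b s : I) (Icc.convexComb a b t) →
      ∃ w ∈ Icc s t, v = Icc.convexComb a b w := by
    intro a b _ s t v hst hv
    have : v ∈ (fun w => Icc.convexComb a b w) '' Icc s t :=
      intermediate_value_Icc hst (Icc.continuous_convexComb a b).continuousOn hv
    obtain ⟨w, hw, rfl⟩ := this
    exact ⟨w, hw, rfl⟩
  have comb : ∀ a b s t u : I, (Icc.convexComb (Icc.convexComb a b s) (Icc.convexComb a b t) u : I)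
      = Icc.convexComb a b (Icc.convexComb s t u) := by
    intro a b s t u
    ext
    simp only [Icc.coe_convexComb]
    ring
  have h1 : IsTransport R γ 1 fun u => g (Icc.convexComb 0 half u) := by
    refine ⟨by simpa using hg.zero, fun s t hst _ i h => ?_⟩
    rw [hg.step _ _ (mono 0 half unitInterval.nonneg' hst) (unitInterval.le_one _) i ?_]
    · congr 1
      refine (R i).congr_path _ _ fun u => Subtype.ext ?_
      change (γ.trans γ') _ = γ _
      rw [comb, e1]
    · intro v hv
      obtain ⟨w, hw, rfl⟩ := surj 0 half unitInterval.nonneg' s t v hst hv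
      rw [e1]
      exact h w hw
  -- Steps multiply on the left, so a right factor preserves the step rule. This one restores the
  -- initial value 1.
  have h2 : IsTransport R γ' 1 fun u => g (Icc.convexComb half 1 u) * (g half)⁻¹ := by
    refine ⟨by simp, fun s t hst _ i h => ?_⟩
    rw [hg.step _ _ (mono half 1 unitInterval.le_one' hst) (unitInterval.le_one _) i ?_, mul_assoc]
    · congr 1
      refine (R i).congr_path _ _ fun u => Subtype.ext ?_
      change (γ.trans γ') _ = γ' _
      rw [comb, e2]
    · intro v hv
      obtain ⟨w, hw, rfl⟩ := surj half 1 unitInterval.le_one' s t v hst hv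
      rw [e2]
      exact h w hw
  rw [(isTransport_transport hc hcov hR γ).eq hc hcov h1,
    (isTransport_transport hc hcov hR γ').eq hc hcov h2]
  simp

/-- The two ways round a square agree. -/
theorem map_square (R : PathRep X G) (S : C(I × I, X)) {p q r s : X}
    (bot : Path p q) (top : Path r s) (left : Path p r) (right : Path q s)
    (hbot : ∀ t, bot t = S (0, t)) (htop : ∀ t, top t = S (1, t))
    (hleft : ∀ t, left t = S (t, 0)) (hright : ∀ t, right t = S (t, 1)) :
    R.val right * R.val bot = R.val top * R.val left := by
  have hp : p = S (0, 0) := by simpa using hbot 0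
  have hq : q = S (0, 1) := by simpa using hbot 1
  have hr : r = S (1, 0) := by simpa using htop 0
  have hs : s = S (1, 1) := by simpa using htop 1
  subst hp hq hr hs
  let f : C(I, X) := S.comp ⟨fun t => (0, t), by fun_prop⟩
  let g : C(I, X) := S.comp ⟨fun t => (1, t), by fun_prop⟩
  let F : f.Homotopy g :=
    { toContinuousMap := S, map_zero_left := fun _ => rfl, map_one_left := fun _ => rfl }
  have key := Path.Homotopic.map_trans_evalAt F Path.id
  have h := R.map_homotopic key
  rw [R.map_trans, R.map_trans] at h
  convert h using 2
  · exact R.congr_path _ _ fun t => hright t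
  · exact R.congr_path _ _ fun t => hbot t
  · exact R.congr_path _ _ fun t => htop t
  · exact R.congr_path _ _ fun t => hleft t

/-- The square is cut into a grid whose cells each map into one member of the cover. Transports
along consecutive rows differ by the value of the vertical edge between them, and this edge is
constant at the right side of the square. -/
theorem transport_homotopic (hc : ∀ i, IsOpen (c i)) (hcov : ∀ x, ∃ i, x ∈ c i)
    {R : ∀ i, PathRep (c i) G} (hR : Compatible R) {x y : X} {γ γ' : Path x y}
    (h : γ.Homotopic γ') : transport hc hcov hR γ 1 = transport hc hcov hR γ' 1 := by
  obtain ⟨H⟩ := h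
  obtain ⟨t, t0, tm, ⟨N, tN⟩, ht⟩ :=
    exists_monotone_Icc_subset_open_cover_unitInterval_prod_self (c := fun i => H ⁻¹' c i)
      (fun i => (hc i).preimage H.continuous) (fun u _ => mem_iUnion.2 (hcov (H u)))
  let g : I → I → G := fun s => transport hc hcov hR (H.eval s)
  have hg : ∀ s, IsTransport R (H.eval s) 1 (g s) := fun s => isTransport_transport hc hcov hR _
  let vert : ∀ (n : ℕ) (b : I), Path (H (t n, b)) (H (t (n + 1), b)) := fun n b =>
    { toFun := fun u => H (Icc.convexComb (t n) (t (n + 1)) u, b)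
      continuous_toFun := H.continuous.comp
        ((Icc.continuous_convexComb _ _).prodMk continuous_const)
      source' := by simp
      target' := by simp }
  have vmem : ∀ n u, Icc.convexComb (t n) (t (n + 1)) u ∈ Icc (t n) (t (n + 1)) :=
    fun n u => unitInterval.convexComb_mem_Icc (tm n.le_succ) u
  -- Quantified over every `i` whose set contains the edge, because the cells on the two sides of an
  -- edge may lie in different members of the cover.
  have key : ∀ n m i (hi : ∀ u, vert n (t m) u ∈ c i),
      g (t (n + 1)) (t m) = (R i).val ((vert n (t m)).codRestrict _ hi) * g (t n) (t m) := by
    intro n m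
    induction m with
    | zero =>
      intro i
      rw [t0]
      intro hi
      rw [(hg _).zero, (hg _).zero, mul_one,
        ← (R i).map_refl (⟨x, by simpa using hi 0⟩ : c i)]
      exact (R i).congr_path _ _ fun u => Subtype.ext (by simp [vert])
    | succ m ih =>
      intro i hi
      obtain ⟨j, hj⟩ := ht n m
      have hj' : ∀ a ∈ Icc (t n) (t (n + 1)), ∀ b ∈ Icc (t m) (t (m + 1)), H (a, b) ∈ c j :=
        fun a ha b hb => hj ⟨ha, hb⟩
      have hv : ∀ b ∈ Icc (t m) (t (m + 1)), ∀ u, vert n b u ∈ c j :=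
        fun b hb u => hj' _ (vmem n u) b hb
      have hm : t m ∈ Icc (t m) (t (m + 1)) := ⟨le_rfl, tm m.le_succ⟩
      have hm' : t (m + 1) ∈ Icc (t m) (t (m + 1)) := ⟨tm m.le_succ, le_rfl⟩
      have hn : t n ∈ Icc (t n) (t (n + 1)) := ⟨le_rfl, tm n.le_succ⟩
      have hn' : t (n + 1) ∈ Icc (t n) (t (n + 1)) := ⟨tm n.le_succ, le_rfl⟩
      rw [hR i j _ hi (hv _ hm'),
        (hg (t (n + 1))).step _ _ (tm m.le_succ) (unitInterval.le_one _) j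
          fun u hu => hj' _ hn' u hu,
        (hg (t n)).step _ _ (tm m.le_succ) (unitInterval.le_one _) j
          fun u hu => hj' _ hn u hu,
        ih j (hv _ hm), ← mul_assoc, ← mul_assoc]
      congr 1
      symm
      let S : C(I × I, c j) :=
        ⟨fun p => ⟨H (Icc.convexComb (t n) (t (n + 1)) p.1, Icc.convexComb (t m) (t (m + 1)) p.2),
          hj' _ (vmem n p.1) _ (unitInterval.convexComb_mem_Icc (tm m.le_succ) p.2)⟩, by
          refine Continuous.subtype_mk (H.continuous.comp ?_) _
          exact ((Icc.continuous_convexComb _ _).comp continuous_fst).prodMk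
            ((Icc.continuous_convexComb _ _).comp continuous_snd)⟩
      refine map_square (R j) S _ _ _ _ ?_ ?_ ?_ ?_ <;> intro u <;> apply Subtype.ext <;>

        simp only [S, ContinuousMap.coe_mk, Icc.convexComb_zero, Icc.convexComb_one] <;> rfl
  -- The last edge of the strip is the constant path at `y`.
  have step : ∀ n, g (t (n + 1)) 1 = g (t n) 1 := by
    intro n
    obtain ⟨i, hi⟩ := hcov y
    have hi' : ∀ u, vert n (t N) u ∈ c i := by
      intro u
      simp [vert, tN N le_rfl, hi]
    have h := key n N i hi'
    rw [show (R i).val ((vert n (t N)).codRestrict _ hi') = 1 by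
      rw [← (R i).map_refl (⟨y, hi⟩ : c i)]
      exact (R i).congr_path _ _ fun u => Subtype.ext (by simp [vert, tN N le_rfl])] at h
    rwa [tN N le_rfl, one_mul] at h
  have all : ∀ n, g (t n) 1 = g 0 1 := by
    intro n
    induction n with
    | zero => rw [t0]
    | succ n ih => rw [step, ih]
  have := all N
  rw [tN N le_rfl] at this
  simpa [g] using this.symm

end VanKampen

namespace PathRep

open VanKampen

variable {X G ι : Type*} [TopologicalSpace X] [Group G] {c : ι → Set X}

/-- The van Kampen theorem, existence: compatible representations of the members of an open cover
extend to the whole space. -/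
theorem exists_glue (hc : ∀ i, IsOpen (c i)) (hcov : ∀ x, ∃ i, x ∈ c i)
    (R : ∀ i, PathRep (c i) G) (hR : Compatible R) :
    ∃ S : PathRep X G, ∀ (i : ι) {x y : X} (γ : Path x y) (h : ∀ t, γ t ∈ c i),
      S.val γ = (R i).val (γ.codRestrict _ h) := by
  refine ⟨⟨fun γ => transport hc hcov hR γ 1, fun h => transport_homotopic hc hcov hR h,
    fun γ γ' => transport_trans hc hcov hR γ γ'⟩, fun i x y γ h => ?_⟩
  have hg := isTransport_transport hc hcov hR γ
  change transport hc hcov hR γ 1 = _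
  rw [hg.step 0 1 zero_le_one le_rfl i fun u _ => h u, hg.zero, mul_one]
  exact (R i).congr_path _ _ fun u => Subtype.ext (by simp)

/-- The van Kampen theorem, uniqueness: a representation is determined by its values on the paths
that lie in a member of an open cover. -/
theorem eq_of_forall_cover (hc : ∀ i, IsOpen (c i)) (hcov : ∀ x, ∃ i, x ∈ c i)
    (R S : PathRep X G)
    (h : ∀ (i : ι) {x y : X} (γ : Path x y), (∀ t, γ t ∈ c i) → R.val γ = S.val γ)
    {x y : X} (γ : Path x y) : R.val γ = S.val γ := by
  obtain ⟨t, t0, tm, ⟨n, tn⟩, ht⟩ := exists_partition hc hcov γ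
  have key : ∀ n, R.val (γ.subpath 0 (t n)) = S.val (γ.subpath 0 (t n)) := by
    intro n
    induction n with
    | zero => rw [t0, Path.subpath_self, R.map_refl, S.map_refl]
    | succ n ih =>
      obtain ⟨i, hi⟩ := ht n
      rw [← R.map_subpath_mul γ 0 (t n), ← S.map_subpath_mul γ 0 (t n), ih,
        h i (γ.subpath (t n) (t (n + 1))) (Path.subpath_mem (tm n.le_succ) hi)]
  rw [← R.map_subpath_zero_one, ← S.map_subpath_zero_one, ← tn n le_rfl, key]

end PathRep

/-! ### Variation of the angle along paths in the circle -/

namespace Circle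

variable {x y z : Circle}

theorem exists_lift (γ : Path x y) :
    ∃ g : I → ℝ, Continuous g ∧ ∀ t, γ t = Circle.exp (g t) := by
  obtain ⟨Γ, h, -⟩ := isCoveringMap_exp.exists_path_lifts γ.toContinuousMap (Complex.arg x)
    (by simp [Circle.exp_arg])
  exact ⟨Γ, Γ.continuous, fun t => (congrFun h t).symm⟩

/-- The variation of the angle along a path in the circle. -/
def angle (γ : Path x y) : ℝ :=
  (exists_lift γ).choose 1 - (exists_lift γ).choose 0

/-- Two lifts of a path differ by a constant, by uniqueness of lifts, so the difference of the end
values does not depend on the lift. -/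
theorem angle_eq (γ : Path x y) {g : I → ℝ} (hg : Continuous g)
    (h : ∀ t, γ t = Circle.exp (g t)) : angle γ = g 1 - g 0 := by
  obtain ⟨hk, hkγ⟩ := (exists_lift γ).choose_spec
  set k := (exists_lift γ).choose with hk_def
  have hex : Circle.exp (k 0) = Circle.exp (g 0) := by rw [← hkγ, ← h]
  have key : (fun t => g t + (k 0 - g 0)) = k :=
    isCoveringMap_exp.eq_of_comp_eq (by fun_prop) hk (by
      ext1 t
      have : Circle.exp (g t + (k 0 - g 0)) = Circle.exp (k t) := by
        rw [Circle.exp_add, Circle.exp_sub, hex, div_self', mul_one, ← h, hkγ]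
      exact this) 0 (by ring)
  have h1 := congrFun key 1
  have : angle γ = k 1 - k 0 := rfl
  rw [this, ← h1]
  ring

theorem angle_trans (γ : Path x y) (γ' : Path y z) :
    angle (γ.trans γ') = angle γ + angle γ' := by
  obtain ⟨g, hg, h⟩ := exists_lift (γ.trans γ')
  let half : I := unitInterval.mid
  rw [angle_eq _ hg h,
    angle_eq γ (g := fun u => g (Icc.convexComb 0 half u))
      (hg.comp (Icc.continuous_convexComb _ _)) (fun t => by rw [← h, Path.trans_convexComb_left]),
    angle_eq γ' (g := fun u => g (Icc.convexComb half 1 u))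
      (hg.comp (Icc.continuous_convexComb _ _)) (fun t => by rw [← h, Path.trans_convexComb_right])]
  simp

/-- Homotopic paths lifted from one starting angle end at one angle. -/
theorem angle_homotopic {γ γ' : Path x y} (h : γ.Homotopic γ') : angle γ = angle γ' := by
  have hx : γ.toContinuousMap 0 = Circle.exp (Complex.arg x) := by simp [Circle.exp_arg]
  have hx' : γ'.toContinuousMap 0 = Circle.exp (Complex.arg x) := by simp [Circle.exp_arg]
  have key := isCoveringMap_exp.liftPath_apply_one_eq_of_homotopicRel
    (γ₀ := γ.toContinuousMap) (γ₁ := γ'.toContinuousMap) h (Complex.arg x) hx hx'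
  rw [angle_eq γ (map_continuous (isCoveringMap_exp.liftPath γ.toContinuousMap (Complex.arg x) hx))
      fun t => (congrFun (isCoveringMap_exp.liftPath_lifts γ.toContinuousMap _ hx) t).symm,
    angle_eq γ' (map_continuous (isCoveringMap_exp.liftPath γ'.toContinuousMap (Complex.arg x) hx'))
      fun t => (congrFun (isCoveringMap_exp.liftPath_lifts γ'.toContinuousMap _ hx') t).symm,
    key, isCoveringMap_exp.liftPath_zero, isCoveringMap_exp.liftPath_zero]

theorem exp_angle (γ : Path x y) : Circle.exp (angle γ) * x = y := by
  obtain ⟨g, hg, h⟩ := exists_lift γ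
  have h0 := h 0
  have h1 := h 1
  rw [γ.source] at h0
  rw [γ.target] at h1
  rw [angle_eq γ hg h, Circle.exp_sub, h0, h1]
  simp

theorem angle_congr {x' y' : Circle} (γ : Path x y) (γ' : Path x' y') (h : ∀ t, γ t = γ' t) :
    angle γ = angle γ' := by
  obtain ⟨g, hg, hγ⟩ := exists_lift γ
  rw [angle_eq γ hg hγ, angle_eq γ' hg fun t => by rw [← h, hγ]]

/-- The path `t ↦ x e^{irt}`. -/
def arc (x : Circle) (r : ℝ) : Path x (Circle.exp r * x) where
  toFun t := Circle.exp (r * t) * x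
  continuous_toFun := by fun_prop
  source' := by simp
  target' := by simp

@[simp] theorem angle_arc (x : Circle) (r : ℝ) : angle (arc x r) = r := by
  rw [angle_eq (arc x r) (g := fun t => r * t + Complex.arg x) (by fun_prop)]
  · simp
  · intro t
    rw [Circle.exp_add, Circle.exp_arg]
    rfl

end Circle

/-- Two paths that lift to paths with the same end points in a vector space are homotopic. -/
theorem Path.homotopic_of_lift {E X : Type*} [AddCommGroup E] [Module ℝ E] [TopologicalSpace E]
    [IsTopologicalAddGroup E] [ContinuousSMul ℝ E] [TopologicalSpace X] (f : C(E, X)) {x y : X}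
    {γ γ' : Path x y} {g g' : I → E} (hg : Continuous g) (hg' : Continuous g')
    (h : ∀ t, γ t = f (g t)) (h' : ∀ t, γ' t = f (g' t)) (h0 : g 0 = g' 0) (h1 : g 1 = g' 1) :
    γ.Homotopic γ' := by
  refine ⟨{
    toFun := fun p => f ((1 - (p.1 : ℝ)) • g p.2 + (p.1 : ℝ) • g' p.2)
    continuous_toFun := by fun_prop
    map_zero_left := fun t => by simp [h]
    map_one_left := fun t => by simp [h']
    prop' := ?_ }⟩
  rintro s t (rfl | ht)
  · simp [← h0, ← add_smul, h]
  · rw [Set.mem_singleton_iff.1 ht]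
    simp [← h1, ← add_smul, h]

/-- After a shift the lifts start together, and equal angles make them end together. The straight
homotopy upstairs then fixes both ends. -/
theorem Circle.homotopic_of_angle_eq {x y : Circle} {γ γ' : Path x y} (h : angle γ = angle γ') :
    γ.Homotopic γ' := by
  obtain ⟨g, hg, hγ⟩ := exists_lift γ
  obtain ⟨g', hg', hγ'⟩ := exists_lift γ'
  have hex : Circle.exp (g 0) = Circle.exp (g' 0) := by rw [← hγ, ← hγ', γ.source, γ'.source]
  refine Path.homotopic_of_lift Circle.exp (g := g) (g' := fun t => g' t + (g 0 - g' 0)) hg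
    (by fun_prop) hγ (fun t => ?_) (by ring) ?_
  · rw [Circle.exp_add, Circle.exp_sub, hex, div_self', mul_one, hγ']
  · rw [angle_eq γ hg hγ, angle_eq γ' hg' hγ'] at h
    linarith

/-! ### Integer representations from maps to the circle -/

namespace PathRep

variable {Y : Type*} [TopologicalSpace Y]

/-- `l` is any choice of angles, in general discontinuous. It corrects the real angle of an open
path to an integer number of turns, so a map to the circle yields a representation of the whole
groupoid and not only of loops. -/
theorem exists_int_angle (φ : C(Y, Circle)) (l : Y → ℝ) (hl : ∀ p, Circle.exp (l p) = φ p)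
    {p q : Y} (γ : Path p q) :
    ∃ n : ℤ, Circle.angle (γ.map φ.continuous) = n * (2 * Real.pi) + (l q - l p) := by
  have h := Circle.exp_angle (γ.map φ.continuous)
  have h2 : Circle.exp (Circle.angle (γ.map φ.continuous) - (l q - l p)) = 1 := by
    rw [Circle.exp_sub, Circle.exp_sub, hl, hl, div_eq_one, eq_div_iff_mul_eq', h]
  obtain ⟨n, hn⟩ := Circle.exp_eq_one.1 h2
  exact ⟨n, by linarith⟩

/-- The winding number relative to a choice `l` of angles of the points. -/
def winding (φ : C(Y, Circle)) (l : Y → ℝ) (hl : ∀ p, Circle.exp (l p) = φ p) {p q : Y}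
    (γ : Path p q) : ℤ := (exists_int_angle φ l hl γ).choose

theorem winding_eq_iff (φ : C(Y, Circle)) (l : Y → ℝ) (hl : ∀ p, Circle.exp (l p) = φ p) {p q : Y}
    (γ : Path p q) (n : ℤ) : winding φ l hl γ = n ↔
      Circle.angle (γ.map φ.continuous) = n * (2 * Real.pi) + (l q - l p) := by
  have h := (exists_int_angle φ l hl γ).choose_spec
  change _ = (winding φ l hl γ : ℝ) * _ + _ at h
  rw [h]
  constructor
  · rintro rfl; rfl
  · intro h
    have : (winding φ l hl γ : ℝ) = n :=
      mul_right_cancel₀ (b := 2 * Real.pi) (by positivity) (by linarith)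
    exact_mod_cast this

/-- The representation `γ ↦ g ^ n`, with `n` the winding number of `γ`. -/
def windingRep {G : Type*} [Group G] (φ : C(Y, Circle)) (l : Y → ℝ)
    (hl : ∀ p, Circle.exp (l p) = φ p) (g : G) : PathRep Y G where
  val γ := g ^ winding φ l hl γ
  map_homotopic {x y γ γ'} h := by
    congr 1
    rw [winding_eq_iff, Circle.angle_homotopic (h.map φ), ← winding_eq_iff φ l hl]
  map_trans {x y z} γ γ' := by
    rw [← zpow_add]
    congr 1
    rw [winding_eq_iff, Path.map_trans, Circle.angle_trans,
      (winding_eq_iff φ l hl γ _).1 rfl, (winding_eq_iff φ l hl γ' _).1 rfl]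
    push_cast
    ring

end PathRep

/-! ### Phases of nonzero complex numbers -/

/-- The point `z / |z|` of the circle. -/
def phase (z : ℂ) : Circle := Circle.exp (Complex.arg z)

theorem norm_mul_phase (z : ℂ) : (‖z‖ : ℂ) * phase z = z := by
  rw [phase, Circle.coe_exp, Complex.norm_mul_exp_arg_mul_I]

theorem phase_eq_of {z : ℂ} {r : ℝ} {u : Circle} (hr : 0 < r) (h : z = r * u) : phase z = u := by
  have hz : ‖z‖ = r := by rw [h, norm_mul, Circle.norm_coe]; simp [abs_of_pos hr]
  have h1 := norm_mul_phase z
  rw [hz] at h1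
  replace h1 := h1.trans h
  exact Circle.coe_injective (mul_left_cancel₀ (Complex.ofReal_ne_zero.2 hr.ne') h1)

theorem coe_phase {z : ℂ} (hz : z ≠ 0) : (phase z : ℂ) = z / ‖z‖ := by
  rw [eq_div_iff (by simpa using hz), mul_comm, norm_mul_phase]

theorem continuousAt_phase {z : ℂ} (hz : z ≠ 0) : ContinuousAt phase z := by
  have hind : Topology.IsInducing (fun u : Circle => (u : ℂ)) := ⟨rfl⟩
  refine hind.continuousAt_iff.2 ?_
  refine ContinuousAt.congr (f := fun z : ℂ => z / ‖z‖) ?_ ?_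
  · exact continuousAt_id.div (by fun_prop) (by simpa using hz)
  · filter_upwards [isOpen_ne.mem_nhds hz] with w hw
    exact (coe_phase hw).symm

theorem Continuous.phase {Y : Type*} [TopologicalSpace Y] {f : Y → ℂ} (hf : Continuous f)
    (h : ∀ y, f y ≠ 0) : Continuous fun y => phase (f y) :=
  continuous_iff_continuousAt.2 fun y => (continuousAt_phase (h y)).comp hf.continuousAt

theorem phase_mul {z w : ℂ} (hz : z ≠ 0) (hw : w ≠ 0) : phase (z * w) = phase z * phase w := by
  refine phase_eq_of (r := ‖z‖ * ‖w‖) (by positivity) ?_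
  push_cast
  conv_lhs => rw [← norm_mul_phase z, ← norm_mul_phase w]
  ring

@[simp] theorem phase_coe (u : Circle) : phase (u : ℂ) = u :=
  phase_eq_of one_pos (by simp)

/-! ### The trefoil group and the binary polyhedral groups -/

namespace TrefoilGroup

theorem rel_a : a = b⁻¹ * c * b := by
  rw [← mul_inv_eq_one]
  exact PresentedGroup.one_of_mem (rels := trefoilRels) (by simp [trefoilRels])

theorem c_eq : c = a⁻¹ * b * a := by
  rw [← mul_inv_eq_one]
  exact PresentedGroup.one_of_mem (rels := trefoilRels) (by simp [trefoilRels])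

/-- Eliminating c by the third relation turns the first one into the braid relation. The second
relation is a consequence, as `lift` confirms. -/
theorem braid : b * a * b = a * b * a := by
  have h := rel_a
  rw [c_eq] at h
  have h2 : b * a = a⁻¹ * b * a * b := by
    conv_lhs => rw [h]
    group
  have h3 : a * (b * a) = b * a * b := by
    conv_lhs => rw [h2]
    group
  rw [← h3, mul_assoc]

/-- The element `ba`, which generates the fundamental group of one of the Heegaard solid tori. -/
def x : TrefoilGroup := b * a

/-- The element `bab`, which generates the fundamental group of the other solid torus. -/
def y : TrefoilGroup := b * a * b

/-- The class of the regular fibre, which generates the centre. -/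
def fiber : TrefoilGroup := x ^ 3

/-- (ba)³ = (bab)(aba), and the braid relation makes the two factors equal. -/
theorem x_pow_three : x ^ 3 = y ^ 2 := by
  have h : x ^ 3 = (b * a * b) * (a * b * a) := by
    simp only [x, pow_succ, pow_zero, one_mul, mul_assoc]
  rw [h, ← braid, y, sq]

theorem a_eq : a = y⁻¹ * x ^ 2 := by
  rw [x, y, sq]
  group

theorem b_eq : b = x⁻¹ * y := by
  rw [x, y]
  group

theorem hom_ext {H : Type*} [Group H] {f g : TrefoilGroup →* H} (ha : f a = g a) (hb : f b = g b) :
    f = g := by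
  refine PresentedGroup.ext fun i => ?_
  fin_cases i
  · exact ha
  · exact hb
  · change f c = g c
    rw [c_eq]
    simp [ha, hb]

/-- As a power of x and of y, the element commutes with both, and a and b are words in x and y. -/
theorem fiber_comm (g : TrefoilGroup) : fiber * g = g * fiber := by
  have hx : fiber * x = x * fiber := by rw [fiber, ← pow_succ, pow_succ']
  have hy : fiber * y = y * fiber := by rw [fiber, x_pow_three, ← pow_succ, pow_succ']
  have hx' : Commute fiber x := hx
  have hy' : Commute fiber y := hy
  have key : (MulAut.conj fiber).toMonoidHom = MonoidHom.id TrefoilGroup := by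
    refine hom_ext ?_ ?_
    · have h : Commute fiber a := by
        rw [a_eq]
        exact hy'.inv_right.mul_right (hx'.pow_right 2)
      simp [h.eq]
    · have h : Commute fiber b := by
        rw [b_eq]
        exact hx'.inv_right.mul_right hy'
      simp [h.eq]
  have h := DFunLike.congr_fun key g
  simpa [mul_inv_eq_iff_eq_mul] using h

/-- Substituting c = a⁻¹ba gives a(cab)a³ = baaba³, and the braid relation turns ba(bab)a · a into
the same word. Centrality of `fiber` then allows cancelling a. -/
theorem cab_eq : c * a * b = fiber * a ^ (-3 : ℤ) := by
  have h1 : fiber = b * a * (b * a * b) * a := by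
    simp only [fiber, x, pow_succ, pow_zero, one_mul, mul_assoc]
  have h2 : a * (c * a * b * a ^ 3) = fiber * a := by
    rw [c_eq, h1, braid]
    simp only [pow_succ, pow_zero, one_mul]
    group
  rw [fiber_comm] at h2
  rw [← mul_left_cancel h2]
  group

/-- Homomorphisms out of the trefoil group, in terms of the braid relation. -/
def lift {H : Type*} [Group H] (u v : H) (h : v * u * v = u * v * u) : TrefoilGroup →* H :=
  PresentedGroup.toGroup (f := ![u, v, u⁻¹ * v * u]) (by
    rintro r (rfl | rfl | rfl)
    · have h1 : v⁻¹ * (u⁻¹ * v * u) * v = u := by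
        calc v⁻¹ * (u⁻¹ * v * u) * v = v⁻¹ * u⁻¹ * (v * u * v) := by group
          _ = u := by rw [h]; group
      simp only [map_mul, map_inv, FreeGroup.lift_apply_of]
      exact mul_inv_eq_one.2 h1.symm
    · have h1 : (u⁻¹ * v * u)⁻¹ * u * (u⁻¹ * v * u) = v := by
        calc (u⁻¹ * v * u)⁻¹ * u * (u⁻¹ * v * u) = u⁻¹ * v⁻¹ * (u * v * u) := by group
          _ = v := by rw [← h]; group
      simp only [map_mul, map_inv, FreeGroup.lift_apply_of]
      exact mul_inv_eq_one.2 h1.symm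
    · simp only [map_mul, map_inv, FreeGroup.lift_apply_of]
      exact mul_inv_cancel _)

theorem lift_a {H : Type*} [Group H] (u v : H) (h : v * u * v = u * v * u) : lift u v h a = u :=
  PresentedGroup.toGroup.of _

theorem lift_b {H : Type*} [Group H] (u v : H) (h : v * u * v = u * v * u) : lift u v h b = v :=
  PresentedGroup.toGroup.of _

theorem lift_x {H : Type*} [Group H] (u v : H) (h : v * u * v = u * v * u) :
    lift u v h x = v * u := by
  rw [x, map_mul, lift_a, lift_b]

theorem lift_y {H : Type*} [Group H] (u v : H) (h : v * u * v = u * v * u) :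
    lift u v h y = v * u * v := by
  rw [y, map_mul, map_mul, lift_a, lift_b]

/-- Homomorphisms out of the trefoil group, in terms of its presentation `x³ = y²`. -/
theorem exists_hom {H : Type*} [Group H] {u v : H} (h : u ^ 3 = v ^ 2) :
    ∃ f : TrefoilGroup →* H, f x = u ∧ f y = v := by
  have h1 : u⁻¹ * v * (v⁻¹ * u ^ 2) = u := by rw [sq]; group
  have h2 : u⁻¹ * v * (v⁻¹ * u ^ 2) * (u⁻¹ * v) = v := by rw [h1]; group
  have h3 : v⁻¹ * u ^ 2 * (u⁻¹ * v) * (v⁻¹ * u ^ 2) = v := by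
    calc v⁻¹ * u ^ 2 * (u⁻¹ * v) * (v⁻¹ * u ^ 2) = v⁻¹ * u ^ 3 := by
          simp only [pow_succ, pow_zero, one_mul]; group
      _ = v := by rw [h, sq]; group
  exact ⟨lift (v⁻¹ * u ^ 2) (u⁻¹ * v) (h2.trans h3.symm), by rw [lift_x, h1], by rw [lift_y, h2]⟩

/-- The automorphism of the trefoil group that inverts the generators `a` and `b`. -/
def inversion : TrefoilGroup →* TrefoilGroup :=
  lift a⁻¹ b⁻¹ (by
    have h := congrArg (·⁻¹) braid
    simpa [mul_assoc] using h)

theorem inversion_a : inversion a = a⁻¹ := lift_a _ _ _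

theorem inversion_fiber : inversion fiber = fiber⁻¹ := by
  have h : inversion y = y⁻¹ := by
    rw [inversion, lift_y, y]
    simp [mul_assoc]
  rw [fiber, x_pow_three, map_pow, h, inv_pow]

theorem inversion_inversion (g : TrefoilGroup) : inversion (inversion g) = g := by
  have key : inversion.comp inversion = MonoidHom.id _ := by
    refine hom_ext ?_ ?_
    · simp [inversion_a]
    · simp [inversion, lift_b]
  exact DFunLike.congr_fun key g

/-- Inversion of the generators, as an automorphism. -/
def inversionEquiv : TrefoilGroup ≃* TrefoilGroup where
  toFun := inversion
  invFun := inversion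
  left_inv := inversion_inversion
  right_inv := inversion_inversion
  map_mul' := map_mul _

/-- The exponent sum. -/
def exponent : TrefoilGroup →* Multiplicative ℤ :=
  lift (Multiplicative.ofAdd 1) (Multiplicative.ofAdd 1) rfl

theorem exponent_a : exponent a = Multiplicative.ofAdd 1 := lift_a _ _ _

theorem exponent_fiber : exponent fiber = Multiplicative.ofAdd 6 := by
  rw [fiber, map_pow, exponent, lift_x]
  rfl

/-- The braid relation identifies b with a in the abelianization, and (ba)³ has length six. -/
theorem abelianization_fiber : Abelianization.of fiber = Abelianization.of a ^ 6 := by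
  have hab : Abelianization.of b = Abelianization.of a := by
    have h := congrArg Abelianization.of braid
    simp only [map_mul] at h
    rw [mul_comm (Abelianization.of a * Abelianization.of b), mul_comm (Abelianization.of b),
      mul_comm _ (Abelianization.of b)] at h
    exact mul_right_cancel h
  rw [fiber, x, map_pow, map_mul, hab, ← sq, ← pow_mul]

end TrefoilGroup

namespace BinaryPolyhedral

variable {p q r : ℕ}

/-- The three generators. -/
def gen (i : Fin 3) : BinaryPolyhedral p q r := PresentedGroup.of i

/-- The central element `ABC`. -/
def central : BinaryPolyhedral p q r := gen 0 * gen 1 * gen 2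

theorem gen_zero_pow : (gen 0 : BinaryPolyhedral p q r) ^ p = central := by
  rw [← mul_inv_eq_one]
  exact PresentedGroup.one_of_mem (rels := binaryPolyhedralRels p q r)
    (by simp [binaryPolyhedralRels])

theorem gen_one_pow : (gen 1 : BinaryPolyhedral p q r) ^ q = central := by
  rw [← mul_inv_eq_one]
  exact PresentedGroup.one_of_mem (rels := binaryPolyhedralRels p q r)
    (by simp [binaryPolyhedralRels])

theorem gen_two_pow : (gen 2 : BinaryPolyhedral p q r) ^ r = central := by
  rw [← mul_inv_eq_one]
  exact PresentedGroup.one_of_mem (rels := binaryPolyhedralRels p q r)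
    (by simp [binaryPolyhedralRels])

/-- Homomorphisms out of the binary polyhedral group. -/
def lift {H : Type*} [Group H] (u v w : H) (h1 : u ^ p = u * v * w) (h2 : v ^ q = u * v * w)
    (h3 : w ^ r = u * v * w) : BinaryPolyhedral p q r →* H :=
  PresentedGroup.toGroup (f := ![u, v, w]) (by
    rintro s (rfl | rfl | rfl) <;>
      simp only [map_mul, map_inv, map_pow, FreeGroup.lift_apply_of]
    · exact mul_inv_eq_one.2 h1
    · exact mul_inv_eq_one.2 h2
    · exact mul_inv_eq_one.2 h3)

theorem lift_gen {H : Type*} [Group H] (u v w : H) (h1 : u ^ p = u * v * w)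
    (h2 : v ^ q = u * v * w) (h3 : w ^ r = u * v * w) (i : Fin 3) :
    lift (p := p) (q := q) (r := r) u v w h1 h2 h3 (gen i) = ![u, v, w] i :=
  PresentedGroup.toGroup.of _

end BinaryPolyhedral

open BinaryPolyhedral in
/-- The quotient of the trefoil group by `fiber * a ^ (-p)` is the group `⟨p, 3, 2⟩`. -/
theorem TrefoilGroup.nonempty_quotient_equiv (p : ℕ) :
    Nonempty (TrefoilGroup ⧸ Subgroup.normalClosure {fiber * a ^ (-(p : ℤ))} ≃*
      BinaryPolyhedral p 3 2) := by
  set N := Subgroup.normalClosure {fiber * a ^ (-(p : ℤ))}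
  let A : BinaryPolyhedral p 3 2 := gen 0
  let B : BinaryPolyhedral p 3 2 := gen 1
  let C : BinaryPolyhedral p 3 2 := gen 2
  have hA : A ^ p = A * B * C := gen_zero_pow
  have hB : B ^ 3 = A * B * C := gen_one_pow
  have hC : C ^ 2 = A * B * C := gen_two_pow
  -- A commutes with A ^ p = ABC, so BCA = ABC = B³; cancel B.
  have hB' : B ^ 2 = C * A := by
    have h1 : B * (B ^ 2) = B * (C * A) := by
      have h2 : A * (B * C * A) = A * (B ^ 3) := by
        have h4 : Commute A (A ^ p) := (Commute.refl A).pow_right p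
        rw [hA] at h4
        calc A * (B * C * A) = (A * B * C) * A := by group
          _ = A * (A * B * C) := h4.eq.symm
          _ = _ := by rw [hB]
      rw [← pow_succ', ← mul_left_cancel h2, mul_assoc]
    exact mul_left_cancel h1
  -- The map sends x to B and y to C, so that a = y⁻¹x² goes to C⁻¹B² = A.
  obtain ⟨f, hfx, hfy⟩ := exists_hom (hB.trans hC.symm)
  have hfa : f a = A := by
    rw [a_eq, map_mul, map_inv, map_pow, hfx, hfy, hB']
    group
  have hfN : N ≤ f.ker := by
    refine Subgroup.normalClosure_le_normal ?_
    rintro _ rfl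
    rw [SetLike.mem_coe, MonoidHom.mem_ker, map_mul, map_zpow, hfa, fiber, map_pow, hfx, hB, ← hA]
    simp
  let π : TrefoilGroup →* TrefoilGroup ⧸ N := QuotientGroup.mk' N
  have hπ : π fiber = π a ^ p := by
    have h : π (fiber * a ^ (-(p : ℤ))) = 1 :=
      (QuotientGroup.eq_one_iff _).2 (Subgroup.subset_normalClosure rfl)
    have e : fiber = fiber * a ^ (-(p : ℤ)) * a ^ p := by simp
    exact (congrArg π e).trans (by rw [map_mul, h, one_mul, map_pow])
  -- The counterpart of the relations with right side ABC: all three powers equal `fiber` in the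
  -- quotient.
  have hax : a * x * y = fiber := by
    have h : y * (a * x * y) = y * fiber := by
      rw [← fiber_comm, fiber, a_eq]
      simp only [pow_succ, pow_zero, one_mul]
      group
    exact mul_left_cancel h
  let g : BinaryPolyhedral p 3 2 →* TrefoilGroup ⧸ N := BinaryPolyhedral.lift (π a) (π x) (π y)
    (by rw [← map_mul, ← map_mul, hax, hπ])
    (by rw [← map_mul, ← map_mul, hax, ← map_pow]; rfl)
    (by rw [← map_mul, ← map_mul, hax, ← map_pow, ← x_pow_three]; rfl)
  refine ⟨MonoidHom.toMulEquiv (QuotientGroup.lift N f hfN) g ?_ ?_⟩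
  · refine QuotientGroup.monoidHom_ext _ (hom_ext ?_ ?_)
    · change g (f a) = π a
      rw [hfa]
      exact lift_gen _ _ _ _ _ _ 0
    · change g (f b) = π b
      have h1 : g B = π x := lift_gen _ _ _ _ _ _ 1
      have h2 : g C = π y := lift_gen _ _ _ _ _ _ 2
      rw [b_eq, map_mul, map_inv, hfx, hfy, map_mul, map_inv, map_mul, map_inv, h1, h2]
  · refine PresentedGroup.ext fun i => ?_
    change QuotientGroup.lift N f hfN (g (gen i)) = gen i
    rw [lift_gen]
    fin_cases i
    · exact hfa
    · exact hfx
    · exact hfy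

/-! ### The order of the binary icosahedral group -/

section IcosahedralBound

variable {Γ : Type*} [Group Γ] {A C : Γ}

/-- The union of the twelve cosets of the powers of `A`. -/
def icosahedralCosets (A C : Γ) : Set Γ :=
  {g | ∃ j : ℤ, g = A ^ j ∨ g = C * A ^ (-2 : ℤ) * C * A ^ 2 * C * A ^ j ∨
    (∃ k : ℤ, g = A ^ k * C * A ^ j) ∨ ∃ k : ℤ, g = A ^ k * C * A ^ 2 * C * A ^ j}

theorem conj_inv_eq (hB : (A⁻¹ * C) ^ 3 = C ^ 2) : C * A⁻¹ * C = A * C * A := by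
  have h : A⁻¹ * (C * A⁻¹ * C) * A⁻¹ * C = C * C := by
    rw [← sq, ← hB]
    simp only [pow_succ, pow_zero, one_mul]
    group
  have h2 := mul_right_cancel h
  calc C * A⁻¹ * C = A * (A⁻¹ * (C * A⁻¹ * C) * A⁻¹) * A := by group
    _ = A * C * A := by rw [h2]

theorem commute_sq (hA : A ^ 5 = C ^ 2) (j : ℤ) : Commute (C ^ 2) (A ^ j) := by
  rw [← hA]
  exact ((Commute.refl A).pow_left 5).zpow_right j

theorem conj_eq (hA : A ^ 5 = C ^ 2) (hB : (A⁻¹ * C) ^ 3 = C ^ 2) :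
    C * A * C = C ^ 2 * A⁻¹ * C * A⁻¹ := by
  have h := congrArg (·⁻¹) (conj_inv_eq hB)
  simp only [mul_inv_rev, inv_inv] at h
  have hc := (commute_sq hA (-1)).eq
  rw [zpow_neg_one] at hc
  calc C * A * C = C ^ 2 * (C⁻¹ * (A * C⁻¹)) * C ^ 2 := by rw [sq]; group
    _ = C ^ 2 * A⁻¹ * C⁻¹ * (A⁻¹ * C ^ 2) := by rw [h]; group
    _ = C ^ 2 * A⁻¹ * C * A⁻¹ := by rw [← hc, sq]; group

/-- Inserting C · C⁻² · C between the two factors A⁻¹ reduces the case to `conj_inv_eq`, applied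
twice. -/
theorem conj_inv_sq_eq (hA : A ^ 5 = C ^ 2) (hB : (A⁻¹ * C) ^ 3 = C ^ 2) :
    C * A ^ (-2 : ℤ) * C = (C ^ 2)⁻¹ * A * C * A ^ 2 * C * A := by
  have hc := (commute_sq (C := C) hA 1).inv_left.eq
  rw [zpow_one] at hc
  have hc2 : Commute (C ^ 2)⁻¹ C := ((Commute.refl C).pow_left 2).inv_left
  calc C * A ^ (-2 : ℤ) * C = (C * A⁻¹ * C) * (C ^ 2)⁻¹ * (C * A⁻¹ * C) := by
        rw [sq]; group
    _ = A * C * (A * (C ^ 2)⁻¹) * (A * C * A) := by rw [conj_inv_eq hB]; group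
    _ = A * (C * (C ^ 2)⁻¹) * A * (A * C * A) := by rw [← hc]; group
    _ = (A * (C ^ 2)⁻¹) * C * A * (A * C * A) := by rw [← hc2.eq]; group
    _ = _ := by rw [← hc, sq A]; group

/-- Geometrically, A is a rotation about a vertex of the icosahedron and Q = CA⁻²CA²C carries this
vertex to its antipode, which A turns the opposite way: AQA = Q. -/
theorem antipode_eq (hA : A ^ 5 = C ^ 2) (hB : (A⁻¹ * C) ^ 3 = C ^ 2) :
    C * A ^ (-2 : ℤ) * C * A ^ 2 * C = A * (C * A ^ (-2 : ℤ) * C * A ^ 2 * C) * A := by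
  have key := conj_inv_sq_eq hA hB
  have hyA : Commute (C ^ 2)⁻¹ A := by simpa using (commute_sq hA 1).inv_left
  have hyC : Commute (C ^ 2)⁻¹ C := ((Commute.refl C).pow_left 2).inv_left
  have h3 : (C ^ 2)⁻¹ * (A * A ^ 2) = A ^ (-2 : ℤ) := by
    rw [← hA]
    group
  have h4 : A ^ 2 * ((C ^ 2)⁻¹ * A) = A ^ (-2 : ℤ) := by
    rw [← hA]
    group
  have h5 := (((hyA.mul_right hyC).mul_right (hyA.pow_right 2)).mul_right hyC).eq
  calc C * A ^ (-2 : ℤ) * C * A ^ 2 * C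
      = (C ^ 2)⁻¹ * (A * C * A ^ 2 * C) * (A * A ^ 2 * C) := by rw [key]; group
    _ = A * C * A ^ 2 * (C * ((C ^ 2)⁻¹ * (A * A ^ 2)) * C) := by rw [h5]; group
    _ = A * C * A ^ 2 * ((C ^ 2)⁻¹ * A * C * A ^ 2 * C * A) := by rw [h3, key]
    _ = A * (C * (A ^ 2 * ((C ^ 2)⁻¹ * A)) * C * A ^ 2 * C) * A := by group
    _ = _ := by rw [h4]

/-- From AQA = Q follows A⁵QA⁵ = Q, and A⁵ = C² commutes with Q. -/
theorem pow_ten_eq_one (hA : A ^ 5 = C ^ 2) (hB : (A⁻¹ * C) ^ 3 = C ^ 2) : A ^ 10 = 1 := by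
  set Q := C * A ^ (-2 : ℤ) * C * A ^ 2 * C with hQ
  have h : Q = A * Q * A := antipode_eq hA hB
  have hn : ∀ n : ℕ, Q = A ^ n * Q * A ^ n := by
    intro n
    induction n with
    | zero => simp
    | succ n ih =>
      conv_lhs => rw [ih, h]
      group
  have hz : ∀ j : ℤ, Commute (A ^ 5) (A ^ j) := fun j =>
    ((Commute.refl A).pow_left 5).zpow_right j
  have hzC : Commute (A ^ 5) C := by rw [hA]; exact (Commute.refl C).pow_left 2
  have hzA : Commute (A ^ 5) (A ^ 2) := (Commute.refl A).pow_pow 5 2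
  have hc : Commute (A ^ 5) Q :=
    (((hzC.mul_right (hz (-2))).mul_right hzC).mul_right hzA).mul_right hzC
  have h5 := hn 5
  rw [mul_assoc, ← hc.eq, ← mul_assoc, ← pow_add] at h5
  simpa using h5

theorem exists_residue (k : ℤ) : ∃ m r : ℤ, k = 5 * m + r ∧
    (r = 0 ∨ r = 1 ∨ r = -1 ∨ r = 2 ∨ r = -2) :=
  ⟨(k + 2) / 5, k - 5 * ((k + 2) / 5), by ring, by omega⟩

/-- The cosets correspond to the vertices of an icosahedron: the pole, its antipode, and two rings
of five. C permutes them. Since A⁵ is central, an exponent k matters only modulo 5, and the balanced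
residues 0, ±1, ±2 are exactly those for which the rules `e1`, `e2`, `e3` rewrite CAʳC. -/
theorem mul_mem_icosahedralCosets (hA : A ^ 5 = C ^ 2) (hB : (A⁻¹ * C) ^ 3 = C ^ 2) {g : Γ}
    (hg : g ∈ icosahedralCosets A C) : C * g ∈ icosahedralCosets A C := by
  have hz : ∀ m j : ℤ, Commute (A ^ (5 * m)) (A ^ j) := fun m j =>
    (Commute.refl A).zpow_zpow _ j
  have hzC : ∀ m : ℤ, Commute (A ^ (5 * m)) C := fun m => by
    rw [zpow_mul, show A ^ (5 : ℤ) = C ^ 2 by exact_mod_cast hA]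
    exact ((Commute.refl C).pow_left 2).zpow_left m
  have hz2 : ∀ m : ℤ, Commute (A ^ (5 * m)) (A ^ 2) := fun m => by exact_mod_cast hz m 2
  have hC2 : C ^ 2 = A ^ (5 : ℤ) := by exact_mod_cast hA.symm
  have e1 : C * A⁻¹ * C = A * C * A := conj_inv_eq hB
  have e2 : C * A * C = A ^ (4 : ℤ) * C * A⁻¹ := by
    rw [conj_eq hA hB, hC2]; group
  have e3 : C * A ^ (-2 : ℤ) * C = A ^ (-4 : ℤ) * C * A ^ 2 * C * A := by
    rw [conj_inv_sq_eq hA hB, hC2]; group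
  obtain ⟨j, rfl | rfl | ⟨k, rfl⟩ | ⟨k, rfl⟩⟩ := hg
  · exact ⟨j, .inr (.inr (.inl ⟨0, by simp⟩))⟩
  · refine ⟨j, .inr (.inr (.inr ⟨3, ?_⟩))⟩
    calc C * (C * A ^ (-2 : ℤ) * C * A ^ 2 * C * A ^ j)
        = C ^ 2 * A ^ (-2 : ℤ) * C * A ^ 2 * C * A ^ j := by rw [sq C]; group
      _ = _ := by rw [hC2]; group
  · obtain ⟨m, r, rfl, hr⟩ := exists_residue k
    have hmove : C * (A ^ (5 * m + r) * C * A ^ j) = C * A ^ r * C * A ^ (5 * m + j) := by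
      calc C * (A ^ (5 * m + r) * C * A ^ j) = C * A ^ r * (A ^ (5 * m) * C) * A ^ j := by
            rw [add_comm, zpow_add]; group
        _ = _ := by rw [(hzC m).eq, zpow_add]; group
    rw [hmove]
    rcases hr with rfl | rfl | rfl | rfl | rfl
    · refine ⟨5 * m + j + 5, .inl ?_⟩
      rw [zpow_zero, mul_one, ← sq, hC2]; group
    · refine ⟨5 * m + j - 1, .inr (.inr (.inl ⟨4, ?_⟩))⟩
      rw [zpow_one, e2]; group
    · refine ⟨5 * m + j + 1, .inr (.inr (.inl ⟨1, ?_⟩))⟩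
      rw [zpow_neg_one, e1]; group
    · exact ⟨5 * m + j, .inr (.inr (.inr ⟨0, by norm_cast; group⟩))⟩
    · refine ⟨5 * m + j + 1, .inr (.inr (.inr ⟨-4, ?_⟩))⟩
      rw [e3]; group
  · obtain ⟨m, r, rfl, hr⟩ := exists_residue k
    have hmove : C * (A ^ (5 * m + r) * C * A ^ 2 * C * A ^ j) =
        C * A ^ r * C * A ^ 2 * C * A ^ (5 * m + j) := by
      calc C * (A ^ (5 * m + r) * C * A ^ 2 * C * A ^ j)
            = C * A ^ r * (A ^ (5 * m) * (C * A ^ 2 * C)) * A ^ j := by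
            rw [add_comm, zpow_add]; group
        _ = _ := by
            rw [(((hzC m).mul_right (hz2 m)).mul_right (hzC m)).eq, zpow_add]; group
    rw [hmove]
    rcases hr with rfl | rfl | rfl | rfl | rfl
    · refine ⟨5 * m + j, .inr (.inr (.inl ⟨7, ?_⟩))⟩
      rw [zpow_zero, mul_one, ← sq, hC2]; group
    · refine ⟨5 * m + j - 1, .inr (.inr (.inl ⟨8, ?_⟩))⟩
      calc C * A ^ (1 : ℤ) * C * A ^ 2 * C * A ^ (5 * m + j)
          = A ^ (4 : ℤ) * C * A⁻¹ * A ^ 2 * C * A ^ (5 * m + j) := by rw [zpow_one, e2]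
        _ = A ^ (4 : ℤ) * (C * A * C) * A ^ (5 * m + j) := by group
        _ = _ := by rw [e2]; group
    · refine ⟨5 * m + j + 6, .inr (.inr (.inr ⟨-3, ?_⟩))⟩
      have h5 := (hzC 1).eq
      calc C * A ^ (-1 : ℤ) * C * A ^ 2 * C * A ^ (5 * m + j)
          = A * C * A ^ (-2 : ℤ) * (A ^ (5 * 1 : ℤ) * C) * A ^ (5 * m + j) := by
            rw [zpow_neg_one, e1]; group
        _ = A * (C * A ^ (-2 : ℤ) * C) * A ^ (5 * m + j + 5) := by rw [h5]; group
        _ = _ := by rw [e3]; group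
    · refine ⟨5 * m + j - 1, .inr (.inr (.inr ⟨4, ?_⟩))⟩
      have e4 : C * A ^ (2 : ℤ) * C = A ^ (4 : ℤ) * (C * A ^ (-2 : ℤ) * C) * A⁻¹ := by
        rw [e3]; group
      calc C * A ^ (2 : ℤ) * C * A ^ 2 * C * A ^ (5 * m + j)
          = A ^ (4 : ℤ) * C * A ^ (-2 : ℤ) * (C * A * C) * A ^ (5 * m + j) := by rw [e4]; group
        _ = _ := by rw [e2]; group
    · exact ⟨5 * m + j, .inr (.inl rfl)⟩

theorem zpow_mul_mem_icosahedralCosets (hA : A ^ 5 = C ^ 2) (hB : (A⁻¹ * C) ^ 3 = C ^ 2) {g : Γ}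
    (n : ℤ) (hg : g ∈ icosahedralCosets A C) : A ^ n * g ∈ icosahedralCosets A C := by
  obtain ⟨j, rfl | rfl | ⟨k, rfl⟩ | ⟨k, rfl⟩⟩ := hg
  · exact ⟨n + j, .inl (zpow_add _ _ _).symm⟩
  · refine ⟨j - n, .inr (.inl ?_)⟩
    set Q := C * A ^ (-2 : ℤ) * C * A ^ 2 * C with hQ
    have h : SemiconjBy Q A⁻¹ A := by
      change Q * A⁻¹ = A * Q
      conv_lhs => rw [hQ, antipode_eq hA hB, ← hQ]
      group
    have h2 := h.zpow_right n
    have h3 : Q * A⁻¹ ^ n = A ^ n * Q := h2.eq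
    rw [← mul_assoc, ← h3]
    group
  · exact ⟨j, .inr (.inr (.inl ⟨n + k, by rw [zpow_add]; group⟩))⟩
  · exact ⟨j, .inr (.inr (.inr ⟨n + k, by rw [zpow_add]; group⟩))⟩

theorem mem_icosahedralCosets (hA : A ^ 5 = C ^ 2) (hB : (A⁻¹ * C) ^ 3 = C ^ 2)
    (hgen : Subgroup.closure {A, C} = ⊤) (g : Γ) : g ∈ icosahedralCosets A C := by
  have key : ∀ g ∈ Subgroup.closure {A, C},
      ∀ s ∈ icosahedralCosets A C, g * s ∈ icosahedralCosets A C ∧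
        g⁻¹ * s ∈ icosahedralCosets A C := by
    intro g hg
    induction hg using Subgroup.closure_induction with
    | mem x hx =>
      intro s hs
      rcases hx with rfl | rfl
      · exact ⟨by simpa using zpow_mul_mem_icosahedralCosets hA hB 1 hs,
          by simpa using zpow_mul_mem_icosahedralCosets hA hB (-1) hs⟩
      · refine ⟨mul_mem_icosahedralCosets hA hB hs, ?_⟩
        -- Here x is C, and C⁻¹ = C⁻² · C = A⁻⁵C, so invariance under C and under powers of A covers
        -- the inverse.
        have h : x⁻¹ * s = A ^ (-5 : ℤ) * (x * s) := by
          have h5 : A ^ (-5 : ℤ) = x⁻¹ * x⁻¹ := by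
            rw [zpow_neg, show A ^ (5 : ℤ) = x ^ 2 by exact_mod_cast hA, sq, mul_inv_rev]
          rw [h5]; group
        rw [h]
        exact zpow_mul_mem_icosahedralCosets hA hB _ (mul_mem_icosahedralCosets hA hB hs)
    | one => intro s hs; simpa using hs
    | mul x y _ _ hx hy =>
      intro s hs
      rw [mul_assoc, mul_inv_rev, mul_assoc]
      exact ⟨(hx _ (hy s hs).1).1, (hy _ (hx s hs).2).2⟩
    | inv x _ hx =>
      intro s hs
      rw [inv_inv]
      exact ⟨(hx s hs).2, (hx s hs).1⟩
  have h := (key g (by rw [hgen]; trivial) 1 ⟨0, .inl (by simp)⟩).1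
  rwa [mul_one] at h

/-- Twelve coset representatives, indexed as 2 + 2 · 5, times the ten powers of A. -/
theorem card_le_of_icosahedral (hA : A ^ 5 = C ^ 2) (hB : (A⁻¹ * C) ^ 3 = C ^ 2)
    (hgen : Subgroup.closure {A, C} = ⊤) : Finite Γ ∧ Nat.card Γ ≤ 120 := by
  let Q := C * A ^ (-2 : ℤ) * C * A ^ 2 * C
  let f : ((Bool ⊕ Bool × Fin 5) × Fin 10) → Γ := fun p =>
    (match p.1 with
      | .inl false => 1
      | .inl true => Q
      | .inr (false, k) => A ^ (k : ℕ) * C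
      | .inr (true, k) => A ^ (k : ℕ) * C * A ^ 2 * C) * A ^ (p.2 : ℕ)
  have h10 := pow_ten_eq_one hA hB
  have hj : ∀ j : ℤ, ∃ i : Fin 10, A ^ j = A ^ (i : ℕ) := by
    intro j
    refine ⟨⟨(j % 10).toNat, by omega⟩, ?_⟩
    rw [← zpow_natCast]
    simp only [Int.toNat_of_nonneg (Int.emod_nonneg j (by norm_num : (10 : ℤ) ≠ 0))]
    conv_lhs => rw [← Int.mul_ediv_add_emod j 10, zpow_add, zpow_mul]
    rw [show A ^ (10 : ℤ) = 1 by exact_mod_cast h10, one_zpow, one_mul]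
  have hzC : ∀ m : ℤ, Commute (A ^ (5 * m)) C := fun m => by
    rw [zpow_mul, show A ^ (5 : ℤ) = C ^ 2 by exact_mod_cast hA]
    exact ((Commute.refl C).pow_left 2).zpow_left m
  have hz2 : ∀ m : ℤ, Commute (A ^ (5 * m)) (A ^ 2) := fun m => by
    exact_mod_cast (Commute.refl A).zpow_zpow (5 * m) 2
  have hk : ∀ k : ℤ, ∃ (i : Fin 5) (m : ℤ), A ^ k = A ^ (i : ℕ) * A ^ (5 * m) := by
    intro k
    refine ⟨⟨(k % 5).toNat, by omega⟩, k / 5, ?_⟩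
    rw [← zpow_natCast]
    simp only [Int.toNat_of_nonneg (Int.emod_nonneg k (by norm_num : (5 : ℤ) ≠ 0))]
    rw [← zpow_add, Int.emod_add_mul_ediv]
  have hf : Function.Surjective f := by
    intro g
    obtain ⟨j, rfl | rfl | ⟨k, rfl⟩ | ⟨k, rfl⟩⟩ := mem_icosahedralCosets hA hB hgen g
    · obtain ⟨i, hi⟩ := hj j
      exact ⟨(.inl false, i), by simp [f, hi]⟩
    · obtain ⟨i, hi⟩ := hj j
      exact ⟨(.inl true, i), by simp [f, Q, hi]⟩
    · obtain ⟨l, m, hl⟩ := hk k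
      obtain ⟨i, hi⟩ := hj (5 * m + j)
      refine ⟨(.inr (false, l), i), ?_⟩
      change A ^ (l : ℕ) * C * A ^ (i : ℕ) = _
      rw [hl, ← hi, mul_assoc _ _ C, (hzC m).eq, zpow_add]
      simp only [mul_assoc]
    · obtain ⟨l, m, hl⟩ := hk k
      obtain ⟨i, hi⟩ := hj (5 * m + j)
      refine ⟨(.inr (true, l), i), ?_⟩
      change A ^ (l : ℕ) * C * A ^ 2 * C * A ^ (i : ℕ) = _
      have h := (((hzC m).mul_right (hz2 m)).mul_right (hzC m)).eq
      calc _ = A ^ (l : ℕ) * (C * A ^ 2 * C * A ^ (5 * m)) * A ^ j := by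
            rw [← hi, zpow_add]; simp only [mul_assoc]
        _ = _ := by rw [← h, hl]; simp only [mul_assoc]
  refine ⟨Finite.of_surjective f hf, (Nat.card_le_card_of_surjective f hf).trans ?_⟩
  simp [Nat.card_eq_fintype_card]

end IcosahedralBound

/-! ### The unit icosians -/

@[simp] theorem quat_re (a b c d : ℝ) : (quat a b c d).re = a := rfl

@[simp] theorem quat_imI (a b c d : ℝ) : (quat a b c d).imI = b := rfl

@[simp] theorem quat_imJ (a b c d : ℝ) : (quat a b c d).imJ = c := rfl

@[simp] theorem quat_imK (a b c d : ℝ) : (quat a b c d).imK = d := rfl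

theorem quat_mul (a b c d a' b' c' d' : ℝ) : quat a b c d * quat a' b' c' d' =
    quat (a * a' - b * b' - c * c' - d * d') (a * b' + b * a' + c * d' - d * c')
      (a * c' - b * d' + c * a' + d * b') (a * d' + b * c' - c * b' + d * a') := by
  apply Quaternion.ext <;> simp

theorem quat_neg_one : (-1 : ℍ[ℝ]) = quat (-1) 0 0 0 := by
  apply Quaternion.ext <;> simp

namespace Icosian

theorem coe_T : (icosianT : ℍ[ℝ]) =
    quat (Real.goldenRatio / 2) ((Real.goldenRatio - 1) / 2) (1 / 2) 0 := by
  have h : Real.goldenRatio⁻¹ = Real.goldenRatio - 1 := by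
    rw [Real.inv_goldenRatio]; linarith [Real.goldenRatio_add_goldenConj]
  rw [← h]
  rfl

theorem coe_S : (icosianS : ℍ[ℝ]) = quat (1 / 2) (1 / 2) (1 / 2) (1 / 2) := rfl

theorem coe_mul {p q : Sphere3} {a b c d a' b' c' d' : ℝ} (hp : (p : ℍ[ℝ]) = quat a b c d)
    (hq : (q : ℍ[ℝ]) = quat a' b' c' d') : ((p * q : Sphere3) : ℍ[ℝ]) =
    quat (a * a' - b * b' - c * c' - d * d') (a * b' + b * a' + c * d' - d * c')
      (a * c' - b * d' + c * a' + d * b') (a * d' + b * c' - c * b' + d * a') := by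
  rw [Metric.unitSphere.coe_mul, hp, hq, quat_mul]

theorem coe_sq_S : ((icosianS ^ 2 : Sphere3) : ℍ[ℝ]) = quat (-1 / 2) (1 / 2) (1 / 2) (1 / 2) := by
  rw [sq, coe_mul coe_S coe_S]
  congr 1 <;> norm_num

theorem coe_sq_T : ((icosianT ^ 2 : Sphere3) : ℍ[ℝ]) =
    quat ((Real.goldenRatio - 1) / 2) (1 / 2) (Real.goldenRatio / 2) 0 := by
  rw [sq, coe_mul coe_T coe_T]
  have h := Real.goldenRatio_sq
  generalize Real.goldenRatio = φ at h
  congr 1 <;> linarith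

theorem S_pow_three : icosianS ^ 3 = -1 := by
  apply Subtype.ext
  rw [pow_succ, coe_mul coe_sq_S coe_S, coe_neg_sphere, Metric.unitSphere.coe_one, quat_neg_one]
  congr 1 <;> norm_num

theorem T_pow_five : icosianT ^ 5 = -1 := by
  have h := Real.goldenRatio_sq
  have h4 : ((icosianT ^ 2 * icosianT ^ 2 : Sphere3) : ℍ[ℝ]) =
      quat (- Real.goldenRatio / 2) ((Real.goldenRatio - 1) / 2) (1 / 2) 0 := by
    rw [coe_mul coe_sq_T coe_sq_T]
    generalize Real.goldenRatio = φ at h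
    congr 1 <;> linarith
  apply Subtype.ext
  rw [show icosianT ^ 5 = icosianT ^ 2 * icosianT ^ 2 * icosianT by group, coe_mul h4 coe_T,
    coe_neg_sphere, Metric.unitSphere.coe_one, quat_neg_one]
  generalize Real.goldenRatio = φ at h
  congr 1 <;> linarith

theorem TS_sq : (icosianT * icosianS) ^ 2 = -1 := by
  have h := Real.goldenRatio_sq
  have h4 : ((icosianT * icosianS : Sphere3) : ℍ[ℝ]) =
      quat 0 (Real.goldenRatio / 2) (1 / 2) ((Real.goldenRatio - 1) / 2) := by
    rw [coe_mul coe_T coe_S]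
    generalize Real.goldenRatio = φ at h
    congr 1 <;> linarith
  apply Subtype.ext
  rw [sq, coe_mul h4 h4, coe_neg_sphere, Metric.unitSphere.coe_one, quat_neg_one]
  generalize Real.goldenRatio = φ at h
  congr 1 <;> linarith

/-- The word is chosen so that multiplication by `icosianS` on the left and on the right gives -j
and -i. These generate the quaternion group of order 8. -/
theorem coe_conj : ((icosianT * icosianS ^ 2 * icosianT ^ 2 : Sphere3) : ℍ[ℝ]) =
    quat (-1 / 2) (-1 / 2) (-1 / 2) (1 / 2) := by
  have h := Real.goldenRatio_sq
  have h4 : ((icosianT * icosianS ^ 2 : Sphere3) : ℍ[ℝ]) =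
      quat (- Real.goldenRatio / 2) (1 / 2) 0 ((Real.goldenRatio - 1) / 2) := by
    rw [coe_mul coe_T coe_sq_S]
    generalize Real.goldenRatio = φ at h
    congr 1 <;> linarith
  rw [coe_mul h4 coe_sq_T]
  generalize Real.goldenRatio = φ at h
  congr 1 <;> linarith

theorem coe_neg_j : ((icosianS * (icosianT * icosianS ^ 2 * icosianT ^ 2) : Sphere3) : ℍ[ℝ]) =
    quat 0 0 (-1) 0 := by
  rw [coe_mul coe_S coe_conj]
  congr 1 <;> norm_num

theorem coe_neg_i : ((icosianT * icosianS ^ 2 * icosianT ^ 2 * icosianS : Sphere3) : ℍ[ℝ]) =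
    quat 0 (-1) 0 0 := by
  rw [coe_mul coe_conj coe_S]
  congr 1 <;> norm_num

theorem quat_inj {a b c d a' b' c' d' : ℝ} (h : quat a b c d = quat a' b' c' d') :
    a = a' ∧ b = b' ∧ c = c' ∧ d = d' :=
  ⟨congrArg (·.re) h, congrArg (·.imI) h, congrArg (·.imJ) h, congrArg (·.imK) h⟩

/-- The unit quaternions with integer coordinates. -/
def lipschitzUnits : Subgroup Sphere3 where
  carrier := {p | ∃ a b c d : ℤ, (p : ℍ[ℝ]) = quat a b c d}
  one_mem' := ⟨1, 0, 0, 0, by simp; rfl⟩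
  mul_mem' := by
    rintro p q ⟨a, b, c, d, hp⟩ ⟨a', b', c', d', hq⟩
    refine ⟨a * a' - b * b' - c * c' - d * d', a * b' + b * a' + c * d' - d * c',
      a * c' - b * d' + c * a' + d * b', a * d' + b * c' - c * b' + d * a', ?_⟩
    rw [coe_mul hp hq]
    push_cast
    rfl
  inv_mem' := by
    rintro p ⟨a, b, c, d, hp⟩
    refine ⟨a, -b, -c, -d, ?_⟩
    have h1 : ‖(p : ℍ[ℝ])‖ = 1 := mem_sphere_zero_iff_norm.1 p.2
    rw [Metric.unitSphere.coe_inv, Quaternion.inv_def, Quaternion.normSq_eq_norm_mul_self, h1, hp]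
    apply Quaternion.ext <;> simp

/-- The integer solutions of `a² + b² + c² + d² = 1`. -/
def unitFinset : Finset (ℤ × ℤ × ℤ × ℤ) :=
  (Finset.Icc (-1) 1 ×ˢ Finset.Icc (-1) 1 ×ˢ Finset.Icc (-1) 1 ×ˢ Finset.Icc (-1) 1).filter
    fun p => p.1 ^ 2 + p.2.1 ^ 2 + p.2.2.1 ^ 2 + p.2.2.2 ^ 2 = 1

theorem sq_sum_of_mem {p : Sphere3} {a b c d : ℤ} (hp : (p : ℍ[ℝ]) = quat a b c d) :
    a ^ 2 + b ^ 2 + c ^ 2 + d ^ 2 = 1 := by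
  have h1 : ‖(p : ℍ[ℝ])‖ = 1 := mem_sphere_zero_iff_norm.1 p.2
  have h2 := Quaternion.normSq_eq_norm_mul_self (p : ℍ[ℝ])
  rw [h1, hp, Quaternion.normSq_def'] at h2
  simp only [quat, mul_one] at h2
  exact_mod_cast h2

theorem mem_unitFinset {a b c d : ℤ} (h : a ^ 2 + b ^ 2 + c ^ 2 + d ^ 2 = 1) :
    (a, b, c, d) ∈ unitFinset := by
  simp only [unitFinset, Finset.mem_filter, Finset.mem_product, Finset.mem_Icc]
  refine ⟨⟨?_, ?_, ?_, ?_⟩, h⟩ <;> constructor <;> nlinarith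

theorem card_lipschitzUnits : Nat.card lipschitzUnits = 8 := by
  let f : unitFinset → lipschitzUnits := fun p =>
    ⟨⟨quat p.1.1 p.1.2.1 p.1.2.2.1 p.1.2.2.2, quat_mem_sphere (by
      have := (Finset.mem_filter.1 p.2).2
      exact_mod_cast this)⟩, _, _, _, _, rfl⟩
  have hf : Function.Bijective f := by
    constructor
    · rintro ⟨⟨a, b, c, d⟩, hp⟩ ⟨⟨a', b', c', d'⟩, hq⟩ h
      have h2 := quat_inj (congrArg (fun x : lipschitzUnits => ((x : Sphere3) : ℍ[ℝ])) h)
      obtain ⟨h3, h4, h5, h6⟩ := h2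
      obtain rfl : a = a' := Int.cast_injective (α := ℝ) h3
      obtain rfl : b = b' := Int.cast_injective (α := ℝ) h4
      obtain rfl : c = c' := Int.cast_injective (α := ℝ) h5
      obtain rfl : d = d' := Int.cast_injective (α := ℝ) h6
      rfl
    · rintro ⟨p, a, b, c, d, hp⟩
      exact ⟨⟨(a, b, c, d), mem_unitFinset (sq_sum_of_mem hp)⟩, Subtype.ext (Subtype.ext hp.symm)⟩
  rw [← Nat.card_eq_of_bijective f hf, Nat.card_eq_fintype_card, Fintype.card_coe]
  decide

theorem S_mem : icosianS ∈ unitIcosians := Subgroup.subset_closure (by simp)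

theorem T_mem : icosianT ∈ unitIcosians := Subgroup.subset_closure (by simp)

theorem neg_one_mem : (-1 : Sphere3) ∈ unitIcosians := by
  rw [← S_pow_three]
  exact pow_mem S_mem 3

theorem unitFinset_cases : ∀ p ∈ unitFinset,
    (p.2.1 = 0 ∧ p.2.2.1 = 0 ∧ p.2.2.2 = 0 ∧ (p.1 = 1 ∨ p.1 = -1)) ∨
      (p.1 = 0 ∧ p.2.2.1 = 0 ∧ p.2.2.2 = 0 ∧ (p.2.1 = 1 ∨ p.2.1 = -1)) ∨
      (p.1 = 0 ∧ p.2.1 = 0 ∧ p.2.2.2 = 0 ∧ (p.2.2.1 = 1 ∨ p.2.2.1 = -1)) ∨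
      (p.1 = 0 ∧ p.2.1 = 0 ∧ p.2.2.1 = 0 ∧ (p.2.2.2 = 1 ∨ p.2.2.2 = -1)) := by
  decide

/-- -1, -i, -j and the product (-i)(-j) are available as words in the generators, and every
Lipschitz unit is one of ±1, ±i, ±j, ±k. -/
theorem lipschitzUnits_le : lipschitzUnits ≤ unitIcosians := by
  have hneg : ∀ p : Sphere3, p ∈ unitIcosians → -p ∈ unitIcosians := fun p hp => by
    have h : (-1 : Sphere3) * p = -p := Subtype.ext (by
      rw [Metric.unitSphere.coe_mul, coe_neg_sphere, coe_neg_sphere, Metric.unitSphere.coe_one,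
        neg_one_mul])
    exact h ▸ mul_mem neg_one_mem hp
  have hv : icosianT * icosianS ^ 2 * icosianT ^ 2 ∈ unitIcosians :=
    mul_mem (mul_mem T_mem (pow_mem S_mem 2)) (pow_mem T_mem 2)
  have hj := mul_mem S_mem hv
  have hi := mul_mem hv S_mem
  have hk := mul_mem hi hj
  have ek := coe_mul coe_neg_i coe_neg_j
  have key : ∀ p ∈ unitIcosians, ∀ q : Sphere3, ((q : ℍ[ℝ]) = p ∨ (q : ℍ[ℝ]) = -p) →
      q ∈ unitIcosians := by
    rintro p hp q (h | h)
    · rwa [Subtype.ext h]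
    · rw [show q = -p from Subtype.ext (by rw [h, coe_neg_sphere])]
      exact hneg p hp
  rintro q ⟨a, b, c, d, hq⟩
  have hcase := unitFinset_cases (a, b, c, d) (mem_unitFinset (sq_sum_of_mem hq))
  simp only at hcase
  rcases hcase with ⟨rfl, rfl, rfl, h⟩ | ⟨rfl, rfl, rfl, h⟩ | ⟨rfl, rfl, rfl, h⟩ |
    ⟨rfl, rfl, rfl, h⟩
  · refine key 1 (one_mem _) q ?_
    rw [hq, Metric.unitSphere.coe_one]
    rcases h with rfl | rfl
    · left; apply Quaternion.ext <;> simp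
    · right; apply Quaternion.ext <;> simp
  · refine key _ hi q ?_
    rw [hq, coe_neg_i]
    rcases h with rfl | rfl
    · right; apply Quaternion.ext <;> simp
    · left; apply Quaternion.ext <;> simp
  · refine key _ hj q ?_
    rw [hq, coe_neg_j]
    rcases h with rfl | rfl
    · right; apply Quaternion.ext <;> simp
    · left; apply Quaternion.ext <;> simp
  · refine key _ hk q ?_
    rw [hq, ek]
    rcases h with rfl | rfl
    · left; apply Quaternion.ext <;> simp
    · right; apply Quaternion.ext <;> simp

theorem sq_S_ne_one : icosianS ^ 2 ≠ 1 := by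
  intro h
  have h2 := congrArg (fun p : Sphere3 => (p : ℍ[ℝ]).re) h
  simp only [coe_sq_S, Metric.unitSphere.coe_one] at h2
  norm_num [quat] at h2

theorem sq_T_ne_one : icosianT ^ 2 ≠ 1 := by
  intro h
  have h2 := congrArg (fun p : Sphere3 => (p : ℍ[ℝ]).imI) h
  simp only [coe_sq_T, Metric.unitSphere.coe_one] at h2
  norm_num [quat] at h2

/-- The factor 8 comes from the Lipschitz units, 3 and 5 from the orders of `icosianS ^ 2` and
`icosianT ^ 2`; the three numbers are pairwise coprime. -/
theorem dvd_card [Finite unitIcosians] : 120 ∣ Nat.card unitIcosians := by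
  have h8 : 8 ∣ Nat.card unitIcosians := by
    rw [← card_lipschitzUnits]
    exact Subgroup.card_dvd_of_le lipschitzUnits_le
  have h3 : 3 ∣ Nat.card unitIcosians := by
    have : Fact (Nat.Prime 3) := ⟨by norm_num⟩
    have h : orderOf (⟨icosianS ^ 2, pow_mem S_mem 2⟩ : unitIcosians) = 3 := by
      refine orderOf_eq_prime (Subtype.ext ?_) fun h => sq_S_ne_one (congrArg Subtype.val h)
      change (icosianS ^ 2) ^ 3 = 1
      rw [← pow_mul, mul_comm, pow_mul, S_pow_three, neg_one_sq]
    rw [← h]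
    exact orderOf_dvd_natCard _
  have h5 : 5 ∣ Nat.card unitIcosians := by
    have : Fact (Nat.Prime 5) := ⟨by norm_num⟩
    have h : orderOf (⟨icosianT ^ 2, pow_mem T_mem 2⟩ : unitIcosians) = 5 := by
      refine orderOf_eq_prime (Subtype.ext ?_) fun h => sq_T_ne_one (congrArg Subtype.val h)
      change (icosianT ^ 2) ^ 5 = 1
      rw [← pow_mul, mul_comm, pow_mul, T_pow_five, neg_one_sq]
    rw [← h]
    exact orderOf_dvd_natCard _
  omega

/-- The representation of the binary icosahedral group by unit quaternions. -/
def rep : BinaryIcosahedral →* Sphere3 :=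
  BinaryPolyhedral.lift icosianT icosianS (icosianT * icosianS)
    (by rw [← sq, T_pow_five, TS_sq]) (by rw [← sq, S_pow_three, TS_sq]) (by rw [sq])

theorem range_rep : rep.range = unitIcosians := by
  have h0 : rep (BinaryPolyhedral.gen 0) = icosianT := BinaryPolyhedral.lift_gen _ _ _ _ _ _ 0
  have h1 : rep (BinaryPolyhedral.gen 1) = icosianS := BinaryPolyhedral.lift_gen _ _ _ _ _ _ 1
  apply le_antisymm
  · rw [MonoidHom.range_eq_map, ← PresentedGroup.closure_range_of, MonoidHom.map_closure,
      Subgroup.closure_le]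
    rintro _ ⟨_, ⟨i, rfl⟩, rfl⟩
    change rep (BinaryPolyhedral.gen i) ∈ unitIcosians
    rw [rep, BinaryPolyhedral.lift_gen]
    fin_cases i
    · exact T_mem
    · exact S_mem
    · exact mul_mem T_mem S_mem
  · rw [unitIcosians, Subgroup.closure_le]
    rintro _ (rfl | rfl)
    · exact ⟨_, h1⟩
    · exact ⟨_, h0⟩

end Icosian

/-- C² = ABC means C = AB. So A and C generate, and the remaining relations are A⁵ = C² and (A⁻¹C)³
= C². -/
theorem BinaryIcosahedral.card_le : Finite BinaryIcosahedral ∧ Nat.card BinaryIcosahedral ≤ 120 := by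
  let A : BinaryIcosahedral := BinaryPolyhedral.gen 0
  let B : BinaryIcosahedral := BinaryPolyhedral.gen 1
  let C : BinaryIcosahedral := BinaryPolyhedral.gen 2
  have hA : A ^ 5 = A * B * C := BinaryPolyhedral.gen_zero_pow
  have hB : B ^ 3 = A * B * C := BinaryPolyhedral.gen_one_pow
  have hC : C ^ 2 = A * B * C := BinaryPolyhedral.gen_two_pow
  have hC' : C = A * B := by
    have h := hC
    rw [sq] at h
    exact mul_right_cancel h
  have hB' : A⁻¹ * C = B := by rw [hC']; group
  refine card_le_of_icosahedral (A := A) (C := C) (hA.trans hC.symm)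
    (by rw [hB', hB, hC]) ?_
  rw [eq_top_iff, ← PresentedGroup.closure_range_of, Subgroup.closure_le]
  have mA : A ∈ Subgroup.closure {A, C} := Subgroup.subset_closure (by simp)
  have mC : C ∈ Subgroup.closure {A, C} := Subgroup.subset_closure (by simp)
  rintro _ ⟨i, rfl⟩
  fin_cases i
  · exact mA
  · change B ∈ Subgroup.closure {A, C}
    rw [← hB']
    exact mul_mem (inv_mem mA) mC
  · exact mC

theorem finite_unitIcosians : Finite unitIcosians := by
  have := BinaryIcosahedral.card_le.1
  rw [← Icosian.range_rep]
  exact Finite.of_surjective _ Icosian.rep.rangeRestrict_surjective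

/-- The group `⟨5, 3, 2⟩` is the group of unit icosians. -/
theorem nonempty_binaryIcosahedral_equiv : Nonempty (BinaryIcosahedral ≃* unitIcosians) := by
  obtain ⟨hfin, hcard⟩ := BinaryIcosahedral.card_le
  have := finite_unitIcosians
  let f : BinaryIcosahedral →* unitIcosians :=
    Icosian.rep.codRestrict unitIcosians fun g => Icosian.range_rep ▸ ⟨g, rfl⟩
  have hsurj : Function.Surjective f := by
    rintro ⟨x, hx⟩
    obtain ⟨g, rfl⟩ := Icosian.range_rep.symm ▸ hx
    exact ⟨g, rfl⟩
  -- A surjection from a group of order at most 120 onto one of order at least 120 is injective.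
  have h1 : 120 ≤ Nat.card unitIcosians := Nat.le_of_dvd Nat.card_pos Icosian.dvd_card
  have h2 := Nat.card_le_card_of_surjective f hsurj
  exact ⟨MulEquiv.ofBijective f
    ((Nat.bijective_iff_surjective_and_card f).2 ⟨hsurj, by omega⟩)⟩

/-! ### Simple connectivity of the sphere, and the Poincaré sphere -/

theorem Path.Homotopic.of_codRestrict {X : Type*} [TopologicalSpace X] {x y : X} {γ γ' : Path x y}
    {s : Set X} {h : ∀ t, γ t ∈ s} {h' : ∀ t, γ' t ∈ s}
    (H : (γ.codRestrict s h).Homotopic (γ'.codRestrict s h')) : γ.Homotopic γ' :=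
  H.map ⟨Subtype.val, continuous_subtype_val⟩

theorem Path.trans_mem {X : Type*} [TopologicalSpace X] {x y z : X} {γ : Path x y}
    {γ' : Path y z} {s : Set X} (h : ∀ t, γ t ∈ s) (h' : ∀ t, γ' t ∈ s) (t : I) :
    γ.trans γ' t ∈ s := by
  rw [Path.trans_apply]
  split_ifs
  exacts [h _, h' _]

theorem Path.symm_mem {X : Type*} [TopologicalSpace X] {x y : X} {γ : Path x y} {s : Set X}
    (h : ∀ t, γ t ∈ s) (t : I) : γ.symm t ∈ s := h _

/-- Paths from a base point in `U ∩ V` that stay in `U`, in `V`, or in both, if their endpoints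
do. -/
theorem exists_sections {X : Type*} [TopologicalSpace X] {U V : Set X} (hU : IsPathConnected U)
    (hV : IsPathConnected V) (hUV : IsPathConnected (U ∩ V)) (hcov : U ∪ V = univ) {x₀ : X}
    (hx₀ : x₀ ∈ U ∩ V) :
    ∃ c : ∀ x, Path x₀ x, (∀ x ∈ U, ∀ t, c x t ∈ U) ∧ (∀ x ∈ V, ∀ t, c x t ∈ V) := by
  have key : ∀ x, ∃ c : Path x₀ x, (x ∈ U → ∀ t, c t ∈ U) ∧ (x ∈ V → ∀ t, c t ∈ V) := by
    intro x
    by_cases h1 : x ∈ U <;> by_cases h2 : x ∈ V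
    · obtain ⟨c, hc⟩ := hUV.joinedIn x₀ hx₀ x ⟨h1, h2⟩
      exact ⟨c, fun _ t => (hc t).1, fun _ t => (hc t).2⟩
    · obtain ⟨c, hc⟩ := hU.joinedIn x₀ hx₀.1 x h1
      exact ⟨c, fun _ t => hc t, fun h => absurd h h2⟩
    · obtain ⟨c, hc⟩ := hV.joinedIn x₀ hx₀.2 x h2
      exact ⟨c, fun h => absurd h h1, fun _ t => hc t⟩
    · exact absurd (hcov ▸ mem_univ x) (by simp [h1, h2])
  choose c hc using key
  exact ⟨c, fun x => (hc x).1, fun x => (hc x).2⟩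

theorem Path.homotopic_of_isSimplyConnected {X : Type*} [TopologicalSpace X] {s : Set X}
    (hs : IsSimplyConnected s) {x y : X} {γ γ' : Path x y} (h : ∀ t, γ t ∈ s)
    (h' : ∀ t, γ' t ∈ s) : γ.Homotopic γ' := by
  have := hs.simplyConnectedSpace
  exact Path.Homotopic.of_codRestrict (h := h) (h' := h')
    (SimplyConnectedSpace.paths_homotopic _ _)

/-- With paths from the base point that stay in U or in V whenever their end does, the tautological
representation is trivial on paths inside U or V. By the uniqueness half of van Kampen it is trivial
on all paths, and the auxiliary paths cancel. -/
theorem simplyConnectedSpace_of_cover {X : Type*} [TopologicalSpace X] {U V : Set X}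
    (oU : IsOpen U) (oV : IsOpen V) (hU : IsSimplyConnected U) (hV : IsSimplyConnected V)
    (hUV : IsPathConnected (U ∩ V)) (hcov : U ∪ V = univ) : SimplyConnectedSpace X := by
  obtain ⟨x₀, hx₀⟩ := hUV.nonempty
  obtain ⟨c, cU, cV⟩ := exists_sections hU.isPathConnected hV.isPathConnected hUV hcov hx₀
  have triv : ∀ {x y : X} (γ : Path x y), (PathRep.ofSections c).val γ = 1 := by
    intro x y γ
    refine PathRep.eq_of_forall_cover (c := fun b : Bool => cond b U V) (by simp [oU, oV])
      (fun x => by simpa [or_comm] using (hcov ▸ mem_univ x : x ∈ U ∪ V)) (PathRep.ofSections c)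
      ⟨fun _ => 1, fun _ => rfl, fun _ _ => (one_mul 1).symm⟩ ?_ γ
    rintro (_ | _) x y γ hγ
    · have hx : x ∈ V := by simpa using hγ 0
      have hy : y ∈ V := by simpa using hγ 1
      exact Path.Homotopic.Quotient.eq.2 (Path.homotopic_of_isSimplyConnected hV
        (Path.trans_mem (cV x hx) (Path.trans_mem hγ (Path.symm_mem (cV y hy))))
        (fun _ => hx₀.2))
    · have hx : x ∈ U := by simpa using hγ 0
      have hy : y ∈ U := by simpa using hγ 1
      exact Path.Homotopic.Quotient.eq.2 (Path.homotopic_of_isSimplyConnected hU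
        (Path.trans_mem (cU x hx) (Path.trans_mem hγ (Path.symm_mem (cU y hy))))
        (fun _ => hx₀.1))
  have : PathConnectedSpace X :=
    ⟨⟨x₀⟩, fun x y => ⟨(c x).symm.trans (c y)⟩⟩
  refine simply_connected_iff_paths_homotopic'.2 ⟨this, fun {x y} γ γ' => ?_⟩
  have h1 := Path.Homotopic.Quotient.eq.1 ((triv γ).trans (triv γ').symm)
  rw [← Path.Homotopic.Quotient.eq] at h1 ⊢
  simp only [Path.Homotopic.Quotient.mk_trans, Path.Homotopic.Quotient.mk_symm] at h1
  have h2 := congrArg (fun q => ((Path.Homotopic.Quotient.mk (c x)).symm.trans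
    (q.trans (Path.Homotopic.Quotient.mk (c y))))) h1
  grind

theorem isSimplyConnected_compl_singleton_sphere {E : Type*} [NormedAddCommGroup E]
    [InnerProductSpace ℝ E] (v : Metric.sphere (0 : E) 1) :
    IsSimplyConnected ({v}ᶜ : Set (Metric.sphere (0 : E) 1)) := by
  have hv : ‖(v : E)‖ = 1 := by simp
  have e := (stereographic hv).toHomeomorphSourceTarget
  rw [stereographic_source, stereographic_target] at e
  exact (e.trans (Homeomorph.Set.univ _)).toHomotopyEquiv.simplyConnectedSpace

/-- The inverse stereographic projection from `v` carries the complement of the origin to this set,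
because `-v` projects to 0. A punctured space of dimension greater than one is path connected. -/
theorem isPathConnected_compl_pair_sphere {E : Type*} [NormedAddCommGroup E]
    [InnerProductSpace ℝ E] (v : Metric.sphere (0 : E) 1)
    (hr : 1 < Module.rank ℝ (Submodule.span ℝ {(v : E)})ᗮ) :
    IsPathConnected ({v}ᶜ ∩ {-v}ᶜ : Set (Metric.sphere (0 : E) 1)) := by
  have hv : ‖(v : E)‖ = 1 := by simp
  have h := isPathConnected_compl_singleton_of_one_lt_rank hr 0
  have hc : Continuous (stereographic hv).symm := by
    rw [← continuousOn_univ, ← stereographic_target hv]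
    exact (stereographic hv).continuousOn_symm
  convert h.image hc using 1
  ext x
  simp only [mem_inter_iff, mem_compl_iff, mem_singleton_iff, mem_image]
  constructor
  · rintro ⟨h1, h2⟩
    have hx : x ∈ (stereographic hv).source := by rw [stereographic_source]; simpa using h1
    refine ⟨stereographic hv x, fun h0 => h2 ?_, (stereographic hv).left_inv hx⟩
    have h3 : -v ∈ (stereographic hv).source := by
      rw [stereographic_source]
      simpa using (ne_neg_of_mem_unit_sphere ℝ v).symm
    exact (stereographic hv).injOn hx h3 (h0.trans (stereographic_apply_neg v).symm)
  · rintro ⟨y, hy, rfl⟩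
    have hyt : y ∈ (stereographic hv).target := by rw [stereographic_target]; trivial
    have h3 := (stereographic hv).map_target hyt
    refine ⟨by simpa [stereographic_source] using h3, fun h4 => hy ?_⟩
    rw [← (stereographic hv).right_inv hyt, h4, stereographic_apply_neg]

/-- The complements of 1 and -1 are simply connected, and their intersection is path connected. -/
instance : SimplyConnectedSpace Sphere3 := by
  let v : Sphere3 := 1
  have hfin : Module.finrank ℝ ℍ[ℝ] = 3 + 1 := Quaternion.finrank_eq_four
  have : Fact (Module.finrank ℝ ℍ[ℝ] = 3 + 1) := ⟨hfin⟩
  refine simplyConnectedSpace_of_cover isOpen_compl_singleton isOpen_compl_singleton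
    (isSimplyConnected_compl_singleton_sphere v) (isSimplyConnected_compl_singleton_sphere (-v))
    (isPathConnected_compl_pair_sphere v ?_) ?_
  · have h3 := Submodule.finrank_orthogonal_span_singleton (𝕜 := ℝ) (n := 3)
      (v := (v : ℍ[ℝ])) (by simp [v])
    rw [← Module.finrank_eq_rank, h3]
    norm_num
  · rw [← compl_inter, compl_univ_iff, ← disjoint_iff_inter_eq_empty, disjoint_singleton]
    exact ne_neg_of_mem_unit_sphere ℝ v

/-- The opposite of the opposite subgroup. -/
def Subgroup.opOpEquiv {G : Type*} [Group G] (S : Subgroup G) : S.opᵐᵒᵖ ≃* S where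
  toFun g := ⟨g.unop.1.unop, g.unop.2⟩
  invFun g := .op ⟨.op g.1, g.2⟩
  left_inv _ := rfl
  right_inv _ := rfl
  map_mul' _ _ := rfl

/-- The quotient map is a covering by a simply connected space. Its group acts by right
multiplication, hence appears as the opposite group, and the fundamental group is the opposite of
this; the two reversals cancel. -/
theorem nonempty_poincareSphere_equiv (y : PoincareSphere) :
    Nonempty (FundamentalGroup PoincareSphere y ≃* BinaryIcosahedral) := by
  have := finite_unitIcosians
  have hd : IsDiscrete (unitIcosians : Set Sphere3) := (toFinite _).isDiscrete
  have hp := unitIcosians.isQuotientCoveringMap hd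
  obtain ⟨x, hx⟩ := QuotientGroup.mk_surjective y
  obtain ⟨e⟩ := nonempty_binaryIcosahedral_equiv
  have e1 := hp.fundamentalGroupEquiv (x := y) ⟨x, hx⟩
  exact ⟨(e1.trans unitIcosians.opOpEquiv).trans e.symm⟩

/-! ### Homotopy equivalences and the fundamental groupoid -/

namespace ContinuousMap.HomotopyEquiv

variable {X Y : Type*} [TopologicalSpace X] [TopologicalSpace Y] (e : X ≃ₕ Y)

/-- A homotopy equivalence induces an equivalence of fundamental groupoids. This is its faithfulness
on paths, and the next statement its fullness. -/
theorem homotopic_of_map {x y : X} {γ γ' : Path x y}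
    (h : (γ.map e.toFun.continuous).Homotopic (γ'.map e.toFun.continuous)) : γ.Homotopic γ' := by
  have key := (FundamentalGroupoidFunctor.equivOfHomotopyEquiv e).functor.map_injective
    (X := ⟨x⟩) (Y := ⟨y⟩) (a₁ := Path.Homotopic.Quotient.mk γ)
    (a₂ := Path.Homotopic.Quotient.mk γ') (Path.Homotopic.Quotient.eq.2 h)
  exact Path.Homotopic.Quotient.eq.1 key

theorem exists_path_map_homotopic {x y : X} (δ : Path (e.toFun x) (e.toFun y)) :
    ∃ γ : Path x y, (γ.map e.toFun.continuous).Homotopic δ := by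
  obtain ⟨q, hq⟩ := (FundamentalGroupoidFunctor.equivOfHomotopyEquiv e).functor.map_surjective
    (X := ⟨x⟩) (Y := ⟨y⟩) (Path.Homotopic.Quotient.mk (X := Y) (x₀ := e.toFun x) (x₁ := e.toFun y) δ)
  obtain ⟨γ, rfl⟩ := Path.Homotopic.Quotient.mk_surjective q
  exact ⟨γ, Path.Homotopic.Quotient.eq.1 hq⟩

end ContinuousMap.HomotopyEquiv

namespace PathRep

variable {X Y G : Type*} [TopologicalSpace X] [TopologicalSpace Y] [Group G]

/-- The representation is injective on homotopy classes of paths. -/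
def IsFaithful (R : PathRep X G) : Prop :=
  ∀ {x y : X} {γ γ' : Path x y}, R.val γ = R.val γ' → γ.Homotopic γ'

/-- The representation takes all values on the loops at any point. -/
def IsFull (R : PathRep X G) : Prop := ∀ (x : X) (g : G), ∃ γ : Path x x, R.val γ = g

theorem toHom_bijective {R : PathRep X G} (h : R.IsFaithful) (h' : R.IsFull) (x : X) :
    Function.Bijective (R.toHom x) := by
  constructor
  · intro p q hpq
    obtain ⟨γ, rfl⟩ := Path.Homotopic.Quotient.mk_surjective p
    obtain ⟨γ', rfl⟩ := Path.Homotopic.Quotient.mk_surjective q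
    exact Path.Homotopic.Quotient.eq.2 (h hpq)
  · intro g
    obtain ⟨γ, hγ⟩ := h' x g
    exact ⟨.fromPath (.mk γ), hγ⟩

theorem IsFaithful.comap {R : PathRep X G} (h : R.IsFaithful) (e : Y ≃ₕ X) :
    (R.comap e.toFun).IsFaithful := fun hγ => e.homotopic_of_map (h hγ)

theorem IsFull.comap {R : PathRep X G} (h : R.IsFull) (e : Y ≃ₕ X) :
    (R.comap e.toFun).IsFull := fun x g => by
  obtain ⟨δ, hδ⟩ := h (e.toFun x) g
  obtain ⟨γ, hγ⟩ := e.exists_path_map_homotopic δ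
  exact ⟨γ, (R.map_homotopic hγ).trans hδ⟩

/-- The auxiliary paths at the two ends cancel up to homotopy. -/
theorem isFaithful_ofSections {x₀ : X} (c : ∀ x, Path x₀ x) : (ofSections c).IsFaithful := by
  intro x y γ γ' h
  replace h : Path.Homotopic.Quotient.mk ((c x).trans (γ.trans (c y).symm)) =
    Path.Homotopic.Quotient.mk ((c x).trans (γ'.trans (c y).symm)) := h
  rw [← Path.Homotopic.Quotient.eq]
  simp only [Path.Homotopic.Quotient.mk_trans, Path.Homotopic.Quotient.mk_symm] at h
  have h2 := congrArg (fun q => ((Path.Homotopic.Quotient.mk (c x)).symm.trans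
    (q.trans (Path.Homotopic.Quotient.mk (c y))))) h
  grind

/-- Conjugation by a path to the base point carries loops at one point to loops at any other. -/
theorem isFull_of_surjective (R : PathRep X G) {x₀ : X} (c : ∀ x, Path x₀ x)
    (h : Function.Surjective (R.toHom x₀)) : R.IsFull := by
  intro x g
  obtain ⟨p, hp⟩ := h ((R.val (c x))⁻¹ * g * R.val (c x))
  obtain ⟨γ, rfl⟩ := Path.Homotopic.Quotient.mk_surjective p
  refine ⟨(c x).symm.trans (γ.trans (c x)), ?_⟩
  replace hp : R.val γ = _ := hp
  rw [R.map_trans, R.map_trans, R.map_symm, hp]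
  group

end PathRep

/-! ### Spaces that are homotopy equivalent to the circle -/

/-- The map to the circle is a homotopy equivalence. -/
def IsCircleEquiv {Y : Type*} [TopologicalSpace Y] (φ : C(Y, Circle)) : Prop :=
  ∃ e : Y ≃ₕ Circle, e.toFun = φ

namespace IsCircleEquiv

variable {Y : Type*} [TopologicalSpace Y] {φ : C(Y, Circle)} {l : Y → ℝ}

theorem homotopic_of_angle_eq (hφ : IsCircleEquiv φ) {x y : Y} {γ γ' : Path x y}
    (h : Circle.angle (γ.map φ.continuous) = Circle.angle (γ'.map φ.continuous)) :
    γ.Homotopic γ' := by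
  obtain ⟨e, rfl⟩ := hφ
  exact e.homotopic_of_map (Circle.homotopic_of_angle_eq h)

theorem homotopic_of_winding_eq (hφ : IsCircleEquiv φ) (hl : ∀ p, Circle.exp (l p) = φ p) {x y : Y}
    {γ γ' : Path x y} (h : PathRep.winding φ l hl γ = PathRep.winding φ l hl γ') :
    γ.Homotopic γ' :=
  hφ.homotopic_of_angle_eq <| by
    rw [(PathRep.winding_eq_iff φ l hl γ _).1 rfl, (PathRep.winding_eq_iff φ l hl γ' _).1 rfl, h]

theorem exists_path_winding (hφ : IsCircleEquiv φ) (hl : ∀ p, Circle.exp (l p) = φ p) (x y : Y)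
    (n : ℤ) : ∃ γ : Path x y, PathRep.winding φ l hl γ = n := by
  obtain ⟨e, rfl⟩ := hφ
  set r : ℝ := n * (2 * Real.pi) + (l y - l x)
  have hr : Circle.exp r * e.toFun x = e.toFun y := by
    rw [← hl, ← hl, ← Circle.exp_add]
    refine Circle.exp_eq_exp.2 ⟨n, ?_⟩
    simp only [r]
    ring
  obtain ⟨γ, hγ⟩ := e.exists_path_map_homotopic ((Circle.arc (e.toFun x) r).cast rfl hr.symm)
  refine ⟨γ, (PathRep.winding_eq_iff _ _ _ _ _).2 ?_⟩
  rw [Circle.angle_homotopic hγ]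
  exact (Circle.angle_congr _ (Circle.arc _ r) fun t => rfl).trans (Circle.angle_arc _ r)

/-- Winding numbers are a faithful representation of the fundamental group, and both sides have the
same winding number. -/
theorem loop_eq_zpow (hφ : IsCircleEquiv φ) (hl : ∀ p, Circle.exp (l p) = φ p) {x : Y}
    (δ γ : Path x x) (hγ : PathRep.winding φ l hl γ = 1) :
    FundamentalGroup.fromPath (Path.Homotopic.Quotient.mk δ) =
      FundamentalGroup.fromPath (Path.Homotopic.Quotient.mk γ) ^ PathRep.winding φ l hl δ := by
  let R := PathRep.windingRep φ l hl (Multiplicative.ofAdd (1 : ℤ))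
  have hR : R.IsFaithful := fun {x y γ γ'} h => hφ.homotopic_of_winding_eq hl (by
    replace h : Multiplicative.ofAdd (1 : ℤ) ^ PathRep.winding φ l hl γ =
      Multiplicative.ofAdd (1 : ℤ) ^ PathRep.winding φ l hl γ' := h
    simpa [← ofAdd_zsmul] using h)
  have hinj : Function.Injective (R.toHom x) := by
    intro p q hpq
    obtain ⟨γ, rfl⟩ := Path.Homotopic.Quotient.mk_surjective p
    obtain ⟨γ', rfl⟩ := Path.Homotopic.Quotient.mk_surjective q
    exact Path.Homotopic.Quotient.eq.2 (hR hpq)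
  apply hinj
  rw [map_zpow, PathRep.toHom_mk, PathRep.toHom_mk]
  change Multiplicative.ofAdd (1 : ℤ) ^ _ = (Multiplicative.ofAdd (1 : ℤ) ^ _) ^ _
  rw [hγ, zpow_one]

end IsCircleEquiv

/-! ### Two circles amalgamated -/

section Amalgam

variable {X G : Type*} [TopologicalSpace X] [Group G]

/-- The class of a path between sections, for a subset homotopy equivalent to the circle. -/
theorem ofSections_eq_zpow {U : Set X} {φ : C(U, Circle)} (hφ : IsCircleEquiv φ) {l : U → ℝ}
    (hl : ∀ p, Circle.exp (l p) = φ p) {x₀ : X} (hx₀ : x₀ ∈ U) (c : ∀ x, Path x₀ x)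
    (cU : ∀ x ∈ U, ∃ h : ∀ t, c x t ∈ U, PathRep.winding φ l hl ((c x).codRestrict U h) = 0)
    (α : Path (⟨x₀, hx₀⟩ : U) ⟨x₀, hx₀⟩) (hα : PathRep.winding φ l hl α = 1) {x y : X}
    (γ : Path x y) (hγ : ∀ t, γ t ∈ U) :
    (PathRep.ofSections c).val γ =
      FundamentalGroup.fromPath (Path.Homotopic.Quotient.mk (α.map continuous_subtype_val)) ^
        PathRep.winding φ l hl (γ.codRestrict U hγ) := by
  obtain ⟨hx, wx⟩ := cU x (by simpa using hγ 0)
  obtain ⟨hy, wy⟩ := cU y (by simpa using hγ 1)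
  let δ := ((c x).codRestrict U hx).trans
    ((γ.codRestrict U hγ).trans ((c y).codRestrict U hy).symm)
  have hδ : PathRep.winding φ l hl δ = PathRep.winding φ l hl (γ.codRestrict U hγ) := by
    let R := PathRep.windingRep φ l hl (Multiplicative.ofAdd (1 : ℤ))
    have hv : ∀ {x y} (γ : Path x y), R.val γ = Multiplicative.ofAdd (PathRep.winding φ l hl γ) :=
      fun γ => by
        change Multiplicative.ofAdd (1 : ℤ) ^ _ = _
        rw [← ofAdd_zsmul, smul_eq_mul, mul_one]
    apply Multiplicative.ofAdd.injective
    rw [← hv, ← hv, R.map_trans, R.map_trans, R.map_symm, hv, hv, hv, wx, wy]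
    simp
  have h := congrArg (FundamentalGroup.map ⟨Subtype.val, continuous_subtype_val⟩
    (⟨x₀, hx₀⟩ : U)) (hφ.loop_eq_zpow hl δ α hα)
  rw [map_zpow, hδ] at h
  refine Eq.trans ?_ h
  change Path.Homotopic.Quotient.mk _ = Path.Homotopic.Quotient.mk (δ.map continuous_subtype_val)
  simp only [δ, Path.map_trans]
  rfl

/-- The fundamental groupoid of a space covered by two open sets that are homotopy equivalent to
the circle, when every loop of the intersection is a multiple of one that winds `m` times around
the first circle and `n` times around the second. -/
theorem PathRep.exists_of_circles {U V : Set X} (oU : IsOpen U) (oV : IsOpen V)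
    (hcov : ∀ x, x ∈ U ∨ x ∈ V) {φ : C(U, Circle)} {ψ : C(V, Circle)} (hφ : IsCircleEquiv φ)
    (hψ : IsCircleEquiv ψ) {l : U → ℝ} (hl : ∀ p, Circle.exp (l p) = φ p) {l' : V → ℝ}
    (hl' : ∀ p, Circle.exp (l' p) = ψ p) {x₀ : X} (hx₀ : x₀ ∈ U) (hx₀' : x₀ ∈ V)
    (hsec : ∀ x, x ∈ U → x ∈ V → ∃ (c : Path x₀ x) (h : ∀ t, c t ∈ U) (h' : ∀ t, c t ∈ V),
      winding φ l hl (c.codRestrict U h) = 0 ∧ winding ψ l' hl' (c.codRestrict V h') = 0)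
    {m n : ℤ} (hfib : ∃ (c : Path x₀ x₀) (h : ∀ t, c t ∈ U) (h' : ∀ t, c t ∈ V),
      winding φ l hl (c.codRestrict U h) = m ∧ winding ψ l' hl' (c.codRestrict V h') = n)
    (hcomp : ∀ {x y : X} (c : Path x y) (h : ∀ t, c t ∈ U) (h' : ∀ t, c t ∈ V), ∃ k : ℤ,
      winding φ l hl (c.codRestrict U h) = m * k ∧ winding ψ l' hl' (c.codRestrict V h') = n * k)
    {u v : G} (huv : u ^ m = v ^ n) (hgen : Subgroup.closure {u, v} = ⊤)
    (huniv : ∀ s t : FundamentalGroup X x₀, s ^ m = t ^ n →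
      ∃ f : G →* FundamentalGroup X x₀, f u = s ∧ f v = t) :
    ∃ F : PathRep X G, F.IsFaithful ∧ F.IsFull ∧
      (∀ {x y : X} (γ : Path x y) (h : ∀ t, γ t ∈ U),
        F.val γ = u ^ winding φ l hl (γ.codRestrict U h)) ∧
      (∀ {x y : X} (γ : Path x y) (h : ∀ t, γ t ∈ V),
        F.val γ = v ^ winding ψ l' hl' (γ.codRestrict V h)) := by
  have oc : ∀ b : Bool, IsOpen (cond b U V) := by simp [oU, oV]
  have hc : ∀ x, ∃ b : Bool, x ∈ cond b U V := fun x => by simpa [or_comm] using hcov x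
  -- On the intersection the winding numbers are mk and nk for one integer k, so the two
  -- representations agree because u ^ m = v ^ n.
  obtain ⟨F, hF⟩ := PathRep.exists_glue (c := fun b : Bool => cond b U V) oc hc
    (fun b => match b with
      | true => (windingRep φ l hl u : PathRep U G)
      | false => (windingRep ψ l' hl' v : PathRep V G)) (by
    have key : ∀ {x y : X} (γ : Path x y) (h : ∀ t, γ t ∈ U) (h' : ∀ t, γ t ∈ V),
        u ^ winding φ l hl (γ.codRestrict U h) = v ^ winding ψ l' hl' (γ.codRestrict V h') := by
      intro x y γ h h'
      obtain ⟨k, h1, h2⟩ := hcomp γ h h'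
      rw [h1, h2, zpow_mul, zpow_mul, huv]
    rintro (_ | _) (_ | _) x y γ h h'
    · rfl
    · exact (key γ h' h).symm
    · exact key γ h h'
    · rfl)
  have hFU : ∀ {x y : X} (γ : Path x y) (h : ∀ t, γ t ∈ U),
      F.val γ = u ^ winding φ l hl (γ.codRestrict U h) := fun γ h => hF true γ h
  have hFV : ∀ {x y : X} (γ : Path x y) (h : ∀ t, γ t ∈ V),
      F.val γ = v ^ winding ψ l' hl' (γ.codRestrict V h) := fun γ h => hF false γ h
  -- Paths of winding number zero in each set that contains the end, so that they contribute nothing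
  -- to the values of `ofSections`.
  have hsec' : ∀ x, ∃ c : Path x₀ x,
      (x ∈ U → ∃ h : ∀ t, c t ∈ U, winding φ l hl (c.codRestrict U h) = 0) ∧
      (x ∈ V → ∃ h : ∀ t, c t ∈ V, winding ψ l' hl' (c.codRestrict V h) = 0) := by
    intro x
    by_cases h1 : x ∈ U <;> by_cases h2 : x ∈ V
    · obtain ⟨c, h, h', w, w'⟩ := hsec x h1 h2
      exact ⟨c, fun _ => ⟨h, w⟩, fun _ => ⟨h', w'⟩⟩
    · obtain ⟨c, hc⟩ := hφ.exists_path_winding hl ⟨x₀, hx₀⟩ ⟨x, h1⟩ 0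
      exact ⟨c.map continuous_subtype_val, fun _ => ⟨fun t => (c t).2, hc⟩, fun h => absurd h h2⟩
    · obtain ⟨c, hc⟩ := hψ.exists_path_winding hl' ⟨x₀, hx₀'⟩ ⟨x, h2⟩ 0
      exact ⟨c.map continuous_subtype_val, fun h => absurd h h1, fun _ => ⟨fun t => (c t).2, hc⟩⟩
    · exact absurd (hcov x) (by simp [h1, h2])
  choose c cU cV using hsec'
  obtain ⟨α, hα⟩ := hφ.exists_path_winding hl ⟨x₀, hx₀⟩ ⟨x₀, hx₀⟩ 1
  obtain ⟨β, hβ⟩ := hψ.exists_path_winding hl' ⟨x₀, hx₀'⟩ ⟨x₀, hx₀'⟩ 1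
  obtain ⟨f, hf, hf', w, w'⟩ := hfib
  have e1 := congrArg (FundamentalGroup.map ⟨Subtype.val, continuous_subtype_val⟩
    (⟨x₀, hx₀⟩ : U)) (hφ.loop_eq_zpow hl (f.codRestrict U hf) α hα)
  have e2 := congrArg (FundamentalGroup.map ⟨Subtype.val, continuous_subtype_val⟩
    (⟨x₀, hx₀'⟩ : V)) (hψ.loop_eq_zpow hl' (f.codRestrict V hf') β hβ)
  rw [map_zpow, w] at e1
  rw [map_zpow, w'] at e2
  -- The common loop in the intersection is the m-th power of α and the n-th power of β, so the
  -- universal property yields a homomorphism back to the fundamental group.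
  obtain ⟨Ψ, hΨu, hΨv⟩ := huniv _ _ (e1.symm.trans e2)
  -- Composed with `Ψ`, the glued representation is the tautological one, since they agree on each
  -- of the two sets. Faithfulness of `F` follows.
  have hΘ : ∀ {x y : X} (γ : Path x y), Ψ (F.val γ) = (ofSections c).val γ := by
    intro x y γ
    refine PathRep.eq_of_forall_cover oc hc (F.mapHom Ψ) (ofSections c) ?_ γ
    rintro (_ | _) x y γ hγ
    · rw [mapHom_apply, hFV γ hγ, map_zpow, hΨv]
      exact (ofSections_eq_zpow hψ hl' hx₀' c cV β hβ γ hγ).symm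
    · rw [mapHom_apply, hFU γ hγ, map_zpow, hΨu]
      exact (ofSections_eq_zpow hφ hl hx₀ c cU α hα γ hγ).symm
  refine ⟨F, ?_, ?_, hFU, hFV⟩
  · intro x y γ γ' h
    exact isFaithful_ofSections c (by rw [← hΘ, ← hΘ, h])
  -- Fullness needs only that the generators u and v are attained, by α and β.
  · refine F.isFull_of_surjective c (MonoidHom.range_eq_top.1 (top_le_iff.1 ?_))
    rw [← hgen, Subgroup.closure_le]
    rintro g (rfl | rfl)
    · refine ⟨.fromPath (.mk (α.map continuous_subtype_val)), ?_⟩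
      rw [toHom_mk, hFU _ (fun t => (α t).2)]
      change g ^ winding φ l hl α = g
      rw [hα, zpow_one]
    · refine ⟨.fromPath (.mk (β.map continuous_subtype_val)), ?_⟩
      rw [toHom_mk, hFV _ (fun t => (β t).2)]
      change g ^ winding ψ l' hl' β = g
      rw [hβ, zpow_one]

end Amalgam

/-! ### The complement of the cone over the trefoil -/

theorem Complex.ofReal_mul_mem_slitPlane {r : ℝ} (hr : 0 < r) {z : ℂ} (hz : z ∈ slitPlane) :
    (r : ℂ) * z ∈ slitPlane := by
  rw [mem_slitPlane_iff] at hz ⊢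
  simp only [re_ofReal_mul, im_ofReal_mul]
  rcases hz with h | h
  · exact .inl (mul_pos hr h)
  · exact .inr (mul_ne_zero hr.ne' h)

theorem TrefoilGroup.closure_x_y : Subgroup.closure {x, y} = (⊤ : Subgroup TrefoilGroup) := by
  have hx : x ∈ Subgroup.closure {x, y} := Subgroup.subset_closure (by simp)
  have hy : y ∈ Subgroup.closure {x, y} := Subgroup.subset_closure (by simp)
  have ha : a ∈ Subgroup.closure {x, y} := by
    rw [a_eq]
    exact mul_mem (inv_mem hy) (pow_mem hx 2)
  have hb : b ∈ Subgroup.closure {x, y} := by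
    rw [b_eq]
    exact mul_mem (inv_mem hx) hy
  rw [← top_le_iff, ← PresentedGroup.closure_range_of, Subgroup.closure_le]
  rintro _ ⟨i, rfl⟩
  fin_cases i
  · exact ha
  · exact hb
  · change c ∈ Subgroup.closure {x, y}
    rw [c_eq]
    exact mul_mem (mul_mem (inv_mem ha) hb) ha

namespace TrefoilCone

/-- The function `z³ w̄²`, which on a torus `|z| = const`, `|w| = const` is constant on the
`(2, 3)` curves. -/
def g (p : ℂ × ℂ) : ℂ := p.1 ^ 3 * conj p.2 ^ 2

theorem continuous_g : Continuous g := by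
  unfold g
  fun_prop

theorem g_smul (r s : ℝ) (p : ℂ × ℂ) :
    g (r * p.1, s * p.2) = ((r ^ 3 * s ^ 2 : ℝ) : ℂ) * g p := by
  simp only [g, map_mul, Complex.conj_ofReal]
  push_cast
  ring

theorem neg_g_smul_mem {r s : ℝ} (hr : 0 < r) (hs : 0 < s) {p : ℂ × ℂ}
    (h : -g p ∈ Complex.slitPlane) : -g (r * p.1, s * p.2) ∈ Complex.slitPlane := by
  rw [g_smul, ← mul_neg]
  exact Complex.ofReal_mul_mem_slitPlane (by positivity) h

/-- The complement in `{w ≠ 0}` of the part over `|z| ≥ |w|` of the surface `g > 0`. -/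
def outer : Set (ℂ × ℂ) := {p | p.2 ≠ 0 ∧ (-g p ∈ Complex.slitPlane ∨ ‖p.1‖ < ‖p.2‖)}

/-- The complement in `{z ≠ 0}` of the part over `|z| ≤ |w|` of the surface `g > 0`. -/
def inner : Set (ℂ × ℂ) := {p | p.1 ≠ 0 ∧ (-g p ∈ Complex.slitPlane ∨ ‖p.2‖ < ‖p.1‖)}

/-- The complement of the cone over the trefoil. -/
def compl : Set (ℂ × ℂ) := outer ∪ inner

theorem ne_zero_of_neg_g_mem {p : ℂ × ℂ} (h : -g p ∈ Complex.slitPlane) : p.1 ≠ 0 ∧ p.2 ≠ 0 := by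
  constructor <;> intro h0 <;> simp [g, h0] at h

/-- Where g ≥ 0, membership would require both |z| < |w| and |w| < |z|. -/
theorem mem_outer_and_inner {p : ℂ × ℂ} :
    p ∈ outer ∧ p ∈ inner ↔ -g p ∈ Complex.slitPlane := by
  constructor
  · rintro ⟨⟨-, h1 | h1⟩, ⟨-, h2 | h2⟩⟩
    exacts [h1, h1, h2, absurd h1 h2.not_gt]
  · intro h
    obtain ⟨h1, h2⟩ := ne_zero_of_neg_g_mem h
    exact ⟨⟨h2, .inl h⟩, h1, .inl h⟩

theorem isOpen_outer : IsOpen outer := by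
  refine (isOpen_ne_fun continuous_snd continuous_const).inter (IsOpen.union ?_ ?_)
  · exact Complex.isOpen_slitPlane.preimage continuous_g.neg
  · exact isOpen_lt (f := fun p : ℂ × ℂ => ‖p.1‖) (g := fun p => ‖p.2‖) (by fun_prop) (by fun_prop)

theorem isOpen_inner : IsOpen inner := by
  refine (isOpen_ne_fun continuous_fst continuous_const).inter (IsOpen.union ?_ ?_)
  · exact Complex.isOpen_slitPlane.preimage continuous_g.neg
  · exact isOpen_lt (f := fun p : ℂ × ℂ => ‖p.2‖) (g := fun p => ‖p.1‖) (by fun_prop) (by fun_prop)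

/-- `outer`, as a subset of the complement of the cone. -/
abbrev outer' : Set compl := Subtype.val ⁻¹' outer

/-- `inner`, as a subset of the complement of the cone. -/
abbrev inner' : Set compl := Subtype.val ⁻¹' inner

/-- The map `w / |w|`. -/
def phaseOuter : C(outer', Circle) where
  toFun p := phase p.1.1.2
  continuous_toFun := Continuous.phase (by fun_prop) fun p => p.2.1

/-- The map `z / |z|`. -/
def phaseInner : C(inner', Circle) where
  toFun p := phase p.1.1.1
  continuous_toFun := Continuous.phase (by fun_prop) fun p => p.2.1

theorem convex_pos {t : I} {r : ℝ} (hr : 0 < r) : 0 < (t : ℝ) + (1 - t) / r := by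
  rcases t.2.1.eq_or_lt with h | h
  · rw [← h]
    simpa using hr
  · have := div_nonneg (sub_nonneg.2 t.2.2) hr.le
    linarith

theorem mul_lt_convex_mul {t : I} {r s : ℝ} (hr : 0 < r) (hs : s < r) :
    t * s < ((t : ℝ) + (1 - t) / r) * r := by
  have h : ((t : ℝ) + (1 - t) / r) * r = t * r + (1 - t) := by field_simp
  rw [h]
  rcases t.2.1.eq_or_lt with h | h
  · simp [← h]
  · have := mul_lt_mul_of_pos_left hs h
    linarith [t.2.2]

/-- Shrinking z to 0 while normalizing w rescales both coordinates by positive numbers as long as t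
> 0. This keeps the argument of g, and the scaling is arranged to preserve |z| < |w|. At t = 0 the
point is (0, w/|w|). -/
theorem outer_contract {p : ℂ × ℂ} (h : p ∈ outer) (t : I) :
    (((t : ℝ) : ℂ) * p.1, (((t : ℝ) + (1 - t) / ‖p.2‖ : ℝ) : ℂ) * p.2) ∈ outer := by
  have hp : 0 < ‖p.2‖ := norm_pos_iff.2 h.1
  have h2 := convex_pos (t := t) hp
  refine ⟨mul_ne_zero (by exact_mod_cast h2.ne') h.1, ?_⟩
  rcases t.2.1.eq_or_lt with h0 | h0
  · right
    simp [← h0, hp.ne']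
  · rcases h.2 with h1 | h1
    · exact .inl (neg_g_smul_mem h0 h2 h1)
    · right
      simp only [norm_mul, Complex.norm_real, Real.norm_of_nonneg t.2.1, Real.norm_of_nonneg h2.le]
      exact mul_lt_convex_mul hp h1

theorem inner_contract {p : ℂ × ℂ} (h : p ∈ inner) (t : I) :
    ((((t : ℝ) + (1 - t) / ‖p.1‖ : ℝ) : ℂ) * p.1, ((t : ℝ) : ℂ) * p.2) ∈ inner := by
  have hp : 0 < ‖p.1‖ := norm_pos_iff.2 h.1
  have h2 := convex_pos (t := t) hp
  refine ⟨mul_ne_zero (by exact_mod_cast h2.ne') h.1, ?_⟩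
  rcases t.2.1.eq_or_lt with h0 | h0
  · right
    simp [← h0, hp.ne']
  · rcases h.2 with h1 | h1
    · exact .inl (neg_g_smul_mem h2 h0 h1)
    · right
      simp only [norm_mul, Complex.norm_real, Real.norm_of_nonneg t.2.1, Real.norm_of_nonneg h2.le]
      exact mul_lt_convex_mul hp h1

/-- The set deformation retracts to the circle z = 0, |w| = 1. -/
theorem isCircleEquiv_phaseOuter : IsCircleEquiv phaseOuter := by
  let inv : C(Circle, outer') :=
    { toFun := fun u => ⟨⟨(0, u), .inl ⟨u.coe_ne_zero, .inr (by simp)⟩⟩,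
        ⟨u.coe_ne_zero, .inr (by simp)⟩⟩
      continuous_toFun := by fun_prop }
  refine ⟨⟨phaseOuter, inv, ⟨⟨⟨fun q => ⟨⟨_, .inl (outer_contract q.2.2 q.1)⟩,
    outer_contract q.2.2 q.1⟩, ?_⟩, ?_, ?_⟩⟩, ?_⟩, rfl⟩
  · refine Continuous.subtype_mk (Continuous.subtype_mk (Continuous.prodMk (by fun_prop) ?_) _) _
    refine Continuous.mul (Complex.continuous_ofReal.comp (Continuous.add (by fun_prop)
      (Continuous.div (by fun_prop) (by fun_prop) ?_))) (by fun_prop)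
    intro q
    exact norm_ne_zero_iff.2 q.2.2.1
  · rintro ⟨⟨p, hp⟩, hp'⟩
    refine Subtype.ext (Subtype.ext (Prod.ext (by simp [inv]) ?_))
    simp only [inv, phaseOuter, ContinuousMap.comp_apply, ContinuousMap.coe_mk]
    rw [coe_phase hp'.1]
    simp [div_eq_inv_mul]
  · rintro ⟨⟨p, hp⟩, hp'⟩
    refine Subtype.ext (Subtype.ext (Prod.ext (by simp) (by simp)))
  · convert ContinuousMap.Homotopic.refl _
    ext u
    simp [inv, phaseOuter, phase_coe]

theorem isCircleEquiv_phaseInner : IsCircleEquiv phaseInner := by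
  let inv : C(Circle, inner') :=
    { toFun := fun u => ⟨⟨(u, 0), .inr ⟨u.coe_ne_zero, .inr (by simp)⟩⟩,
        ⟨u.coe_ne_zero, .inr (by simp)⟩⟩
      continuous_toFun := by fun_prop }
  refine ⟨⟨phaseInner, inv, ⟨⟨⟨fun q => ⟨⟨_, .inr (inner_contract q.2.2 q.1)⟩,
    inner_contract q.2.2 q.1⟩, ?_⟩, ?_, ?_⟩⟩, ?_⟩, rfl⟩
  · refine Continuous.subtype_mk (Continuous.subtype_mk (Continuous.prodMk ?_ (by fun_prop)) _) _
    refine Continuous.mul (Complex.continuous_ofReal.comp (Continuous.add (by fun_prop)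
      (Continuous.div (by fun_prop) (by fun_prop) ?_))) (by fun_prop)
    intro q
    exact norm_ne_zero_iff.2 q.2.2.1
  · rintro ⟨⟨p, hp⟩, hp'⟩
    refine Subtype.ext (Subtype.ext (Prod.ext ?_ (by simp [inv])))
    simp only [inv, phaseInner, ContinuousMap.comp_apply, ContinuousMap.coe_mk]
    rw [coe_phase hp'.1]
    simp [div_eq_inv_mul]
  · rintro ⟨⟨p, hp⟩, hp'⟩
    refine Subtype.ext (Subtype.ext (Prod.ext (by simp) (by simp)))
  · convert ContinuousMap.Homotopic.refl _
    ext u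
    simp [inv, phaseInner, phase_coe]

/-! #### Coordinates adapted to the Seifert fibration -/

/-- The point `(r₁ s², r₂ s³ e^{iθ})` with `s = e^{iτ}`. -/
def point (r₁ r₂ τ θ : ℝ) : ℂ × ℂ :=
  (r₁ * Circle.exp (2 * τ), r₂ * Circle.exp (3 * τ + θ))

theorem continuous_point {Y : Type*} [TopologicalSpace Y] {r₁ r₂ τ θ : Y → ℝ} (h₁ : Continuous r₁)
    (h₂ : Continuous r₂) (hτ : Continuous τ) (hθ : Continuous θ) :
    Continuous fun y => point (r₁ y) (r₂ y) (τ y) (θ y) := by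
  unfold point
  fun_prop

theorem conj_coe (u : Circle) : conj (u : ℂ) = (u⁻¹ : Circle) := by
  rw [Circle.coe_inv_eq_conj]

/-- The fibre coordinate τ drops out, as 3 · 2τ - 2(3τ + θ) = -2θ. -/
theorem g_point (r₁ r₂ τ θ : ℝ) :
    g (point r₁ r₂ τ θ) = (r₁ ^ 3 * r₂ ^ 2 : ℝ) * (Circle.exp (-2 * θ) : ℂ) := by
  have h : (Circle.exp (-2 * θ)) = Circle.exp (2 * τ) ^ 3 * (Circle.exp (3 * τ + θ))⁻¹ ^ 2 := by
    simp only [pow_succ, pow_zero, one_mul, ← Circle.exp_add, ← Circle.exp_neg]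
    congr 1
    ring
  rw [h]
  simp only [g, point, map_mul, Complex.conj_ofReal, conj_coe]
  push_cast
  ring

theorem neg_g_point_mem {r₁ r₂ τ θ : ℝ} (h₁ : 0 < r₁) (h₂ : 0 < r₂) (hθ : θ ∈ Ioo 0 Real.pi) :
    -g (point r₁ r₂ τ θ) ∈ Complex.slitPlane := by
  rw [g_point, ← mul_neg]
  refine Complex.ofReal_mul_mem_slitPlane (by positivity) ?_
  have hs := Real.sin_pos_of_mem_Ioo hθ
  rw [Complex.mem_slitPlane_iff, Circle.coe_exp, Complex.neg_re, Complex.neg_im,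
    Complex.exp_ofReal_mul_I_re, Complex.exp_ofReal_mul_I_im, show -2 * θ = -(2 * θ) by ring,
    Real.cos_neg, Real.sin_neg, neg_neg, Real.sin_two_mul, Real.cos_two_mul]
  by_cases hc : Real.cos θ = 0
  · left
    rw [hc]
    norm_num
  · right
    positivity

theorem phase_point_fst {r₁ : ℝ} (h₁ : 0 < r₁) (r₂ τ θ : ℝ) :
    phase (point r₁ r₂ τ θ).1 = Circle.exp (2 * τ) := phase_eq_of h₁ rfl

theorem phase_point_snd {r₂ : ℝ} (h₂ : 0 < r₂) (r₁ τ θ : ℝ) :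
    phase (point r₁ r₂ τ θ).2 = Circle.exp (3 * τ + θ) := phase_eq_of h₂ rfl

/-- The angle `θ ∈ (0, π)` with `g = |g| exp (-2 θ i)`, where `g` is not positive. -/
def angle (p : ℂ × ℂ) : ℝ := (Real.pi - Complex.arg (-g p)) / 2

/-- The Seifert fibre coordinate where `g` is not positive. -/
def fiberCoord (p : ℂ × ℂ) : Circle := phase p.2 * Circle.exp (-angle p) * (phase p.1)⁻¹

theorem angle_mem {p : ℂ × ℂ} (h : -g p ∈ Complex.slitPlane) : angle p ∈ Ioo 0 Real.pi := by
  have h1 := Complex.arg_le_pi (-g p)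
  have h2 := Complex.neg_pi_lt_arg (-g p)
  have h3 := (Complex.mem_slitPlane_iff_arg.1 h).1
  have h4 := lt_of_le_of_ne h1 h3
  constructor <;> unfold angle <;> linarith

theorem phase_g {p : ℂ × ℂ} (h1 : p.1 ≠ 0) (h2 : p.2 ≠ 0) :
    phase (g p) = phase p.1 ^ 3 * (phase p.2)⁻¹ ^ 2 := by
  refine phase_eq_of (r := ‖p.1‖ ^ 3 * ‖p.2‖ ^ 2) (by positivity) ?_
  conv_lhs => rw [g, ← norm_mul_phase p.1, ← norm_mul_phase p.2]
  simp only [map_mul, Complex.conj_ofReal, conj_coe]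
  push_cast
  ring

/-- With s² and s³e^{iθ} as the phases of z and w, the quotient of w e^{-iθ} by z recovers s,
provided that the phase of g is e^{-2iθ}. Both angle functions, `angle` away from g ≥ 0 and `skew`
near g > 0, use this inversion. -/
theorem point_eq_of {p : ℂ × ℂ} (h1 : p.1 ≠ 0) (h2 : p.2 ≠ 0) {τ θ : ℝ}
    (hθ : phase (g p) = Circle.exp (-2 * θ))
    (hτ : Circle.exp τ = phase p.2 * Circle.exp (-θ) * (phase p.1)⁻¹) :
    point ‖p.1‖ ‖p.2‖ τ θ = p := by
  have hsq : Circle.exp (2 * τ) = phase p.1 := by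
    rw [phase_g h1 h2, show -2 * θ = -θ + -θ by ring, Circle.exp_add] at hθ
    have h5 : Circle.exp (2 * τ) = phase p.2 ^ 2 * (Circle.exp (-θ) * Circle.exp (-θ)) *
        (phase p.1)⁻¹ ^ 2 := by
      rw [two_mul, Circle.exp_add, ← sq, hτ, mul_pow, mul_pow, sq (Circle.exp _)]
    rw [h5, ← hθ]
    ext
    have := (phase p.1).coe_ne_zero
    have := (phase p.2).coe_ne_zero
    push_cast
    field_simp
  have hcube : Circle.exp (3 * τ + θ) = phase p.2 := by
    rw [show 3 * τ + θ = 2 * τ + (τ + θ) by ring, Circle.exp_add, Circle.exp_add, hsq, hτ,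
      Circle.exp_neg]
    ext
    have := (phase p.1).coe_ne_zero
    have := (Circle.exp θ).coe_ne_zero
    push_cast
    field_simp
  rw [point, hsq, hcube, norm_mul_phase, norm_mul_phase]

theorem point_eq {p : ℂ × ℂ} (h : -g p ∈ Complex.slitPlane) {τ : ℝ}
    (hτ : Circle.exp τ = fiberCoord p) : point ‖p.1‖ ‖p.2‖ τ (angle p) = p := by
  obtain ⟨h1, h2⟩ := ne_zero_of_neg_g_mem h
  refine point_eq_of h1 h2 ?_ hτ
  have hg : g p ≠ 0 := by
    rintro h0
    simp [h0] at h
  have : phase (-g p) = Circle.exp (Real.pi) * phase (g p) := by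
    rw [← phase_coe (Circle.exp Real.pi), ← phase_mul (by simp) hg]
    simp [Circle.coe_exp]
  rw [phase] at this
  rw [← inv_mul_eq_iff_eq_mul.2 this, ← Circle.exp_neg, ← Circle.exp_add, angle]
  congr 1
  ring

/-- An angle of `w` at each point. -/
def gaugeOuter (p : outer') : ℝ :=
  open Classical in
  if -g p.1.1 ∈ Complex.slitPlane then 3 * Complex.arg (fiberCoord p.1.1) + angle p.1.1
  else Complex.arg p.1.1.2

/-- An angle of `z` at each point. -/
def gaugeInner (p : inner') : ℝ :=
  open Classical in
  if -g p.1.1 ∈ Complex.slitPlane then 2 * Complex.arg (fiberCoord p.1.1)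
  else Complex.arg p.1.1.1

theorem gaugeOuter_of (p : outer') (h : -g p.1.1 ∈ Complex.slitPlane) :
    gaugeOuter p = 3 * Complex.arg (fiberCoord p.1.1) + angle p.1.1 := if_pos h

theorem gaugeInner_of (p : inner') (h : -g p.1.1 ∈ Complex.slitPlane) :
    gaugeInner p = 2 * Complex.arg (fiberCoord p.1.1) := if_pos h

/-- On the overlap the two gauges are 3τ + θ and 2τ for one and the same choice of τ. Both winding
numbers of a path there thus count the turns of τ. Elsewhere any argument will do. -/
theorem exp_gaugeOuter (p : outer') : Circle.exp (gaugeOuter p) = phaseOuter p := by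
  by_cases h : -g p.1.1 ∈ Complex.slitPlane
  · rw [gaugeOuter_of p h]
    have h2 := phase_point_snd (norm_pos_iff.2 p.2.1) ‖p.1.1.1‖
      (Complex.arg (fiberCoord p.1.1)) (angle p.1.1)
    rw [point_eq h (Circle.exp_arg _)] at h2
    exact h2.symm
  · rw [gaugeOuter, if_neg h]
    rfl

theorem exp_gaugeInner (p : inner') : Circle.exp (gaugeInner p) = phaseInner p := by
  by_cases h : -g p.1.1 ∈ Complex.slitPlane
  · rw [gaugeInner_of p h]
    have h2 := phase_point_fst (norm_pos_iff.2 p.2.1) ‖p.1.1.2‖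
      (Complex.arg (fiberCoord p.1.1)) (angle p.1.1)
    rw [point_eq h (Circle.exp_arg _)] at h2
    exact h2.symm
  · rw [gaugeInner, if_neg h]
    rfl

theorem winding_outer_eq {x y : compl} (γ : Path x y) (h : ∀ t, γ t ∈ outer')
    (hx : -g x.1 ∈ Complex.slitPlane) (hy : -g y.1 ∈ Complex.slitPlane) {τ : I → ℝ}
    (hτ : Continuous τ) (hγ : ∀ t, phase (γ t).1.2 = Circle.exp (τ t)) {n : ℤ}
    (hn : τ 1 - τ 0 = n * (2 * Real.pi) + ((3 * Complex.arg (fiberCoord y) + angle y) -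
      (3 * Complex.arg (fiberCoord x) + angle x))) :
    PathRep.winding phaseOuter gaugeOuter exp_gaugeOuter (γ.codRestrict outer' h) = n := by
  rw [PathRep.winding_eq_iff, gaugeOuter_of ⟨x, _⟩ hx, gaugeOuter_of ⟨y, _⟩ hy, ← hn]
  exact Circle.angle_eq _ hτ hγ

theorem winding_inner_eq {x y : compl} (γ : Path x y) (h : ∀ t, γ t ∈ inner')
    (hx : -g x.1 ∈ Complex.slitPlane) (hy : -g y.1 ∈ Complex.slitPlane) {τ : I → ℝ}
    (hτ : Continuous τ) (hγ : ∀ t, phase (γ t).1.1 = Circle.exp (τ t)) {n : ℤ}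
    (hn : τ 1 - τ 0 = n * (2 * Real.pi) + (2 * Complex.arg (fiberCoord y) -
      2 * Complex.arg (fiberCoord x))) :
    PathRep.winding phaseInner gaugeInner exp_gaugeInner (γ.codRestrict inner' h) = n := by
  rw [PathRep.winding_eq_iff, gaugeInner_of ⟨x, _⟩ hx, gaugeInner_of ⟨y, _⟩ hy, ← hn]
  exact Circle.angle_eq _ hτ hγ

theorem mem_compl_of {p : ℂ × ℂ} (h : -g p ∈ Complex.slitPlane) : p ∈ compl :=
  .inl (mem_outer_and_inner.2 h).1

/-- A path in Seifert coordinates. -/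
def pointPath {r₁ r₂ τ θ : I → ℝ} (h₁ : Continuous r₁) (h₂ : Continuous r₂) (hτ : Continuous τ)
    (hθ : Continuous θ) (h : ∀ t, point (r₁ t) (r₂ t) (τ t) (θ t) ∈ compl) {x y : compl}
    (hx : point (r₁ 0) (r₂ 0) (τ 0) (θ 0) = x) (hy : point (r₁ 1) (r₂ 1) (τ 1) (θ 1) = y) :
    Path x y where
  toFun t := ⟨point (r₁ t) (r₂ t) (τ t) (θ t), h t⟩
  continuous_toFun := (continuous_point h₁ h₂ hτ hθ).subtype_mk _
  source' := Subtype.ext hx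
  target' := Subtype.ext hy

/-- In Seifert coordinates the overlap is convex apart from the periodicity of τ, so the coordinates
are interpolated linearly between their chosen values. The variation of angle then equals the
difference of the gauges. -/
theorem exists_section {x y : compl} (hx : -g x.1 ∈ Complex.slitPlane)
    (hy : -g y.1 ∈ Complex.slitPlane) :
    ∃ (c : Path x y) (h : ∀ t, c t ∈ outer') (h' : ∀ t, c t ∈ inner'),
      PathRep.winding phaseOuter gaugeOuter exp_gaugeOuter (c.codRestrict outer' h) = 0 ∧
        PathRep.winding phaseInner gaugeInner exp_gaugeInner (c.codRestrict inner' h') = 0 := by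
  obtain ⟨a1, a2⟩ := ne_zero_of_neg_g_mem hx
  obtain ⟨b1, b2⟩ := ne_zero_of_neg_g_mem hy
  let r₁ : I → ℝ := fun t => (1 - t) * ‖x.1.1‖ + t * ‖y.1.1‖
  let r₂ : I → ℝ := fun t => (1 - t) * ‖x.1.2‖ + t * ‖y.1.2‖
  let τ : I → ℝ := fun t =>
    (1 - t) * Complex.arg (fiberCoord x.1) + t * Complex.arg (fiberCoord y.1)
  let θ : I → ℝ := fun t => (1 - t) * angle x.1 + t * angle y.1
  have hr₁ : ∀ t, 0 < r₁ t := fun t =>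
    convex_Ioi (0 : ℝ) (norm_pos_iff.2 a1) (norm_pos_iff.2 b1) (sub_nonneg.2 t.2.2) t.2.1
      (sub_add_cancel 1 _)
  have hr₂ : ∀ t, 0 < r₂ t := fun t =>
    convex_Ioi (0 : ℝ) (norm_pos_iff.2 a2) (norm_pos_iff.2 b2) (sub_nonneg.2 t.2.2) t.2.1
      (sub_add_cancel 1 _)
  have hθ : ∀ t, θ t ∈ Ioo 0 Real.pi := fun t =>
    convex_Ioo 0 Real.pi (angle_mem hx) (angle_mem hy) (sub_nonneg.2 t.2.2) t.2.1
      (sub_add_cancel 1 _)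
  have hmem : ∀ t, -g (point (r₁ t) (r₂ t) (τ t) (θ t)) ∈ Complex.slitPlane := fun t =>
    neg_g_point_mem (hr₁ t) (hr₂ t) (hθ t)
  have hτc : Continuous τ := by fun_prop
  have hθc : Continuous θ := by fun_prop
  refine ⟨pointPath (r₁ := r₁) (r₂ := r₂) (τ := τ) (θ := θ) (by fun_prop) (by fun_prop) hτc hθc
    (fun t => mem_compl_of (hmem t)) ?_ ?_, fun t => (mem_outer_and_inner.2 (hmem t)).1,
    fun t => (mem_outer_and_inner.2 (hmem t)).2, ?_, ?_⟩
  · rw [← point_eq hx (Circle.exp_arg _)]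
    simp [r₁, r₂, τ, θ]
  · rw [← point_eq hy (Circle.exp_arg _)]
    simp [r₁, r₂, τ, θ]
  · refine winding_outer_eq _ _ hx hy (τ := fun t => 3 * τ t + θ t) (by fun_prop)
      (fun t => phase_point_snd (hr₂ t) _ _ _) ?_
    simp [τ, θ]
  · refine winding_inner_eq _ _ hx hy (τ := fun t => 2 * τ t) (by fun_prop)
      (fun t => phase_point_fst (hr₁ t) _ _ _) ?_
    simp [τ]

/-- The regular fibre, τ increasing by 2π with the other coordinates fixed. -/
theorem exists_fiber {x : compl} (hx : -g x.1 ∈ Complex.slitPlane) :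
    ∃ (c : Path x x) (h : ∀ t, c t ∈ outer') (h' : ∀ t, c t ∈ inner'),
      PathRep.winding phaseOuter gaugeOuter exp_gaugeOuter (c.codRestrict outer' h) = 3 ∧
        PathRep.winding phaseInner gaugeInner exp_gaugeInner (c.codRestrict inner' h') = 2 := by
  obtain ⟨a1, a2⟩ := ne_zero_of_neg_g_mem hx
  have hr₁ := norm_pos_iff.2 a1
  have hr₂ := norm_pos_iff.2 a2
  let τ : I → ℝ := fun t => Complex.arg (fiberCoord x.1) + 2 * Real.pi * t
  have hτc : Continuous τ := by fun_prop
  have hmem : ∀ t, -g (point ‖x.1.1‖ ‖x.1.2‖ (τ t) (angle x.1)) ∈ Complex.slitPlane := fun t =>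
    neg_g_point_mem hr₁ hr₂ (angle_mem hx)
  refine ⟨pointPath (r₁ := fun _ => ‖x.1.1‖) (r₂ := fun _ => ‖x.1.2‖) (τ := τ)
    (θ := fun _ => angle x.1) (by fun_prop) (by fun_prop) hτc (by fun_prop)
    (fun t => mem_compl_of (hmem t)) ?_ ?_, fun t => (mem_outer_and_inner.2 (hmem t)).1,
    fun t => (mem_outer_and_inner.2 (hmem t)).2, ?_, ?_⟩
  · exact point_eq hx (by simp [τ, Circle.exp_arg])
  · refine point_eq hx ?_
    simp [τ, Circle.exp_add, Circle.exp_arg]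
  · refine winding_outer_eq _ _ hx hx (τ := fun t => 3 * τ t + angle x.1) (by fun_prop)
      (fun t => phase_point_snd hr₂ _ _ _) ?_
    simp [τ]
    ring
  · refine winding_inner_eq _ _ hx hx (τ := fun t => 2 * τ t) (by fun_prop)
      (fun t => phase_point_fst hr₁ _ _ _) ?_
    simp [τ]
    ring

/-- Along a path in the overlap the fibre coordinate has a continuous angle τ. The number of its
turns relative to the chosen values is k, and the angles 3τ + θ and 2τ turn 3k and 2k times. -/
theorem exists_winding_eq {x y : compl} (c : Path x y) (h : ∀ t, c t ∈ outer')
    (h' : ∀ t, c t ∈ inner') :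
    ∃ k : ℤ, PathRep.winding phaseOuter gaugeOuter exp_gaugeOuter (c.codRestrict outer' h) = 3 * k ∧
        PathRep.winding phaseInner gaugeInner exp_gaugeInner (c.codRestrict inner' h') = 2 * k := by
  have hc : ∀ t, -g (c t).1 ∈ Complex.slitPlane := fun t =>
    mem_outer_and_inner.1 ⟨h t, h' t⟩
  have hx : -g x.1 ∈ Complex.slitPlane := by simpa using hc 0
  have hy : -g y.1 ∈ Complex.slitPlane := by simpa using hc 1
  have hθ : Continuous fun t => angle (c t).1 := by
    refine (continuous_const.sub ?_).div_const 2
    exact continuous_iff_continuousAt.2 fun t =>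
      ContinuousAt.comp (f := fun t => -g (c t).1) (Complex.continuousAt_arg (hc t))
        (continuous_g.comp (continuous_subtype_val.comp c.continuous)).neg.continuousAt
  have hs : Continuous fun t => fiberCoord (c t).1 := by
    refine ((Continuous.phase (by fun_prop) fun t => (ne_zero_of_neg_g_mem (hc t)).2).mul
      (Circle.exp.continuous.comp hθ.neg)).mul (Continuous.inv ?_)
    exact Continuous.phase (by fun_prop) fun t => (ne_zero_of_neg_g_mem (hc t)).1
  obtain ⟨τ, hτ, hτc⟩ := Circle.exists_lift
    (⟨⟨fun t => fiberCoord (c t).1, hs⟩, by simp, by simp⟩ : Path (fiberCoord x) (fiberCoord y))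
  replace hτc : ∀ t, fiberCoord (c t).1 = Circle.exp (τ t) := hτc
  have h0 : Circle.exp (τ 0) = Circle.exp (Complex.arg (fiberCoord x.1)) := by
    rw [← hτc, Circle.exp_arg, c.source]
  have h1 : Circle.exp (τ 1) = Circle.exp (Complex.arg (fiberCoord y.1)) := by
    rw [← hτc, Circle.exp_arg, c.target]
  obtain ⟨i, hi⟩ := Circle.exp_eq_exp.1 h0
  obtain ⟨j, hj⟩ := Circle.exp_eq_exp.1 h1
  have hpt := fun t => point_eq (hc t) (hτc t).symm
  refine ⟨j - i, winding_outer_eq c _ hx hy (τ := fun t => 3 * τ t + angle (c t).1)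
    (by fun_prop) (fun t => ?_) ?_, winding_inner_eq c _ hx hy (τ := fun t => 2 * τ t)
    (by fun_prop) (fun t => ?_) ?_⟩
  · conv_lhs => rw [← hpt t]
    exact phase_point_snd (norm_pos_iff.2 (ne_zero_of_neg_g_mem (hc t)).2) _ _ _
  · simp only [c.source, c.target]
    rw [hi, hj]
    push_cast
    ring
  · conv_lhs => rw [← hpt t]
    exact phase_point_fst (norm_pos_iff.2 (ne_zero_of_neg_g_mem (hc t)).1) _ _ _
  · rw [hi, hj]
    push_cast
    ring

/-- Van Kampen for `outer` and `inner`: the circle of w gives x, that of z gives y, and the common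
fibre gives x³ = y². -/
theorem exists_pathRep : ∃ F : PathRep compl TrefoilGroup, F.IsFaithful ∧ F.IsFull ∧
    (∀ {x y : compl} (γ : Path x y) (h : ∀ t, γ t ∈ outer'), F.val γ =
      TrefoilGroup.x ^ PathRep.winding phaseOuter gaugeOuter exp_gaugeOuter
        (γ.codRestrict outer' h)) ∧
    (∀ {x y : compl} (γ : Path x y) (h : ∀ t, γ t ∈ inner'), F.val γ =
      TrefoilGroup.y ^ PathRep.winding phaseInner gaugeInner exp_gaugeInner
        (γ.codRestrict inner' h)) := by
  -- The base point lies in the overlap, as g(1, i) = -1.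
  have hp₀ : -g (1, Complex.I) ∈ Complex.slitPlane := by simp [g]
  let x₀ : compl := ⟨(1, Complex.I), mem_compl_of hp₀⟩
  refine PathRep.exists_of_circles (isOpen_outer.preimage continuous_subtype_val)
    (isOpen_inner.preimage continuous_subtype_val) (fun x => x.2) isCircleEquiv_phaseOuter
    isCircleEquiv_phaseInner exp_gaugeOuter exp_gaugeInner (x₀ := x₀) (m := 3) (n := 2)
    (mem_outer_and_inner.2 hp₀).1 (mem_outer_and_inner.2 hp₀).2 ?_ ?_ ?_
    (by exact_mod_cast TrefoilGroup.x_pow_three) TrefoilGroup.closure_x_y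
    fun s t h => TrefoilGroup.exists_hom (by exact_mod_cast h)
  · exact fun x hU hV => exists_section hp₀ (mem_outer_and_inner.1 ⟨hU, hV⟩)
  · exact exists_fiber hp₀
  · exact fun c h h' => exists_winding_eq c h h'

end TrefoilCone

/-! ### The peripheral structure of the trefoil -/

namespace TrefoilCone

/-- A neighbourhood of the cone over the trefoil. -/
def nbhd : Set (ℂ × ℂ) := {p | g p ∈ Complex.slitPlane}

theorem ne_zero_of_mem_nbhd {p : ℂ × ℂ} (h : p ∈ nbhd) : p.1 ≠ 0 ∧ p.2 ≠ 0 := by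
  constructor <;> intro h0 <;> simp [nbhd, g, h0] at h

/-- The angle `θ ∈ (-π/2, π/2)` with `g = |g| exp (-2 θ i)`. -/
def skew (p : ℂ × ℂ) : ℝ := -Complex.arg (g p) / 2

theorem skew_mem {p : ℂ × ℂ} (h : p ∈ nbhd) : skew p ∈ Ioo (-(Real.pi / 2)) (Real.pi / 2) := by
  have h1 := Complex.arg_le_pi (g p)
  have h2 := Complex.neg_pi_lt_arg (g p)
  have h3 := (Complex.mem_slitPlane_iff_arg.1 h).1
  have h4 := lt_of_le_of_ne h1 h3
  constructor <;> unfold skew <;> linarith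

/-- The longitudinal coordinate near the cone over the trefoil. -/
def longCoord (p : ℂ × ℂ) : Circle := phase p.2 * Circle.exp (-skew p) * (phase p.1)⁻¹

/-- The transverse coordinate near the cone over the trefoil. -/
def normalCoord (p : ℂ × ℂ) : ℂ := ⟨Real.log ‖p.1‖ - Real.log ‖p.2‖, -Real.tan (skew p)⟩

theorem phase_g_skew (p : ℂ × ℂ) : phase (g p) = Circle.exp (-2 * skew p) := by
  rw [phase, skew]
  congr 1
  ring

theorem continuousAt_skew {p : ℂ × ℂ} (h : p ∈ nbhd) : ContinuousAt skew p :=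
  (((Complex.continuousAt_arg h).comp continuous_g.continuousAt).neg).div_const 2

theorem continuousAt_longCoord {p : ℂ × ℂ} (h : p ∈ nbhd) : ContinuousAt longCoord p := by
  obtain ⟨h1, h2⟩ := ne_zero_of_mem_nbhd h
  refine (ContinuousAt.mul ?_ ?_).mul (ContinuousAt.inv ?_)
  · exact (continuousAt_phase h2).comp continuousAt_snd
  · exact Circle.exp.continuous.continuousAt.comp (continuousAt_skew h).neg
  · exact (continuousAt_phase h1).comp continuousAt_fst

theorem cos_skew_pos {p : ℂ × ℂ} (h : p ∈ nbhd) : 0 < Real.cos (skew p) :=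
  Real.cos_pos_of_mem_Ioo (skew_mem h)

theorem continuousAt_normalCoord {p : ℂ × ℂ} (h : p ∈ nbhd) : ContinuousAt normalCoord p := by
  obtain ⟨h1, h2⟩ := ne_zero_of_mem_nbhd h
  have e : normalCoord = fun p => ((Real.log ‖p.1‖ - Real.log ‖p.2‖ : ℝ) : ℂ) +
      ((-Real.tan (skew p) : ℝ) : ℂ) * Complex.I := by
    ext p
    exact Complex.mk_eq_add_mul_I _ _
  rw [e]
  refine ContinuousAt.add (Complex.continuous_ofReal.continuousAt.comp (ContinuousAt.sub ?_ ?_))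
    (ContinuousAt.mul (Complex.continuous_ofReal.continuousAt.comp (ContinuousAt.neg ?_))
      continuousAt_const)
  · exact continuousAt_fst.norm.log (norm_ne_zero_iff.2 h1)
  · exact continuousAt_snd.norm.log (norm_ne_zero_iff.2 h2)
  · exact (Real.continuousAt_tan.2 (cos_skew_pos h).ne').comp (continuousAt_skew h)

theorem normalCoord_eq_zero_iff {p : ℂ × ℂ} (h : p ∈ nbhd) :
    normalCoord p = 0 ↔ ‖p.1‖ = ‖p.2‖ ∧ skew p = 0 := by
  obtain ⟨h1, h2⟩ := ne_zero_of_mem_nbhd h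
  rw [Complex.ext_iff]
  refine and_congr ?_ ?_
  · simp only [normalCoord, Complex.zero_re, sub_eq_zero]
    exact ⟨fun h => Real.log_injOn_pos (norm_pos_iff.2 h1) (norm_pos_iff.2 h2) h, fun h => by rw [h]⟩
  · simp only [normalCoord, Complex.zero_im, neg_eq_zero]
    refine ⟨fun h0 => ?_, fun h0 => by rw [h0, Real.tan_zero]⟩
    exact Real.injOn_tan (skew_mem h) ⟨by linarith [Real.pi_pos], by linarith [Real.pi_pos]⟩
      (h0.trans Real.tan_zero.symm)

theorem neg_g_mem_of_skew_ne {p : ℂ × ℂ} (h : p ∈ nbhd) (h0 : skew p ≠ 0) :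
    -g p ∈ Complex.slitPlane := by
  rw [Complex.mem_slitPlane_iff]
  right
  intro him
  have him' : (g p).im = 0 := by simpa using him
  rcases (Complex.mem_slitPlane_iff.1 h) with hr | hr
  · exact h0 (by simp [skew, Complex.arg_eq_zero_iff.2 ⟨hr.le, him'⟩])
  · exact hr him'

/-- The transverse coordinate vanishes exactly on |z| = |w| with g > 0, which is the cone. -/
theorem mem_compl_iff_normalCoord_ne {p : ℂ × ℂ} (h : p ∈ nbhd) :
    p ∈ compl ↔ normalCoord p ≠ 0 := by
  obtain ⟨h1, h2⟩ := ne_zero_of_mem_nbhd h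
  rw [Ne, normalCoord_eq_zero_iff h]
  constructor
  · rintro hp ⟨h3, h4⟩
    have h5 : -g p ∉ Complex.slitPlane := by
      have h6 : Complex.arg (g p) = 0 := by
        rw [skew] at h4
        linarith
      obtain ⟨h7, h8⟩ := Complex.arg_eq_zero_iff.1 h6
      rw [Complex.mem_slitPlane_iff]
      simp [h7, h8]
    rcases hp with ⟨-, h | h⟩ | ⟨-, h | h⟩
    exacts [h5 h, h.ne h3, h5 h, h.ne' h3]
  · intro hp
    by_cases h3 : skew p = 0
    · have h4 : ‖p.1‖ ≠ ‖p.2‖ := fun h4 => hp ⟨h4, h3⟩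
      rcases lt_or_gt_of_ne h4 with h5 | h5
      · exact .inl ⟨h2, .inr h5⟩
      · exact .inr ⟨h1, .inr h5⟩
    · exact mem_compl_of (neg_g_mem_of_skew_ne h h3)

theorem arg_exp {t : ℝ} (h : t ∈ Ioc (-Real.pi) Real.pi) :
    Complex.arg (Circle.exp t) = t := by
  rw [Circle.coe_exp, Complex.arg_exp_mul_I, (toIocMod_eq_self _).2]
  rwa [show -Real.pi + 2 * Real.pi = Real.pi by ring]

theorem point_mem_nbhd {r₁ r₂ τ θ : ℝ} (h₁ : 0 < r₁) (h₂ : 0 < r₂)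
    (hθ : θ ∈ Ioo (-(Real.pi / 2)) (Real.pi / 2)) :
    point r₁ r₂ τ θ ∈ nbhd ∧ skew (point r₁ r₂ τ θ) = θ := by
  have h : Complex.arg (g (point r₁ r₂ τ θ)) = -2 * θ := by
    rw [g_point, Complex.arg_real_mul _ (by positivity), arg_exp]
    constructor <;> linarith [hθ.1, hθ.2]
  refine ⟨Complex.mem_slitPlane_iff_arg.2 ⟨?_, ?_⟩, ?_⟩
  · rw [h]
    linarith [hθ.1]
  · rw [g_point]
    exact mul_ne_zero (by exact_mod_cast (by positivity)) (Circle.coe_ne_zero _)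
  · rw [skew, h]
    ring

theorem norm_point_fst {r₁ : ℝ} (h₁ : 0 < r₁) (r₂ τ θ : ℝ) : ‖(point r₁ r₂ τ θ).1‖ = r₁ := by
  rw [point, norm_mul, Circle.norm_coe, mul_one, Complex.norm_real, Real.norm_of_nonneg h₁.le]

theorem norm_point_snd {r₂ : ℝ} (h₂ : 0 < r₂) (r₁ τ θ : ℝ) : ‖(point r₁ r₂ τ θ).2‖ = r₂ := by
  rw [point, norm_mul, Circle.norm_coe, mul_one, Complex.norm_real, Real.norm_of_nonneg h₂.le]

/-- The universal covering of the complement in the neighbourhood, where the transverse coordinate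
is `e^{a + ib}`. -/
def cover (v : ℝ × ℝ × ℝ × ℝ) : ℂ × ℂ :=
  point (Real.exp (v.1 + (Complex.exp ⟨v.2.2.1, v.2.2.2⟩).re)) (Real.exp v.1) v.2.1
    (-Real.arctan (Complex.exp ⟨v.2.2.1, v.2.2.2⟩).im)

theorem neg_arctan_mem (x : ℝ) : -Real.arctan x ∈ Ioo (-(Real.pi / 2)) (Real.pi / 2) := by
  have h := Real.arctan_mem_Ioo x
  constructor <;> linarith [h.1, h.2]

theorem cover_mem_nbhd (v : ℝ × ℝ × ℝ × ℝ) : cover v ∈ nbhd :=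
  (point_mem_nbhd (Real.exp_pos _) (Real.exp_pos _) (neg_arctan_mem _)).1

theorem skew_cover (v : ℝ × ℝ × ℝ × ℝ) :
    skew (cover v) = -Real.arctan (Complex.exp ⟨v.2.2.1, v.2.2.2⟩).im :=
  (point_mem_nbhd (Real.exp_pos _) (Real.exp_pos _) (neg_arctan_mem _)).2

theorem normalCoord_cover (v : ℝ × ℝ × ℝ × ℝ) :
    normalCoord (cover v) = Complex.exp ⟨v.2.2.1, v.2.2.2⟩ := by
  apply Complex.ext
  · have h1 : ‖(cover v).1‖ = _ := norm_point_fst (Real.exp_pos _) _ _ _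
    have h2 : ‖(cover v).2‖ = _ := norm_point_snd (Real.exp_pos _) _ _ _
    simp only [normalCoord]
    rw [h1, h2, Real.log_exp, Real.log_exp]
    ring
  · simp [normalCoord, skew_cover, Real.tan_neg, Real.tan_arctan]

theorem cover_mem_compl (v : ℝ × ℝ × ℝ × ℝ) : cover v ∈ compl :=
  (mem_compl_iff_normalCoord_ne (cover_mem_nbhd v)).2
    (by rw [normalCoord_cover]; exact Complex.exp_ne_zero _)

theorem continuous_cover : Continuous cover := by
  have h : Continuous fun v : ℝ × ℝ × ℝ × ℝ => Complex.exp ⟨v.2.2.1, v.2.2.2⟩ := by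
    simp only [Complex.mk_eq_add_mul_I]
    fun_prop
  exact continuous_point
    (Real.continuous_exp.comp (continuous_fst.add (Complex.continuous_re.comp h)))
    (by fun_prop) (by fun_prop)
    (Real.continuous_arctan.comp (Complex.continuous_im.comp h)).neg

/-- The covering, as a map to the complement. -/
def coverMap : C(ℝ × ℝ × ℝ × ℝ, compl) :=
  ⟨fun v => ⟨cover v, cover_mem_compl v⟩, continuous_cover.subtype_mk _⟩

/-- An explicit inverse of the covering, up to the two angles τ and b. Lifting a path therefore only
requires continuous angles of the longitudinal and the transverse coordinate. -/
theorem cover_eq {p : ℂ × ℂ} (h : p ∈ nbhd) (h' : p ∈ compl) {τ b : ℝ}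
    (hτ : Circle.exp τ = longCoord p) (hb : Circle.exp b = phase (normalCoord p)) :
    cover (Real.log ‖p.2‖, τ, Real.log ‖normalCoord p‖, b) = p := by
  obtain ⟨h1, h2⟩ := ne_zero_of_mem_nbhd h
  have hk := (mem_compl_iff_normalCoord_ne h).1 h'
  have e : Complex.exp ⟨Real.log ‖normalCoord p‖, b⟩ = normalCoord p := by
    rw [Complex.mk_eq_add_mul_I, Complex.exp_add, ← Circle.coe_exp, hb, ← Complex.ofReal_exp,
      Real.exp_log (norm_pos_iff.2 hk), norm_mul_phase]
  have h3 : -Real.arctan (normalCoord p).im = skew p := by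
    have := skew_mem h
    rw [show (normalCoord p).im = -Real.tan (skew p) from rfl, Real.arctan_neg, neg_neg,
      Real.arctan_tan this.1 this.2]
  have h4 : Real.log ‖p.2‖ + (normalCoord p).re = Real.log ‖p.1‖ := by
    rw [show (normalCoord p).re = Real.log ‖p.1‖ - Real.log ‖p.2‖ from rfl]
    ring
  simp only [cover, e, h3, h4]
  rw [Real.exp_log (norm_pos_iff.2 h1), Real.exp_log (norm_pos_iff.2 h2)]
  exact point_eq_of h1 h2 (phase_g_skew p) hτ

/-- The deck transformations of the covering. -/
def deck (i j : ℤ) : ℝ × ℝ × ℝ × ℝ := (0, i * (2 * Real.pi), 0, j * (2 * Real.pi))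

theorem cover_add_deck (v : ℝ × ℝ × ℝ × ℝ) (i j : ℤ) : cover (v + deck i j) = cover v := by
  have e : Complex.exp ⟨v.2.2.1, v.2.2.2 + j * (2 * Real.pi)⟩ =
      Complex.exp ⟨v.2.2.1, v.2.2.2⟩ := by
    rw [Complex.exp_eq_exp_iff_exists_int]
    refine ⟨j, ?_⟩
    simp only [Complex.mk_eq_add_mul_I]
    push_cast
    ring
  have h1 : Circle.exp (2 * (v.2.1 + i * (2 * Real.pi))) = Circle.exp (2 * v.2.1) :=
    Circle.exp_eq_exp.2 ⟨2 * i, by push_cast; ring⟩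
  have h2 : ∀ θ, Circle.exp (3 * (v.2.1 + i * (2 * Real.pi)) + θ) = Circle.exp (3 * v.2.1 + θ) :=
    fun θ => Circle.exp_eq_exp.2 ⟨3 * i, by push_cast; ring⟩
  simp only [cover, deck, Prod.fst_add, Prod.snd_add, add_zero, e, point, h1, h2]

/-- The segment between two points. -/
def segmentPath {E : Type*} [AddCommGroup E] [Module ℝ E] [TopologicalSpace E]
    [IsTopologicalAddGroup E] [ContinuousSMul ℝ E] (v w : E) : Path v w where
  toFun t := v + (t : ℝ) • (w - v)
  continuous_toFun := by fun_prop
  source' := by simp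
  target' := by simp

theorem segmentPath_apply {E : Type*} [AddCommGroup E] [Module ℝ E] [TopologicalSpace E]
    [IsTopologicalAddGroup E] [ContinuousSMul ℝ E] (v w : E) (t : I) :
    segmentPath v w t = v + (t : ℝ) • (w - v) := rfl

/-! ### Representations restricted to the punctured neighbourhood of the cone -/

section Values

variable {G : Type*} [Group G] (F : PathRep compl G)

/-- The value of a representation on the image of the paths between two points of the covering. -/
def coverVal (v w : ℝ × ℝ × ℝ × ℝ) : G := (F.comap coverMap).val (segmentPath v w)

/-- ℝ⁴ is simply connected, so the value depends on the end points only. -/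
theorem comap_coverMap_val {v w : ℝ × ℝ × ℝ × ℝ} (δ : Path v w) :
    (F.comap coverMap).val δ = coverVal F v w :=
  (F.comap coverMap).map_homotopic (SimplyConnectedSpace.paths_homotopic _ _)

theorem coverVal_mul (u v w : ℝ × ℝ × ℝ × ℝ) :
    coverVal F v w * coverVal F u v = coverVal F u w := by
  rw [coverVal, coverVal, ← PathRep.map_trans, comap_coverMap_val]

/-- Translates under the deck group have the same image. -/
theorem coverVal_deck (v w : ℝ × ℝ × ℝ × ℝ) (i j : ℤ) :
    coverVal F (v + deck i j) (w + deck i j) = coverVal F v w := by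
  refine F.congr_path _ _ fun t => Subtype.ext ?_
  have h : v + deck i j + (t : ℝ) • (w + deck i j - (v + deck i j)) =
      v + (t : ℝ) • (w - v) + deck i j := by
    rw [add_sub_add_right_eq_sub]
    abel
  change cover (v + deck i j + (t : ℝ) • (w + deck i j - (v + deck i j))) =
    cover (v + (t : ℝ) • (w - v))
  rw [h, cover_add_deck]

theorem deck_add (i j i' j' : ℤ) : deck (i + i') (j + j') = deck i j + deck i' j' := by
  simp only [deck, Prod.mk_add_mk]
  push_cast
  ring_nf

theorem coverVal_deck_add (v : ℝ × ℝ × ℝ × ℝ) (i j i' j' : ℤ) :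
    coverVal F v (v + deck (i + i') (j + j')) =
      coverVal F v (v + deck i j) * coverVal F v (v + deck i' j') := by
  rw [← coverVal_mul F v (v + deck i' j'), deck_add, add_comm (deck i j), ← add_assoc,
    add_right_comm v, coverVal_deck]

/-- Deck invariance makes the value additive in the translation, so each of the two directions gives
a homomorphism from ℤ. -/
theorem coverVal_deck_zpow (v : ℝ × ℝ × ℝ × ℝ) (i j : ℤ) :
    coverVal F v (v + deck i j) =
      coverVal F v (v + deck 1 0) ^ i * coverVal F v (v + deck 0 1) ^ j := by
  have h0 : deck 0 0 = 0 := by simp [deck]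
  have hself : coverVal F v v = 1 := by
    have := coverVal_mul F v v v
    simpa using this
  let f : Multiplicative ℤ →* G :=
    { toFun := fun n => coverVal F v (v + deck n.toAdd 0)
      map_one' := by simp [h0, hself]
      map_mul' := fun m n => by simpa using coverVal_deck_add F v m.toAdd 0 n.toAdd 0 }
  let f' : Multiplicative ℤ →* G :=
    { toFun := fun n => coverVal F v (v + deck 0 n.toAdd)
      map_one' := by simp [h0, hself]
      map_mul' := fun m n => by simpa using coverVal_deck_add F v 0 m.toAdd 0 n.toAdd }
  have h1 : ∀ n : ℤ, coverVal F v (v + deck n 0) = coverVal F v (v + deck 1 0) ^ n := fun n => by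
    have := map_zpow f (Multiplicative.ofAdd 1) n
    rwa [← ofAdd_zsmul, smul_eq_mul, mul_one] at this
  have h2 : ∀ n : ℤ, coverVal F v (v + deck 0 n) = coverVal F v (v + deck 0 1) ^ n := fun n => by
    have := map_zpow f' (Multiplicative.ofAdd 1) n
    rwa [← ofAdd_zsmul, smul_eq_mul, mul_one] at this
  have := coverVal_deck_add F v i 0 0 j
  rwa [add_zero, zero_add, h1, h2] at this

/-- The values of a representation on the loops at a point near the cone over the trefoil. -/
theorem exists_conj_val {p : compl} (hp : p.1 ∈ nbhd) (v₀ : ℝ × ℝ × ℝ × ℝ) :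
    ∃ q : G, ∀ (γ : Path p p) (τ b : I → ℝ), (∀ t, (γ t).1 ∈ nbhd) → Continuous τ → Continuous b →
      (∀ t, Circle.exp (τ t) = longCoord (γ t).1) →
      (∀ t, Circle.exp (b t) = phase (normalCoord (γ t).1)) → ∀ i j : ℤ,
      τ 1 - τ 0 = i * (2 * Real.pi) → b 1 - b 0 = j * (2 * Real.pi) →
      F.val γ = q * (coverVal F v₀ (v₀ + deck 1 0) ^ i * coverVal F v₀ (v₀ + deck 0 1) ^ j) *
        q⁻¹ := by
  obtain ⟨τ₀, hτ₀⟩ := Circle.exp_surjective (longCoord p.1)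
  obtain ⟨b₀, hb₀⟩ := Circle.exp_surjective (phase (normalCoord p.1))
  let v : ℝ × ℝ × ℝ × ℝ := (Real.log ‖p.1.2‖, τ₀, Real.log ‖normalCoord p.1‖, b₀)
  have hv : cover v = p.1 := cover_eq hp p.2 hτ₀ hb₀
  -- The conjugating element is the value of a path from the reference point `v₀` to a lift of p. It
  -- does not depend on the loop, so meridian and longitude are conjugated simultaneously.
  refine ⟨coverVal F v₀ v, fun γ τ b hγ hτ hb hτγ hbγ i j hi hj => ?_⟩
  have hnc : Continuous fun t => normalCoord (γ t).1 :=
    continuous_iff_continuousAt.2 fun t => ContinuousAt.comp (f := fun t => (γ t).1)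
      (continuousAt_normalCoord (hγ t)) (by fun_prop)
  have hne : ∀ t, normalCoord (γ t).1 ≠ 0 := fun t =>
    (mem_compl_iff_normalCoord_ne (hγ t)).1 (γ t).2
  have shift : ∀ {f : I → ℝ} {x : ℝ} {u : I → Circle}, Circle.exp x = u 0 →
      (∀ t, Circle.exp (f t) = u t) → ∀ t, Circle.exp (f t + (x - f 0)) = u t := by
    intro f x u hx hf t
    rw [Circle.exp_add, Circle.exp_sub, hf, hf, hx, div_self', mul_one]
  -- The lift of the loop, with both angles shifted so that it starts at `v`.
  let δ : Path v (v + deck i j) :=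
    { toFun := fun t => (Real.log ‖(γ t).1.2‖, τ t + (τ₀ - τ 0), Real.log ‖normalCoord (γ t).1‖,
        b t + (b₀ - b 0))
      continuous_toFun := by
        refine (Continuous.log (by fun_prop) fun t => ?_).prodMk ((by fun_prop : Continuous
          fun t => τ t + (τ₀ - τ 0)).prodMk ((hnc.norm.log fun t => ?_).prodMk (by fun_prop)))
        · exact norm_ne_zero_iff.2 (ne_zero_of_mem_nbhd (hγ t)).2
        · exact norm_ne_zero_iff.2 (hne t)
      source' := by simp [v]
      target' := by
        have h1 : τ 1 + (τ₀ - τ 0) = τ₀ + i * (2 * Real.pi) := by linarith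
        have h2 : b 1 + (b₀ - b 0) = b₀ + j * (2 * Real.pi) := by linarith
        rw [h1, h2]
        simp [v, deck] }
  have e : F.val γ = coverVal F v (v + deck i j) := by
    rw [← comap_coverMap_val F δ]
    refine F.congr_path _ _ fun t => Subtype.ext (cover_eq (hγ t) (γ t).2 ?_ ?_).symm
    · exact shift (u := fun t => longCoord (γ t).1) (by simp [hτ₀]) hτγ t
    · exact shift (u := fun t => phase (normalCoord (γ t).1)) (by simp [hb₀]) hbγ t
  rw [e, ← coverVal_deck_zpow, eq_mul_inv_iff_mul_eq, coverVal_mul, ← coverVal_deck F v₀ v i j,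
    coverVal_mul]

end Values

/-- The base point used to name the generators of the peripheral subgroup. -/
def basePt : ℝ × ℝ × ℝ × ℝ := (0, 0, 0, Real.pi / 2)

theorem exp_im (b : ℝ) : Complex.exp ⟨0, b⟩ = ⟨Real.cos b, Real.sin b⟩ := by
  rw [Complex.mk_eq_add_mul_I, Complex.ofReal_zero, zero_add]
  apply Complex.ext
  · exact Complex.exp_ofReal_mul_I_re b
  · exact Complex.exp_ofReal_mul_I_im b

theorem cover_unit (τ b : ℝ) : cover (0, τ, 0, b) =
    point (Real.exp (Real.cos b)) 1 τ (-Real.arctan (Real.sin b)) := by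
  simp [cover, exp_im]

theorem angle_point {r₁ r₂ τ θ : ℝ} (h₁ : 0 < r₁) (h₂ : 0 < r₂) (hθ : θ ∈ Ioo 0 Real.pi) :
    angle (point r₁ r₂ τ θ) = θ := by
  have h : -g (point r₁ r₂ τ θ) = (r₁ ^ 3 * r₂ ^ 2 : ℝ) * (Circle.exp (Real.pi - 2 * θ) : ℂ) := by
    rw [g_point, sub_eq_add_neg, Circle.exp_add, Circle.coe_mul, Circle.coe_exp Real.pi,
      Complex.exp_pi_mul_I, neg_mul]
    ring
  rw [angle, h, Complex.arg_real_mul _ (by positivity), arg_exp]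
  · ring
  · constructor <;> linarith [hθ.1, hθ.2]

theorem fiberCoord_point {r₁ r₂ τ θ : ℝ} (h₁ : 0 < r₁) (h₂ : 0 < r₂) (hθ : θ ∈ Ioo 0 Real.pi) :
    fiberCoord (point r₁ r₂ τ θ) = Circle.exp τ := by
  rw [fiberCoord, angle_point h₁ h₂ hθ, phase_point_fst h₁, phase_point_snd h₂, ← Circle.exp_neg,
    ← Circle.exp_add, ← Circle.exp_add]
  congr 1
  ring

/-- The point of the base fibre where the transverse coordinate is `i`. -/
theorem cover_basePt : cover basePt = point 1 1 Real.pi (3 * Real.pi / 4) := by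
  rw [basePt, cover_unit, Real.cos_pi_div_two, Real.sin_pi_div_two, Real.arctan_one, Real.exp_zero,
    point, point]
  refine Prod.ext ?_ ?_
  · simp
  -- The two descriptions of the point use values of θ that differ by π, and then the fibre
  -- coordinates differ by a half-turn.
  · have h : Circle.exp (3 * 0 + -(Real.pi / 4)) = Circle.exp (3 * Real.pi + 3 * Real.pi / 4) :=
      Circle.exp_eq_exp.2 ⟨-2, by push_cast; ring⟩
    simp only [h]

theorem cos_three_pi_div_two : Real.cos (3 * Real.pi / 2) = 0 := by
  rw [show 3 * Real.pi / 2 = Real.pi / 2 + Real.pi by ring, Real.cos_add_pi, Real.cos_pi_div_two,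
    neg_zero]

theorem sin_three_pi_div_two : Real.sin (3 * Real.pi / 2) = -1 := by
  rw [show 3 * Real.pi / 2 = Real.pi / 2 + Real.pi by ring, Real.sin_add_pi, Real.sin_pi_div_two]

theorem cover_opposite : cover (0, 0, 0, 3 * Real.pi / 2) = point 1 1 0 (Real.pi / 4) := by
  rw [cover_unit, cos_three_pi_div_two, sin_three_pi_div_two, Real.arctan_neg, Real.arctan_one,
    Real.exp_zero, neg_neg]

theorem neg_g_cover_unit_mem (τ : ℝ) {b : ℝ} (hb : Real.sin b ≠ 0) :
    -g (cover (0, τ, 0, b)) ∈ Complex.slitPlane := by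
  refine neg_g_mem_of_skew_ne (cover_mem_nbhd _) ?_
  rw [skew_cover, exp_im]
  simpa using hb

/-- Here |z| = exp (cos b) ≤ 1 = |w|. Only at sin b = 0 does the arc meet g > 0, and there cos b =
-1 makes the inequality strict. -/
theorem cover_unit_mem_outer (τ : ℝ) {b : ℝ} (hb : Real.cos b ≤ 0) :
    cover (0, τ, 0, b) ∈ outer := by
  by_cases hs : Real.sin b = 0
  · refine ⟨(ne_zero_of_mem_nbhd (cover_mem_nbhd _)).2, .inr ?_⟩
    rw [cover_unit, norm_point_fst (Real.exp_pos _), norm_point_snd one_pos, Real.exp_lt_one_iff]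
    refine lt_of_le_of_ne hb fun hc => ?_
    have := Real.sin_sq_add_cos_sq b
    rw [hs, hc] at this
    norm_num at this
  · exact (mem_outer_and_inner.2 (neg_g_cover_unit_mem τ hs)).1

theorem cover_unit_mem_inner (τ : ℝ) {b : ℝ} (hb : 0 ≤ Real.cos b) :
    cover (0, τ, 0, b) ∈ inner := by
  by_cases hs : Real.sin b = 0
  · refine ⟨(ne_zero_of_mem_nbhd (cover_mem_nbhd _)).1, .inr ?_⟩
    rw [cover_unit, norm_point_fst (Real.exp_pos _), norm_point_snd one_pos, Real.one_lt_exp_iff]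
    refine lt_of_le_of_ne hb fun hc => ?_
    have := Real.sin_sq_add_cos_sq b
    rw [hs, ← hc] at this
    norm_num at this
  · exact (mem_outer_and_inner.2 (neg_g_cover_unit_mem τ hs)).2

theorem coverVal_eq_of_outer {F : PathRep compl TrefoilGroup}
    (hF : ∀ {x y : compl} (γ : Path x y) (h : ∀ t, γ t ∈ outer'), F.val γ =
      TrefoilGroup.x ^ PathRep.winding phaseOuter gaugeOuter exp_gaugeOuter
        (γ.codRestrict outer' h)) {v w : ℝ × ℝ × ℝ × ℝ}
    (h : ∀ t, cover (segmentPath v w t) ∈ outer)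
    (hv : -g (cover v) ∈ Complex.slitPlane) (hw : -g (cover w) ∈ Complex.slitPlane) {τ : I → ℝ}
    (hτ : Continuous τ) (hγ : ∀ t, phase (cover (segmentPath v w t)).2 = Circle.exp (τ t)) {n : ℤ}
    (hn : τ 1 - τ 0 = n * (2 * Real.pi) +
      ((3 * Complex.arg (fiberCoord (cover w)) + angle (cover w)) -
        (3 * Complex.arg (fiberCoord (cover v)) + angle (cover v)))) :
    coverVal F v w = TrefoilGroup.x ^ n := by
  have := winding_outer_eq (x := coverMap v) (y := coverMap w)
    ((segmentPath v w).map coverMap.continuous) h hv hw hτ hγ hn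
  rw [coverVal, PathRep.comap_apply, hF _ h, this]

theorem coverVal_eq_of_inner {F : PathRep compl TrefoilGroup}
    (hF : ∀ {x y : compl} (γ : Path x y) (h : ∀ t, γ t ∈ inner'), F.val γ =
      TrefoilGroup.y ^ PathRep.winding phaseInner gaugeInner exp_gaugeInner
        (γ.codRestrict inner' h)) {v w : ℝ × ℝ × ℝ × ℝ}
    (h : ∀ t, cover (segmentPath v w t) ∈ inner)
    (hv : -g (cover v) ∈ Complex.slitPlane) (hw : -g (cover w) ∈ Complex.slitPlane) {τ : I → ℝ}
    (hτ : Continuous τ) (hγ : ∀ t, phase (cover (segmentPath v w t)).1 = Circle.exp (τ t)) {n : ℤ}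
    (hn : τ 1 - τ 0 = n * (2 * Real.pi) + (2 * Complex.arg (fiberCoord (cover w)) -
        2 * Complex.arg (fiberCoord (cover v)))) :
    coverVal F v w = TrefoilGroup.y ^ n := by
  have := winding_inner_eq (x := coverMap v) (y := coverMap w)
    ((segmentPath v w).map coverMap.continuous) h hv hw hτ hγ hn
  rw [coverVal, PathRep.comap_apply, hF _ h, this]

/-- The fibre winds three times round the circle of w, so its value is x³. The meridian consists of
an arc in `outer` of winding number 2 and one in `inner` of winding number -1. Its value is y⁻¹x²,
which is a. -/
theorem exists_pathRep_peripheral : ∃ F : PathRep compl TrefoilGroup, F.IsFaithful ∧ F.IsFull ∧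
    coverVal F basePt (basePt + deck 1 0) = TrefoilGroup.fiber ∧
    coverVal F basePt (basePt + deck 0 1) = TrefoilGroup.a := by
  obtain ⟨F, hF, hF', hU, hV⟩ := exists_pathRep
  have hpi := Real.pi_pos
  have m0 : (3 * Real.pi / 4) ∈ Ioo 0 Real.pi := ⟨by positivity, by linarith⟩
  have m1 : (Real.pi / 4) ∈ Ioo 0 Real.pi := ⟨by positivity, by linarith⟩
  have a0 : angle (cover basePt) = 3 * Real.pi / 4 := by
    rw [cover_basePt, angle_point one_pos one_pos m0]
  have f0 : Complex.arg (fiberCoord (cover basePt)) = Real.pi := by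
    rw [cover_basePt, fiberCoord_point one_pos one_pos m0, arg_exp ⟨by linarith, le_rfl⟩]
  have g0 : -g (cover basePt) ∈ Complex.slitPlane := by
    rw [cover_basePt]
    exact neg_g_point_mem one_pos one_pos m0
  have a1 : angle (cover (0, 0, 0, 3 * Real.pi / 2)) = Real.pi / 4 := by
    rw [cover_opposite, angle_point one_pos one_pos m1]
  have f1 : Complex.arg (fiberCoord (cover (0, 0, 0, 3 * Real.pi / 2))) = 0 := by
    rw [cover_opposite, fiberCoord_point one_pos one_pos m1, arg_exp ⟨by linarith, hpi.le⟩]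
  have g1 : -g (cover (0, 0, 0, 3 * Real.pi / 2)) ∈ Complex.slitPlane := by
    rw [cover_opposite]
    exact neg_g_point_mem one_pos one_pos m1
  refine ⟨F, hF, hF', ?_, ?_⟩
  · have e : ∀ t : I, segmentPath basePt (basePt + deck 1 0) t =
        (0, (t : ℝ) * (2 * Real.pi), 0, Real.pi / 2) := fun t => by
      rw [segmentPath_apply]
      simp [basePt, deck]
    have hs : Real.sin (Real.pi / 2) ≠ 0 := by simp
    refine (coverVal_eq_of_outer hU (n := 3) (fun t => ?mem) g0 (by rwa [cover_add_deck])
      (τ := fun t => 3 * ((t : ℝ) * (2 * Real.pi)) + -Real.arctan (Real.sin (Real.pi / 2)))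
      (by fun_prop) (fun t => ?ph) ?val).trans ?fin
    case fin => rfl
    case mem =>
      rw [e]
      exact (mem_outer_and_inner.2 (neg_g_cover_unit_mem _ hs)).1
    case ph => rw [e, cover_unit, phase_point_snd one_pos]
    case val =>
      rw [cover_add_deck]
      simp
  -- The meridian is cut at b = 3π/2. The chosen fibre coordinate has argument π at the start and 0
  -- at the cut, whence the winding numbers 2 and -1.
  · rw [← coverVal_mul F basePt (0, 0, 0, 3 * Real.pi / 2), TrefoilGroup.a_eq]
    congr 1
    · have e : ∀ t : I, segmentPath (0, 0, 0, 3 * Real.pi / 2) (basePt + deck 0 1) t =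
          (0, 0, 0, 3 * Real.pi / 2 + t * Real.pi) := fun t => by
        rw [segmentPath_apply]
        simp only [basePt, deck, Prod.mk_add_mk, Prod.mk_sub_mk, Prod.smul_mk,
          smul_eq_mul]
        push_cast
        ring_nf
      refine (coverVal_eq_of_inner hV (n := -1) (fun t => ?mem) g1 (by rwa [cover_add_deck])
        (τ := fun t => 2 * 0) (by fun_prop) (fun t => ?ph) ?val).trans ?fin
      case fin => simp
      case mem =>
        rw [e]
        refine cover_unit_mem_inner 0 ?_
        rw [← Real.cos_sub_two_pi]
        refine Real.cos_nonneg_of_neg_pi_div_two_le_of_le ?_ ?_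
        · nlinarith [t.2.1]
        · nlinarith [t.2.2]
      case ph => rw [e, cover_unit, phase_point_fst (Real.exp_pos _)]
      case val =>
        rw [cover_add_deck, f0, f1]
        push_cast
        ring
    · have e : ∀ t : I, segmentPath basePt (0, 0, 0, 3 * Real.pi / 2) t =
          (0, 0, 0, Real.pi / 2 + t * Real.pi) := fun t => by
        rw [segmentPath_apply]
        simp only [basePt, Prod.mk_add_mk, Prod.mk_sub_mk, Prod.smul_mk,
          smul_eq_mul]
        ring_nf
      refine (coverVal_eq_of_outer hU (n := 2) (fun t => ?mem) g0 g1
        (τ := fun t => 3 * 0 + -Real.arctan (Real.sin (Real.pi / 2 + t * Real.pi)))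
        (by fun_prop) (fun t => ?ph) ?val).trans ?fin
      case fin => norm_cast
      case mem =>
        rw [e]
        refine cover_unit_mem_outer 0 ?_
        refine Real.cos_nonpos_of_pi_div_two_le_of_le ?_ ?_
        · nlinarith [t.2.1]
        · nlinarith [t.2.2]
      case ph => rw [e, cover_unit, phase_point_snd one_pos]
      case val =>
        rw [a0, f0, a1, f1]
        simp [Real.sin_add_pi, Real.arctan_neg, Real.arctan_one]
        ring

end TrefoilCone

/-! ### Topology of framed knots -/

/-- Four quaternions with nonzero determinant span the quaternions. -/
theorem exists_eq_of_quatDet_ne_zero {p q r s : ℍ[ℝ]} (h : quatDet p q r s ≠ 0) (y : ℍ[ℝ]) :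
    ∃ a b c d : ℝ, a • p + b • q + c • r + d • s = y := by
  set M : Matrix (Fin 4) (Fin 4) ℝ := !![p.re, p.imI, p.imJ, p.imK; q.re, q.imI, q.imJ, q.imK;
    r.re, r.imI, r.imJ, r.imK; s.re, s.imI, s.imJ, s.imK] with hM
  have hu : IsUnit M.det := isUnit_iff_ne_zero.2 h
  set x := Matrix.vecMul ![y.re, y.imI, y.imJ, y.imK] M⁻¹ with hx
  have hxM : Matrix.vecMul x M = ![y.re, y.imI, y.imJ, y.imK] := by
    rw [hx, Matrix.vecMul_vecMul, Matrix.nonsing_inv_mul _ hu, Matrix.vecMul_one]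
  refine ⟨x 0, x 1, x 2, x 3, ?_⟩
  have e := fun i => congrFun hxM i
  simp only [Matrix.vecMul, dotProduct, Fin.sum_univ_four, hM] at e
  apply Quaternion.ext
  · simpa using e 0
  · simpa using e 1
  · simpa using e 2
  · simpa using e 3

namespace FramedKnot

variable (h : FramedKnot)

/-- The embedding in terms of the angle. -/
def lifted (p : ℝ × ℂ) : ℍ[ℝ] := (h.toFun (Circle.exp p.1, p.2) : ℍ[ℝ])

theorem contDiff_lifted : ContDiff ℝ ∞ h.lifted := h.smooth

theorem isOpenQuotientMap_exp_prod :
    IsOpenQuotientMap (Prod.map Circle.exp id : ℝ × ℂ → Circle × ℂ) :=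
  (⟨Circle.exp_surjective, Circle.exp.continuous,
    Circle.isCoveringMap_exp.isLocalHomeomorph.isOpenMap⟩ : IsOpenQuotientMap Circle.exp).prodMap
    .id

theorem continuous_toFun : Continuous h.toFun := by
  rw [← isOpenQuotientMap_exp_prod.continuous_comp_iff]
  exact Continuous.subtype_mk h.smooth.continuous _

theorem norm_coe (x : Sphere3) : ‖(x : ℍ[ℝ])‖ = 1 := mem_sphere_zero_iff_norm.1 x.2

/-- The embedding maps neighbourhoods of interior points to neighbourhoods. -/
theorem image_mem_nhds {p : Circle × ℂ} (hp : ‖p.2‖ ≤ 1) {s : Set (Circle × ℂ)} (hs : s ∈ 𝓝 p) :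
    h.toFun '' s ∈ 𝓝 (h.toFun p) := by
  obtain ⟨x, v⟩ := p
  obtain ⟨t, rfl⟩ := Circle.exp_surjective x
  have hd : HasStrictFDerivAt h.lifted (fderiv ℝ h.lifted (t, v)) (t, v) :=
    h.contDiff_lifted.contDiffAt.hasStrictFDerivAt (by simp)
  set D := fderiv ℝ h.lifted (t, v) with hD
  have hor := h.orientation (t, v) hp
  -- A radial variable is added so that source and target both have dimension four. The orientation
  -- condition says that the derivative is onto ℍ, so the extended map is open at the point.
  have hΦ : HasStrictFDerivAt (fun q : ℝ × (ℝ × ℂ) => (1 + q.1) • h.lifted q.2)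
      (((1 : ℝ) + 0) • D.comp (ContinuousLinearMap.snd ℝ ℝ (ℝ × ℂ)) +
        ((ContinuousLinearMap.fst ℝ ℝ (ℝ × ℂ)).smulRight (h.lifted (t, v)))) (0, (t, v)) := by
    have hA : HasStrictFDerivAt (fun q : ℝ × (ℝ × ℂ) => 1 + q.1)
        (ContinuousLinearMap.fst ℝ ℝ (ℝ × ℂ)) (0, (t, v)) := hasStrictFDerivAt_fst.const_add 1
    have hB : HasStrictFDerivAt (fun q : ℝ × (ℝ × ℂ) => h.lifted q.2)
        (D.comp (ContinuousLinearMap.snd ℝ ℝ (ℝ × ℂ))) (0, (t, v)) :=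
      HasStrictFDerivAt.comp (g := h.lifted) (0, (t, v)) hd hasStrictFDerivAt_snd
    exact hA.smul hB
  have hsurj : (((1 : ℝ) + 0) • D.comp (ContinuousLinearMap.snd ℝ ℝ (ℝ × ℂ)) +
        ((ContinuousLinearMap.fst ℝ ℝ (ℝ × ℂ)).smulRight (h.lifted (t, v)))).range = ⊤ := by
    rw [LinearMap.range_eq_top]
    intro y
    obtain ⟨a, b, c, d, hy⟩ := exists_eq_of_quatDet_ne_zero hor.ne' y
    refine ⟨(a, (b, ⟨c, d⟩)), ?_⟩
    have e : ((b, ⟨c, d⟩) : ℝ × ℂ) = b • (1, 0) + c • (0, 1) + d • (0, Complex.I) := by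
      apply Prod.ext
      · simp
      · apply Complex.ext <;> simp
    rw [← hy]
    change ((1 : ℝ) + 0) • D (b, ⟨c, d⟩) + a • h.lifted (t, v) = _
    rw [e, map_add, map_add, map_smul, map_smul, map_smul, add_zero, one_smul, add_comm,
      ← add_assoc, ← add_assoc]
    rfl
  have hmap := hΦ.map_nhds_eq_of_surj hsurj
  have hs' : {q : ℝ × (ℝ × ℂ) | -1 < q.1 ∧ Prod.map Circle.exp id q.2 ∈ s} ∈
      𝓝 ((0 : ℝ), (t, v)) := by
    refine Filter.inter_mem ?_ ?_
    · exact (isOpen_lt continuous_const continuous_fst).mem_nhds (by simp)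
    · exact (isOpenQuotientMap_exp_prod.continuous.comp continuous_snd).continuousAt hs
  have himg := Filter.image_mem_map (m := fun q : ℝ × (ℝ × ℂ) => (1 + q.1) • h.lifted q.2) hs'
  rw [hmap] at himg
  have e0 : ((1 : ℝ) + 0) • h.lifted (t, v) = (h.toFun (Circle.exp t, v) : ℍ[ℝ]) := by
    rw [add_zero, one_smul]
    rfl
  simp only [e0] at himg
  refine Filter.mem_of_superset (continuous_subtype_val.continuousAt himg) ?_
  rintro y ⟨⟨r, u⟩, ⟨hr, hu⟩, hy⟩
  have hr' : (0 : ℝ) < 1 + r := by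
    have : -1 < r := hr
    linarith
  -- Points of the sphere have norm one, so the radial factor of a preimage is trivial and the
  -- preimage lies in the original domain.
  have h1 : (1 + r) = 1 := by
    have := congrArg norm hy
    simp only [norm_smul, Real.norm_of_nonneg hr'.le, norm_coe] at this
    rwa [show ‖h.lifted u‖ = 1 from norm_coe _, mul_one] at this
  simp only [h1, one_smul] at hy
  exact ⟨_, hu, Subtype.ext hy⟩

theorem isOpen_image {s : Set (Circle × ℂ)} (hs : IsOpen s) (h1 : ∀ p ∈ s, ‖p.2‖ ≤ 1) :
    IsOpen (h.toFun '' s) := by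
  rw [isOpen_iff_mem_nhds]
  rintro _ ⟨p, hp, rfl⟩
  exact h.image_mem_nhds (h1 p hp) (hs.mem_nhds hp)

theorem isOpen_openTube : IsOpen h.openTube :=
  h.isOpen_image (isOpen_lt (by fun_prop) (by fun_prop)) fun _ hp => le_of_lt hp

/-- The closed solid torus `S¹ × D²`. -/
def solidTorus : Set (Circle × ℂ) := {p | ‖p.2‖ ≤ 1}

theorem isCompact_solidTorus : IsCompact solidTorus := by
  have : solidTorus = univ ×ˢ Metric.closedBall (0 : ℂ) 1 := by
    ext p
    simp [solidTorus]
  rw [this]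
  exact isCompact_univ.prod (isCompact_closedBall _ _)

/-- The closed tubular neighbourhood `N(K)`. -/
def tube : Set Sphere3 := h.toFun '' solidTorus

theorem isClosed_tube : IsClosed h.tube :=
  (isCompact_solidTorus.image h.continuous_toFun).isClosed

/-- The coordinates in the closed tubular neighbourhood. -/
def coord (x : Sphere3) : Circle × ℂ := Function.invFunOn h.toFun solidTorus x

theorem coord_mem {x : Sphere3} (hx : x ∈ h.tube) : h.coord x ∈ solidTorus :=
  Function.invFunOn_mem hx

theorem toFun_coord {x : Sphere3} (hx : x ∈ h.tube) : h.toFun (h.coord x) = x :=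
  Function.invFunOn_eq hx

theorem coord_toFun {p : Circle × ℂ} (hp : p ∈ solidTorus) : h.coord (h.toFun p) = p :=
  h.injOn.leftInvOn_invFunOn hp

/-- An injective continuous map on a compact set carries relatively closed sets to closed sets, so
its inverse is continuous. -/
theorem continuousOn_coord : ContinuousOn h.coord h.tube := by
  rw [continuousOn_iff_isClosed]
  intro t ht
  refine ⟨h.toFun '' (solidTorus ∩ t),
    ((isCompact_solidTorus.inter_right ht).image h.continuous_toFun).isClosed, ?_⟩
  ext x
  constructor
  · rintro ⟨h1, h2⟩
    exact ⟨⟨_, ⟨h.coord_mem h2, h1⟩, h.toFun_coord h2⟩, h2⟩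
  · rintro ⟨⟨p, ⟨h1, h2⟩, rfl⟩, h3⟩
    refine ⟨?_, h3⟩
    rw [mem_preimage, h.coord_toFun h1]
    exact h2

theorem openTube_subset_tube : h.openTube ⊆ h.tube :=
  image_mono fun p (hp : ‖p.2‖ < 1) => hp.le

theorem toFun_mem_openTube {p : Circle × ℂ} (hp : p ∈ solidTorus) :
    h.toFun p ∈ h.openTube ↔ ‖p.2‖ < 1 := by
  constructor
  · rintro ⟨q, hq, hqp⟩
    have hq' : ‖q.2‖ < 1 := hq
    have e : q = p := h.injOn (show ‖q.2‖ ≤ 1 from hq'.le) hp hqp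
    rwa [← e]
  · exact fun hp => ⟨p, hp, rfl⟩

theorem toFun_mem_core {p : Circle × ℂ} (hp : p ∈ solidTorus) :
    h.toFun p ∈ h.core ↔ p.2 = 0 := by
  constructor
  · rintro ⟨x, hx⟩
    have := h.injOn (show (x, (0 : ℂ)) ∈ solidTorus by simp [solidTorus]) hp hx
    rw [← this]
  · intro h0
    exact ⟨p.1, by rw [← h0]⟩

theorem core_subset_openTube : h.core ⊆ h.openTube := by
  rintro _ ⟨x, rfl⟩
  exact ⟨(x, 0), by simp, rfl⟩

/-- Radial expansion of the punctured disc towards its boundary. -/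
def expand (t : ℝ) (p : Circle × ℂ) : Circle × ℂ := (p.1, ((1 - t + t / ‖p.2‖ : ℝ) : ℂ) * p.2)

theorem norm_expand {t : ℝ} (ht : t ∈ Icc (0 : ℝ) 1) {p : Circle × ℂ} (hp : p.2 ≠ 0) :
    ‖(expand t p).2‖ = (1 - t) * ‖p.2‖ + t := by
  have h1 : 0 < ‖p.2‖ := norm_pos_iff.2 hp
  have h2 : 0 ≤ 1 - t + t / ‖p.2‖ := add_nonneg (by linarith [ht.2]) (div_nonneg ht.1 h1.le)
  rw [expand, norm_mul, Complex.norm_real, Real.norm_of_nonneg h2]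
  field_simp

theorem expand_mem {t : ℝ} (ht : t ∈ Icc (0 : ℝ) 1) {p : Circle × ℂ} (hp : p.2 ≠ 0)
    (h1 : p ∈ solidTorus) : expand t p ∈ solidTorus ∧ (expand t p).2 ≠ 0 := by
  have h1' : ‖p.2‖ ≤ 1 := h1
  have h2 : 0 < ‖p.2‖ := norm_pos_iff.2 hp
  constructor
  · change ‖(expand t p).2‖ ≤ 1
    rw [norm_expand ht hp]
    nlinarith [ht.1, ht.2]
  · rw [← norm_pos_iff, norm_expand ht hp]
    rcases ht.1.eq_or_lt with h0 | h0
    · rw [← h0]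
      simpa using hp
    · nlinarith [ht.1, ht.2]

theorem expand_zero (p : Circle × ℂ) : expand 0 p = p := by simp [expand]

theorem expand_of_norm_eq_one (t : ℝ) {p : Circle × ℂ} (hp : ‖p.2‖ = 1) : expand t p = p := by
  simp [expand, hp]

open Classical in
/-- The radial deformation of the complement of the core onto the exterior. -/
def push (t : ℝ) (x : Sphere3) : Sphere3 :=
  if x ∈ h.tube then h.toFun (expand t (h.coord x)) else x

theorem push_of_notMem_openTube (t : ℝ) {x : Sphere3} (hx : x ∉ h.openTube) : h.push t x = x := by
  by_cases h1 : x ∈ h.tube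
  · rw [push, if_pos h1, expand_of_norm_eq_one, h.toFun_coord h1]
    refine le_antisymm (h.coord_mem h1) (not_lt.1 fun h2 => hx ?_)
    rw [← h.toFun_coord h1]
    exact ⟨_, h2, rfl⟩
  · rw [push, if_neg h1]

theorem push_zero (x : Sphere3) : h.push 0 x = x := by
  by_cases h1 : x ∈ h.tube
  · rw [push, if_pos h1, expand_zero, h.toFun_coord h1]
  · rw [push, if_neg h1]

theorem coord_ne_zero {x : Sphere3} (hx : x ∈ h.tube) (h' : x ∉ h.core) : (h.coord x).2 ≠ 0 := by
  rwa [Ne, ← h.toFun_mem_core (h.coord_mem hx), h.toFun_coord hx]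

theorem push_notMem_core {t : ℝ} (ht : t ∈ Icc (0 : ℝ) 1) {x : Sphere3} (hx : x ∉ h.core) :
    h.push t x ∉ h.core := by
  by_cases h1 : x ∈ h.tube
  · obtain ⟨h2, h3⟩ := expand_mem ht (h.coord_ne_zero h1 hx) (h.coord_mem h1)
    rwa [push, if_pos h1, h.toFun_mem_core h2]
  · rwa [push, if_neg h1]

theorem push_one_notMem_openTube {x : Sphere3} (hx : x ∉ h.core) : h.push 1 x ∉ h.openTube := by
  by_cases h1 : x ∈ h.tube
  · have ht : (1 : ℝ) ∈ Icc (0 : ℝ) 1 := by simp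
    obtain ⟨h2, h3⟩ := expand_mem ht (h.coord_ne_zero h1 hx) (h.coord_mem h1)
    rw [push, if_pos h1, h.toFun_mem_openTube h2, norm_expand ht (h.coord_ne_zero h1 hx)]
    simp
  · rw [push, if_neg h1]
    exact fun h2 => h1 (h.openTube_subset_tube h2)

/-- The closed tube and the complement of the open tube are closed and cover the space. On the first
the deformation is continuous in the tube coordinates, because the core is excluded; on the second
it is the identity. -/
theorem continuous_push :
    Continuous fun q : I × {x : Sphere3 // x ∉ h.core} => h.push q.1 q.2 := by
  rw [← continuousOn_univ]
  have hcov : (univ : Set (I × {x : Sphere3 // x ∉ h.core})) =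
      {q | (q.2 : Sphere3) ∈ h.tube} ∪ {q | (q.2 : Sphere3) ∉ h.openTube} := by
    refine (eq_univ_of_forall fun q => ?_).symm
    by_cases h1 : (q.2 : Sphere3) ∈ h.tube
    · exact .inl h1
    · exact .inr fun h2 => h1 (h.openTube_subset_tube h2)
  rw [hcov]
  refine ContinuousOn.union_of_isClosed ?_ ?_ ?_ ?_
  · have hc : ContinuousOn (fun q : I × {x : Sphere3 // x ∉ h.core} => h.coord q.2)
        {q | (q.2 : Sphere3) ∈ h.tube} :=
      h.continuousOn_coord.comp (by fun_prop) fun q hq => hq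
    refine ContinuousOn.congr (f := fun q : I × {x : Sphere3 // x ∉ h.core} =>
      h.toFun (expand q.1 (h.coord q.2))) ?_ fun q hq => if_pos hq
    refine h.continuous_toFun.comp_continuousOn ?_
    refine hc.fst.prodMk (ContinuousOn.mul (Complex.continuous_ofReal.comp_continuousOn
      (ContinuousOn.add (by fun_prop) (ContinuousOn.div (by fun_prop) hc.snd.norm ?_))) hc.snd)
    exact fun q hq => norm_ne_zero_iff.2 (h.coord_ne_zero hq q.2.2)
  · exact ContinuousOn.congr (f := fun q : I × {x : Sphere3 // x ∉ h.core} => (q.2 : Sphere3))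
      (by fun_prop) fun q hq => h.push_of_notMem_openTube _ hq
  · exact h.isClosed_tube.preimage (by fun_prop)
  · exact h.isOpen_openTube.isClosed_compl.preimage
      (f := fun q : I × {x : Sphere3 // x ∉ h.core} => (q.2 : Sphere3)) (by fun_prop)

/-- The complement of the core. -/
abbrev CoreCompl : Type := {x : Sphere3 // x ∉ h.core}

/-- The exterior is a deformation retract of the complement of the core. -/
def exteriorEquiv : h.Exterior ≃ₕ h.CoreCompl where
  toFun := ⟨fun x => ⟨x.1, fun h1 => x.2 (h.core_subset_openTube h1)⟩, by fun_prop⟩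
  invFun := ⟨fun x => ⟨h.push 1 x.1, h.push_one_notMem_openTube x.2⟩,
    Continuous.subtype_mk (h.continuous_push.comp (f := fun x : h.CoreCompl => ((1 : I), x))
      (by fun_prop)) _⟩
  left_inv := by
    convert ContinuousMap.Homotopic.refl _
    ext x : 2
    exact (h.push_of_notMem_openTube 1 x.2).symm
  right_inv := ⟨⟨⟨fun q => ⟨h.push (unitInterval.symm q.1) q.2, h.push_notMem_core
      (unitInterval.symm q.1).2 q.2.2⟩, Continuous.subtype_mk (h.continuous_push.comp
      (f := fun q : I × h.CoreCompl => (unitInterval.symm q.1, q.2)) (by fun_prop)) _⟩,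
    fun x => Subtype.ext (by simp), fun x => Subtype.ext (by simpa using h.push_zero x)⟩⟩

end FramedKnot

/-! ### The exterior of the trefoil -/

/-- The coordinates `(z, w)` of the quaternion `z + w j`. -/
def quatEquiv : ℍ[ℝ] ≃L[ℝ] ℂ × ℂ :=
  LinearEquiv.toContinuousLinearEquiv
    { toFun := fun q => (⟨q.re, q.imI⟩, ⟨q.imJ, q.imK⟩)
      invFun := fun p => ⟨p.1.re, p.1.im, p.2.re, p.2.im⟩
      map_add' := fun _ _ => rfl
      map_smul' := fun r q => by
        refine Prod.ext (Complex.ext ?_ ?_) (Complex.ext ?_ ?_) <;> simp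
      left_inv := fun _ => rfl
      right_inv := fun _ => rfl }

theorem quatEquiv_apply (q : ℍ[ℝ]) : quatEquiv q = (⟨q.re, q.imI⟩, ⟨q.imJ, q.imK⟩) := rfl

theorem sq_norm_quat (q : ℍ[ℝ]) : ‖q‖ ^ 2 = ‖(quatEquiv q).1‖ ^ 2 + ‖(quatEquiv q).2‖ ^ 2 := by
  rw [sq, ← Quaternion.normSq_eq_norm_mul_self, Quaternion.normSq_def', Complex.sq_norm,
    Complex.sq_norm, Complex.normSq_apply, Complex.normSq_apply, quatEquiv_apply]
  ring

theorem quatEquiv_trefoil (t : ℝ) :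
    quatEquiv (trefoil t) = TrefoilCone.point (√2)⁻¹ (√2)⁻¹ t 0 := by
  have key : ∀ s : ℝ, (((√2)⁻¹ : ℝ) : ℂ) * (Circle.exp s : ℂ) =
      ⟨(√2)⁻¹ * Real.cos s, (√2)⁻¹ * Real.sin s⟩ := fun s => by
    apply Complex.ext
    · rw [Complex.re_ofReal_mul, Circle.coe_exp, Complex.exp_ofReal_mul_I_re]
    · rw [Complex.im_ofReal_mul, Circle.coe_exp, Complex.exp_ofReal_mul_I_im]
  rw [TrefoilCone.point, key, key, add_zero]
  rfl

namespace TrefoilCone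

theorem point_zero_notMem_compl {r : ℝ} (hr : 0 < r) (τ : ℝ) : point r r τ 0 ∉ compl := by
  have hpi := Real.pi_pos
  obtain ⟨h1, h2⟩ := point_mem_nbhd (τ := τ) hr hr (θ := 0) ⟨by linarith, by linarith⟩
  rw [mem_compl_iff_normalCoord_ne h1, not_not, normalCoord_eq_zero_iff h1,
    norm_point_fst hr, norm_point_snd hr]
  exact ⟨rfl, h2⟩

/-- Failing both defining conditions forces z, w ≠ 0, |z| = |w| and arg g = 0, that is, θ = 0. -/
theorem exists_eq_point {p : ℂ × ℂ} (h0 : p ≠ 0) (h : p ∉ compl) :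
    ∃ r > 0, ∃ τ, p = point r r τ 0 := by
  simp only [compl, mem_union, not_or] at h
  obtain ⟨ho, hi⟩ := h
  simp only [outer, inner, mem_ofPred_eq, not_and_or, not_not, not_or, not_lt] at ho hi
  have hw : p.2 ≠ 0 := by
    intro hw
    rcases hi with h1 | ⟨-, h1⟩
    · exact h0 (Prod.ext h1 hw)
    · rw [hw, norm_zero, norm_le_zero_iff] at h1
      exact h0 (Prod.ext h1 hw)
  obtain ⟨h1, h2⟩ := ho.resolve_left hw
  have hz : p.1 ≠ 0 := by
    intro hz
    rw [hz, norm_zero, norm_le_zero_iff] at h2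
    exact hw h2
  obtain ⟨-, h3⟩ := hi.resolve_left hz
  have hn : ‖p.1‖ = ‖p.2‖ := le_antisymm h3 h2
  have hg : Complex.arg (g p) = 0 := by
    rw [Complex.mem_slitPlane_iff, not_or] at h1
    simp only [Complex.neg_re, Complex.neg_im, neg_pos, not_lt, neg_eq_zero, not_not] at h1
    exact Complex.arg_eq_zero_iff.2 h1
  obtain ⟨τ, hτ⟩ := Circle.exp_surjective (phase p.2 * Circle.exp (-0) * (phase p.1)⁻¹)
  refine ⟨‖p.2‖, norm_pos_iff.2 hw, τ, ?_⟩
  have := point_eq_of hz hw (θ := 0) (by rw [phase, hg]; simp) hτ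
  rwa [hn, eq_comm] at this

theorem smul_mem_compl {p : ℂ × ℂ} (h : p ∈ compl) {r : ℝ} (hr : 0 < r) : r • p ∈ compl := by
  by_contra hn
  have h0 : p ≠ 0 := by
    rintro rfl
    rcases h with h | h <;> exact h.1 rfl
  obtain ⟨s, hs, τ, hp⟩ := exists_eq_point (smul_ne_zero hr.ne' h0) hn
  have : p = point (r⁻¹ * s) (r⁻¹ * s) τ 0 := by
    rw [← inv_smul_smul₀ hr.ne' p, hp, point, point]
    refine Prod.ext ?_ ?_ <;> simp [mul_assoc]
  rw [this] at h
  exact point_zero_notMem_compl (by positivity) τ h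

theorem ne_zero_of_mem_compl {p : ℂ × ℂ} (h : p ∈ compl) : p ≠ 0 := by
  rintro rfl
  rcases h with h | h <;> exact h.1 rfl

end TrefoilCone

/-- The cone meets the unit sphere where 2r² = 1, which is the trefoil. -/
theorem quatEquiv_mem_compl_iff (x : Sphere3) :
    quatEquiv x ∈ TrefoilCone.compl ↔ (x : ℍ[ℝ]) ∉ range trefoil := by
  rw [← not_iff_not, not_not]
  constructor
  · intro hx
    have h0 : quatEquiv (x : ℍ[ℝ]) ≠ 0 := by
      rw [Ne, quatEquiv.map_eq_zero_iff]
      intro h0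
      simpa [h0] using FramedKnot.norm_coe x
    obtain ⟨r, hr, τ, h⟩ := TrefoilCone.exists_eq_point h0 hx
    refine ⟨τ, quatEquiv.injective ?_⟩
    have h1 := sq_norm_quat (x : ℍ[ℝ])
    rw [FramedKnot.norm_coe, h, TrefoilCone.norm_point_fst hr, TrefoilCone.norm_point_snd hr] at h1
    have h2 : r = (√2)⁻¹ := by
      rw [← Real.sqrt_inv, eq_comm, Real.sqrt_eq_iff_mul_self_eq (by positivity) hr.le]
      linarith
    rw [quatEquiv_trefoil, h, h2]
  · rintro ⟨t, ht⟩
    rw [← ht, quatEquiv_trefoil]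
    exact TrefoilCone.point_zero_notMem_compl (by positivity) t

namespace FramedKnot

variable (h : FramedKnot)

theorem notMem_core_iff (hT : (Subtype.val '' h.core : Set ℍ[ℝ]) = range trefoil) (x : Sphere3) :
    x ∉ h.core ↔ quatEquiv x ∈ TrefoilCone.compl := by
  rw [quatEquiv_mem_compl_iff, ← hT]
  simp

theorem norm_symm_pos (p : TrefoilCone.compl) : 0 < ‖quatEquiv.symm p.1‖ := by
  rw [norm_pos_iff, Ne, quatEquiv.symm.map_eq_zero_iff]
  exact TrefoilCone.ne_zero_of_mem_compl p.2

/-- Radial projection to the sphere. -/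
def toSphere (p : TrefoilCone.compl) : Sphere3 :=
  ⟨‖quatEquiv.symm p.1‖⁻¹ • quatEquiv.symm p.1, by
    rw [mem_sphere_zero_iff_norm, norm_smul, norm_inv, norm_norm,
      inv_mul_cancel₀ (norm_symm_pos p).ne']⟩

theorem continuous_toSphere : Continuous toSphere := by
  have h1 : Continuous fun p : TrefoilCone.compl => quatEquiv.symm p.1 :=
    quatEquiv.symm.continuous.comp continuous_subtype_val
  exact Continuous.subtype_mk ((h1.norm.inv₀ fun p => (norm_symm_pos p).ne').smul h1) _

theorem quatEquiv_toSphere (p : TrefoilCone.compl) :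
    quatEquiv (toSphere p : ℍ[ℝ]) = ‖quatEquiv.symm p.1‖⁻¹ • p.1 := by
  rw [toSphere, map_smul, quatEquiv.apply_symm_apply]

theorem toSphere_quatEquiv (x : Sphere3) (hx : quatEquiv x ∈ TrefoilCone.compl) :
    toSphere ⟨quatEquiv x, hx⟩ = x := by
  refine Subtype.ext ?_
  rw [toSphere]
  simp only [quatEquiv.symm_apply_apply, norm_coe, inv_one, one_smul]

theorem toSphere_notMem_core (hT : (Subtype.val '' h.core : Set ℍ[ℝ]) = range trefoil)
    (p : TrefoilCone.compl) : toSphere p ∉ h.core := by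
  rw [h.notMem_core_iff hT, quatEquiv_toSphere]
  exact TrefoilCone.smul_mem_compl p.2 (inv_pos.2 (norm_symm_pos p))

/-- The complement of the trefoil is homotopy equivalent to the complement of the cone over it. -/
def coneEquiv (hT : (Subtype.val '' h.core : Set ℍ[ℝ]) = range trefoil) :
    h.CoreCompl ≃ₕ TrefoilCone.compl where
  toFun := ⟨fun x => ⟨quatEquiv x.1, (h.notMem_core_iff hT x).1 x.2⟩, by fun_prop⟩
  invFun := ⟨fun p => ⟨toSphere p, h.toSphere_notMem_core hT p⟩,
    continuous_toSphere.subtype_mk (h.toSphere_notMem_core hT)⟩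
  left_inv := by
    convert ContinuousMap.Homotopic.refl _
    ext x : 2
    exact (toSphere_quatEquiv x.1 _).symm
  right_inv := by
    refine ⟨⟨⟨fun q => ⟨((q.1 : ℝ) + (1 - q.1) / ‖quatEquiv.symm q.2.1‖) • q.2.1,
      TrefoilCone.smul_mem_compl q.2.2 (TrefoilCone.convex_pos (norm_symm_pos q.2))⟩, ?_⟩, ?_, ?_⟩⟩
    · have h1 : Continuous fun q : I × TrefoilCone.compl => ‖quatEquiv.symm q.2.1‖ :=
        (quatEquiv.symm.continuous.comp (continuous_subtype_val.comp continuous_snd)).norm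
      exact Continuous.subtype_mk (Continuous.smul (Continuous.add (by fun_prop)
        (Continuous.div (by fun_prop) h1 fun q => (norm_symm_pos q.2).ne')) (by fun_prop)) _
    · intro p
      refine Subtype.ext ?_
      change ((0 : ℝ) + (1 - 0) / ‖quatEquiv.symm p.1‖) • p.1 = quatEquiv (toSphere p : ℍ[ℝ])
      rw [quatEquiv_toSphere, zero_add, sub_zero, one_div]
    · intro p
      refine Subtype.ext ?_
      change ((1 : ℝ) + (1 - 1) / ‖quatEquiv.symm p.1‖) • p.1 = p.1
      rw [sub_self, zero_div, add_zero, one_smul]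

/-- The exterior of the trefoil is homotopy equivalent to the complement of the cone over it. -/
def exteriorConeEquiv (hT : (Subtype.val '' h.core : Set ℍ[ℝ]) = range trefoil) :
    h.Exterior ≃ₕ TrefoilCone.compl := h.exteriorEquiv.trans (h.coneEquiv hT)

end FramedKnot

/-! ### Degrees of maps of the circle -/

/-- The degree of an injective map of the circle, from the sign of its derivative. -/
theorem Circle.degree_eq_one {τ : ℝ → ℝ} (hτ : Continuous τ)
    (hinj : ∀ s ∈ Ico 0 (2 * Real.pi), ∀ t ∈ Ico 0 (2 * Real.pi),
      Circle.exp (τ s) = Circle.exp (τ t) → s = t)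
    (hper : Circle.exp (τ (2 * Real.pi)) = Circle.exp (τ 0)) {c : ℝ} (hd : HasDerivAt τ c 0)
    (hc : 0 < c) : τ (2 * Real.pi) - τ 0 = 2 * Real.pi := by
  have hpi := Real.pi_pos
  have hne : ∀ t ∈ Ioo 0 (2 * Real.pi), ∀ n : ℤ, τ t ≠ τ 0 + n * (2 * Real.pi) := by
    intro t ht n hn
    have := hinj t ⟨ht.1.le, ht.2⟩ 0 ⟨le_rfl, by positivity⟩ (Circle.exp_eq_exp.2 ⟨n, hn⟩)
    exact ht.1.ne' this
  -- Just after 0 the positive derivative lifts τ above τ 0, and continuity keeps it below τ 0 + 2π.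
  obtain ⟨t₀, ht₀, h0, h1⟩ : ∃ t₀ ∈ Ioo 0 (2 * Real.pi), τ 0 < τ t₀ ∧ τ t₀ < τ 0 + 2 * Real.pi := by
    have e1 : ∀ᶠ t in 𝓝[>] (0 : ℝ), t ∈ Ioo 0 (2 * Real.pi) := Ioo_mem_nhdsGT (by positivity)
    have e2 : ∀ᶠ t in 𝓝[>] (0 : ℝ), τ t < τ 0 + 2 * Real.pi :=
      nhdsWithin_le_nhds (hτ.continuousAt.eventually_lt_const (by linarith))
    have e3 : ∀ᶠ t in 𝓝[>] (0 : ℝ), 0 < slope τ 0 t :=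
      ((hasDerivAt_iff_tendsto_slope.1 hd).mono_left
        (nhdsWithin_mono _ fun x hx => ne_of_gt hx)).eventually_const_lt hc
    obtain ⟨t, ht1, ht2, ht3⟩ := (e1.and (e2.and e3)).exists
    refine ⟨t, ht1, ?_, ht2⟩
    rw [slope_def_field, sub_zero, div_pos_iff_of_pos_right ht1.1] at ht3
    linarith
  have hsub : ∀ t ∈ Ioo 0 (2 * Real.pi), uIcc t t₀ ⊆ Ioo 0 (2 * Real.pi) := fun t ht =>
    Set.OrdConnected.uIcc_subset ordConnected_Ioo ht ht₀
  -- By injectivity τ avoids τ 0 + 2πℤ inside the period, so by the intermediate value theorem it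
  -- stays in the gap that contains τ t₀.
  have hlow : ∀ t ∈ Ioo 0 (2 * Real.pi), τ 0 < τ t := by
    intro t ht
    by_contra hle
    obtain ⟨s, hs, hs'⟩ := intermediate_value_uIcc (a := t) (b := t₀) hτ.continuousOn
      (show τ 0 ∈ uIcc (τ t) (τ t₀) from mem_uIcc.2 (.inl ⟨not_lt.1 hle, h0.le⟩))
    exact hne s (hsub t ht hs) 0 (by simpa using hs')
  have hup : ∀ t ∈ Ioo 0 (2 * Real.pi), τ t < τ 0 + 2 * Real.pi := by
    intro t ht
    by_contra hle
    obtain ⟨s, hs, hs'⟩ := intermediate_value_uIcc (a := t) (b := t₀) hτ.continuousOn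
      (show τ 0 + 2 * Real.pi ∈ uIcc (τ t) (τ t₀) from mem_uIcc.2 (.inr ⟨h1.le, not_lt.1 hle⟩))
    exact hne s (hsub t ht hs) 1 (by simpa using hs')
  have hmem : τ (2 * Real.pi) ∈ Icc (τ 0) (τ 0 + 2 * Real.pi) := by
    have hcl : IsClosed (τ ⁻¹' Icc (τ 0) (τ 0 + 2 * Real.pi)) := isClosed_Icc.preimage hτ
    have : closure (Ioo 0 (2 * Real.pi)) ⊆ τ ⁻¹' Icc (τ 0) (τ 0 + 2 * Real.pi) :=
      hcl.closure_subset_iff.2 fun t ht => ⟨(hlow t ht).le, (hup t ht).le⟩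
    rw [closure_Ioo (by positivity)] at this
    exact this ⟨by positivity, le_rfl⟩
  obtain ⟨n, hn⟩ := Circle.exp_eq_exp.1 hper
  have hn0 : (-1 : ℝ) < n := by nlinarith [hmem.1]
  have hn1 : (n : ℝ) < 2 := by nlinarith [hmem.2]
  have hn0' : -1 < n := by exact_mod_cast hn0
  have hn1' : n < 2 := by exact_mod_cast hn1
  obtain rfl | rfl : n = 0 ∨ n = 1 := by omega
  -- If τ returned to τ 0, it would take an intermediate value both before and after time π, against
  -- injectivity.
  · exfalso
    have hm := hlow Real.pi ⟨hpi, by linarith⟩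
    have hmid : (τ 0 + τ Real.pi) / 2 ∈ Icc (τ 0) (τ Real.pi) := ⟨by linarith, by linarith⟩
    obtain ⟨s, hs, hs'⟩ := intermediate_value_Icc hpi.le hτ.continuousOn hmid
    have e2 : τ (2 * Real.pi) = τ 0 := by simpa using hn
    obtain ⟨t, ht, ht'⟩ := intermediate_value_Icc' (by linarith : Real.pi ≤ 2 * Real.pi)
      hτ.continuousOn (e2.symm ▸ hmid)
    have ht2 : t < 2 * Real.pi := by
      refine lt_of_le_of_ne ht.2 ?_
      rintro rfl
      linarith
    have hst := hinj s ⟨hs.1, by linarith [hs.2]⟩ t ⟨by linarith [ht.1], ht2⟩ (by rw [hs', ht', e2])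
    have : s = Real.pi := le_antisymm hs.2 (hst ▸ ht.1)
    rw [this] at hs'
    linarith
  · rw [hn]
    push_cast
    ring

theorem Circle.degree_eq_neg_one {τ : ℝ → ℝ} (hτ : Continuous τ)
    (hinj : ∀ s ∈ Ico 0 (2 * Real.pi), ∀ t ∈ Ico 0 (2 * Real.pi),
      Circle.exp (τ s) = Circle.exp (τ t) → s = t)
    (hper : Circle.exp (τ (2 * Real.pi)) = Circle.exp (τ 0)) {c : ℝ} (hd : HasDerivAt τ c 0)
    (hc : c < 0) : τ (2 * Real.pi) - τ 0 = -(2 * Real.pi) := by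
  have := Circle.degree_eq_one (τ := fun t => -τ t) hτ.neg
    (fun s hs t ht h => hinj s hs t ht (by
      rwa [Circle.exp_neg, Circle.exp_neg, inv_inj] at h))
    (by rw [Circle.exp_neg, Circle.exp_neg, hper]) hd.neg (neg_pos.2 hc)
  linarith

/-- A continuous argument of a differentiable function is differentiable. -/
theorem exists_hasDerivAt_of_exp_eq {τ : ℝ → ℝ} {u : ℝ → ℂ} {u' : ℂ} {t₀ : ℝ}
    (hτ : ContinuousAt τ t₀) (hu : HasDerivAt u u' t₀) (h : ∀ t, u t = Circle.exp (τ t)) :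
    ∃ c, HasDerivAt τ c t₀ := by
  have h0 : u t₀ ≠ 0 := by
    rw [h]
    exact Circle.coe_ne_zero _
  have h1 : HasDerivAt (fun t => u t / u t₀) (u' / u t₀) t₀ := hu.div_const _
  have h2 := h1.clog_real (by simp [div_self h0])
  have h3 := Complex.imCLM.hasFDerivAt.comp_hasDerivAt t₀ h2
  refine ⟨_, (h3.add_const (τ t₀)).congr_of_eventuallyEq ?_⟩
  have e : ∀ᶠ t in 𝓝 t₀, τ t ∈ Ioo (τ t₀ - Real.pi) (τ t₀ + Real.pi) :=
    hτ (Ioo_mem_nhds (by linarith [Real.pi_pos]) (by linarith [Real.pi_pos]))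
  filter_upwards [e] with t ht
  have e2 : u t / u t₀ = (Circle.exp (τ t - τ t₀) : ℂ) := by
    rw [h, h, Circle.exp_sub, Circle.coe_div]
  simp only [Function.comp_apply, Complex.imCLM_apply, Complex.log_im, e2]
  rw [TrefoilCone.arg_exp ⟨by linarith [ht.1], by linarith [ht.2]⟩]
  ring

/-! ### Winding around a zero of a differentiable map of the plane -/

theorem Complex.div_mem_slitPlane {z w : ℂ} (h : ‖z - w‖ < ‖w‖) : z / w ∈ slitPlane := by
  have hw : w ≠ 0 := by
    rintro rfl
    rw [norm_zero] at h
    exact (norm_nonneg _).not_gt h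
  have h1 : ‖z / w - 1‖ < 1 := by
    rw [div_sub_one hw, norm_div, div_lt_one (norm_pos_iff.2 hw)]
    exact h
  have h2 := (abs_le.1 (Complex.abs_re_le_norm (z / w - 1))).1
  left
  simp only [sub_re, one_re] at h2
  linarith

/-- A real linear map of the plane is v ↦ av + bv̄, and its determinant is |a|² - |b|². When this is
positive, f v differs from av by less than |av| near 0, so f v and av make an angle below π/2. -/
theorem exists_div_mem_slitPlane {f : ℂ → ℂ} {A : ℂ →L[ℝ] ℂ} (hf : HasFDerivAt f A 0) (h0 : f 0 = 0)
    (hA : 0 < (A 1).re * (A Complex.I).im - (A 1).im * (A Complex.I).re) :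
    ∃ a : ℂ, a ≠ 0 ∧ ∀ᶠ v in 𝓝 (0 : ℂ), v ≠ 0 → f v / (a * v) ∈ Complex.slitPlane := by
  set a : ℂ := (A 1 - Complex.I * A Complex.I) / 2 with ha
  set b : ℂ := (A 1 + Complex.I * A Complex.I) / 2 with hb
  have hAv : ∀ v, A v = a * v + b * conj v := by
    intro v
    have e : v = v.re • (1 : ℂ) + v.im • Complex.I := by
      apply Complex.ext <;> simp
    conv_lhs => rw [e, map_add, map_smul, map_smul]
    apply Complex.ext <;> simp [ha, hb] <;> ring
  have hab : ‖b‖ < ‖a‖ := by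
    rw [← sq_lt_sq₀ (norm_nonneg _) (norm_nonneg _), Complex.sq_norm, Complex.sq_norm,
      Complex.normSq_apply, Complex.normSq_apply]
    simp only [ha, hb, Complex.div_ofNat_re, Complex.div_ofNat_im, Complex.sub_re, Complex.sub_im,
      Complex.add_re, Complex.add_im, Complex.mul_re, Complex.mul_im, Complex.I_re, Complex.I_im]
    nlinarith
  have ha0 : a ≠ 0 := norm_pos_iff.1 ((norm_nonneg b).trans_lt hab)
  refine ⟨a, ha0, ?_⟩
  have hlo := (hasFDerivAt_iff_isLittleO_nhds_zero.1 hf).bound (half_pos (sub_pos.2 hab))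
  filter_upwards [hlo] with v hv hv0
  simp only [zero_add, h0, sub_zero] at hv
  refine Complex.div_mem_slitPlane ?_
  have hvp : 0 < ‖v‖ := norm_pos_iff.2 hv0
  calc ‖f v - a * v‖ = ‖(f v - A v) + b * conj v‖ := by
        congr 1
        rw [hAv]
        ring
    _ ≤ ‖f v - A v‖ + ‖b * conj v‖ := norm_add_le _ _
    _ ≤ (‖a‖ - ‖b‖) / 2 * ‖v‖ + ‖b‖ * ‖v‖ := by
        gcongr
        rw [norm_mul, RCLike.norm_conj]
    _ < ‖a * v‖ := by
        rw [norm_mul]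
        nlinarith

/-- Precomposition with conjugation changes the sign of the determinant. -/
theorem exists_div_conj_mem_slitPlane {f : ℂ → ℂ} {A : ℂ →L[ℝ] ℂ} (hf : HasFDerivAt f A 0)
    (h0 : f 0 = 0) (hA : (A 1).re * (A Complex.I).im - (A 1).im * (A Complex.I).re < 0) :
    ∃ a : ℂ, a ≠ 0 ∧ ∀ᶠ v in 𝓝 (0 : ℂ), v ≠ 0 → f v / (a * conj v) ∈ Complex.slitPlane := by
  have hc : HasFDerivAt (fun v : ℂ => f (conj v)) (A.comp (Complex.conjCLE : ℂ →L[ℝ] ℂ)) 0 := by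
    refine HasFDerivAt.comp (g := f) 0 ?_ Complex.conjCLE.hasFDerivAt
    simpa using hf
  obtain ⟨a, ha, h⟩ := exists_div_mem_slitPlane hc (by simpa using h0) (by
    simp only [ContinuousLinearMap.comp_apply, ContinuousLinearEquiv.coe_coe, Complex.conjCLE_apply,
      map_one, Complex.conj_I, map_neg, Complex.neg_im, Complex.neg_re]
    linarith)
  refine ⟨a, ha, ?_⟩
  have hcont : Filter.Tendsto (fun v : ℂ => conj v) (𝓝 0) (𝓝 0) := by
    simpa using (Complex.continuous_conj.tendsto 0)
  filter_upwards [hcont.eventually h] with v hv hv0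
  simpa using hv (by simpa using hv0)

/-! ### Orientation near the trefoil -/

namespace TrefoilCone

/-- A polynomial version of the transverse coordinate, `|z|² - |w|² + i Im g`. -/
def normalPoly (p : ℂ × ℂ) : ℂ := p.1 * conj p.1 - p.2 * conj p.2 + (g p - conj (g p)) / 2

theorem normalPoly_re (p : ℂ × ℂ) : (normalPoly p).re = ‖p.1‖ ^ 2 - ‖p.2‖ ^ 2 := by
  rw [Complex.sq_norm, Complex.sq_norm, normalPoly, Complex.mul_conj, Complex.mul_conj]
  simp

theorem normalPoly_im (p : ℂ × ℂ) : (normalPoly p).im = (g p).im := by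
  rw [normalPoly, Complex.mul_conj, Complex.mul_conj]
  simp

/-- The real parts have equal signs because log is monotone, the imaginary parts because tan and sin
2θ have the same sign on (-π/2, π/2). The two transverse coordinates thus make an angle below π/2,
and the polynomial one, which is easier to differentiate, can be used to count turns. -/
theorem normalCoord_mul_normalPoly {p : ℂ × ℂ} (h : p ∈ nbhd) (h0 : normalCoord p ≠ 0) :
    0 < (normalCoord p).re * (normalPoly p).re + (normalCoord p).im * (normalPoly p).im := by
  obtain ⟨h1, h2⟩ := ne_zero_of_mem_nbhd h
  have hz := norm_pos_iff.2 h1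
  have hw := norm_pos_iff.2 h2
  have hcos := cos_skew_pos h
  have him : (normalCoord p).im * (normalPoly p).im = 2 * ‖g p‖ * Real.sin (skew p) ^ 2 := by
    have e : Complex.arg (g p) = -(2 * skew p) := by
      rw [skew]
      ring
    rw [normalPoly_im, ← Complex.norm_mul_sin_arg (g p), e, Real.sin_neg, Real.sin_two_mul]
    simp only [normalCoord]
    rw [Real.tan_eq_sin_div_cos]
    field_simp
  have hg : 0 < ‖g p‖ := norm_pos_iff.2 (Complex.slitPlane_ne_zero h)
  have hre : (normalCoord p).re * (normalPoly p).re =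
      (Real.log ‖p.1‖ - Real.log ‖p.2‖) * (‖p.1‖ - ‖p.2‖) * (‖p.1‖ + ‖p.2‖) := by
    rw [normalPoly_re]
    simp only [normalCoord]
    ring
  have hre0 : 0 ≤ (Real.log ‖p.1‖ - Real.log ‖p.2‖) * (‖p.1‖ - ‖p.2‖) := by
    rcases le_total ‖p.1‖ ‖p.2‖ with h3 | h3
    · exact mul_nonneg_of_nonpos_of_nonpos (sub_nonpos.2 (Real.log_le_log hz h3))
        (sub_nonpos.2 h3)
    · exact mul_nonneg (sub_nonneg.2 (Real.log_le_log hw h3)) (sub_nonneg.2 h3)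
  rw [him, hre]
  by_cases hs : skew p = 0
  · have h3 : ‖p.1‖ ≠ ‖p.2‖ := fun h3 => h0 ((normalCoord_eq_zero_iff h).2 ⟨h3, hs⟩)
    refine add_pos_of_pos_of_nonneg (mul_pos (lt_of_le_of_ne hre0 (Ne.symm ?_)) (by positivity))
      (by positivity)
    refine mul_ne_zero (sub_ne_zero.2 fun h4 => h3 ?_) (sub_ne_zero.2 h3)
    exact Real.log_injOn_pos hz hw h4
  · refine add_pos_of_nonneg_of_pos (mul_nonneg hre0 (by positivity)) ?_
    have : Real.sin (skew p) ≠ 0 := by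
      have h3 := skew_mem h
      exact (Real.sin_eq_zero_iff_of_lt_of_lt (by linarith [h3.1, Real.pi_pos])
        (by linarith [h3.2, Real.pi_pos])).not.2 hs
    positivity

theorem normalCoord_div_mem {p : ℂ × ℂ} (h : p ∈ nbhd) (h0 : normalCoord p ≠ 0) :
    normalPoly p ≠ 0 ∧ normalCoord p / normalPoly p ∈ Complex.slitPlane := by
  have h1 := normalCoord_mul_normalPoly h h0
  have h2 : normalPoly p ≠ 0 := by
    intro h2
    simp [h2] at h1
  refine ⟨h2, .inl ?_⟩
  rw [Complex.div_re, ← add_div]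
  exact div_pos h1 (Complex.normSq_pos.2 h2)

/-- The derivative of `normalPoly`. -/
def normalDeriv (z w dz dw : ℂ) : ℂ :=
  dz * conj z + z * conj dz - (dw * conj w + w * conj dw) +
    ((3 * z ^ 2 * conj w ^ 2 * dz + 2 * z ^ 3 * conj w * conj dw) -
      conj (3 * z ^ 2 * conj w ^ 2 * dz + 2 * z ^ 3 * conj w * conj dw)) / 2

theorem exists_hasFDerivAt_normalPoly {Z W : ℂ → ℂ} {Z' W' : ℂ →L[ℝ] ℂ} (hZ : HasFDerivAt Z Z' 0)
    (hW : HasFDerivAt W W' 0) : ∃ A : ℂ →L[ℝ] ℂ,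
      HasFDerivAt (fun v => normalPoly (Z v, W v)) A 0 ∧
      ∀ v, A v = normalDeriv (Z 0) (W 0) (Z' v) (W' v) := by
  have hc : ∀ {f : ℂ → ℂ} {f' : ℂ →L[ℝ] ℂ}, HasFDerivAt f f' 0 →
      HasFDerivAt (fun v => conj (f v)) ((Complex.conjCLE : ℂ →L[ℝ] ℂ).comp f') 0 := fun hf =>
    HasFDerivAt.comp (g := fun z : ℂ => conj z) 0 Complex.conjCLE.hasFDerivAt hf
  have hg := (hZ.pow 3).mul ((hc hW).pow 2)
  have hg' := hc hg
  have key := ((hZ.mul (hc hZ)).sub (hW.mul (hc hW))).add ((hg.sub hg').mul_const ((2 : ℂ)⁻¹))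
  refine ⟨_, key.congr_of_eventuallyEq (Filter.Eventually.of_forall fun v => ?_), fun v => ?_⟩
  · simp [normalPoly, g, div_eq_mul_inv]
  · simp [normalDeriv]
    ring

/-- Tangent vectors are measured relative to the phases u and v. On the cone u³ = v² makes g real,
and the phases cancel. -/
theorem normalDeriv_eq (ρ : ℝ) {u v : Circle} (huv : u ^ 3 = v ^ 2) (ζ η : ℂ) :
    normalDeriv (ρ * u) (ρ * v) (u * ζ) (v * η) =
      ⟨2 * ρ * (ζ.re - η.re), ρ ^ 4 * (3 * ζ.im - 2 * η.im)⟩ := by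
  have hu : (u : ℂ) * conj (u : ℂ) = 1 := by rw [Complex.mul_conj, Circle.normSq_coe]; simp
  have hv : (v : ℂ) * conj (v : ℂ) = 1 := by rw [Complex.mul_conj, Circle.normSq_coe]; simp
  have h1 : (u : ℂ) ^ 3 * conj (v : ℂ) ^ 2 = 1 := by
    have : (u : ℂ) ^ 3 = v ^ 2 := by exact_mod_cast congrArg (fun x : Circle => (x : ℂ)) huv
    rw [this, ← mul_pow, hv, one_pow]
  have hG : 3 * (ρ * u : ℂ) ^ 2 * conj (ρ * v : ℂ) ^ 2 * (u * ζ) +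
      2 * (ρ * u : ℂ) ^ 3 * conj (ρ * v : ℂ) * conj (v * η) =
      ((ρ ^ 4 : ℝ) : ℂ) * (3 * ζ + 2 * conj η) := by
    simp only [map_mul, Complex.conj_ofReal]
    push_cast
    linear_combination (3 * (ρ : ℂ) ^ 4 * ζ + 2 * (ρ : ℂ) ^ 4 * conj η) * h1
  have hR : (u * ζ) * conj (ρ * u : ℂ) + (ρ * u) * conj (u * ζ) -
      ((v * η) * conj (ρ * v : ℂ) + (ρ * v) * conj (v * η)) =
      ((ρ : ℝ) : ℂ) * ((ζ + conj ζ) - (η + conj η)) := by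
    simp only [map_mul, Complex.conj_ofReal]
    linear_combination ((ρ : ℂ) * (ζ + conj ζ)) * hu - ((ρ : ℂ) * (η + conj η)) * hv
  rw [normalDeriv, hG, hR]
  generalize ρ ^ 4 = r
  apply Complex.ext
  · simp
    ring
  · simp
    ring

/-- Multiplying the two complex coordinates by unit numbers is a rotation of ℝ⁴, so the phases do
not affect the determinant. -/
theorem quatDet_eq (ρ c : ℝ) (u v : Circle) (ζ₁ η₁ ζ₂ η₂ : ℂ) :
    quatDet (quatEquiv.symm (ρ * u, ρ * v))
      (quatEquiv.symm (c * (2 * Complex.I * (ρ * u)), c * (3 * Complex.I * (ρ * v))))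
      (quatEquiv.symm (u * ζ₁, v * η₁)) (quatEquiv.symm (u * ζ₂, v * η₂)) =
    c * ρ ^ 2 * ((η₁.re - ζ₁.re) * (2 * η₂.im - 3 * ζ₂.im) -
      (η₂.re - ζ₂.re) * (2 * η₁.im - 3 * ζ₁.im)) := by
  have hu : (u : ℂ).re ^ 2 + (u : ℂ).im ^ 2 = 1 := by
    have := u.normSq_coe
    rw [Complex.normSq_apply] at this
    linarith
  have hv : (v : ℂ).re ^ 2 + (v : ℂ).im ^ 2 = 1 := by
    have := v.normSq_coe
    rw [Complex.normSq_apply] at this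
    linarith
  have e : ∀ p : ℂ × ℂ, quatEquiv.symm p = ⟨p.1.re, p.1.im, p.2.re, p.2.im⟩ := fun _ => rfl
  have key : ∀ a b c' d : ℝ, a = 1 → b = 1 → a * b * c' = d → c' = d := by
    rintro a b c' d rfl rfl h
    linarith
  symm
  refine key _ _ _ _ hu hv ?_
  -- After multiplication by |u|²|v|² = 1 the claim is a polynomial identity.
  simp only [quatDet, e, Matrix.det_succ_row_zero, Fin.sum_univ_succ]
  simp [Fin.succAbove]
  ring

end TrefoilCone

/-! ### Framed knots whose core is the standard trefoil -/

namespace TrefoilCone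

theorem longCoord_point {r : ℝ} (hr : 0 < r) (τ : ℝ) :
    longCoord (point r r τ 0) = Circle.exp τ := by
  have hpi := Real.pi_pos
  rw [longCoord, (point_mem_nbhd hr hr (θ := 0) ⟨by linarith, by linarith⟩).2, phase_point_fst hr,
    phase_point_snd hr, ← Circle.exp_neg, ← Circle.exp_add, ← Circle.exp_add]
  congr 1
  ring

theorem point_congr {τ τ' : ℝ} (h : Circle.exp τ = Circle.exp τ') (r : ℝ) :
    point r r τ 0 = point r r τ' 0 := by
  have h2 : Circle.exp (2 * τ) = Circle.exp (2 * τ') := by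
    rw [two_mul, two_mul, Circle.exp_add, Circle.exp_add, h]
  have h3 : Circle.exp (3 * τ + 0) = Circle.exp (3 * τ' + 0) := by
    rw [show 3 * τ + 0 = 2 * τ + τ by ring, show 3 * τ' + 0 = 2 * τ' + τ' by ring, Circle.exp_add,
      Circle.exp_add, h, h2]
  rw [point, point, h2, h3]

theorem hasDerivAt_exp_mul {τ : ℝ → ℝ} {c : ℝ} {t : ℝ} (hτ : HasDerivAt τ c t) (r k : ℝ) :
    HasDerivAt (fun s => (r : ℂ) * (Circle.exp (k * τ s) : ℂ))
      (c * (k * Complex.I * (r * Circle.exp (k * τ t)))) t := by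
  have h1 : HasDerivAt (fun s => ((k * τ s : ℝ) : ℂ)) ((k * c : ℝ) : ℂ) t :=
    (hτ.const_mul k).ofReal_comp
  have h2 := ((h1.mul_const Complex.I).cexp).const_mul (r : ℂ)
  simp only [Circle.coe_exp]
  refine h2.congr_deriv ?_
  push_cast
  ring

/-- The sign of the velocity of the core determines the sign of the transverse determinant. -/
theorem jacobian_pos {r c : ℝ} (hr : 0 < r) {u v : Circle} (huv : u ^ 3 = v ^ 2) {z₁ w₁ z₂ w₂ : ℂ}
    (h : 0 < quatDet (quatEquiv.symm (r * u, r * v))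
      (quatEquiv.symm (c * (2 * Complex.I * (r * u)), c * (3 * Complex.I * (r * v))))
      (quatEquiv.symm (z₁, w₁)) (quatEquiv.symm (z₂, w₂))) :
    0 < c * ((normalDeriv (r * u) (r * v) z₁ w₁).re * (normalDeriv (r * u) (r * v) z₂ w₂).im -
      (normalDeriv (r * u) (r * v) z₁ w₁).im * (normalDeriv (r * u) (r * v) z₂ w₂).re) := by
  have e : ∀ (x : Circle) (z : ℂ), z = x * ((x : ℂ)⁻¹ * z) := fun x z => by
    rw [mul_inv_cancel_left₀ (Circle.coe_ne_zero x)]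
  rw [e u z₁, e v w₁, e u z₂, e v w₂] at h ⊢
  rw [quatDet_eq] at h
  rw [normalDeriv_eq r huv, normalDeriv_eq r huv]
  refine lt_of_lt_of_eq (mul_pos (show 0 < 2 * r ^ 3 by positivity) h) ?_
  ring

end TrefoilCone

/-! ### The direction of the core and the sense of small meridians -/

namespace FramedKnot

open TrefoilCone

variable (h : FramedKnot)

/-- The embedding in complex coordinates. -/
def chart (p : Circle × ℂ) : ℂ × ℂ := quatEquiv (h.toFun p : ℍ[ℝ])

theorem continuous_chart : Continuous h.chart :=
  quatEquiv.continuous.comp (continuous_subtype_val.comp h.continuous_toFun)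

theorem chart_injOn : InjOn h.chart solidTorus := fun _ hp _ hq hpq =>
  h.injOn hp hq (Subtype.ext (quatEquiv.injective hpq))

/-- The longitudinal coordinate recovers the parameter of a point of the trefoil up to 2πℤ, so the
core has a continuous parameter τ by lifting. -/
theorem exists_core_lift (hT : (Subtype.val '' h.core : Set ℍ[ℝ]) = range trefoil) :
    ∃ τ : ℝ → ℝ, Continuous τ ∧
    ∀ t, h.chart (Circle.exp t, 0) = point (√2)⁻¹ (√2)⁻¹ (τ t) 0 := by
  have hr : 0 < (√2)⁻¹ := by positivity
  have hpi := Real.pi_pos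
  have h1 : ∀ t : ℝ, ∃ s, h.chart (Circle.exp t, 0) = point (√2)⁻¹ (√2)⁻¹ s 0 := by
    intro t
    have : (h.toFun (Circle.exp t, 0) : ℍ[ℝ]) ∈ range trefoil := by
      rw [← hT]
      exact ⟨_, ⟨_, rfl⟩, rfl⟩
    obtain ⟨s, hs⟩ := this
    exact ⟨s, by rw [chart, ← hs, quatEquiv_trefoil]⟩
  have h2 : ∀ t : ℝ, h.chart (Circle.exp t, 0) ∈ nbhd := by
    intro t
    obtain ⟨s, hs⟩ := h1 t
    rw [hs]
    exact (point_mem_nbhd hr hr ⟨by linarith, by linarith⟩).1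
  have hc : Continuous fun t : ℝ => longCoord (h.chart (Circle.exp t, 0)) :=
    continuous_iff_continuousAt.2 fun t => (continuousAt_longCoord (h2 t)).comp
      (f := fun t : ℝ => h.chart (Circle.exp t, 0))
      (h.continuous_chart.comp (by fun_prop)).continuousAt
  obtain ⟨s, hs⟩ := h1 0
  obtain ⟨τ, ⟨-, hτ⟩, -⟩ := Circle.isCoveringMap_exp.existsUnique_continuousMap_lifts ⟨_, hc⟩
    (e₀ := s) (a₀ := 0) (by
      change Circle.exp s = longCoord (h.chart (Circle.exp 0, 0))
      rw [hs, longCoord_point hr])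
  refine ⟨τ, τ.continuous, fun t => ?_⟩
  obtain ⟨s, hs⟩ := h1 t
  rw [hs]
  refine point_congr ?_ _
  rw [← longCoord_point hr s, ← hs]
  exact (congrFun hτ t).symm

/-- The velocity of the core and the transverse derivative, with compatible signs. -/
theorem exists_core_deriv (hT : (Subtype.val '' h.core : Set ℍ[ℝ]) = range trefoil) :
    ∃ (τ : ℝ → ℝ) (c : ℝ) (A : ℂ →L[ℝ] ℂ), Continuous τ ∧
    (∀ t, h.chart (Circle.exp t, 0) = point (√2)⁻¹ (√2)⁻¹ (τ t) 0) ∧ HasDerivAt τ c 0 ∧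
    HasFDerivAt (fun v => normalPoly (h.chart (1, v))) A 0 ∧
    0 < c * ((A 1).re * (A Complex.I).im - (A 1).im * (A Complex.I).re) := by
  obtain ⟨τ, hτ, hP⟩ := h.exists_core_lift hT
  have hr : 0 < (√2)⁻¹ := by positivity
  set r := (√2)⁻¹ with hrdef
  set D := fderiv ℝ h.lifted (0, 0) with hD
  have hd : HasFDerivAt h.lifted D (0, 0) :=
    (h.contDiff_lifted.differentiable (by simp) _).hasFDerivAt
  have hdP : HasFDerivAt (fun p : ℝ × ℂ => h.chart (Circle.exp p.1, p.2))
      ((quatEquiv : ℍ[ℝ] →L[ℝ] ℂ × ℂ).comp D) (0, 0) :=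
    HasFDerivAt.comp (g := quatEquiv) _ quatEquiv.hasFDerivAt hd
  have ht : HasDerivAt (fun t : ℝ => h.chart (Circle.exp t, 0)) (quatEquiv (D (1, 0))) 0 :=
    HasFDerivAt.comp_hasDerivAt (f := fun t : ℝ => (t, (0 : ℂ))) 0 hdP
      ((hasDerivAt_id 0).prodMk (hasDerivAt_const _ _))
  have hv : HasFDerivAt (fun v : ℂ => h.chart (1, v))
      (((quatEquiv : ℍ[ℝ] →L[ℝ] ℂ × ℂ).comp D).comp (ContinuousLinearMap.inr ℝ ℝ ℂ)) 0 := by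
    have := HasFDerivAt.comp (f := fun v : ℂ => ((0 : ℝ), v)) 0 hdP
      ((ContinuousLinearMap.inr ℝ ℝ ℂ).hasFDerivAt (x := (0 : ℂ)))
    simpa [Function.comp_def] using this
  have h1 : HasDerivAt (fun t : ℝ => (h.chart (Circle.exp t, 0)).1) (quatEquiv (D (1, 0))).1 0 :=
    (ContinuousLinearMap.fst ℝ ℂ ℂ).hasFDerivAt.comp_hasDerivAt 0 ht
  have h2 : HasDerivAt (fun t : ℝ => (h.chart (Circle.exp t, 0)).2) (quatEquiv (D (1, 0))).2 0 :=
    (ContinuousLinearMap.snd ℝ ℂ ℂ).hasFDerivAt.comp_hasDerivAt 0 ht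
  have hr' : (r : ℂ) ≠ 0 := by exact_mod_cast hr.ne'
  -- On the trefoil w/z = e^{3iτ}/e^{2iτ} = e^{iτ}, which expresses τ by a differentiable function.
  obtain ⟨c, hc⟩ : ∃ c, HasDerivAt τ c 0 := by
    refine exists_hasDerivAt_of_exp_eq hτ.continuousAt (h2.div h1 ?_) fun t => ?_
    · rw [hP, point]
      exact mul_ne_zero hr' (Circle.coe_ne_zero _)
    · change (h.chart (Circle.exp t, 0)).2 / (h.chart (Circle.exp t, 0)).1 = _
      rw [hP, point]
      simp only
      rw [mul_div_mul_left _ _ hr', div_eq_iff (Circle.coe_ne_zero _), ← Circle.coe_mul,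
        ← Circle.exp_add]
      congr 2
      ring
  have e1 : (quatEquiv (D (1, 0))).1 = c * (2 * Complex.I * (r * Circle.exp (2 * τ 0))) := by
    refine h1.unique ?_
    simp only [hP, point]
    exact hasDerivAt_exp_mul hc r 2
  have e2 : (quatEquiv (D (1, 0))).2 = c * (3 * Complex.I * (r * Circle.exp (3 * τ 0))) := by
    refine h2.unique ?_
    simp only [hP, point, add_zero]
    exact hasDerivAt_exp_mul hc r 3
  obtain ⟨A, hA, hA'⟩ := exists_hasFDerivAt_normalPoly hv.fst hv.snd
  have h0 : h.chart (1, 0) =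
      ((r : ℂ) * (Circle.exp (2 * τ 0) : ℂ), (r : ℂ) * (Circle.exp (3 * τ 0) : ℂ)) := by
    have := hP 0
    rwa [Circle.exp_zero, point, add_zero] at this
  refine ⟨τ, c, A, hτ, hP, hc, hA, ?_⟩
  have hor := h.orientation (0, 0) (by simp)
  have huv : Circle.exp (2 * τ 0) ^ 3 = Circle.exp (3 * τ 0) ^ 2 := by
    simp only [pow_succ, pow_zero, one_mul, ← Circle.exp_add]
    congr 1
    ring
  have key := jacobian_pos (c := c) hr huv (z₁ := (quatEquiv (D (0, 1))).1)
    (w₁ := (quatEquiv (D (0, 1))).2) (z₂ := (quatEquiv (D (0, Complex.I))).1)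
    (w₂ := (quatEquiv (D (0, Complex.I))).2) (by
      rw [← e1, ← e2, ← h0]
      simp only [Prod.mk.eta, chart, ContinuousLinearEquiv.symm_apply_apply]
      simp only [Circle.exp_zero] at hor
      exact hor)
  rw [hA', hA']
  simp only [h0]
  exact key

/-- Near the core, the core winds once around the trefoil in the direction in which small
meridians wind around it. -/
theorem exists_core_sign (hT : (Subtype.val '' h.core : Set ℍ[ℝ]) = range trefoil) :
    ∃ (τ : ℝ → ℝ) (δ : ℤ) (a : ℂ), Continuous τ ∧ (δ = 1 ∨ δ = -1) ∧
    a ≠ 0 ∧ (∀ t, h.chart (Circle.exp t, 0) = point (√2)⁻¹ (√2)⁻¹ (τ t) 0) ∧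
    τ (2 * Real.pi) - τ 0 = δ * (2 * Real.pi) ∧
    ∀ᶠ v in 𝓝 (0 : ℂ), ∀ (r φ : ℝ), 0 < r → v = r * (Circle.exp φ : ℂ) →
      normalPoly (h.chart (1, v)) / (a * Circle.exp (δ * φ)) ∈ Complex.slitPlane := by
  obtain ⟨τ, c, A, hτ, hP, hc, hA, hJ⟩ := h.exists_core_deriv hT
  have hr : 0 < (√2)⁻¹ := by positivity
  have hinj : ∀ s ∈ Ico 0 (2 * Real.pi), ∀ t ∈ Ico 0 (2 * Real.pi),
      Circle.exp (τ s) = Circle.exp (τ t) → s = t := by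
    intro s hs t ht hst
    have h1 : h.chart (Circle.exp s, 0) = h.chart (Circle.exp t, 0) := by
      rw [hP, hP, point_congr hst]
    have h2 := h.chart_injOn (by simp [solidTorus]) (by simp [solidTorus]) h1
    exact Circle.exp_injOn_Ico (by simp) hs ht (congrArg Prod.fst h2)
  have hper : Circle.exp (τ (2 * Real.pi)) = Circle.exp (τ 0) := by
    rw [← longCoord_point hr, ← longCoord_point hr, ← hP, ← hP]
    simp
  have h0 : normalPoly (h.chart (1, 0)) = 0 := by
    have e := hP 0
    rw [Circle.exp_zero] at e
    apply Complex.ext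
    · rw [normalPoly_re, e, norm_point_fst hr, norm_point_snd hr]
      simp
    · rw [normalPoly_im, e, g_point]
      generalize (√2)⁻¹ ^ 3 * (√2)⁻¹ ^ 2 = r
      simp
  have scale : ∀ {x y : ℂ} {r : ℝ}, 0 < r → x / (r * y) ∈ Complex.slitPlane →
      x / y ∈ Complex.slitPlane := by
    intro x y r hr hx
    have := Complex.ofReal_mul_mem_slitPlane hr hx
    rwa [← mul_div_assoc, mul_div_mul_left _ _ (by exact_mod_cast hr.ne')] at this
  -- The orientation makes the product of the speed c and the transverse Jacobian positive. So c ≠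
  -- 0, and both signs are the same δ.
  rcases lt_trichotomy c 0 with hc0 | rfl | hc0
  · obtain ⟨a, ha, hev⟩ := exists_div_conj_mem_slitPlane hA h0 (by
      by_contra! hn
      exact (mul_nonpos_of_nonpos_of_nonneg hc0.le hn).not_gt hJ)
    refine ⟨τ, -1, a, hτ, .inr rfl, ha, hP, ?_, ?_⟩
    · rw [Circle.degree_eq_neg_one hτ hinj hper hc hc0]
      simp
    · filter_upwards [hev] with v hv r φ hr' hvr
      refine scale hr' ?_
      have e := hv (by rw [hvr]; exact mul_ne_zero (by exact_mod_cast hr'.ne') (Circle.coe_ne_zero _))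
      convert e using 2
      rw [hvr, map_mul (starRingEnd ℂ), Complex.conj_ofReal, ← Circle.coe_inv_eq_conj,
        ← Circle.exp_neg]
      push_cast
      rw [neg_one_mul]
      ring
  · simp at hJ
  · obtain ⟨a, ha, hev⟩ := exists_div_mem_slitPlane hA h0 (pos_of_mul_pos_right hJ hc0.le)
    refine ⟨τ, 1, a, hτ, .inl rfl, ha, hP, ?_, ?_⟩
    · rw [Circle.degree_eq_one hτ hinj hper hc hc0]
      simp
    · filter_upwards [hev] with v hv r φ hr' hvr
      refine scale hr' ?_
      have e := hv (by rw [hvr]; exact mul_ne_zero (by exact_mod_cast hr'.ne') (Circle.coe_ne_zero _))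
      convert e using 2
      rw [hvr]
      push_cast
      rw [one_mul]
      ring

end FramedKnot

/-! ### Meridians and longitudes close to the core -/

namespace TrefoilCone

theorem isOpen_nbhd : IsOpen nbhd := Complex.isOpen_slitPlane.preimage continuous_g

theorem continuous_normalPoly : Continuous normalPoly := by
  have hg := continuous_g
  have hc := Complex.continuous_conj
  unfold normalPoly
  fun_prop

end TrefoilCone

namespace FramedKnot

open TrefoilCone

variable (h : FramedKnot)

theorem chart_mem_compl (hT : (Subtype.val '' h.core : Set ℍ[ℝ]) = range trefoil) {p : Circle × ℂ}
    (hp : p ∈ solidTorus) (h0 : p.2 ≠ 0) : h.chart p ∈ compl := by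
  rw [chart, ← h.notMem_core_iff hT, h.toFun_mem_core hp]
  exact h0

theorem chart_core_mem (hT : (Subtype.val '' h.core : Set ℍ[ℝ]) = range trefoil) (x : Circle) :
    h.chart (x, 0) ∈ nbhd := by
  have hpi := Real.pi_pos
  obtain ⟨τ, -, hP⟩ := h.exists_core_lift hT
  obtain ⟨t, rfl⟩ := Circle.exp_surjective x
  rw [hP]
  exact (point_mem_nbhd (by positivity) (by positivity) ⟨by linarith, by linarith⟩).1

/-- On the core the quotient of the longitudinal coordinates is 1; compactness of the circle makes
the neighbourhoods uniform. -/
theorem eventually_near_core (hT : (Subtype.val '' h.core : Set ℍ[ℝ]) = range trefoil) :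
    ∀ᶠ v in 𝓝 (0 : ℂ), ∀ x : Circle, h.chart (x, v) ∈ nbhd ∧
      ((longCoord (h.chart (x, v)) * (longCoord (h.chart (x, 0)))⁻¹ : Circle) : ℂ) ∈
        Complex.slitPlane := by
  have key : ∀ᶠ v in 𝓝 (0 : ℂ), ∀ x ∈ (univ : Set Circle), h.chart (x, v) ∈ nbhd ∧
      ((longCoord (h.chart (x, v)) * (longCoord (h.chart (x, 0)))⁻¹ : Circle) : ℂ) ∈
        Complex.slitPlane := by
    refine isCompact_univ.eventually_forall_of_forall_eventually fun x _ => ?_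
    have hc : Continuous fun z : ℂ × Circle => h.chart (z.2, z.1) :=
      h.continuous_chart.comp (by fun_prop)
    have hc' : Continuous fun z : ℂ × Circle => h.chart (z.2, 0) :=
      h.continuous_chart.comp (by fun_prop)
    have hx := h.chart_core_mem hT x
    refine Filter.Eventually.and (hc.continuousAt.eventually_mem (isOpen_nbhd.mem_nhds hx)) ?_
    have hl : ContinuousAt (fun z : ℂ × Circle =>
        ((longCoord (h.chart (z.2, z.1)) * (longCoord (h.chart (z.2, 0)))⁻¹ : Circle) : ℂ))
        (0, x) := by
      refine ContinuousAt.comp (g := fun u : Circle => (u : ℂ)) (by fun_prop) ?_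
      exact ((continuousAt_longCoord hx).comp_of_eq hc.continuousAt rfl).mul
        ((continuousAt_longCoord hx).comp_of_eq hc'.continuousAt rfl).inv
    refine hl.eventually_mem (Complex.isOpen_slitPlane.mem_nhds ?_)
    simp
  filter_upwards [key] with v hv x using hv x (mem_univ x)

/-- A path in the tubular neighbourhood of the trefoil, off the core. -/
def chartPath (hT : (Subtype.val '' h.core : Set ℍ[ℝ]) = range trefoil) {f : I → Circle × ℂ}
    (hf : Continuous f) (h1 : ∀ t, f t ∈ solidTorus ∧ (f t).2 ≠ 0) {x y : compl}
    (hx : h.chart (f 0) = x) (hy : h.chart (f 1) = y) : Path x y where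
  toFun t := ⟨h.chart (f t), h.chart_mem_compl hT (h1 t).1 (h1 t).2⟩
  continuous_toFun := (h.continuous_chart.comp hf).subtype_mk _
  source' := Subtype.ext hx
  target' := Subtype.ext hy

theorem mem_solidTorus_of {r : ℝ} (hr : 0 < r ∧ r ≤ 1) (x y : Circle) :
    (x, (r : ℂ) * (y : ℂ)) ∈ solidTorus ∧ (r : ℂ) * (y : ℂ) ≠ 0 := by
  refine ⟨?_, mul_ne_zero (by exact_mod_cast hr.1.ne') (Circle.coe_ne_zero _)⟩
  change ‖(r : ℂ) * (y : ℂ)‖ ≤ 1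
  rw [norm_mul, Circle.norm_coe, mul_one, Complex.norm_real, Real.norm_of_nonneg hr.1.le]
  exact hr.2

section Loops

variable (hT : (Subtype.val '' h.core : Set ℍ[ℝ]) = range trefoil) {r : ℝ} (hr : 0 < r ∧ r ≤ 1)

/-- The base point at distance `r` from the core. -/
def chartBase : compl :=
  ⟨h.chart (1, (r : ℂ) * ((1 : Circle) : ℂ)), h.chart_mem_compl hT (mem_solidTorus_of hr 1 1).1
    (mem_solidTorus_of hr 1 1).2⟩

/-- The meridian at distance `r` from the core. -/
def meridianLoop : Path (h.chartBase hT hr) (h.chartBase hT hr) :=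
  h.chartPath hT (f := fun s => (1, (r : ℂ) * (Circle.exp (2 * Real.pi * s) : ℂ)))
    (by fun_prop) (fun t => mem_solidTorus_of hr 1 _) (by simp [chartBase]) (by simp [chartBase])

/-- The longitude at distance `r` from the core. -/
def longitudeLoop : Path (h.chartBase hT hr) (h.chartBase hT hr) :=
  h.chartPath hT (f := fun s => (Circle.exp (2 * Real.pi * s), (r : ℂ) * ((1 : Circle) : ℂ)))
    (by fun_prop) (fun t => mem_solidTorus_of hr _ 1) (by simp [chartBase]) (by simp [chartBase])

end Loops

theorem continuous_arg_comp {Y : Type*} [TopologicalSpace Y] {f : Y → ℂ} (hf : Continuous f)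
    (h : ∀ y, f y ∈ Complex.slitPlane) : Continuous fun y => Complex.arg (f y) :=
  continuous_iff_continuousAt.2 fun y => (Complex.continuousAt_arg (h y)).comp hf.continuousAt

/-- The values of a representation on small meridians and longitudes. -/
theorem exists_val_small_loops (hT : (Subtype.val '' h.core : Set ℍ[ℝ]) = range trefoil)
    {G : Type*} [Group G] (F : PathRep compl G) (v₀ : ℝ × ℝ × ℝ × ℝ) :
    ∃ (r : ℝ) (hr : 0 < r ∧ r ≤ 1) (δ k : ℤ) (q : G), (δ = 1 ∨ δ = -1) ∧
      F.val (h.meridianLoop hT hr) = q * coverVal F v₀ (v₀ + deck 0 1) ^ δ * q⁻¹ ∧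
      F.val (h.longitudeLoop hT hr) = q * (coverVal F v₀ (v₀ + deck 1 0) ^ δ *
        coverVal F v₀ (v₀ + deck 0 1) ^ k) * q⁻¹ := by
  obtain ⟨τ, δ, a, hτ, hδ, ha, hP, hdeg, hev⟩ := h.exists_core_sign hT
  obtain ⟨ε, hε, hball⟩ := Metric.eventually_nhds_iff.1 (hev.and (h.eventually_near_core hT))
  obtain ⟨r, hr0, hrε, hr1⟩ : ∃ r : ℝ, 0 < r ∧ r < ε ∧ r ≤ 1 :=
    ⟨min (ε / 2) 1, by positivity, (min_le_left _ _).trans_lt (by linarith), min_le_right _ _⟩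
  have hr : 0 < r ∧ r ≤ 1 := ⟨hr0, hr1⟩
  have hr2 : 0 < (√2)⁻¹ := by positivity
  have hsmall : ∀ y : Circle, dist ((r : ℂ) * (y : ℂ)) 0 < ε := fun y => by
    rw [dist_zero_right, norm_mul, Circle.norm_coe, mul_one, Complex.norm_real,
      Real.norm_of_nonneg hr0.le]
    exact hrε
  have hn : ∀ x y : Circle, h.chart (x, (r : ℂ) * (y : ℂ)) ∈ nbhd := fun x y =>
    ((hball (hsmall y)).2 x).1
  have hl : ∀ x y : Circle, ((longCoord (h.chart (x, (r : ℂ) * (y : ℂ))) *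
      (longCoord (h.chart (x, 0)))⁻¹ : Circle) : ℂ) ∈ Complex.slitPlane := fun x y =>
    ((hball (hsmall y)).2 x).2
  have hm : ∀ φ : ℝ, normalPoly (h.chart (1, (r : ℂ) * (Circle.exp φ : ℂ))) /
      (a * Circle.exp (δ * φ)) ∈ Complex.slitPlane := fun φ =>
    (hball (hsmall (Circle.exp φ))).1 r φ hr0 rfl
  have hN0 : ∀ x y : Circle, normalCoord (h.chart (x, (r : ℂ) * (y : ℂ))) ≠ 0 := fun x y =>
    (mem_compl_iff_normalCoord_ne (hn x y)).1 (h.chart_mem_compl hT (mem_solidTorus_of hr x y).1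
      (mem_solidTorus_of hr x y).2)
  have hcc : Continuous fun p : Circle × Circle => h.chart (p.1, (r : ℂ) * (p.2 : ℂ)) :=
    h.continuous_chart.comp (by fun_prop)
  have hcl : Continuous fun p : Circle × Circle =>
      longCoord (h.chart (p.1, (r : ℂ) * (p.2 : ℂ))) := continuous_iff_continuousAt.2 fun p =>
    (continuousAt_longCoord (hn p.1 p.2)).comp_of_eq hcc.continuousAt rfl
  have hcn : Continuous fun p : Circle × Circle =>
      normalCoord (h.chart (p.1, (r : ℂ) * (p.2 : ℂ))) := continuous_iff_continuousAt.2 fun p =>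
    (continuousAt_normalCoord (hn p.1 p.2)).comp_of_eq hcc.continuousAt rfl
  have hcp : Continuous fun p : Circle × Circle =>
      normalPoly (h.chart (p.1, (r : ℂ) * (p.2 : ℂ))) := continuous_normalPoly.comp hcc
  have hl0 : ∀ t : ℝ, longCoord (h.chart (Circle.exp t, 0)) = Circle.exp (τ t) := fun t => by
    rw [hP, longCoord_point hr2]
  have hcl0 : Continuous fun x : Circle => longCoord (h.chart (x, 0)) :=
    continuous_iff_continuousAt.2 fun x =>
      (continuousAt_longCoord (h.chart_core_mem hT x)).comp_of_eq
        (f := fun x : Circle => h.chart (x, 0))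
        (h.continuous_chart.comp (by fun_prop)).continuousAt rfl
  -- The small angle by which the longitudinal coordinate at distance r deviates from that of the
  -- core. It is continuous and single-valued, so it does not affect the number of turns.
  set L : Circle → Circle → ℝ := fun x y => Complex.arg ((longCoord (h.chart (x, (r : ℂ) * (y : ℂ))) *
      (longCoord (h.chart (x, 0)))⁻¹ : Circle) : ℂ) with hL
  have hLc : Continuous fun p : Circle × Circle => L p.1 p.2 :=
    continuous_arg_comp (Continuous.comp (g := fun u : Circle => (u : ℂ)) (by fun_prop)
      (hcl.mul (hcl0.comp continuous_fst).inv)) fun p => hl p.1 p.2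
  have hLe : ∀ (t : ℝ) (y : Circle), Circle.exp (L (Circle.exp t) y + τ t) =
      longCoord (h.chart (Circle.exp t, (r : ℂ) * (y : ℂ))) := fun t y => by
    rw [Circle.exp_add, ← hl0, hL, Circle.exp_arg, inv_mul_cancel_right]
  obtain ⟨q, hq⟩ := exists_conj_val F (p := h.chartBase hT hr) (hn 1 1) v₀
  -- the angle along the longitude
  have hpath : Continuous fun s : I => phase (normalCoord (h.chart (Circle.exp (2 * Real.pi * s),
      (r : ℂ) * ((1 : Circle) : ℂ)))) :=
    (hcn.comp (f := fun s : I => (Circle.exp (2 * Real.pi * s), (1 : Circle)))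
      (by fun_prop)).phase fun s => hN0 _ _
  obtain ⟨b, hb, hb'⟩ := Circle.exists_lift
    (⟨⟨fun s : I => phase (normalCoord (h.chart (Circle.exp (2 * Real.pi * s),
      (r : ℂ) * ((1 : Circle) : ℂ)))), hpath⟩, rfl, rfl⟩ : Path _ _)
  replace hb' : ∀ s : I, phase (normalCoord (h.chart (Circle.exp (2 * Real.pi * s),
      (r : ℂ) * ((1 : Circle) : ℂ)))) = Circle.exp (b s) := hb'
  -- The number of turns of the transverse coordinate along the longitude. It is left undetermined
  -- here and is fixed later by the framing number.
  obtain ⟨k, hk⟩ := Circle.exp_eq_exp.1 (show Circle.exp (b 1) = Circle.exp (b 0) by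
    rw [← hb', ← hb']
    simp)
  refine ⟨r, hr, δ, k, q, hδ, ?_, ?_⟩
  · set N : I → ℂ := fun s => normalCoord (h.chart (1, (r : ℂ) *
      (Circle.exp (2 * Real.pi * s) : ℂ))) with hN
    set Q : I → ℂ := fun s => normalPoly (h.chart (1, (r : ℂ) *
      (Circle.exp (2 * Real.pi * s) : ℂ))) with hQ
    set E : I → ℂ := fun s => a * Circle.exp (δ * (2 * Real.pi * s)) with hE
    have hNc : Continuous N := hcn.comp
      (f := fun s : I => ((1 : Circle), Circle.exp (2 * Real.pi * s))) (by fun_prop)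
    have hQc : Continuous Q := hcp.comp
      (f := fun s : I => ((1 : Circle), Circle.exp (2 * Real.pi * s))) (by fun_prop)
    have hEc : Continuous E := by fun_prop
    have hE0 : ∀ s, E s ≠ 0 := fun s => mul_ne_zero ha (Circle.coe_ne_zero _)
    have hQ0 : ∀ s, Q s ≠ 0 ∧ N s / Q s ∈ Complex.slitPlane := fun s =>
      normalCoord_div_mem (hn _ _) (hN0 _ _)
    have hQE : ∀ s, Q s / E s ∈ Complex.slitPlane := fun s => hm _
    -- The angle of N is decomposed as that of N/Q, plus that of Q/E, plus that of E = a exp (iδφ).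
    -- The first two quotients stay in the slit plane and return to their initial values, so only
    -- the δ turns of E remain. The longitudinal angle also returns.
    have key := hq (h.meridianLoop hT hr)
      (fun s => L 1 (Circle.exp (2 * Real.pi * s)) + τ 0)
      (fun s => Complex.arg (N s / Q s) + Complex.arg (Q s / E s) + Complex.arg a +
        δ * (2 * Real.pi * s)) (fun s => hn _ _)
      ((hLc.comp (f := fun s : I => ((1 : Circle), Circle.exp (2 * Real.pi * s)))
        (by fun_prop)).add continuous_const)
      (((continuous_arg_comp (hNc.div hQc fun s => (hQ0 s).1) fun s => (hQ0 s).2).add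
        (continuous_arg_comp (hQc.div hEc hE0) hQE)).add continuous_const |>.add (by fun_prop))
      (fun s => by
        have e := hLe 0 (Circle.exp (2 * Real.pi * s))
        rw [Circle.exp_zero] at e
        exact e)
      (fun s => by
        change _ = phase (N s)
        rw [Circle.exp_add, Circle.exp_add, Circle.exp_add]
        change phase (N s / Q s) * phase (Q s / E s) * phase a * _ = _
        have e : phase (E s) = phase a * Circle.exp (δ * (2 * Real.pi * s)) := by
          rw [hE, phase_mul ha (Circle.coe_ne_zero _), phase_coe]
        rw [mul_assoc, ← e, ← phase_mul (Complex.slitPlane_ne_zero (hQ0 s).2)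
          (Complex.slitPlane_ne_zero (hQE s)), ← phase_mul (mul_ne_zero
          (Complex.slitPlane_ne_zero (hQ0 s).2) (Complex.slitPlane_ne_zero (hQE s))) (hE0 s),
          div_mul_div_cancel₀ (hQ0 s).1, div_mul_cancel₀ _ (hE0 s)]) 0 δ
      (by simp) (by
        have hN1 : N 1 = N 0 := by simp [hN]
        have hQ1 : Q 1 = Q 0 := by simp [hQ]
        have hE1 : E 1 = E 0 := by
          simp [hE]
        rw [hN1, hQ1, hE1]
        simp)
    rw [key, zpow_zero, one_mul]
  · refine hq (h.longitudeLoop hT hr) (fun s => L (Circle.exp (2 * Real.pi * s)) 1 +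
      τ (2 * Real.pi * s)) b (fun s => hn _ _) ((hLc.comp
      (f := fun s : I => (Circle.exp (2 * Real.pi * s), (1 : Circle))) (by fun_prop)).add
      (by fun_prop)) hb (fun s => hLe _ 1) (fun s => (hb' s).symm) δ k ?_ ?_
    · simp [hdeg]
    · rw [hk]
      ring

end FramedKnot

/-! ### From small loops to loops on the boundary torus -/

namespace FramedKnot

open TrefoilCone

variable (h : FramedKnot)

/-- The values of a representation on meridians and longitudes at different distances from the core
are simultaneously conjugate. -/
theorem exists_conj_val_loops (hT : (Subtype.val '' h.core : Set ℍ[ℝ]) = range trefoil)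
    {G : Type*} [Group G] (F : PathRep compl G) {r r' : ℝ} (hr : 0 < r ∧ r ≤ 1)
    (hr' : 0 < r' ∧ r' ≤ 1) : ∃ q : G,
      F.val (h.meridianLoop hT hr') = q * F.val (h.meridianLoop hT hr) * q⁻¹ ∧
      F.val (h.longitudeLoop hT hr') = q * F.val (h.longitudeLoop hT hr) * q⁻¹ := by
  set ρ : I → ℝ := fun u => (1 - u) * r' + u * r with hρ
  have hρ' : ∀ u, 0 < ρ u ∧ ρ u ≤ 1 := by
    intro u
    have h0 := u.2.1
    have h1 := u.2.2
    constructor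
    · rcases h0.eq_or_lt with h2 | h2
      · simp only [hρ, ← h2]
        linarith [hr'.1]
      · exact add_pos_of_nonneg_of_pos (mul_nonneg (by linarith) hr'.1.le) (mul_pos h2 hr.1)
    · simp only [hρ]
      nlinarith [hr.2, hr'.2]
  have hρc : Continuous ρ := by fun_prop
  have h0 : ρ 0 = r' := by simp [hρ]
  have h1 : ρ 1 = r := by simp [hρ]
  let S (x y : I → Circle) (hx : Continuous x) (hy : Continuous y) : C(I × I, compl) :=
    ⟨fun p => ⟨h.chart (x p.2, (ρ p.1 : ℂ) * (y p.2 : ℂ)), h.chart_mem_compl hT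
      (mem_solidTorus_of (hρ' p.1) (x p.2) (y p.2)).1
      (mem_solidTorus_of (hρ' p.1) (x p.2) (y p.2)).2⟩, Continuous.subtype_mk
        (h.continuous_chart.comp (f := fun p : I × I => (x p.2, (ρ p.1 : ℂ) * (y p.2 : ℂ)))
          (by fun_prop)) _⟩
  -- One radial path bounds both annuli, so the same element conjugates meridian and longitude.
  let radial : Path (h.chartBase hT hr') (h.chartBase hT hr) :=
    h.chartPath hT (f := fun u => (1, (ρ u : ℂ) * ((1 : Circle) : ℂ))) (by fun_prop)
      (fun u => mem_solidTorus_of (hρ' u) 1 1) (by simp only [h0]; rfl) (by simp only [h1]; rfl)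
  have hrad : ∀ u, (radial u).1 = h.chart (1, (ρ u : ℂ) * ((1 : Circle) : ℂ)) := fun _ => rfl
  have key : ∀ {a b c : G}, a * b = c * a → b = a⁻¹ * c * a⁻¹⁻¹ := by
    intro a b c habc
    rw [inv_inv, mul_assoc, ← habc, inv_mul_cancel_left]
  refine ⟨(F.val radial)⁻¹, key ?_, key ?_⟩
  · refine VanKampen.map_square F (S (fun _ => 1) (fun s => Circle.exp (2 * Real.pi * s)) (by fun_prop)
      (by fun_prop)) _ _ radial radial ?_ ?_ ?_ ?_ <;> intro t <;> refine Subtype.ext ?_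
    · simp only [S, ContinuousMap.coe_mk, h0]
      rfl
    · simp only [S, ContinuousMap.coe_mk, h1]
      rfl
    · simp [S, hrad]
    · simp [S, hrad]
  · refine VanKampen.map_square F (S (fun s => Circle.exp (2 * Real.pi * s)) (fun _ => 1) (by fun_prop)
      (by fun_prop)) _ _ radial radial ?_ ?_ ?_ ?_ <;> intro t <;> refine Subtype.ext ?_
    · simp only [S, ContinuousMap.coe_mk, h0]
      rfl
    · simp only [S, ContinuousMap.coe_mk, h1]
      rfl
    · simp [S, hrad]
    · simp [S, hrad]

/-- The peripheral structure of the group of the standard trefoil. -/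
theorem exists_peripheral_equiv (hT : (Subtype.val '' h.core : Set ℍ[ℝ]) = range trefoil) :
    ∃ (e : h.KnotGroup ≃* TrefoilGroup) (k : ℤ), e h.meridian = TrefoilGroup.a ∧
      e h.longitude = TrefoilGroup.fiber * TrefoilGroup.a ^ k := by
  obtain ⟨F, hF, hF', hfib, ha⟩ := exists_pathRep_peripheral
  obtain ⟨r, hr, δ, k, q, hδ, hm, hl⟩ := h.exists_val_small_loops hT F basePt
  obtain ⟨q', hm', hl'⟩ := h.exists_conj_val_loops hT F hr ⟨one_pos, le_rfl⟩
  rw [hm, ha] at hm'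
  rw [hl, ha, hfib] at hl'
  set R := F.comap (h.exteriorConeEquiv hT).toFun with hR
  set e₀ : h.KnotGroup ≃* TrefoilGroup := MulEquiv.ofBijective (R.toHom (h.boundary 1 1))
    (PathRep.toHom_bijective (hF.comap _) (hF'.comap _) _) with he₀
  have em : e₀ h.meridian = (q' * q) * TrefoilGroup.a ^ δ * (q' * q)⁻¹ := by
    have : e₀ h.meridian = F.val (h.meridianLoop hT ⟨one_pos, le_rfl⟩) := by
      refine F.congr_path _ _ fun t => Subtype.ext ?_
      change quatEquiv (h.toFun _) = quatEquiv (h.toFun _)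
      simp
    rw [this, hm']
    group
  have el : e₀ h.longitude =
      (q' * q) * (TrefoilGroup.fiber ^ δ * TrefoilGroup.a ^ k) * (q' * q)⁻¹ := by
    have : e₀ h.longitude = F.val (h.longitudeLoop hT ⟨one_pos, le_rfl⟩) := by
      refine F.congr_path _ _ fun t => Subtype.ext ?_
      change quatEquiv (h.toFun _) = quatEquiv (h.toFun _)
      simp
    rw [this, hl']
    group
  set e₁ := e₀.trans (MulAut.conj (q' * q)⁻¹) with he₁
  have em₁ : e₁ h.meridian = TrefoilGroup.a ^ δ := by
    simp only [he₁, MulEquiv.trans_apply, em, MulAut.conj_apply]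
    group
  have el₁ : e₁ h.longitude = TrefoilGroup.fiber ^ δ * TrefoilGroup.a ^ k := by
    simp only [he₁, MulEquiv.trans_apply, el, MulAut.conj_apply]
    group
  -- If core and meridians both run backwards, the automorphism that inverts a and b, and hence
  -- `fiber`, repairs both at once.
  rcases hδ with rfl | rfl
  · exact ⟨e₁, k, by rw [em₁, zpow_one], by rw [el₁, zpow_one]⟩
  · refine ⟨e₁.trans TrefoilGroup.inversionEquiv, -k, ?_, ?_⟩
    · change TrefoilGroup.inversion (e₁ h.meridian) = _
      rw [em₁, map_zpow, TrefoilGroup.inversion_a]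
      simp
    · change TrefoilGroup.inversion (e₁ h.longitude) = _
      rw [el₁, map_mul, map_zpow, map_zpow, TrefoilGroup.inversion_a, TrefoilGroup.inversion_fiber]
      simp

end FramedKnot

/-! ### Transport of framed knots by diffeomorphisms -/

theorem quatDet_eq_det (p q r s : ℍ[ℝ]) :
    quatDet p q r s = (QuaternionAlgebra.basisOneIJK (-1 : ℝ) 0 (-1)).det ![p, q, r, s] := by
  rw [Module.Basis.det_apply, ← Matrix.det_transpose, quatDet]
  congr 1
  ext i j
  fin_cases i <;> fin_cases j <;> rfl

theorem quatDet_map (L : ℍ[ℝ] →L[ℝ] ℍ[ℝ]) (p q r s : ℍ[ℝ]) :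
    quatDet (L p) (L q) (L r) (L s) = L.det * quatDet p q r s := by
  have h := (QuaternionAlgebra.basisOneIJK (-1 : ℝ) 0 (-1)).det_comp (L : ℍ[ℝ] →ₗ[ℝ] ℍ[ℝ])
    ![p, q, r, s]
  rw [quatDet_eq_det, quatDet_eq_det]
  refine Eq.trans (congrArg _ (funext fun i => ?_)) h
  fin_cases i <;> rfl

namespace IsOrientedSphereDiffeo

variable {F : ℍ[ℝ] → ℍ[ℝ]} (hF : IsOrientedSphereDiffeo F)

/-- The inverse of a diffeomorphism of the 3-sphere. -/
def inv : ℍ[ℝ] → ℍ[ℝ] := Function.surjInv hF.bijective.surjective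

theorem apply_inv (y : ℍ[ℝ]) : F (hF.inv y) = y := Function.surjInv_eq _ y

theorem inv_apply (x : ℍ[ℝ]) : hF.inv (F x) = x := hF.bijective.injective (hF.apply_inv _)

theorem norm_inv (y : ℍ[ℝ]) : ‖hF.inv y‖ = ‖y‖ := by
  conv_rhs => rw [← hF.apply_inv y, hF.norm_map]

theorem inv_smul (r : ℝ) (y : ℍ[ℝ]) (hr : 0 ≤ r) : hF.inv (r • y) = r • hF.inv y :=
  hF.bijective.injective (by rw [hF.apply_inv, hF.map_smul _ _ hr, hF.apply_inv])

theorem inv_ne_zero {y : ℍ[ℝ]} (hy : y ≠ 0) : hF.inv y ≠ 0 := by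
  rwa [← norm_ne_zero_iff, hF.norm_inv, norm_ne_zero_iff]

theorem contDiffAt (hF : IsOrientedSphereDiffeo F) {x : ℍ[ℝ]} (hx : x ≠ 0) : ContDiffAt ℝ ∞ F x :=
  hF.contDiffOn.contDiffAt (isOpen_compl_singleton.mem_nhds hx)

/-- By the inverse function theorem there is a smooth local inverse, and by injectivity the global
inverse agrees with it. -/
theorem contDiffAt_inv {y : ℍ[ℝ]} (hy : y ≠ 0) : ContDiffAt ℝ ∞ hF.inv y := by
  have hx := hF.inv_ne_zero hy
  set x := hF.inv y with hxdef
  have hc := hF.contDiffAt hx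
  set f' : ℍ[ℝ] ≃L[ℝ] ℍ[ℝ] :=
    ContinuousLinearMap.toContinuousLinearEquivOfDetNeZero (fderiv ℝ F x) (hF.det_pos x hx).ne'
  have hd : HasFDerivAt F (f' : ℍ[ℝ] →L[ℝ] ℍ[ℝ]) x :=
    (hc.differentiableAt (by simp)).hasFDerivAt
  have key := hc.to_localInverse hd (by simp)
  have hFx : F x = y := hF.apply_inv y
  rw [hFx] at key
  refine key.congr_of_eventuallyEq ?_
  have hev := (hc.hasStrictFDerivAt' hd (by simp)).eventually_right_inverse
  rw [hFx] at hev
  filter_upwards [hev] with z hz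
  refine hF.bijective.injective ?_
  rw [hF.apply_inv]
  exact hz.symm

/-- Euler's relation for a map that is homogeneous of degree one. It makes the position vector
transform like the tangent vectors in the orientation determinant. -/
theorem fderiv_inv_self {y : ℍ[ℝ]} (hy : y ≠ 0) : fderiv ℝ hF.inv y y = hF.inv y := by
  have hd : HasFDerivAt hF.inv (fderiv ℝ hF.inv y) y :=
    ((hF.contDiffAt_inv hy).differentiableAt (by simp)).hasFDerivAt
  have hl : HasDerivAt (fun r : ℝ => r • y) y 1 := by
    simpa using (hasDerivAt_id (1 : ℝ)).smul_const y
  have h1 : HasDerivAt (fun r : ℝ => hF.inv (r • y)) (fderiv ℝ hF.inv y y) 1 :=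
    HasFDerivAt.comp_hasDerivAt_of_eq (l := hF.inv) 1 hd hl (by simp)
  have h2 : HasDerivAt (fun r : ℝ => r • hF.inv y) (hF.inv y) 1 := by
    simpa using (hasDerivAt_id (1 : ℝ)).smul_const (hF.inv y)
  refine h1.unique (h2.congr_of_eventuallyEq ?_)
  filter_upwards [lt_mem_nhds (zero_lt_one (α := ℝ))] with r hr
  exact hF.inv_smul r y hr.le

theorem det_fderiv_inv_pos {y : ℍ[ℝ]} (hy : y ≠ 0) : 0 < (fderiv ℝ hF.inv y).det := by
  have hx := hF.inv_ne_zero hy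
  have hd : HasFDerivAt hF.inv (fderiv ℝ hF.inv y) y :=
    ((hF.contDiffAt_inv hy).differentiableAt (by simp)).hasFDerivAt
  have hd' : HasFDerivAt F (fderiv ℝ F (hF.inv y)) (hF.inv y) :=
    ((hF.contDiffAt hx).differentiableAt (by simp)).hasFDerivAt
  have hcomp := hd'.comp y hd
  have hid : HasFDerivAt (F ∘ hF.inv) (ContinuousLinearMap.id ℝ ℍ[ℝ]) y := by
    have : F ∘ hF.inv = id := funext hF.apply_inv
    rw [this]
    exact hasFDerivAt_id y
  have e := hcomp.unique hid
  have e' : (fderiv ℝ F (hF.inv y)).det * (fderiv ℝ hF.inv y).det = 1 := by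
    have := congrArg ContinuousLinearMap.det e
    simp only [ContinuousLinearMap.det, ContinuousLinearMap.toLinearMap_comp,
      ContinuousLinearMap.coe_id, LinearMap.det_comp, LinearMap.det_id] at this
    exact this
  exact pos_of_mul_pos_right (e'.symm ▸ one_pos) (hF.det_pos _ hx).le

theorem coe_ne_zero (x : Sphere3) : (x : ℍ[ℝ]) ≠ 0 := by
  rw [← norm_ne_zero_iff, FramedKnot.norm_coe]
  exact one_ne_zero

/-- A diffeomorphism of the 3-sphere as a homeomorphism. -/
def toHomeomorph : Sphere3 ≃ₜ Sphere3 where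
  toFun x := ⟨F x, by rw [mem_sphere_zero_iff_norm, hF.norm_map, FramedKnot.norm_coe]⟩
  invFun x := ⟨hF.inv x, by rw [mem_sphere_zero_iff_norm, hF.norm_inv, FramedKnot.norm_coe]⟩
  left_inv x := Subtype.ext (hF.inv_apply x)
  right_inv x := Subtype.ext (hF.apply_inv x)
  continuous_toFun := Continuous.subtype_mk (continuous_iff_continuousAt.2 fun x =>
    (hF.contDiffAt (coe_ne_zero x)).continuousAt.comp continuous_subtype_val.continuousAt) _
  continuous_invFun := Continuous.subtype_mk (continuous_iff_continuousAt.2 fun x =>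
    (hF.contDiffAt_inv (coe_ne_zero x)).continuousAt.comp continuous_subtype_val.continuousAt) _

/-- The preimage of a framed knot under a diffeomorphism. -/
def pullback (h : FramedKnot) : FramedKnot where
  toFun p := hF.toHomeomorph.symm (h.toFun p)
  smooth := by
    refine contDiff_iff_contDiffAt.2 fun p => ?_
    exact ContDiffAt.comp (g := hF.inv) p (hF.contDiffAt_inv (coe_ne_zero _))
      h.contDiff_lifted.contDiffAt
  injOn := fun _ hp _ hq hpq => h.injOn hp hq (hF.toHomeomorph.symm.injective hpq)
  orientation := by
    intro p hp
    have hor := h.orientation p hp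
    have hy : h.lifted p ≠ 0 := coe_ne_zero _
    have hd : HasFDerivAt hF.inv (fderiv ℝ hF.inv (h.lifted p)) (h.lifted p) :=
      ((hF.contDiffAt_inv hy).differentiableAt (by simp)).hasFDerivAt
    have hl : HasFDerivAt h.lifted (fderiv ℝ h.lifted p) p :=
      (h.contDiff_lifted.differentiable (by simp) _).hasFDerivAt
    have e : fderiv ℝ (fun p : ℝ × ℂ =>
        (hF.toHomeomorph.symm (h.toFun (Circle.exp p.1, p.2)) : ℍ[ℝ])) p =
        (fderiv ℝ hF.inv (h.lifted p)).comp (fderiv ℝ h.lifted p) := (hd.comp p hl).fderiv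
    have e' : (hF.toHomeomorph.symm (h.toFun (Circle.exp p.1, p.2)) : ℍ[ℝ]) =
        fderiv ℝ hF.inv (h.lifted p) (h.lifted p) := (hF.fderiv_inv_self hy).symm
    simp only [e, e', ContinuousLinearMap.comp_apply]
    -- All four rows are images under the derivative of the inverse, so the determinant is
    -- multiplied by a positive number.
    rw [quatDet_map]
    exact mul_pos (hF.det_fderiv_inv_pos hy) hor

theorem core_pullback (h : FramedKnot) {s : Set ℍ[ℝ]}
    (hs : (Subtype.val '' h.core : Set ℍ[ℝ]) = F '' s) :
    (Subtype.val '' (hF.pullback h).core : Set ℍ[ℝ]) = s := by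
  have h1 : (Subtype.val '' (hF.pullback h).core : Set ℍ[ℝ]) =
      hF.inv '' (Subtype.val '' h.core) := by
    rw [FramedKnot.core, FramedKnot.core, ← range_comp, ← range_comp, ← range_comp]
    rfl
  rw [h1, hs, ← image_comp, show hF.inv ∘ F = id from funext hF.inv_apply, image_id]

theorem openTube_pullback (h : FramedKnot) (x : Sphere3) :
    hF.toHomeomorph.symm x ∈ (hF.pullback h).openTube ↔ x ∈ h.openTube := by
  have : (hF.pullback h).openTube = hF.toHomeomorph.symm '' h.openTube :=
    image_comp hF.toHomeomorph.symm h.toFun _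
  rw [this, hF.toHomeomorph.symm.injective.mem_set_image]

/-- The exterior of the preimage of a framed knot. -/
def exteriorHomeomorph (h : FramedKnot) : h.Exterior ≃ₜ (hF.pullback h).Exterior :=
  hF.toHomeomorph.symm.subtype fun x => (hF.openTube_pullback h x).symm.not

/-- The isomorphism of knot groups. -/
def knotGroupEquiv (h : FramedKnot) : h.KnotGroup ≃* (hF.pullback h).KnotGroup :=
  MulEquiv.ofBijective (FundamentalGroup.map ⟨_, (hF.exteriorHomeomorph h).continuous⟩
    (h.boundary 1 1)) (by
    constructor
    · intro p q hpq
      obtain ⟨γ, rfl⟩ := Path.Homotopic.Quotient.mk_surjective p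
      obtain ⟨γ', rfl⟩ := Path.Homotopic.Quotient.mk_surjective q
      exact Path.Homotopic.Quotient.eq.2
        ((hF.exteriorHomeomorph h).toHomotopyEquiv.homotopic_of_map
          (Path.Homotopic.Quotient.eq.1 hpq))
    · intro p
      obtain ⟨γ, rfl⟩ := Path.Homotopic.Quotient.mk_surjective p
      obtain ⟨γ', hγ'⟩ := (hF.exteriorHomeomorph h).toHomotopyEquiv.exists_path_map_homotopic
        (x := h.boundary 1 1) (y := h.boundary 1 1) γ
      exact ⟨Path.Homotopic.Quotient.mk γ', Path.Homotopic.Quotient.eq.2 hγ'⟩)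

end IsOrientedSphereDiffeo

namespace FramedKnot

/-- The peripheral structure of the trefoil group. -/
theorem IsTrefoil.exists_equiv {h : FramedKnot} (hT : h.IsTrefoil) :
    ∃ (e : h.KnotGroup ≃* TrefoilGroup) (k : ℤ), e h.meridian = TrefoilGroup.a ∧
      e h.longitude = TrefoilGroup.fiber * TrefoilGroup.a ^ k := by
  obtain ⟨F, hF, hcore⟩ := hT
  obtain ⟨e, k, hm, hl⟩ := (hF.pullback h).exists_peripheral_equiv (hF.core_pullback h hcore)
  exact ⟨(hF.knotGroupEquiv h).trans e, k, hm, hl⟩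

/-- The exponent sum of `fiber` is 6 and that of a is 1, so the longitude has linking number 6 + k.
Conversely, in the abelianization `fiber` is the sixth power of a. -/
theorem hasFraming_iff {h : FramedKnot} {e : h.KnotGroup ≃* TrefoilGroup} {k : ℤ}
    (hm : e h.meridian = TrefoilGroup.a)
    (hl : e h.longitude = TrefoilGroup.fiber * TrefoilGroup.a ^ k) (n : ℤ) :
    h.HasFraming n ↔ k = n - 6 := by
  constructor
  · intro hn
    have h1 := congrArg (Abelianization.lift (TrefoilGroup.exponent.comp e.toMonoidHom)) hn
    simp only [map_zpow, Abelianization.lift_apply_of] at h1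
    change TrefoilGroup.exponent (e h.longitude) = TrefoilGroup.exponent (e h.meridian) ^ n at h1
    rw [hl, hm, map_mul, map_zpow, TrefoilGroup.exponent_a, TrefoilGroup.exponent_fiber,
      ← ofAdd_zsmul, ← ofAdd_zsmul, ← ofAdd_add] at h1
    have h2 := Multiplicative.ofAdd.injective h1
    simp only [smul_eq_mul, mul_one] at h2
    linarith
  · rintro rfl
    refine e.abelianizationCongr.injective ?_
    rw [map_zpow, abelianizationCongr_of, abelianizationCongr_of, hl, hm, map_mul, map_zpow,
      TrefoilGroup.abelianization_fiber, ← zpow_natCast, ← zpow_add]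
    congr 1
    push_cast
    ring

end FramedKnot

/-! ### A tubular neighbourhood of the trefoil -/

namespace TrefoilTube

/-- Coordinates around the trefoil, in `ℂ²`. -/
def tubeCoord (p : ℝ × ℂ) : ℂ × ℂ :=
  (Complex.exp ((2 * p.1 : ℝ) * Complex.I) * (Real.cos (Real.pi / 4 + p.2.re / 2) : ℝ),
    Complex.exp ((3 * p.1 + p.2.im / 2 : ℝ) * Complex.I) *
      (Real.sin (Real.pi / 4 + p.2.re / 2) : ℝ))

theorem tubeCoord_eq (t : ℝ) (v : ℂ) : tubeCoord (t, v) =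
    ((Circle.exp t : ℂ) ^ 2 * (Real.cos (Real.pi / 4 + v.re / 2) : ℝ),
      (Circle.exp t : ℂ) ^ 3 * Circle.exp (v.im / 2) *
        (Real.sin (Real.pi / 4 + v.re / 2) : ℝ)) := by
  simp only [tubeCoord, Circle.coe_exp, ← Complex.exp_nat_mul, ← Complex.exp_add]
  congr 3
  · push_cast
    ring_nf
  · push_cast
    ring_nf

theorem contDiff_tubeCoord : ContDiff ℝ ∞ tubeCoord := by
  have hre : ContDiff ℝ ∞ fun p : ℝ × ℂ => p.2.re := Complex.reCLM.contDiff.comp contDiff_snd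
  have him : ContDiff ℝ ∞ fun p : ℝ × ℂ => p.2.im := Complex.imCLM.contDiff.comp contDiff_snd
  have hof : ∀ {f : ℝ × ℂ → ℝ}, ContDiff ℝ ∞ f → ContDiff ℝ ∞ fun p => (f p : ℂ) := fun hf =>
    Complex.ofRealCLM.contDiff.comp hf
  refine ContDiff.prodMk (ContDiff.mul ?_ (hof ?_)) (ContDiff.mul ?_ (hof ?_))
  · exact ((hof (contDiff_const.mul contDiff_fst)).mul contDiff_const).cexp
  · exact (contDiff_const.add (hre.div_const 2)).cos
  · exact ((hof ((contDiff_const.mul contDiff_fst).add (him.div_const 2))).mul contDiff_const).cexp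
  · exact (contDiff_const.add (hre.div_const 2)).sin

theorem fderiv_apply_eq {E E' : Type*} [NormedAddCommGroup E] [NormedSpace ℝ E]
    [NormedAddCommGroup E'] [NormedSpace ℝ E'] {f : E → E'} {p w : E} {d : E'}
    (hf : DifferentiableAt ℝ f p) (hd : HasDerivAt (fun s : ℝ => f (p + s • w)) d 0) :
    fderiv ℝ f p w = d :=
  (hf.hasFDerivAt.hasLineDerivAt w).unique hd

theorem hasDerivAt_cexp_mul (a b : ℝ) (c : ℂ) :
    HasDerivAt (fun s : ℝ => Complex.exp ((a + b * s : ℝ) * Complex.I) * c)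
      (Complex.exp (a * Complex.I) * (b * Complex.I * c)) 0 := by
  have h1 : HasDerivAt (fun s : ℝ => ((a + b * s : ℝ) : ℂ)) ((b : ℝ) : ℂ) 0 := by
    have := ((hasDerivAt_id (0 : ℝ)).const_mul b).const_add a
    simpa using this.ofReal_comp
  have h2 := ((h1.mul_const Complex.I).cexp).mul_const c
  refine h2.congr_deriv ?_
  simp
  ring

theorem hasDerivAt_trig (a : ℝ) (c : ℂ) :
    HasDerivAt (fun s : ℝ => c * (Real.cos (a + s / 2) : ℝ)) (c * (-Real.sin a / 2 : ℝ)) 0 ∧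
    HasDerivAt (fun s : ℝ => c * (Real.sin (a + s / 2) : ℝ)) (c * (Real.cos a / 2 : ℝ)) 0 := by
  have h1 : HasDerivAt (fun s : ℝ => a + s / 2) (1 / 2) 0 :=
    ((hasDerivAt_id (0 : ℝ)).div_const 2).const_add a
  constructor
  · refine (h1.cos.ofReal_comp.const_mul c).congr_deriv ?_
    norm_num
    ring
  · refine (h1.sin.ofReal_comp.const_mul c).congr_deriv ?_
    norm_num
    left
    ring

theorem quatDet_tube (C S : ℝ) {u v : ℂ} (hu : ‖u‖ = 1) (hv : ‖v‖ = 1) :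
    quatDet (quatEquiv.symm (u * C, v * S))
      (quatEquiv.symm (u * ((2 : ℝ) * Complex.I * C), v * ((3 : ℝ) * Complex.I * S)))
      (quatEquiv.symm (u * (-S / 2 : ℝ), v * (C / 2 : ℝ)))
      (quatEquiv.symm (0, v * ((1 / 2 : ℝ) * Complex.I * S))) =
    C * S * (C ^ 2 + S ^ 2) / 2 := by
  have hn : ∀ {u : ℂ}, ‖u‖ = 1 → u.re ^ 2 + u.im ^ 2 = 1 := fun {u} hu => by
    have h1 := Complex.sq_norm u
    rw [hu, Complex.normSq_apply] at h1
    linarith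
  have e : ∀ p : ℂ × ℂ, quatEquiv.symm p = ⟨p.1.re, p.1.im, p.2.re, p.2.im⟩ := fun _ => rfl
  have key : ∀ a b c d : ℝ, a = 1 → b = 1 → a * b * c = d → c = d := by
    rintro a b c d rfl rfl h
    linarith
  symm
  refine key _ _ _ _ (hn hu) (hn hv) ?_
  simp only [quatDet, e, Matrix.det_succ_row_zero, Fin.sum_univ_succ]
  simp [Fin.succAbove]
  ring

theorem bounds {a : ℝ} (ha : |a| ≤ 1) : Real.pi / 4 + a / 2 ∈ Ioo 0 (Real.pi / 2) := by
  have := Real.pi_gt_three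
  have := abs_le.1 ha
  constructor <;> linarith

/-- The real part of v moves across the tori |z| = const, and the imaginary part rotates w. Up to
phases the determinant is CS/2, with C and S the cosine and sine of an angle in (0, π/2). -/
theorem orientation_tubeCoord (p : ℝ × ℂ) (hp : ‖p.2‖ ≤ 1) :
    0 < quatDet (quatEquiv.symm (tubeCoord p))
      (fderiv ℝ (fun p => quatEquiv.symm (tubeCoord p)) p (1, 0))
      (fderiv ℝ (fun p => quatEquiv.symm (tubeCoord p)) p (0, 1))
      (fderiv ℝ (fun p => quatEquiv.symm (tubeCoord p)) p (0, Complex.I)) := by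
  obtain ⟨t, v⟩ := p
  have hv : |v.re| ≤ 1 := (Complex.abs_re_le_norm v).trans hp
  have hdiff : DifferentiableAt ℝ (fun p => quatEquiv.symm (tubeCoord p)) (t, v) :=
    (quatEquiv.symm.contDiff.comp contDiff_tubeCoord).differentiable (by simp) _
  have hsymm : ∀ {f : ℝ → ℂ × ℂ} {d : ℂ × ℂ}, HasDerivAt f d 0 →
      HasDerivAt (fun s => quatEquiv.symm (f s)) (quatEquiv.symm d) 0 := fun hf =>
    quatEquiv.symm.hasFDerivAt.comp_hasDerivAt 0 hf
  set C := Real.cos (Real.pi / 4 + v.re / 2) with hC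
  set S := Real.sin (Real.pi / 4 + v.re / 2) with hS
  set u := Complex.exp ((2 * t : ℝ) * Complex.I) with hu
  set w := Complex.exp ((3 * t + v.im / 2 : ℝ) * Complex.I) with hw
  have e1 := fderiv_apply_eq (w := ((1 : ℝ), (0 : ℂ))) hdiff
    (d := quatEquiv.symm (u * ((2 : ℝ) * Complex.I * C), w * ((3 : ℝ) * Complex.I * S)))
    (hsymm (by
      convert (hasDerivAt_cexp_mul (2 * t) 2 C).prodMk
        (hasDerivAt_cexp_mul (3 * t + v.im / 2) 3 S) using 2 with s
      simp [tubeCoord, hC, hS]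
      ring_nf
      simp))
  have e2 := fderiv_apply_eq (w := ((0 : ℝ), (1 : ℂ))) hdiff
    (d := quatEquiv.symm (u * (-S / 2 : ℝ), w * (C / 2 : ℝ)))
    (hsymm (by
      convert (hasDerivAt_trig (Real.pi / 4 + v.re / 2) u).1.prodMk
        (hasDerivAt_trig (Real.pi / 4 + v.re / 2) w).2 using 2 with s
      simp [tubeCoord, hu, hw]
      ring_nf
      simp))
  have e3 := fderiv_apply_eq (w := ((0 : ℝ), Complex.I)) hdiff
    (d := quatEquiv.symm (0, w * ((1 / 2 : ℝ) * Complex.I * S)))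
    (hsymm (by
      convert (hasDerivAt_const (0 : ℝ) (u * C)).prodMk
        (hasDerivAt_cexp_mul (3 * t + v.im / 2) (1 / 2) S) using 2 with s
      simp [tubeCoord, hC, hS, hu]
      ring_nf
      simp))
  have hb := bounds hv
  have hCpos : 0 < C := Real.cos_pos_of_mem_Ioo ⟨by linarith [hb.1, Real.pi_pos], hb.2⟩
  have hSpos : 0 < S := Real.sin_pos_of_mem_Ioo ⟨hb.1, by linarith [hb.2, Real.pi_pos]⟩
  rw [e1, e2, e3, show tubeCoord (t, v) = (u * C, w * S) from rfl,
    quatDet_tube C S (Complex.norm_exp_ofReal_mul_I _) (Complex.norm_exp_ofReal_mul_I _)]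
  positivity

/-- The tube around the trefoil. -/
def tubeFun (p : Circle × ℂ) : ℂ × ℂ :=
  ((p.1 : ℂ) ^ 2 * (Real.cos (Real.pi / 4 + p.2.re / 2) : ℝ),
    (p.1 : ℂ) ^ 3 * Circle.exp (p.2.im / 2) * (Real.sin (Real.pi / 4 + p.2.re / 2) : ℝ))

theorem norm_tubeFun_fst (p : Circle × ℂ) :
    ‖(tubeFun p).1‖ = |Real.cos (Real.pi / 4 + p.2.re / 2)| := by
  rw [tubeFun, norm_mul, norm_pow, Circle.norm_coe, Complex.norm_real, one_pow, one_mul,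
    Real.norm_eq_abs]

theorem norm_tubeFun_snd (p : Circle × ℂ) :
    ‖(tubeFun p).2‖ = |Real.sin (Real.pi / 4 + p.2.re / 2)| := by
  rw [tubeFun, norm_mul, norm_mul, norm_pow, Circle.norm_coe, Circle.norm_coe, Complex.norm_real,
    one_pow, one_mul, one_mul, Real.norm_eq_abs]

theorem norm_tubeFun (p : Circle × ℂ) : ‖quatEquiv.symm (tubeFun p)‖ = 1 := by
  rw [← sq_eq_sq₀ (norm_nonneg _) zero_le_one, sq_norm_quat, quatEquiv.apply_symm_apply,
    norm_tubeFun_fst, norm_tubeFun_snd, sq_abs, sq_abs, Real.cos_sq_add_sin_sq, one_pow]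

/-- The norms give the real part of v. The first coordinate then gives x², and the quotient of the
two gives x e^{i Im v/2}. Comparing its square with x² yields e^{i Im v}, which determines Im v
since |Im v| ≤ 1; finally x follows. -/
theorem tubeFun_injOn : InjOn tubeFun {p | ‖p.2‖ ≤ 1} := by
  rintro ⟨x, v⟩ hv ⟨x', v'⟩ hv' heq
  have hpi := Real.pi_gt_three
  have re_le : |v.re| ≤ 1 := (Complex.abs_re_le_norm v).trans hv
  have re_le' : |v'.re| ≤ 1 := (Complex.abs_re_le_norm v').trans hv'
  have im_le := abs_le.1 ((Complex.abs_im_le_norm v).trans hv)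
  have im_le' := abs_le.1 ((Complex.abs_im_le_norm v').trans hv')
  have hb := bounds re_le
  have hb' := bounds re_le'
  have hC : 0 < Real.cos (Real.pi / 4 + v.re / 2) :=
    Real.cos_pos_of_mem_Ioo ⟨by linarith [hb.1], hb.2⟩
  have hC' : 0 < Real.cos (Real.pi / 4 + v'.re / 2) :=
    Real.cos_pos_of_mem_Ioo ⟨by linarith [hb'.1], hb'.2⟩
  have hS : 0 < Real.sin (Real.pi / 4 + v.re / 2) :=
    Real.sin_pos_of_mem_Ioo ⟨hb.1, by linarith [hb.2]⟩
  have hre : v.re = v'.re := by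
    have h1 := congrArg (fun p => ‖p.1‖) heq
    simp only [norm_tubeFun_fst, abs_of_pos hC, abs_of_pos hC'] at h1
    have h2 := Real.injOn_cos ⟨hb.1.le, by linarith [hb.2]⟩ ⟨hb'.1.le, by linarith [hb'.2]⟩ h1
    linarith
  have h1 : (x : ℂ) ^ 2 = x' ^ 2 := by
    have := congrArg Prod.fst heq
    simp only [tubeFun, ← hre] at this
    exact mul_right_cancel₀ (by exact_mod_cast hC.ne') this
  have h2 : (x : ℂ) ^ 3 * Circle.exp (v.im / 2) = x' ^ 3 * Circle.exp (v'.im / 2) := by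
    have := congrArg Prod.snd heq
    simp only [tubeFun, ← hre] at this
    exact mul_right_cancel₀ (by exact_mod_cast hS.ne') this
  have h3 : (x : ℂ) * Circle.exp (v.im / 2) = x' * Circle.exp (v'.im / 2) := by
    rw [pow_succ, pow_succ (x' : ℂ), h1, mul_assoc, mul_assoc] at h2
    exact mul_left_cancel₀ (pow_ne_zero 2 (Circle.coe_ne_zero _)) h2
  have h4 : Circle.exp (v.im) = Circle.exp (v'.im) := by
    apply Circle.coe_injective
    have e : ∀ b : ℝ, (Circle.exp b : ℂ) = Circle.exp (b / 2) ^ 2 := fun b => by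
      rw [← Circle.coe_pow, sq, ← Circle.exp_add, add_halves]
    rw [e v.im, e v'.im]
    have h5 : (x : ℂ) ^ 2 * (Circle.exp (v.im / 2) : ℂ) ^ 2 =
        x' ^ 2 * (Circle.exp (v'.im / 2) : ℂ) ^ 2 := by rw [← mul_pow, h3, mul_pow]
    rw [h1] at h5
    exact mul_left_cancel₀ (pow_ne_zero 2 (Circle.coe_ne_zero _)) h5
  have him : v.im = v'.im :=
    Circle.exp_injOn_Icc (a := -1) (b := 1) (by linarith) im_le im_le' h4
  rw [him] at h3
  have hx : x = x' := Circle.coe_injective (mul_right_cancel₀ (Circle.coe_ne_zero _) h3)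
  exact Prod.ext hx (Complex.ext hre him)

end TrefoilTube

namespace FramedKnot

open TrefoilTube

/-- A framed trefoil. -/
def trefoilTube : FramedKnot where
  toFun p := ⟨quatEquiv.symm (tubeFun p), mem_sphere_zero_iff_norm.2 (norm_tubeFun p)⟩
  smooth := by
    have e : (fun p : ℝ × ℂ => quatEquiv.symm (tubeFun (Circle.exp p.1, p.2))) =
        fun p => quatEquiv.symm (tubeCoord p) := funext fun p => by
      rw [show p = (p.1, p.2) from rfl, tubeCoord_eq, tubeFun]
    simp only [e]
    exact quatEquiv.symm.contDiff.comp contDiff_tubeCoord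
  injOn := fun _ hp _ hq hpq =>
    tubeFun_injOn hp hq (quatEquiv.symm.injective (congrArg Subtype.val hpq))
  orientation := by
    intro p hp
    have e : (fun p : ℝ × ℂ => quatEquiv.symm (tubeFun (Circle.exp p.1, p.2))) =
        fun p => quatEquiv.symm (tubeCoord p) := funext fun p => by
      rw [show p = (p.1, p.2) from rfl, tubeCoord_eq, tubeFun]
    have e' : quatEquiv.symm (tubeFun (Circle.exp p.1, p.2)) = quatEquiv.symm (tubeCoord p) :=
      congrFun e p
    simp only [e, e']
    exact orientation_tubeCoord p hp

theorem core_trefoilTube :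
    (Subtype.val '' trefoilTube.core : Set ℍ[ℝ]) = range trefoil := by
  have key : ∀ t : ℝ, (trefoilTube.toFun (Circle.exp t, 0) : ℍ[ℝ]) = trefoil t := by
    intro t
    refine quatEquiv.injective ?_
    rw [quatEquiv_trefoil]
    change quatEquiv (quatEquiv.symm _) = _
    rw [quatEquiv.apply_symm_apply, tubeFun, TrefoilCone.point]
    have hs : √2 / 2 = (√2)⁻¹ := by
      rw [div_eq_iff two_ne_zero, inv_mul_eq_div, eq_div_iff (by positivity)]
      exact Real.mul_self_sqrt zero_le_two
    have h2 : Circle.exp (2 * t) = Circle.exp t ^ 2 := by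
      rw [two_mul, Circle.exp_add, sq]
    have h3 : Circle.exp (3 * t + 0) = Circle.exp t ^ 3 := by
      rw [pow_succ, ← h2, ← Circle.exp_add]
      congr 1
      ring
    rw [h2, h3]
    simp only [Complex.zero_re, Complex.zero_im, zero_div, add_zero, Real.cos_pi_div_four,
      Real.sin_pi_div_four, hs, Circle.exp_zero, Circle.coe_one, one_mul, Circle.coe_pow, mul_comm]
  have hc : trefoilTube.core = range fun t : ℝ => trefoilTube.toFun (Circle.exp t, 0) :=
    (Circle.exp_surjective.range_comp (fun x : Circle => trefoilTube.toFun (x, 0))).symm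
  rw [hc, ← range_comp]
  exact congrArg range (funext key)

theorem isOrientedSphereDiffeo_id : IsOrientedSphereDiffeo id where
  bijective := Function.bijective_id
  norm_map _ := rfl
  map_smul _ _ _ := rfl
  contDiffOn := contDiffOn_id
  det_pos x _ := by
    rw [fderiv_id, ContinuousLinearMap.det, ContinuousLinearMap.coe_id, LinearMap.det_id]
    exact one_pos

theorem isTrefoil_trefoilTube : trefoilTube.IsTrefoil :=
  ⟨id, isOrientedSphereDiffeo_id, by rw [image_id, core_trefoilTube]⟩

end FramedKnot

/-! ### Twisting the framing -/

/-- A row operation followed by a rotation of the last two rows. -/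
theorem quatDet_shear (y d₁ d₂ d₃ : ℍ[ℝ]) (a b : ℝ) {c s : ℝ} (h : c ^ 2 + s ^ 2 = 1) :
    quatDet y (d₁ + (a • d₂ + b • d₃)) (c • d₂ + s • d₃) ((-s) • d₂ + c • d₃) =
      quatDet y d₁ d₂ d₃ := by
  have key : ∀ x y : ℝ, x = (c ^ 2 + s ^ 2) * y → x = y := by
    rintro x y hx
    rw [hx, h, one_mul]
  refine key _ _ ?_
  simp only [quatDet, Matrix.det_succ_row_zero, Fin.sum_univ_succ]
  simp [Fin.succAbove]
  ring

namespace FramedKnot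

variable (h : FramedKnot)

theorem exp_zpow (t : ℝ) (j : ℤ) : Circle.exp t ^ j = Circle.exp (j * t) := by
  rw [← zsmul_eq_mul]
  exact (map_zsmul Circle.expHom j t).symm

/-- The shear of the solid torus that twists the framing, in terms of the angle. -/
def shear (j : ℤ) (p : ℝ × ℂ) : ℝ × ℂ := (p.1, (Circle.exp (j * p.1) : ℂ) * p.2)

theorem contDiff_shear (j : ℤ) : ContDiff ℝ ∞ (shear j) := by
  have h1 : ContDiff ℝ ∞ fun p : ℝ × ℂ => ((j * p.1 : ℝ) : ℂ) :=
    Complex.ofRealCLM.contDiff.comp (contDiff_const.mul contDiff_fst)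
  have h2 : ContDiff ℝ ∞ fun p : ℝ × ℂ => (Circle.exp (j * p.1) : ℂ) := by
    simp only [Circle.coe_exp]
    exact (h1.mul contDiff_const).cexp
  exact contDiff_fst.prodMk (h2.mul contDiff_snd)

theorem norm_zpow_mul (x : Circle) (j : ℤ) (v : ℂ) : ‖((x ^ j : Circle) : ℂ) * v‖ = ‖v‖ := by
  rw [norm_mul, Circle.norm_coe, one_mul]

theorem lifted_shear (j : ℤ) (p : ℝ × ℂ) :
    (h.toFun (Circle.exp p.1, ((Circle.exp p.1 ^ j : Circle) : ℂ) * p.2) : ℍ[ℝ]) =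
      h.lifted (shear j p) := by
  rw [exp_zpow]
  rfl

/-- The derivative of the shear rotates the disc directions by e^{ijt} and adds to the direction of
t a vector along the disc. -/
theorem orientation_shear (j : ℤ) (p : ℝ × ℂ) (hp : ‖p.2‖ ≤ 1) :
    0 < quatDet (h.lifted (shear j p)) (fderiv ℝ (fun p => h.lifted (shear j p)) p (1, 0))
      (fderiv ℝ (fun p => h.lifted (shear j p)) p (0, 1))
      (fderiv ℝ (fun p => h.lifted (shear j p)) p (0, Complex.I)) := by
  obtain ⟨t, v⟩ := p
  set D := fderiv ℝ h.lifted (shear j (t, v)) with hD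
  have hl : HasFDerivAt h.lifted D (shear j (t, v)) :=
    (h.contDiff_lifted.differentiable (by simp) _).hasFDerivAt
  have hs : HasFDerivAt (shear j) (fderiv ℝ (shear j) (t, v)) (t, v) :=
    ((contDiff_shear j).differentiable (by simp) _).hasFDerivAt
  have e : fderiv ℝ (fun p => h.lifted (shear j p)) (t, v) =
      D.comp (fderiv ℝ (shear j) (t, v)) := (hl.comp (t, v) hs).fderiv
  set c := Real.cos (j * t) with hc
  set s := Real.sin (j * t) with hs'
  have hexp : (Circle.exp (j * t) : ℂ) = ⟨c, s⟩ := by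
    rw [Circle.coe_exp]
    exact Complex.ext (Complex.exp_ofReal_mul_I_re _) (Complex.exp_ofReal_mul_I_im _)
  have e1 : ∃ z : ℂ, fderiv ℝ (shear j) (t, v) (1, 0) = (1, z) := by
    have h1 := (hasFDerivAt_fst.comp (t, v) hs).fderiv
    have h2 : fderiv ℝ (Prod.fst ∘ shear j) (t, v) = ContinuousLinearMap.fst ℝ ℝ ℂ :=
      fderiv_fst
    rw [h2] at h1
    refine ⟨(fderiv ℝ (shear j) (t, v) (1, 0)).2, Prod.ext ?_ rfl⟩
    exact (DFunLike.congr_fun h1 ((1 : ℝ), (0 : ℂ))).symm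
  have e2 : ∀ z : ℂ, fderiv ℝ (shear j) (t, v) (0, z) = (0, (⟨c, s⟩ : ℂ) * z) := by
    intro z
    refine TrefoilTube.fderiv_apply_eq hs.differentiableAt ?_
    have h1 : HasDerivAt (fun r : ℝ => (⟨c, s⟩ : ℂ) * (v + r * z)) ((⟨c, s⟩ : ℂ) * z) 0 := by
      have := (((hasDerivAt_id (0 : ℝ)).ofReal_comp.mul_const z).const_add v).const_mul (⟨c, s⟩ : ℂ)
      simpa using this
    refine ((hasDerivAt_const (0 : ℝ) t).prodMk h1).congr_of_eventuallyEq
      (Filter.Eventually.of_forall fun r => ?_)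
    simp only [shear, Prod.smul_mk, Prod.mk_add_mk, smul_zero, add_zero, hexp, Complex.real_smul]
  obtain ⟨z, hz⟩ := e1
  have split : ∀ (r : ℝ) (w : ℂ), D (r, w) = r • D (1, 0) + (w.re • D (0, 1) +
      w.im • D (0, Complex.I)) := by
    intro r w
    rw [← map_smul, ← map_smul, ← map_smul, ← map_add, ← map_add]
    congr 1
    refine Prod.ext (by simp) (Complex.ext ?_ ?_) <;> simp
  have hor := h.orientation (shear j (t, v)) (by
    change ‖(Circle.exp (j * t) : ℂ) * v‖ ≤ 1
    rw [norm_mul, Circle.norm_coe, one_mul]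
    exact hp)
  have r1 : D.comp (fderiv ℝ (shear j) (t, v)) (1, 0) =
      D (1, 0) + (z.re • D (0, 1) + z.im • D (0, Complex.I)) := by
    rw [ContinuousLinearMap.comp_apply, hz, split, one_smul]
  have r2 : D.comp (fderiv ℝ (shear j) (t, v)) (0, 1) = c • D (0, 1) + s • D (0, Complex.I) := by
    rw [ContinuousLinearMap.comp_apply, e2, mul_one, split, zero_smul, zero_add]
  have r3 : D.comp (fderiv ℝ (shear j) (t, v)) (0, Complex.I) =
      (-s) • D (0, 1) + c • D (0, Complex.I) := by
    rw [ContinuousLinearMap.comp_apply, e2, split, zero_smul, zero_add]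
    simp
  rw [e, r1, r2, r3, quatDet_shear _ _ _ _ _ _ (Real.cos_sq_add_sin_sq _)]
  exact hor

/-- The framed knot with the same core and the framing twisted `j` times. -/
def twist (j : ℤ) : FramedKnot where
  toFun p := h.toFun (p.1, ((p.1 ^ j : Circle) : ℂ) * p.2)
  smooth := by
    simp only [h.lifted_shear]
    exact h.contDiff_lifted.comp (contDiff_shear j)
  injOn := by
    rintro ⟨x, v⟩ hv ⟨x', v'⟩ hv' heq
    have h1 := h.injOn (show ‖_‖ ≤ 1 by rw [norm_zpow_mul]; exact hv)
      (show ‖_‖ ≤ 1 by rw [norm_zpow_mul]; exact hv') heq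
    obtain rfl : x = x' := congrArg Prod.fst h1
    exact Prod.ext rfl (mul_left_cancel₀ (Circle.coe_ne_zero _) (congrArg Prod.snd h1))
  orientation := by
    intro p hp
    simp only [h.lifted_shear]
    exact h.orientation_shear j p hp

theorem core_twist (j : ℤ) : (h.twist j).core = h.core := by
  simp only [core, twist, mul_zero]

theorem openTube_twist (j : ℤ) : (h.twist j).openTube = h.openTube := by
  ext x
  constructor
  · rintro ⟨⟨y, v⟩, hv, rfl⟩
    refine ⟨(y, ((y ^ j : Circle) : ℂ) * v), ?_, rfl⟩
    change ‖_‖ < 1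
    rw [norm_zpow_mul]
    exact hv
  · rintro ⟨⟨y, v⟩, hv, rfl⟩
    refine ⟨(y, ((y ^ (-j) : Circle) : ℂ) * v), ?_, ?_⟩
    · change ‖_‖ < 1
      rw [norm_zpow_mul]
      exact hv
    · simp only [twist]
      rw [← mul_assoc, ← Circle.coe_mul, ← zpow_add, add_neg_cancel, zpow_zero, Circle.coe_one,
        one_mul]

theorem IsTrefoil.twist {h : FramedKnot} (hT : h.IsTrefoil) (j : ℤ) : (h.twist j).IsTrefoil := by
  obtain ⟨F, hF, hc⟩ := hT
  exact ⟨F, hF, by rw [core_twist, hc]⟩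

/-- The universal covering of the boundary torus. -/
def torusMap : C(ℝ × ℝ, h.Exterior) :=
  ⟨fun p => h.boundary (Circle.exp p.1) (Circle.exp p.2), Continuous.subtype_mk
    (h.continuous_toFun.comp (f := fun p : ℝ × ℝ => (Circle.exp p.1, (Circle.exp p.2 : ℂ)))
      (by fun_prop)) _⟩

theorem continuous_boundary : Continuous fun p : Circle × Circle => h.boundary p.1 p.2 :=
  Continuous.subtype_mk (h.continuous_toFun.comp
    (f := fun p : Circle × Circle => (p.1, (p.2 : ℂ))) (by fun_prop)) _

/-- The loop that runs `j` times along the meridian. -/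
def meridianPow (j : ℤ) : Path (h.boundary 1 1) (h.boundary 1 1) where
  toFun s := h.boundary 1 (Circle.exp (j * (2 * Real.pi * s)))
  continuous_toFun := h.continuous_boundary.comp
    (f := fun s : I => ((1 : Circle), Circle.exp (j * (2 * Real.pi * s)))) (by fun_prop)
  source' := by simp
  target' := by simp

theorem meridianPow_one : h.meridianPow 1 = h.meridianPath := by
  ext1
  funext s
  change h.boundary _ _ = h.boundary _ _
  simp

theorem meridianPow_neg_one : h.meridianPow (-1) = h.meridianPath.symm := by
  ext1
  funext s
  change h.boundary _ _ = h.boundary _ _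
  congr 1
  rw [Circle.exp_eq_exp]
  refine ⟨-1, ?_⟩
  rw [unitInterval.coe_symm_eq]
  push_cast
  ring

/-- The longitude of the twisted framing. -/
def twistedPath (j : ℤ) : Path (h.boundary 1 1) (h.boundary 1 1) where
  toFun s := h.boundary (Circle.exp (2 * Real.pi * s)) (Circle.exp (j * (2 * Real.pi * s)))
  continuous_toFun := h.continuous_boundary.comp
    (f := fun s : I => (Circle.exp (2 * Real.pi * s), Circle.exp (j * (2 * Real.pi * s))))
    (by fun_prop)
  source' := by simp
  target' := by simp

/-- In the universal covering of the torus one path is the diagonal of a rectangle, the other runs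
along two sides; their end points agree. The minimum and the maximum parametrize the two sides in
one formula. -/
theorem twistedPath_homotopic (j : ℤ) :
    (h.twistedPath j).Homotopic (h.longitudePath.trans (h.meridianPow j)) := by
  refine Path.homotopic_of_lift h.torusMap
    (g := fun s : I => (2 * Real.pi * s, j * (2 * Real.pi * s)))
    (g' := fun s : I => (2 * Real.pi * min (1 : ℝ) (2 * (s : ℝ)),
      j * (2 * Real.pi * max (0 : ℝ) (2 * (s : ℝ) - 1))))
    (by fun_prop) (by fun_prop) (fun t => rfl) (fun t => ?_) ?_ ?_
  · rw [Path.trans_apply]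
    split_ifs with ht
    · rw [min_eq_right (by linarith), max_eq_left (by linarith)]
      change h.boundary _ _ = h.boundary _ _
      simp
    · rw [not_le] at ht
      rw [min_eq_left (by linarith), max_eq_right (by linarith)]
      change h.boundary _ _ = h.boundary _ _
      simp
  · simp
  · norm_num

/-- The identification of the exteriors. -/
def toTwist (j : ℤ) : C(h.Exterior, (h.twist j).Exterior) :=
  ⟨fun x => ⟨x.1, by rw [openTube_twist]; exact x.2⟩, by fun_prop⟩

theorem toTwist_boundary (j : ℤ) (x y : Circle) :
    h.toTwist j (h.boundary x (x ^ j * y)) = (h.twist j).boundary x y :=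
  Subtype.ext (congrArg (fun v => h.toFun (x, v)) (Circle.coe_mul _ _))

theorem toTwist_base (j : ℤ) :
    h.toTwist j (h.boundary 1 1) = (h.twist j).boundary 1 1 := by
  rw [← toTwist_boundary, one_zpow, one_mul]

/-- Both framed knots have the same exterior and meridian, and the new longitude is the old one
times the j-th power of the meridian. The premise `hj` about the loop running j times is needed only
for j = ±1, where it is immediate. -/
theorem hasFraming_twist {n : ℤ} (hn : h.HasFraming n) {j : ℤ}
    (hj : FundamentalGroup.fromPath (Path.Homotopic.Quotient.mk (h.meridianPow j)) =
      h.meridian ^ j) : (h.twist j).HasFraming (n + j) := by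
  set φ := FundamentalGroup.mapOfEq (h.toTwist j) (h.toTwist_base j) with hφ
  have hm : φ h.meridian = (h.twist j).meridian := by
    rw [hφ, FundamentalGroup.mapOfEq_apply]
    refine congrArg Path.Homotopic.Quotient.mk ?_
    ext1
    funext s
    refine ((h.toTwist_boundary j 1 _).symm.trans ?_).symm
    rw [one_zpow, one_mul]
    rfl
  have hl : φ (FundamentalGroup.fromPath (Path.Homotopic.Quotient.mk (h.twistedPath j))) =
      (h.twist j).longitude := by
    rw [hφ, FundamentalGroup.mapOfEq_apply]
    refine congrArg Path.Homotopic.Quotient.mk ?_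
    ext1
    funext s
    refine ((h.toTwist_boundary j _ 1).symm.trans ?_).symm
    rw [exp_zpow, mul_one]
    rfl
  have ht : FundamentalGroup.fromPath (Path.Homotopic.Quotient.mk (h.twistedPath j)) =
      h.meridian ^ j * h.longitude := by
    rw [← hj]
    exact Path.Homotopic.Quotient.eq.2 (h.twistedPath_homotopic j)
  rw [HasFraming, ← hl, ← hm, ht, ← Abelianization.map_of, ← Abelianization.map_of, map_mul,
    map_zpow, show Abelianization.of h.longitude = _ from hn, ← zpow_add, map_zpow, add_comm]

/-- The framing number of the explicit tube need not be computed: it is some integer, and single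
twists in both directions reach every other. -/
theorem exists_hasFraming (n : ℤ) : ∃ h : FramedKnot, h.IsTrefoil ∧ h.HasFraming n := by
  obtain ⟨e, k, hm, hl⟩ := isTrefoil_trefoilTube.exists_equiv
  have h0 : ∃ h : FramedKnot, h.IsTrefoil ∧ h.HasFraming (k + 6) :=
    ⟨_, isTrefoil_trefoilTube, (hasFraming_iff hm hl _).2 (by ring)⟩
  have key : ∀ i : ℤ, ∃ h : FramedKnot, h.IsTrefoil ∧ h.HasFraming (k + 6 + i) := by
    intro i
    induction i using Int.induction_on with
    | zero => simpa using h0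
    | succ i ih =>
      obtain ⟨h, hT, hn⟩ := ih
      refine ⟨h.twist 1, hT.twist 1, ?_⟩
      rw [← add_assoc]
      exact h.hasFraming_twist hn (by rw [meridianPow_one, zpow_one]; rfl)
    | pred i ih =>
      obtain ⟨h, hT, hn⟩ := ih
      refine ⟨h.twist (-1), hT.twist (-1), ?_⟩
      rw [sub_eq_add_neg, ← add_assoc]
      exact h.hasFraming_twist hn (by rw [meridianPow_neg_one, zpow_neg_one]; rfl)
  simpa using key (n - (k + 6))

end FramedKnot

/-! ### Gauge transformations -/

namespace PathRep

variable {X G : Type*} [TopologicalSpace X] [Group G]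

/-- The change of a representation by a family of group elements. -/
def gauge (R : PathRep X G) (A : X → G) : PathRep X G where
  val {x y} γ := A y * R.val γ * (A x)⁻¹
  map_homotopic h := by rw [R.map_homotopic h]
  map_trans γ γ' := by
    rw [R.map_trans]
    group

theorem gauge_apply (R : PathRep X G) (A : X → G) {x y : X} (γ : Path x y) :
    (R.gauge A).val γ = A y * R.val γ * (A x)⁻¹ := rfl

/-- A representation is determined by its values on loops and on a family of paths. -/
theorem eq_gauge_ofSections (R : PathRep X G) {x₀ : X} (c : ∀ x, Path x₀ x) {x y : X}
    (γ : Path x y) : R.val γ =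
      R.val (c y) * R.toHom x₀ ((ofSections c).val γ) * (R.val (c x))⁻¹ := by
  rw [ofSections_apply, toHom_mk, R.map_trans, R.map_trans, R.map_symm]
  group

end PathRep

/-! ### Representations that are trivial on the longitude -/

namespace FramedKnot

open TrefoilCone

variable (h : FramedKnot) {G : Type*} [Group G] (R : PathRep h.Exterior G)

/-- The value of a representation on a path in the boundary torus. -/
def torusVal (v w : ℝ × ℝ) : G := (R.comap h.torusMap).val (segmentPath v w)

theorem comap_torusMap_val {v w : ℝ × ℝ} (δ : Path v w) :
    (R.comap h.torusMap).val δ = h.torusVal R v w :=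
  (R.comap h.torusMap).map_homotopic (SimplyConnectedSpace.paths_homotopic _ _)

theorem torusVal_mul (u v w : ℝ × ℝ) : h.torusVal R v w * h.torusVal R u v = h.torusVal R u w := by
  rw [torusVal, torusVal, ← PathRep.map_trans, comap_torusMap_val]

theorem torusVal_self (v : ℝ × ℝ) : h.torusVal R v v = 1 := by
  have := h.torusVal_mul R v v v
  rwa [mul_eq_right] at this

theorem torusMap_eq_iff {v w : ℝ × ℝ} : h.torusMap v = h.torusMap w ↔
    ∃ i j : ℤ, v = w + (i * (2 * Real.pi), j * (2 * Real.pi)) := by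
  constructor
  · intro hvw
    have h1 : h.toFun (Circle.exp v.1, (Circle.exp v.2 : ℂ)) =
        h.toFun (Circle.exp w.1, (Circle.exp w.2 : ℂ)) := congrArg Subtype.val hvw
    have h2 := h.injOn (Circle.norm_coe _).le (Circle.norm_coe _).le h1
    obtain ⟨i, hi⟩ := Circle.exp_eq_exp.1 (congrArg Prod.fst h2)
    obtain ⟨j, hj⟩ := Circle.exp_eq_exp.1 (Circle.coe_injective (congrArg Prod.snd h2))
    exact ⟨i, j, Prod.ext hi hj⟩
  · rintro ⟨i, j, rfl⟩
    change h.boundary _ _ = h.boundary _ _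
    congr 1
    · exact Circle.exp_eq_exp.2 ⟨i, rfl⟩
    · exact Circle.exp_eq_exp.2 ⟨j, rfl⟩

theorem torusVal_add (v w : ℝ × ℝ) (i j : ℤ) :
    h.torusVal R (v + (i * (2 * Real.pi), j * (2 * Real.pi)))
      (w + (i * (2 * Real.pi), j * (2 * Real.pi))) = h.torusVal R v w := by
  refine R.congr_path _ _ fun t => h.torusMap_eq_iff.2 ⟨i, j, ?_⟩
  rw [segmentPath_apply, segmentPath_apply, add_sub_add_right_eq_sub]
  abel

variable {R}

/-- A longitude based at another point is conjugate to the standard one through a path and its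
translate, which have equal values. -/
theorem torusVal_longitude (hR : R.val h.longitudePath = 1) (v : ℝ × ℝ) (n : ℤ) :
    h.torusVal R v (v + (n * (2 * Real.pi), 0)) = 1 := by
  have h0 : h.torusVal R 0 (2 * Real.pi, 0) = 1 := by
    rw [← hR]
    refine R.congr_path _ _ fun t => ?_
    change h.boundary _ _ = h.boundary _ _
    simp [segmentPath_apply, mul_comm]
  have h1 : ∀ v : ℝ × ℝ, h.torusVal R v (v + (2 * Real.pi, 0)) = 1 := by
    intro v
    have e := h.torusVal_add R 0 v 1 0
    simp only [Int.cast_one, one_mul, Int.cast_zero, zero_mul, zero_add] at e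
    rw [← h.torusVal_mul R v (2 * Real.pi, 0), e, ← h.torusVal_mul R v 0, h0, one_mul,
      torusVal_mul, torusVal_self]
  induction n using Int.induction_on with
  | zero =>
    rw [Int.cast_zero, zero_mul, Prod.mk_zero_zero, add_zero]
    exact h.torusVal_self R v
  | succ n ih =>
    have e : v + ((((n : ℤ) + 1 : ℤ) : ℝ) * (2 * Real.pi), (0 : ℝ)) =
        v + (((n : ℤ) : ℝ) * (2 * Real.pi), 0) + (2 * Real.pi, 0) := by
      refine Prod.ext ?_ ?_
      · simp
        ring
      · simp
    rw [e, ← h.torusVal_mul R v (v + (((n : ℤ) : ℝ) * (2 * Real.pi), 0)), h1, ih, one_mul]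
  | pred n ih =>
    have e : v + (((-(n : ℤ) : ℤ) : ℝ) * (2 * Real.pi), (0 : ℝ)) =
        v + (((-(n : ℤ) - 1 : ℤ) : ℝ) * (2 * Real.pi), 0) + (2 * Real.pi, 0) := by
      refine Prod.ext ?_ ?_
      · simp
        ring
      · simp
    rw [e, ← h.torusVal_mul R v (v + (((-(n : ℤ) - 1 : ℤ) : ℝ) * (2 * Real.pi), 0)), h1,
      one_mul] at ih
    exact ih

/-- Two lifts of a point differ by a deck translation, and the paths to the line ξ = 0 differ by a
translation and a multiple of the longitude, which has value 1. -/
theorem torusVal_eq_of_torusMap_eq (hR : R.val h.longitudePath = 1) {v w : ℝ × ℝ}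
    (hvw : h.torusMap v = h.torusMap w) :
    h.torusVal R v (0, v.2) = h.torusVal R w (0, w.2) := by
  obtain ⟨i, j, rfl⟩ := h.torusMap_eq_iff.1 hvw
  have e := h.torusVal_add R w (0, w.2) i j
  have e' : (0, w.2) + ((i : ℝ) * (2 * Real.pi), (j : ℝ) * (2 * Real.pi)) =
      ((0 : ℝ), (w + ((i : ℝ) * (2 * Real.pi), (j : ℝ) * (2 * Real.pi))).2) +
        ((i : ℝ) * (2 * Real.pi), 0) := by
    refine Prod.ext ?_ ?_ <;> simp
  rw [e', ← h.torusVal_mul R _ (0, (w + ((i : ℝ) * (2 * Real.pi), (j : ℝ) * (2 * Real.pi))).2),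
    h.torusVal_longitude hR, one_mul] at e
  exact e

open Classical in
/-- A representation that is trivial on the longitude is, after a change of gauge, independent of
the longitudinal coordinate on the boundary torus. -/
theorem exists_gauge (hR : R.val h.longitudePath = 1) : ∃ A : h.Exterior → G,
    ∀ {x x' y : I → Circle}, Continuous x → Continuous x' → Continuous y →
    ∀ {p q p' q' : h.Exterior} (γ : Path p q) (γ' : Path p' q'),
      (∀ t, γ t = h.boundary (x t) (y t)) → (∀ t, γ' t = h.boundary (x' t) (y t)) →
      (R.gauge A).val γ = (R.gauge A).val γ' := by
  -- At a point of the torus, the value of the path to the line ξ = 0 in the longitudinal direction,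
  -- for any lift. Off the torus the gauge is irrelevant and set to 1.
  set A : h.Exterior → G := fun e => if he : ∃ v, h.torusMap v = e then
    h.torusVal R he.choose (0, he.choose.2) else 1 with hA
  have hA' : ∀ v, A (h.torusMap v) = h.torusVal R v (0, v.2) := by
    intro v
    have he : ∃ w, h.torusMap w = h.torusMap v := ⟨v, rfl⟩
    rw [hA]
    simp only [dif_pos he]
    exact h.torusVal_eq_of_torusMap_eq hR he.choose_spec
  -- After the change of gauge, only the meridional angle φ at the two ends matters.
  have key : ∀ {ξ φ : I → ℝ}, Continuous ξ → Continuous φ → ∀ {p q : h.Exterior} (γ : Path p q),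
      (∀ t, γ t = h.boundary (Circle.exp (ξ t)) (Circle.exp (φ t))) →
      (R.gauge A).val γ = h.torusVal R (0, φ 0) (0, φ 1) := by
    intro ξ φ hξ hφ p q γ hγ
    have hp : p = h.torusMap (ξ 0, φ 0) := by rw [← γ.source, hγ]; rfl
    have hq : q = h.torusMap (ξ 1, φ 1) := by rw [← γ.target, hγ]; rfl
    have hv : R.val γ = h.torusVal R (ξ 0, φ 0) (ξ 1, φ 1) := by
      rw [← h.comap_torusMap_val R (⟨⟨fun t => (ξ t, φ t), by fun_prop⟩, rfl, rfl⟩ :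
        Path (ξ 0, φ 0) (ξ 1, φ 1))]
      exact R.congr_path _ _ hγ
    rw [PathRep.gauge_apply, hv, hp, hq, hA', hA', torusVal_mul,
      ← h.torusVal_mul R (ξ 0, φ 0) (0, φ 0) (0, φ 1), mul_inv_cancel_right]
  have lift : ∀ {x : I → Circle}, Continuous x → ∃ ξ : I → ℝ, Continuous ξ ∧
      ∀ t, x t = Circle.exp (ξ t) := fun {x} hx =>
    Circle.exists_lift (⟨⟨x, hx⟩, rfl, rfl⟩ : Path (x 0) (x 1))
  refine ⟨A, fun {x x' y} hx hx' hy {p q p' q'} γ γ' hγ hγ' => ?_⟩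
  obtain ⟨ξ, hξ, hξx⟩ := lift hx
  obtain ⟨ξ', hξ', hξx'⟩ := lift hx'
  obtain ⟨φ, hφ, hφy⟩ := lift hy
  rw [key hξ hφ γ fun t => by rw [hγ, hξx, hφy], key hξ' hφ γ' fun t => by rw [hγ', hξx', hφy]]

end FramedKnot

/-! ### The topology of the surgered manifold -/

namespace FramedKnot

variable (h : FramedKnot)

/-- The inclusion of the exterior. -/
def inclExt : C(h.Exterior, h.Surgery) :=
  ⟨fun e => Quot.mk _ (Sum.inl e), continuous_quot_mk.comp continuous_inl⟩

/-- The inclusion of the glued solid torus. -/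
def inclTorus : C(Disc × Circle, h.Surgery) :=
  ⟨fun p => Quot.mk _ (Sum.inr p), continuous_quot_mk.comp continuous_inr⟩

theorem inclExt_boundary (x y : Circle) :
    h.inclExt (h.boundary x y) = h.inclTorus (circleToDisc x, y) := Quot.sound (.glue x y)

theorem surgery_cases {P : h.Surgery → Prop} (h1 : ∀ e, P (h.inclExt e))
    (h2 : ∀ p, P (h.inclTorus p)) (x : h.Surgery) : P x := by
  induction x using Quot.inductionOn with
  | _ s => rcases s with e | p <;> [exact h1 e; exact h2 p]

/-- The function on the surgered manifold given by compatible functions on the pieces. -/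
def surgeryLift {Z : Type*} (f : h.Exterior → Z) (g : Disc × Circle → Z)
    (hfg : ∀ x y, f (h.boundary x y) = g (circleToDisc x, y)) : h.Surgery → Z :=
  Quot.lift (Sum.elim f g) (by
    rintro _ _ ⟨x, y⟩
    exact hfg x y)

/-- The quotient topology reduces continuity on an open set to continuity on its preimage, and both
summands are open there. -/
theorem continuousOn_surgery {Z : Type*} [TopologicalSpace Z] {g : h.Surgery → Z}
    {s : Set h.Surgery} (hs : IsOpen s)
    (h1 : ∀ e, h.inclExt e ∈ s → ContinuousAt (fun e => g (h.inclExt e)) e)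
    (h2 : ∀ p, h.inclTorus p ∈ s → ContinuousAt (fun p => g (h.inclTorus p)) p) :
    ContinuousOn g s := by
  rw [isQuotientMap_quot_mk.continuousOn_isOpen_iff hs]
  rintro (e | p) hx
  · exact (Topology.IsOpenEmbedding.inl.continuousAt_iff.1 (h1 e hx)).continuousWithinAt
  · exact (Topology.IsOpenEmbedding.inr.continuousAt_iff.1 (h2 p hx)).continuousWithinAt

/-- The distance from the core of the glued solid torus. -/
def radius : h.Surgery → ℝ :=
  h.surgeryLift (fun _ => 1) (fun p => ‖(p.1 : ℂ)‖) fun x _ => (Circle.norm_coe x).symm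

theorem radius_inclExt (e : h.Exterior) : h.radius (h.inclExt e) = 1 := rfl

theorem radius_inclTorus (p : Disc × Circle) : h.radius (h.inclTorus p) = ‖(p.1 : ℂ)‖ := rfl

theorem continuous_radius : Continuous h.radius := by
  rw [← continuousOn_univ]
  refine h.continuousOn_surgery isOpen_univ (fun e _ => continuousAt_const) fun p _ => ?_
  exact (continuous_norm.comp (continuous_subtype_val.comp continuous_fst)).continuousAt

/-- The complement of the core of the glued solid torus. -/
def outerPart : Set h.Surgery := {x | h.radius x ≠ 0}

/-- The interior of the glued solid torus. -/
def innerPart : Set h.Surgery := {x | h.radius x < 1}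

theorem isOpen_outerPart : IsOpen h.outerPart := isOpen_ne_fun h.continuous_radius continuous_const

theorem isOpen_innerPart : IsOpen h.innerPart := isOpen_lt h.continuous_radius continuous_const

theorem mem_outerPart_or_innerPart (x : h.Surgery) : x ∈ h.outerPart ∨ x ∈ h.innerPart := by
  by_cases hx : h.radius x = 0
  · exact .inr (show h.radius x < 1 by rw [hx]; exact one_pos)
  · exact .inl hx

theorem inclExt_mem_outerPart (e : h.Exterior) : h.inclExt e ∈ h.outerPart :=
  show h.radius (h.inclExt e) ≠ 0 by rw [radius_inclExt]; exact one_ne_zero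

theorem inclTorus_mem_outerPart {p : Disc × Circle} :
    h.inclTorus p ∈ h.outerPart ↔ (p.1 : ℂ) ≠ 0 :=
  show h.radius (h.inclTorus p) ≠ 0 ↔ _ by rw [radius_inclTorus, norm_ne_zero_iff]

theorem inclExt_notMem_innerPart (e : h.Exterior) : h.inclExt e ∉ h.innerPart :=
  show ¬ h.radius (h.inclExt e) < 1 by rw [radius_inclExt]; exact lt_irrefl 1

theorem phase_coe_circle (x : Circle) : phase (x : ℂ) = x := phase_coe x

/-- The radial retraction to the exterior. -/
def retr : h.Surgery → h.Exterior :=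
  h.surgeryLift id (fun p => h.boundary (phase p.1) p.2) fun x y => by
    rw [circleToDisc, phase_coe_circle]
    rfl

theorem retr_inclTorus (p : Disc × Circle) :
    h.retr (h.inclTorus p) = h.boundary (phase p.1) p.2 := rfl

theorem continuousOn_retr : ContinuousOn h.retr h.outerPart := by
  refine h.continuousOn_surgery h.isOpen_outerPart (fun e _ => continuousAt_id) fun p hp => ?_
  rw [inclTorus_mem_outerPart] at hp
  refine h.continuous_boundary.continuousAt.comp (f := fun p : Disc × Circle => (phase p.1, p.2))
    (ContinuousAt.prodMk ?_ continuousAt_snd)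
  exact (continuousAt_phase hp).comp_of_eq (f := fun p : Disc × Circle => (p.1 : ℂ))
    (by fun_prop) rfl

/-- The disc coordinate in the glued solid torus. -/
def discCoord : h.Surgery → Disc :=
  h.surgeryLift (fun e => circleToDisc (h.coord e).1) Prod.fst fun x y => by
    rw [boundary, h.coord_toFun (show ‖(y : ℂ)‖ ≤ 1 from y.norm_coe.le)]

/-- The circle coordinate in the glued solid torus. -/
def circleCoord : h.Surgery → Circle :=
  h.surgeryLift (fun e => phase (h.coord e).2) Prod.snd fun x y => by
    rw [boundary, h.coord_toFun (show ‖(y : ℂ)‖ ≤ 1 from y.norm_coe.le), phase_coe_circle]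

/-- The values on the exterior were chosen only to match on the boundary torus; the interior of the
solid torus does not meet it. -/
theorem continuousOn_discCoord : ContinuousOn h.discCoord h.innerPart :=
  h.continuousOn_surgery h.isOpen_innerPart (fun e he => absurd he (h.inclExt_notMem_innerPart e))
    fun _ _ => continuousAt_fst

theorem continuousOn_circleCoord : ContinuousOn h.circleCoord h.innerPart :=
  h.continuousOn_surgery h.isOpen_innerPart (fun e he => absurd he (h.inclExt_notMem_innerPart e))
    fun _ _ => continuousAt_snd

theorem inclTorus_coord {x : h.Surgery} (hx : x ∈ h.innerPart) :
    h.inclTorus (h.discCoord x, h.circleCoord x) = x := by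
  induction x using h.surgery_cases with
  | h1 e => exact absurd hx (h.inclExt_notMem_innerPart e)
  | h2 p => rfl

theorem norm_radial_le (u : I) (d : Disc) :
    ‖((1 - u + u / ‖(d : ℂ)‖ : ℝ) : ℂ) * (d : ℂ)‖ ≤ 1 := by
  have h1 : ‖(d : ℂ)‖ ≤ 1 := mem_closedBall_zero_iff.1 d.2
  have hu := u.2
  have h0 : 0 ≤ 1 - (u : ℝ) + u / ‖(d : ℂ)‖ :=
    add_nonneg (by linarith [hu.2]) (div_nonneg hu.1 (norm_nonneg _))
  rw [norm_mul, Complex.norm_real, Real.norm_of_nonneg h0]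
  rcases eq_or_ne ‖(d : ℂ)‖ 0 with h2 | h2
  · rw [h2, mul_zero]
    exact zero_le_one
  · rw [add_mul, div_mul_cancel₀ _ h2]
    nlinarith [hu.1, hu.2, norm_nonneg (d : ℂ)]

/-- Radial expansion of the disc. -/
def radial (u : I) (d : Disc) : Disc :=
  ⟨((1 - u + u / ‖(d : ℂ)‖ : ℝ) : ℂ) * (d : ℂ), mem_closedBall_zero_iff.2 (norm_radial_le u d)⟩

theorem radial_zero (d : Disc) : radial 0 d = d := Subtype.ext (by simp [radial])

theorem radial_one {d : Disc} (hd : (d : ℂ) ≠ 0) : radial 1 d = circleToDisc (phase d) := by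
  refine Subtype.ext ?_
  change _ = (phase (d : ℂ) : ℂ)
  rw [coe_phase hd]
  simp [radial, div_eq_inv_mul]

theorem radial_circle (u : I) (x : Circle) : radial u (circleToDisc x) = circleToDisc x :=
  Subtype.ext (by
    change ((1 - u + u / ‖(x : ℂ)‖ : ℝ) : ℂ) * (x : ℂ) = x
    rw [Circle.norm_coe]
    simp)

theorem continuousAt_radial {q : I × Disc} (hq : (q.2 : ℂ) ≠ 0) :
    ContinuousAt (fun q : I × Disc => radial q.1 q.2) q := by
  refine Topology.IsInducing.subtypeVal.continuousAt_iff.2 ?_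
  change ContinuousAt (fun q : I × Disc => ((1 - q.1 + q.1 / ‖(q.2 : ℂ)‖ : ℝ) : ℂ) * (q.2 : ℂ)) q
  have h1 : ContinuousAt (fun q : I × Disc => (1 - q.1 + q.1 / ‖(q.2 : ℂ)‖ : ℝ)) q :=
    ContinuousAt.add (by fun_prop) (ContinuousAt.div (by fun_prop) (by fun_prop)
      (norm_ne_zero_iff.2 hq))
  exact (Complex.continuous_ofReal.continuousAt.comp h1).mul (by fun_prop)

/-- The radial deformation of the surgered manifold. -/
def flow (u : I) : h.Surgery → h.Surgery :=
  h.surgeryLift h.inclExt (fun p => h.inclTorus (radial u p.1, p.2)) fun x y => by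
    rw [inclExt_boundary, radial_circle]

theorem flow_inclTorus (u : I) (p : Disc × Circle) :
    h.flow u (h.inclTorus p) = h.inclTorus (radial u p.1, p.2) := rfl

theorem flow_zero (x : h.Surgery) : h.flow 0 x = x := by
  induction x using h.surgery_cases with
  | h1 e => rfl
  | h2 p => rw [flow_inclTorus, radial_zero]

theorem flow_one {x : h.Surgery} (hx : x ∈ h.outerPart) : h.flow 1 x = h.inclExt (h.retr x) := by
  induction x using h.surgery_cases with
  | h1 e => rfl
  | h2 p =>
    rw [flow_inclTorus, radial_one (h.inclTorus_mem_outerPart.1 hx), retr_inclTorus,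
      inclExt_boundary]

/-- The quotient map restricted over an open set is again a quotient map, and remains one after the
product with the locally compact interval. So continuity is checked on the two pieces, where the
only singularity, the centre of the disc, is excluded. -/
theorem continuous_flow : Continuous fun q : I × h.outerPart => h.flow q.1 q.2 := by
  refine (isQuotientMap_quot_mk.restrictPreimage_isOpen
    h.isOpen_outerPart).continuous_lift_prod_right ?_
  have key : ∀ q : I × (h.Exterior ⊕ Disc × Circle), Quot.mk h.GlueRel q.2 ∈ h.outerPart →
      ContinuousAt (fun q : I × (h.Exterior ⊕ Disc × Circle) =>
        h.flow q.1 (Quot.mk h.GlueRel q.2)) q := by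
    rintro ⟨u, e | p⟩ hq
    · refine (Topology.IsOpenEmbedding.id.prodMap
        Topology.IsOpenEmbedding.inl).continuousAt_iff (x := (u, e)) |>.1 ?_
      exact (h.inclExt.continuous.comp continuous_snd).continuousAt
    · refine (Topology.IsOpenEmbedding.id.prodMap
        Topology.IsOpenEmbedding.inr).continuousAt_iff (x := (u, p)) |>.1 ?_
      have hp : (p.1 : ℂ) ≠ 0 := h.inclTorus_mem_outerPart.1 hq
      refine h.inclTorus.continuous.continuousAt.comp
        (f := fun q : I × (Disc × Circle) => (radial q.1 q.2.1, q.2.2))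
        (ContinuousAt.prodMk ?_ (by fun_prop))
      exact (continuousAt_radial (q := (u, p.1)) hp).comp_of_eq
        (f := fun q : I × (Disc × Circle) => (q.1, q.2.1)) (by fun_prop) rfl
  refine continuous_iff_continuousAt.2 fun q => ?_
  exact (key (q.1, q.2.1) q.2.2).comp_of_eq (f := fun q : I × (Quot.mk h.GlueRel ⁻¹' h.outerPart) =>
    (q.1, q.2.1)) (by fun_prop) rfl

/-- The segment in the disc from `1` to a point. -/
def contract (u : I) (d : Disc) : Disc :=
  ⟨(1 - u : ℝ) • (1 : ℂ) + (u : ℝ) • (d : ℂ), (convex_closedBall (0 : ℂ) 1)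
    (mem_closedBall_zero_iff.2 (by simp)) d.2 (by linarith [u.2.2]) u.2.1 (by ring)⟩

theorem contract_zero (d : Disc) : contract 0 d = circleToDisc 1 :=
  Subtype.ext (by simp [contract, circleToDisc])

theorem contract_one (d : Disc) : contract 1 d = d := Subtype.ext (by simp [contract])

theorem continuous_contract : Continuous fun q : I × Disc => contract q.1 q.2 :=
  Continuous.subtype_mk (by fun_prop) _

end FramedKnot

/-! ### The fundamental group of the surgered manifold -/

namespace PathRep

/-- The van Kampen theorem for two open sets. -/
theorem exists_glue_pair {X G : Type*} [TopologicalSpace X] [Group G] {U V : Set X}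
    (oU : IsOpen U) (oV : IsOpen V) (hcov : ∀ x, x ∈ U ∨ x ∈ V) (R : PathRep U G)
    (R' : PathRep V G) (hR : ∀ {x y : X} (γ : Path x y) (h : ∀ t, γ t ∈ U) (h' : ∀ t, γ t ∈ V),
      R.val (γ.codRestrict U h) = R'.val (γ.codRestrict V h')) :
    ∃ F : PathRep X G,
      (∀ {x y : X} (γ : Path x y) (h : ∀ t, γ t ∈ U), F.val γ = R.val (γ.codRestrict U h)) ∧
      (∀ {x y : X} (γ : Path x y) (h : ∀ t, γ t ∈ V), F.val γ = R'.val (γ.codRestrict V h)) := by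
  obtain ⟨F, hF⟩ := PathRep.exists_glue (c := fun b : Bool => cond b U V) (by simp [oU, oV])
    (fun x => by simpa [or_comm] using hcov x)
    (fun b => match b with
      | true => R
      | false => R') (by
    rintro (_ | _) (_ | _) x y γ h h'
    · rfl
    · exact (hR γ h' h).symm
    · exact hR γ h h'
    · rfl)
  exact ⟨F, fun γ h => hF true γ h, fun γ h => hF false γ h⟩

theorem eq_of_forall_pair {X G : Type*} [TopologicalSpace X] [Group G] {U V : Set X}
    (oU : IsOpen U) (oV : IsOpen V) (hcov : ∀ x, x ∈ U ∨ x ∈ V) (R S : PathRep X G)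
    (hU : ∀ {x y : X} (γ : Path x y), (∀ t, γ t ∈ U) → R.val γ = S.val γ)
    (hV : ∀ {x y : X} (γ : Path x y), (∀ t, γ t ∈ V) → R.val γ = S.val γ)
    {x y : X} (γ : Path x y) : R.val γ = S.val γ := by
  refine PathRep.eq_of_forall_cover (c := fun b : Bool => cond b U V) (by simp [oU, oV])
    (fun x => by simpa [or_comm] using hcov x) R S ?_ γ
  rintro (_ | _) x y γ hγ
  · exact hV γ hγ
  · exact hU γ hγ

end PathRep

namespace FramedKnot

variable (h : FramedKnot)

/-- The path along the radial deformation. -/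
def flowPath (x : h.outerPart) : Path (x : h.Surgery) (h.inclExt (h.retr x)) where
  toFun u := h.flow u x
  continuous_toFun := h.continuous_flow.comp (f := fun u : I => (u, x)) (by fun_prop)
  source' := h.flow_zero x
  target' := h.flow_one x.2

/-- The path in a meridian disc of the glued solid torus from its base point. -/
def spoke (p : Disc × Circle) : Path (h.inclExt (h.boundary 1 p.2)) (h.inclTorus p) where
  toFun u := h.inclTorus (contract u p.1, p.2)
  continuous_toFun := h.inclTorus.continuous.comp ((continuous_contract.comp
    (f := fun u : I => (u, p.1)) (by fun_prop)).prodMk continuous_const)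
  source' := by rw [contract_zero, inclExt_boundary]
  target' := by rw [contract_one]

/-- A path in the boundary torus in the direction of the longitude. -/
def arcPath (ξ : ℝ) (y : Circle) : Path (h.boundary 1 y) (h.boundary (Circle.exp ξ) y) where
  toFun s := h.boundary (Circle.exp (s * ξ)) y
  continuous_toFun := h.continuous_boundary.comp
    (f := fun s : I => (Circle.exp (s * ξ), y)) (by fun_prop)
  source' := by simp
  target' := by simp

instance : SimplyConnectedSpace Disc :=
  haveI : ContractibleSpace Disc := (convex_closedBall (0 : ℂ) 1).contractibleSpace ⟨0, by simp⟩
  inferInstance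

/-- Paths in a meridian disc of the glued solid torus with the same ends are equivalent. -/
theorem val_arcPath {G : Type*} [Group G] (T : PathRep h.Surgery G) {p : Disc × Circle}
    (hp : h.inclTorus p ∈ h.outerPart) {ξ : ℝ} (hξ : Circle.exp ξ = phase p.1) :
    (T.comap h.inclExt).val (h.arcPath ξ p.2) =
      T.val (h.flowPath ⟨_, hp⟩) * T.val (h.spoke p) := by
  have hp0 := h.inclTorus_mem_outerPart.1 hp
  let δ : C(Disc, h.Surgery) := ⟨fun d => h.inclTorus (d, p.2), by fun_prop⟩
  let α : Path (circleToDisc 1) (circleToDisc (phase p.1)) :=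
    { toFun := fun s => circleToDisc (Circle.exp (s * ξ))
      continuous_toFun := Continuous.subtype_mk (by fun_prop) _
      source' := by simp
      target' := by simp [hξ] }
  let ρ : Path p.1 (circleToDisc (phase p.1)) :=
    { toFun := fun u => radial u p.1
      continuous_toFun := continuous_iff_continuousAt.2 fun u =>
        (continuousAt_radial (q := (u, p.1)) hp0).comp_of_eq (f := fun u : I => (u, p.1))
          (by fun_prop) rfl
      source' := radial_zero _
      target' := radial_one hp0 }
  let β : Path (circleToDisc 1) p.1 :=
    { toFun := fun u => contract u p.1
      continuous_toFun := continuous_contract.comp (f := fun u : I => (u, p.1)) (by fun_prop)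
      source' := contract_zero _
      target' := contract_one _ }
  have e1 : (T.comap h.inclExt).val (h.arcPath ξ p.2) = (T.comap δ).val α :=
    T.congr_path _ _ fun t => h.inclExt_boundary _ _
  have e2 : T.val (h.flowPath ⟨_, hp⟩) = (T.comap δ).val ρ := T.congr_path _ _ fun t => rfl
  have e3 : T.val (h.spoke p) = (T.comap δ).val β := T.congr_path _ _ fun t => rfl
  rw [e1, e2, e3, ← PathRep.map_trans]
  exact (T.comap δ).map_homotopic (SimplyConnectedSpace.paths_homotopic _ _)

theorem exists_path_surgery [PathConnectedSpace h.Exterior] (x : h.Surgery) :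
    Nonempty (Path (h.inclExt (h.boundary 1 1)) x) := by
  have h1 : ∀ e, Nonempty (Path (h.inclExt (h.boundary 1 1)) (h.inclExt e)) := fun e =>
    ⟨(PathConnectedSpace.somePath (h.boundary 1 1) e).map h.inclExt.continuous⟩
  induction x using h.surgery_cases with
  | h1 e => exact h1 e
  | h2 p =>
    obtain ⟨γ⟩ := h1 (h.boundary 1 p.2)
    exact ⟨γ.trans (h.spoke p)⟩

/-- The retraction of the complement of the core of the glued solid torus. -/
def retrMap : C(h.outerPart, h.Exterior) := ⟨fun x => h.retr x, h.continuousOn_retr.domRestrict⟩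

/-- The projection of the interior of the glued solid torus to a meridian of the knot. -/
def projMap : C(h.innerPart, h.Exterior) :=
  ⟨fun x => h.boundary 1 (h.circleCoord x), h.continuous_boundary.comp
    (continuous_const.prodMk h.continuousOn_circleCoord.domRestrict)⟩

theorem retr_eq {x : h.Surgery} (hx : x ∈ h.innerPart) :
    h.retr x = h.boundary (phase (h.discCoord x)) (h.circleCoord x) := by
  conv_lhs => rw [← h.inclTorus_coord hx, retr_inclTorus]

theorem discCoord_ne_zero {x : h.Surgery} (hx : x ∈ h.innerPart) (hx' : x ∈ h.outerPart) :
    (h.discCoord x : ℂ) ≠ 0 := by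
  rw [← h.inclTorus_coord hx] at hx'
  exact h.inclTorus_mem_outerPart.1 hx'

/-- A representation of the exterior that does not depend on the longitudinal coordinate extends
to the surgered manifold. -/
theorem exists_extension {G : Type*} [Group G] (R : PathRep h.Exterior G)
    (hR : ∀ {x x' y : I → Circle}, Continuous x → Continuous x' → Continuous y →
      ∀ {p q p' q' : h.Exterior} (γ : Path p q) (γ' : Path p' q'),
      (∀ t, γ t = h.boundary (x t) (y t)) → (∀ t, γ' t = h.boundary (x' t) (y t)) →
      R.val γ = R.val γ') :
    ∃ S : PathRep h.Surgery G,
      (∀ {x y : h.Surgery} (γ : Path x y) (hγ : ∀ t, γ t ∈ h.outerPart),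
        S.val γ = (R.comap h.retrMap).val (γ.codRestrict _ hγ)) ∧
      (∀ {x y : h.Surgery} (γ : Path x y) (hγ : ∀ t, γ t ∈ h.innerPart),
        S.val γ = (R.comap h.projMap).val (γ.codRestrict _ hγ)) := by
  refine PathRep.exists_glue_pair h.isOpen_outerPart h.isOpen_innerPart
    h.mem_outerPart_or_innerPart _ _ fun γ hU hV => ?_
  have hd : Continuous fun t => (h.discCoord (γ t) : ℂ) :=
    continuous_subtype_val.comp (h.continuousOn_discCoord.comp_continuous γ.continuous hV)
  -- On the overlap the retraction and the projection have the same meridional coordinate and differ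
  -- only in the longitudinal one.
  exact hR (x := fun t => phase (h.discCoord (γ t))) (x' := fun _ => 1)
    (y := fun t => h.circleCoord (γ t)) (hd.phase fun t => h.discCoord_ne_zero (hV t) (hU t))
    continuous_const (h.continuousOn_circleCoord.comp_continuous γ.continuous hV) _ _
    (fun t => h.retr_eq (hV t)) fun t => rfl

open Classical in
/-- A representation of the surgered manifold is determined up to gauge by its restriction to the
exterior. -/
theorem exists_eq_gauge {G G' : Type*} [Group G] [Group G'] {R : PathRep h.Exterior G}
    (hR : ∀ (ξ : ℝ) (y : Circle), R.val (h.arcPath ξ y) = 1) {S : PathRep h.Surgery G}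
    (hU : ∀ {x y : h.Surgery} (γ : Path x y) (hγ : ∀ t, γ t ∈ h.outerPart),
      S.val γ = (R.comap h.retrMap).val (γ.codRestrict _ hγ))
    (hV : ∀ {x y : h.Surgery} (γ : Path x y) (hγ : ∀ t, γ t ∈ h.innerPart),
      S.val γ = (R.comap h.projMap).val (γ.codRestrict _ hγ))
    (T : PathRep h.Surgery G') (φ : G →* G') (g : h.Exterior → G')
    (hg : ∀ {e e' : h.Exterior} (γ : Path e e'),
      (T.comap h.inclExt).val γ = g e' * φ (R.val γ) * (g e)⁻¹) :
    ∃ A : h.Surgery → G', ∀ {x y : h.Surgery} (γ : Path x y),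
      T.val γ = A y * φ (S.val γ) * (A x)⁻¹ := by
  -- The gauge transports `g` from the exterior to x: along the radial deformation off the core of
  -- the solid torus, and along a meridian disc on the core.
  set A : h.Surgery → G' := fun x => if hx : x ∈ h.outerPart then
    (T.val (h.flowPath ⟨x, hx⟩))⁻¹ * g (h.retr x) else
    T.val (h.spoke (h.discCoord x, h.circleCoord x)) * g (h.boundary 1 (h.circleCoord x)) with hA
  have hAU : ∀ {x : h.Surgery} (hx : x ∈ h.outerPart),
      A x = (T.val (h.flowPath ⟨x, hx⟩))⁻¹ * g (h.retr x) := fun hx => by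
    rw [hA]
    exact dif_pos hx
  -- On the overlap the two prescriptions agree, because the two ways to x differ by an arc of
  -- longitude bounding a region of a meridian disc, and `R` is trivial on such arcs.
  have hAV : ∀ {x : h.Surgery}, x ∈ h.innerPart → A x =
      T.val (h.spoke (h.discCoord x, h.circleCoord x)) * g (h.boundary 1 (h.circleCoord x)) := by
    intro x hx
    by_cases hx' : x ∈ h.outerPart
    · induction x using h.surgery_cases with
      | h1 e => exact absurd hx (h.inclExt_notMem_innerPart e)
      | h2 p =>
        obtain ⟨ξ, hξ⟩ := Circle.exp_surjective (phase p.1)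
        have e1 := h.val_arcPath T hx' hξ
        have e2 := hg (h.arcPath ξ p.2)
        rw [hR, map_one, mul_one, e1, eq_mul_inv_iff_mul_eq] at e2
        have e3 : g (h.retr (h.inclTorus p)) =
            T.val (h.flowPath ⟨_, hx'⟩) * T.val (h.spoke p) * g (h.boundary 1 p.2) :=
          (congrArg (fun z => g (h.boundary z p.2)) hξ.symm).trans e2.symm
        rw [hAU hx', e3, mul_assoc, inv_mul_cancel_left]
        rfl
    · rw [hA]
      exact dif_neg hx'
  refine ⟨A, fun {x y} γ => ?_⟩
  refine PathRep.eq_of_forall_pair h.isOpen_outerPart h.isOpen_innerPart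
    h.mem_outerPart_or_innerPart T ((S.mapHom φ).gauge A) ?_ ?_ γ
  · intro x y γ hγ
    have hx : x ∈ h.outerPart := by simpa using hγ 0
    have hy : y ∈ h.outerPart := by simpa using hγ 1
    -- The radial deformation sweeps out a square between the path and its retraction to the
    -- exterior.
    have key := VanKampen.map_square T ⟨fun q : I × I => h.flow q.1 (γ q.2),
      h.continuous_flow.comp (f := fun q : I × I => (q.1, (⟨γ q.2, hγ q.2⟩ : h.outerPart)))
        (by fun_prop)⟩ γ (((γ.codRestrict _ hγ).map h.retrMap.continuous).map h.inclExt.continuous)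
      (h.flowPath ⟨x, hx⟩) (h.flowPath ⟨y, hy⟩) (fun t => (h.flow_zero _).symm)
      (fun t => (h.flow_one (hγ t)).symm)
      (fun t => by change h.flow t x = h.flow t (γ 0); rw [γ.source])
      (fun t => by change h.flow t y = h.flow t (γ 1); rw [γ.target])
    have e := hg ((γ.codRestrict _ hγ).map h.retrMap.continuous)
    rw [PathRep.comap_apply] at e
    rw [e] at key
    rw [PathRep.gauge_apply, PathRep.mapHom_apply, hU γ hγ, hAU hx, hAU hy, PathRep.comap_apply,
      mul_inv_rev, inv_inv, mul_assoc, mul_assoc, eq_inv_mul_iff_mul_eq]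
    refine key.trans ?_
    simp only [mul_assoc]
    rfl
  · intro x y γ hγ
    have hx : x ∈ h.innerPart := by simpa using hγ 0
    have hy : y ∈ h.innerPart := by simpa using hγ 1
    have hd : Continuous fun t => h.discCoord (γ t) :=
      h.continuousOn_discCoord.comp_continuous γ.continuous hγ
    have hc : Continuous fun t => h.circleCoord (γ t) :=
      h.continuousOn_circleCoord.comp_continuous γ.continuous hγ
    let κ : ∀ {z : h.Surgery} (hz : z ∈ h.innerPart), Path (h.inclExt (h.projMap ⟨z, hz⟩)) z :=
      fun hz => (h.spoke _).cast rfl (h.inclTorus_coord hz).symm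
    have hκ : ∀ {z : h.Surgery} (hz : z ∈ h.innerPart),
        T.val (κ hz) = T.val (h.spoke (h.discCoord z, h.circleCoord z)) := fun hz =>
      T.congr_path _ _ fun t => rfl
    -- Likewise, the contraction of the meridian discs sweeps out a square between the projected
    -- path and the path itself.
    have key := VanKampen.map_square T ⟨fun q : I × I => h.inclTorus
      (contract q.1 (h.discCoord (γ q.2)), h.circleCoord (γ q.2)),
      h.inclTorus.continuous.comp ((continuous_contract.comp (f := fun q : I × I =>
        (q.1, h.discCoord (γ q.2))) (continuous_fst.prodMk (hd.comp continuous_snd))).prodMk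
          (hc.comp continuous_snd))⟩
      (((γ.codRestrict _ hγ).map h.projMap.continuous).map h.inclExt.continuous) γ
      (κ hx) (κ hy)
      (fun t => by
        simp only [ContinuousMap.coe_mk, contract_zero]
        exact h.inclExt_boundary _ _)
      (fun t => by
        simp only [ContinuousMap.coe_mk, contract_one]
        exact (h.inclTorus_coord (hγ t)).symm)
      (fun t => by
        change h.inclTorus (contract t (h.discCoord x), h.circleCoord x) =
          h.inclTorus (contract t (h.discCoord (γ 0)), h.circleCoord (γ 0))
        rw [γ.source])
      (fun t => by
        change h.inclTorus (contract t (h.discCoord y), h.circleCoord y) =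
          h.inclTorus (contract t (h.discCoord (γ 1)), h.circleCoord (γ 1))
        rw [γ.target])
    have e := hg ((γ.codRestrict _ hγ).map h.projMap.continuous)
    rw [PathRep.comap_apply] at e
    rw [e, hκ, hκ] at key
    rw [PathRep.gauge_apply, PathRep.mapHom_apply, hV γ hγ, hAV hx, hAV hy, PathRep.comap_apply,
      mul_inv_rev, ← mul_assoc, eq_mul_inv_iff_mul_eq]
    refine key.symm.trans ?_
    simp only [mul_assoc]
    rfl

/-- The longitude bounds a disc in the surgered manifold. -/
theorem val_longitude {G : Type*} [Group G] (T : PathRep h.Surgery G) :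
    (T.comap h.inclExt).val h.longitudePath = 1 := by
  let δ : C(Disc, h.Surgery) := ⟨fun d => h.inclTorus (d, 1), by fun_prop⟩
  let α : Path (circleToDisc 1) (circleToDisc 1) :=
    { toFun := fun s => circleToDisc (Circle.exp (2 * Real.pi * s))
      continuous_toFun := Continuous.subtype_mk (by fun_prop) _
      source' := by simp
      target' := by simp }
  have e : (T.comap h.inclExt).val h.longitudePath = (T.comap δ).val α :=
    T.congr_path _ _ fun t => h.inclExt_boundary _ _
  rw [e, (T.comap δ).map_homotopic (SimplyConnectedSpace.paths_homotopic α (Path.refl _)),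
    PathRep.map_refl]

/-- The fundamental group of the surgered manifold. -/
theorem nonempty_surgery_equiv [PathConnectedSpace h.Exterior] (x : h.Surgery) :
    Nonempty (FundamentalGroup h.Surgery x ≃*
      h.KnotGroup ⧸ Subgroup.normalClosure {h.longitude}) := by
  set N := Subgroup.normalClosure {h.longitude} with hN
  have hlN : h.longitude ∈ N := Subgroup.subset_normalClosure (mem_singleton _)
  let c : ∀ e, Path (h.boundary 1 1) e := fun e => PathConnectedSpace.somePath _ e
  have hconj : ∀ γ : Path (h.boundary 1 1) (h.boundary 1 1), (PathRep.ofSections c).val γ =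
      (FundamentalGroup.fromPath (.mk (c (h.boundary 1 1))))⁻¹ *
        FundamentalGroup.fromPath (.mk γ) * FundamentalGroup.fromPath (.mk (c (h.boundary 1 1))) := by
    intro γ
    rw [PathRep.ofSections_apply]
    rfl
  -- The tautological representation of the exterior modulo the longitude. A gauge makes it
  -- independent of the longitudinal coordinate, and then it extends to a representation `S` of the
  -- surgered manifold.
  set R₀ : PathRep h.Exterior (h.KnotGroup ⧸ N) :=
    (PathRep.ofSections c).mapHom (QuotientGroup.mk' N) with hR₀
  have hl : R₀.val h.longitudePath = 1 := by
    rw [hR₀, PathRep.mapHom_apply, hconj, QuotientGroup.mk'_apply, QuotientGroup.eq_one_iff]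
    exact Subgroup.Normal.conj_mem' Subgroup.normalClosure_normal _ hlN _
  obtain ⟨A, hA⟩ := h.exists_gauge hl
  set R := R₀.gauge A with hR
  obtain ⟨S, hU, hV⟩ := h.exists_extension R hA
  have harc : ∀ (ξ : ℝ) (y : Circle), R.val (h.arcPath ξ y) = 1 := by
    intro ξ y
    rw [hA (x := fun s => Circle.exp (s * ξ)) (x' := fun _ => 1) (y := fun _ => y) (by fun_prop)
      continuous_const continuous_const _ (Path.refl (h.boundary 1 y)) (fun t => rfl)
      (fun t => rfl), PathRep.map_refl]
  let d : ∀ x, Path (h.inclExt (h.boundary 1 1)) x := fun x => (h.exists_path_surgery x).some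
  have hSE : ∀ {e e' : h.Exterior} (γ : Path e e'),
      S.val (γ.map h.inclExt.continuous) = R.val γ := by
    intro e e' γ
    rw [hU _ fun t => h.inclExt_mem_outerPart _]
    exact R.congr_path _ _ fun t => rfl
  -- Loops of the exterior already attain every value. The conjugations by A and k compensate the
  -- gauge and the auxiliary loop at the base point.
  have hfull : S.IsFull := by
    refine S.isFull_of_surjective d fun q => ?_
    obtain ⟨p, hp⟩ := QuotientGroup.mk'_surjective N
      ((A (h.boundary 1 1))⁻¹ * q * A (h.boundary 1 1))
    set k : h.KnotGroup := FundamentalGroup.fromPath (.mk (c (h.boundary 1 1)))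
    obtain ⟨γ, hγ⟩ := Path.Homotopic.Quotient.mk_surjective (k * p * k⁻¹ : h.KnotGroup)
    refine ⟨FundamentalGroup.fromPath (.mk (γ.map h.inclExt.continuous)), ?_⟩
    rw [PathRep.toHom_mk, hSE, hR, PathRep.gauge_apply, hR₀, PathRep.mapHom_apply, hconj]
    have e : k⁻¹ * FundamentalGroup.fromPath (.mk γ) * k = p := by
      rw [show FundamentalGroup.fromPath (.mk γ) = (k * p * k⁻¹ : h.KnotGroup) from hγ]
      group
    rw [e, hp]
    group
  -- The tautological representation `T` of the surgered manifold is recovered from `S` up to gauge.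
  -- As `T` is faithful, so is `S`.
  have hfaith : S.IsFaithful := by
    intro x y γ γ' hγ
    set T := PathRep.ofSections d with hT
    set P := T.comap h.inclExt with hP
    -- The longitude bounds a disc in the surgered manifold, so the map from the knot group factors
    -- through the quotient.
    set φ := QuotientGroup.lift N (P.toHom (h.boundary 1 1)) (by
      have : N ≤ (P.toHom (h.boundary 1 1)).ker := by
        refine Subgroup.normalClosure_le_normal ?_
        rintro _ rfl
        exact h.val_longitude T
      exact fun g hg => this hg) with hφ
    obtain ⟨B, hB⟩ := h.exists_eq_gauge harc hU hV T φ
      (fun e => P.val (c e) * (φ (A e))⁻¹) (by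
        intro e e' γ
        rw [← hP, P.eq_gauge_ofSections c γ, hR, PathRep.gauge_apply, map_mul, map_mul, map_inv]
        have : P.toHom (h.boundary 1 1) ((PathRep.ofSections c).val γ) = φ (R₀.val γ) := rfl
        rw [this]
        group)
    refine PathRep.isFaithful_ofSections d ?_
    rw [← hT, hB, hB, hγ]
  exact ⟨MulEquiv.ofBijective (S.toHom x) (PathRep.toHom_bijective hfaith hfull x)⟩

end FramedKnot

/-! ### Connectedness of the exterior, and surgery on a trefoil -/

namespace TrefoilCone

instance : PathConnectedSpace compl := by
  have hp₀ : -g (1, Complex.I) ∈ Complex.slitPlane := by simp [g]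
  have h0 := mem_outer_and_inner.2 hp₀
  refine pathConnectedSpace_iff_univ.2 ⟨⟨_, mem_compl_of hp₀⟩, mem_univ _, fun {x} _ => ?_⟩
  rw [joinedIn_univ]
  rcases x.2 with hx | hx
  · obtain ⟨c, -⟩ := isCircleEquiv_phaseOuter.exists_path_winding exp_gaugeOuter
      ⟨⟨_, mem_compl_of hp₀⟩, h0.1⟩ ⟨x, hx⟩ 0
    exact ⟨c.map continuous_subtype_val⟩
  · obtain ⟨c, -⟩ := isCircleEquiv_phaseInner.exists_path_winding exp_gaugeInner
      ⟨⟨_, mem_compl_of hp₀⟩, h0.2⟩ ⟨x, hx⟩ 0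
    exact ⟨c.map continuous_subtype_val⟩

end TrefoilCone

namespace FramedKnot

theorem pathConnectedSpace_exterior {h : FramedKnot}
    (hT : (Subtype.val '' h.core : Set ℍ[ℝ]) = range trefoil) : PathConnectedSpace h.Exterior where
  nonempty := ⟨h.boundary 1 1⟩
  joined x y := by
    obtain ⟨γ, -⟩ := (h.exteriorConeEquiv hT).exists_path_map_homotopic
      (PathConnectedSpace.somePath ((h.exteriorConeEquiv hT).toFun x) _)
    exact ⟨γ⟩

theorem IsTrefoil.pathConnectedSpace {h : FramedKnot} (hT : h.IsTrefoil) :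
    PathConnectedSpace h.Exterior := by
  obtain ⟨F, hF, hcore⟩ := hT
  have := pathConnectedSpace_exterior (hF.core_pullback h hcore)
  exact (hF.exteriorHomeomorph h).symm.surjective.pathConnectedSpace
    (hF.exteriorHomeomorph h).symm.continuous

/-- The fundamental group of the manifold obtained by surgery on a trefoil. -/
theorem IsTrefoil.nonempty_surgery_equiv {h : FramedKnot} (hT : h.IsTrefoil)
    {e : h.KnotGroup ≃* TrefoilGroup} {p : ℕ}
    (hl : e h.longitude = TrefoilGroup.fiber * TrefoilGroup.a ^ (-(p : ℤ))) (x : h.Surgery) :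
    Nonempty (FundamentalGroup h.Surgery x ≃*
      h.KnotGroup ⧸ Subgroup.normalClosure {h.longitude}) ∧
    Nonempty (FundamentalGroup h.Surgery x ≃* BinaryPolyhedral p 3 2) := by
  have := hT.pathConnectedSpace
  obtain ⟨f⟩ := h.nonempty_surgery_equiv x
  obtain ⟨f'⟩ := TrefoilGroup.nonempty_quotient_equiv p
  -- The isomorphism e carries the normal closure of the longitude to that of `fiber * a ^ (-p)`.
  refine ⟨⟨f⟩, ⟨f.trans ((QuotientGroup.congr _ _ e ?_).trans f')⟩⟩
  rw [← hl, Subgroup.map_normalClosure _ _ e.surjective, image_singleton]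
  rfl

end FramedKnot

end

/-! ### The theorem -/

theorem mainTheorem1 :
    ((∃ h : FramedKnot, h.IsTrefoil ∧ h.HasFraming 3) ∧
      ∀ h : FramedKnot, h.IsTrefoil → h.HasFraming 3 →
        (∃ e : h.KnotGroup ≃* TrefoilGroup,
          e h.meridian = TrefoilGroup.a ∧
          e h.longitude = TrefoilGroup.c * TrefoilGroup.a * TrefoilGroup.b) ∧
        ∀ x : h.Surgery,
          Nonempty (FundamentalGroup h.Surgery x ≃*
            h.KnotGroup ⧸ Subgroup.normalClosure {h.longitude}) ∧
          Nonempty (FundamentalGroup h.Surgery x ≃* BinaryTetrahedral)) ∧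
    ((∃ h : FramedKnot, h.IsTrefoil ∧ h.HasFraming 1) ∧
      ∀ h : FramedKnot, h.IsTrefoil → h.HasFraming 1 →
        (∃ e : h.KnotGroup ≃* TrefoilGroup,
          e h.meridian = TrefoilGroup.a ∧
          e h.longitude =
            TrefoilGroup.c * TrefoilGroup.a * TrefoilGroup.b * TrefoilGroup.a ^ (-2 : ℤ)) ∧
        ∀ x : h.Surgery,
          Nonempty (FundamentalGroup h.Surgery x ≃*
            h.KnotGroup ⧸ Subgroup.normalClosure {h.longitude}) ∧
          Nonempty (FundamentalGroup h.Surgery x ≃* BinaryIcosahedral)) ∧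
    ∀ y : PoincareSphere, Nonempty (FundamentalGroup PoincareSphere y ≃* BinaryIcosahedral) := by
  refine ⟨⟨FramedKnot.exists_hasFraming 3, fun h hT hn => ?_⟩,
    ⟨FramedKnot.exists_hasFraming 1, fun h hT hn => ?_⟩, nonempty_poincareSphere_equiv⟩
  · obtain ⟨e, k, hm, hl⟩ := hT.exists_equiv
    -- k = 3 - 6, so the longitude is `fiber * a ^ (-3)`, which is cab; it also gives p = 3.
    obtain rfl : k = -3 := (FramedKnot.hasFraming_iff hm hl 3).1 hn
    exact ⟨⟨e, hm, hl.trans TrefoilGroup.cab_eq.symm⟩,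
      fun x => hT.nonempty_surgery_equiv (p := 3) hl x⟩
  · obtain ⟨e, k, hm, hl⟩ := hT.exists_equiv
    -- k = 1 - 6, so p = 5, and a⁻⁵ = a⁻³a⁻² splits off the two negative curls.
    obtain rfl : k = -5 := (FramedKnot.hasFraming_iff hm hl 1).1 hn
    refine ⟨⟨e, hm, ?_⟩, fun x => hT.nonempty_surgery_equiv (p := 5) hl x⟩
    rw [hl, TrefoilGroup.cab_eq, mul_assoc, ← zpow_add]
    rfl
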